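/- Let $M$ be a smooth $n$-dimensional manifold, $P\subset M$ a smooth (embedded) submanifold, $a<b$, and let $TM^*$ carry its canonical symplectic form $\omega=-\mathrm d\theta=\sum_i \mathrm dq_i\wedge \mathrm dp_i$. Let $H$ be a smooth function on an open set $U\subset\mathbb R\times TM^*$ that is hyper-regular, i.e. its fibre derivative $(t,p)\mapsto(t,\mathrm d(H_t|_{T_xM^*})(p))$, $p\in T_xM^*$, is a diffeomorphism of $U$ onto an open set $V\subset\mathbb R\times TM$, and let $L:V\to\mathbb R$ be the corresponding Lagrangian, $L(t,v)=p(v)-H(t,p)$ where $(t,p)\in U$ is mapped to $(t,v)$. Let $\Gamma:[a,b]\to TM^*$ be an integral curve of the Hamiltonian vector field $\vec H$ ($\mathrm dH_t=\omega(\vec H,\cdot)$) with $\Gamma(a)$ in the annihilator $TP^o=\{p\in T_mM^*: m\in P,\ p|_{T_mP}=0\}$, and let $\gamma=\pi\circ\Gamma$ be its projection to $M$. Let $\mathcal H_\Gamma$ be the Hilbert space of vector fields $\mathfrak v$ along $\gamma$ of Sobolev class $H^1$ with $\mathfrak v(a)\in T_{\gamma(a)}P$ and $\mathfrak v(b)=0$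 (its $H^1$ norm, taken in a smooth frame along $\gamma$, is well defined up to equivalence). The index form $I_\Gamma$ on $\mathcal H_\Gamma$ is defined as follows. Let $\phi(t):\mathbb R^n\oplus{\mathbb R^n}^*\to T_{\Gamma(t)}TM^*$, $t\in[a,b]$, be a smooth family of linear symplectomorphisms that map $\{0\}\oplus{\mathbb R^n}^*$ onto the vertical subspaces, let $F_{t,a}$ be the flow of $\vec H$ from time $a$, put $\Psi(t)=\phi(t)^{-1}\circ\mathrm dF_{t,a}(\Gamma(a))\circ\phi(a)$ and $X=\Psi'\Psi^{-1}=\begin{pmatrix}A&B\\C&-A^*\end{pmatrix}$, $\mathcal Z_t(x)=\mathrm d\pi(\phi(t)(x,0))$, $\ell_0=\phi(a)^{-1}(T_{\Gamma(a)}TP^o)$, and let $S(x,y)=-\alpha(y)$ for $(x,\alpha)\in\ell_0$ and $y$ in the projection of $\ell_0$ to $\mathbb R^n$. With $u=\mathcal Z^{-1}\mathfrak v$, $w=\mathcal Z^{-1}\mathfrak w$, $\alpha_u=B^{-1}(u'-Au)$ and $\alpha_w=B^{-1}(w'-Aw)$, $$I_\Gamma(\mathfrak v,\mathfrak w)=\int_a^b\big[B(\alpha_u,\alpha_w)+C(u,w)\big]\,\mathrm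 dt-S(u(a),w(a)).$$ Consider the action functional $\vartheta\mapsto\int_a^bL(t,\vartheta'(t))\,\mathrm dt$ on the manifold of $C^1$ curves $\vartheta:[a,b]\to M$ with $(t,\vartheta'(t))\in V$ for all $t$, $\vartheta(a)\in P$ and $\vartheta(b)=\gamma(b)$. Its Hessian at $\gamma$ is the symmetric bilinear form $h$ on the space of $C^1$ vector fields $\mathfrak v$ along $\gamma$ with $\mathfrak v(a)\in T_{\gamma(a)}P$, $\mathfrak v(b)=0$, such that $h(\mathfrak v,\mathfrak v)$ is the second derivative at $s=0$ of the action along every $C^2$ curve $s\mapsto\sigma_s$ in this manifold of curves with $\sigma_0=\gamma$ and initial velocity $\mathfrak v$. Then this Hessian exists and is unique, it has a unique extension to a bounded symmetric bilinear form on $\mathcal H_\Gamma$, and this extension equals $I_\Gamma$, whichever $\phi$ is used to compute $I_\Gamma$. -/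

import Mathlib

open Set MeasureTheory
open scoped Manifold ContDiff Topology

noncomputable section

namespace HamiltonianIndex

/-! ### Curves, tangent spaces of subsets, submanifolds -/

section General

variable {E₀ : Type*} [NormedAddCommGroup E₀] [NormedSpace ℝ E₀]
  {H₀ : Type*} [TopologicalSpace H₀] (I : ModelWithCorners ℝ E₀ H₀)
  {N : Type*} [TopologicalSpace N] [ChartedSpace H₀ N]

/-- The velocity `c'(t)`, as a point of the tangent bundle, of a curve `c` defined on the
set of times `s` (one-sided at the endpoints of an interval). -/
def velocity (c : ℝ → N) (s : Set ℝ) (t : ℝ) : TangentBundle I N :=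
  ⟨c t, mfderivWithin 𝓘(ℝ, ℝ) I c s t (1 : ℝ)⟩

/-- The tangent space at `x` of a subset `S` of a manifold: the span of the velocities at `x`
of the smooth curves in `S` through `x`.  (If `S` is a submanifold, these velocities already
form a vector space, the usual tangent space of `S`.) -/
def tangentSpaceOf (S : Set N) (x : N) : Submodule ℝ (TangentSpace I x) :=
  Submodule.span ℝ
    {v | ∃ c : ℝ → N, ContMDiffAt 𝓘(ℝ, ℝ) I ∞ c 0 ∧ (∀ᶠ s in 𝓝 (0 : ℝ), c s ∈ S) ∧
      velocity I c univ 0 = (⟨x, v⟩ : TangentBundle I N)}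

/-- A family `τ s` of continuous maps `K → N` such that, in charts, `τ` and its first two
derivatives in `s` are jointly continuous in `(s, t)`; for compact `K` this says that
`s ↦ τ s` is a curve of class `C²` in the Banach manifold `C⁰(K, N)`. -/
def IsC2Family (J K : Set ℝ) (τ : ℝ → ℝ → N) : Prop :=
  ∀ s₀ ∈ J, ∀ t₀ ∈ K, ∃ O : Set ℝ, IsOpen O ∧ s₀ ∈ O ∧ O ⊆ J ∧ ∃ W ∈ 𝓝[K] t₀, W ⊆ K ∧
    (∀ s ∈ O, ∀ t ∈ W, τ s t ∈ (extChartAt I (τ s₀ t₀)).source) ∧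
    (∀ t ∈ W, ContDiffOn ℝ 2 (fun s => extChartAt I (τ s₀ t₀) (τ s t)) O) ∧
    ∀ j : ℕ, j ≤ 2 → ContinuousOn
      (fun z : ℝ × ℝ => iteratedDeriv j (fun s => extChartAt I (τ s₀ t₀) (τ s z.2)) z.1)
      (O ×ˢ W)

end General

/-- The model space `ℝⁿ`. -/
abbrev Eu (n : ℕ) := EuclideanSpace ℝ (Fin n)

/-- The dual space `ℝⁿ*`. -/
abbrev EuDual (n : ℕ) := Eu n →L[ℝ] ℝ

/-- The cotangent bundle of an `n`-dimensional manifold `M`, with its bundle charts `(q, p)`. -/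
abbrev Cot (n : ℕ) (M : Type*) [TopologicalSpace M] [ChartedSpace (Eu n) M] :=
  Bundle.TotalSpace (EuDual n)
    (fun x : M => TangentSpace (𝓡 n) x →L[ℝ] Bundle.Trivial M ℝ x)

/-- The model with corners of the cotangent bundle. -/
abbrev ICot (n : ℕ) := (𝓡 n).prod 𝓘(ℝ, EuDual n)

/-- The canonical symplectic form of `ℝⁿ ⊕ ℝⁿ*`. -/
def stdSymp {n : ℕ} (x y : Eu n × EuDual n) : ℝ := y.2 x.1 - x.2 y.1

/-- `u : [a,b] → ℝⁿ` is of Sobolev class `H¹`: absolutely continuous, with square integrable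
derivative. -/
def IsH1 {n : ℕ} (a b : ℝ) (u : ℝ → Eu n) : Prop :=
  AbsolutelyContinuousOnInterval u a b ∧ MemLp (deriv u) 2 (volume.restrict (Icc a b))

/-- The `H¹` norm on the interval `[a,b]`. -/
def h1Norm {n : ℕ} (a b : ℝ) (u : ℝ → Eu n) : ℝ :=
  Real.sqrt (∫ t in a..b, (‖u t‖ ^ 2 + ‖deriv u t‖ ^ 2))

theorem ae_differentiableAt_of_ac {n : ℕ} {a b : ℝ} (hab : a ≤ b) {u : ℝ → Eu n}
    (hu : AbsolutelyContinuousOnInterval u a b) :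
    ∀ᵐ t ∂(volume.restrict (Icc a b)), DifferentiableAt ℝ u t := by
  have h1 := hu.boundedVariationOn.locallyBoundedVariationOn.ae_differentiableWithinAt_of_mem
  rw [uIcc_of_le hab] at h1
  rw [← Measure.restrict_congr_set (Ioo_ae_eq_Icc (a := a) (b := b)),
    ae_restrict_iff' measurableSet_Ioo]
  filter_upwards [h1] with t ht hmem
  exact (ht (Ioo_subset_Icc_self hmem)).differentiableAt (Icc_mem_nhds hmem.1 hmem.2)

theorem isH1_add {n : ℕ} {a b : ℝ} (hab : a ≤ b) {u w : ℝ → Eu n} (hu : IsH1 a b u)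
    (hw : IsH1 a b w) : IsH1 a b (fun t => u t + w t) := by
  refine ⟨hu.1.add hw.1, (hu.2.add hw.2).ae_eq ?_⟩
  filter_upwards [ae_differentiableAt_of_ac hab hu.1, ae_differentiableAt_of_ac hab hw.1]
    with t h1 h2
  exact (deriv_fun_add h1 h2).symm

theorem isH1_smul {n : ℕ} {a b : ℝ} (hab : a ≤ b) (c : ℝ) {u : ℝ → Eu n} (hu : IsH1 a b u) :
    IsH1 a b (fun t => c • u t) := by
  refine ⟨hu.1.const_smul c, (hu.2.const_smul c).ae_eq ?_⟩
  filter_upwards [ae_differentiableAt_of_ac hab hu.1] with t h1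
  exact (deriv_fun_const_smul c h1).symm

theorem isH1_zero {n : ℕ} {a b : ℝ} : IsH1 a b (fun _ => (0 : Eu n)) := by
  refine ⟨contDiffOn_const.absolutelyContinuousOnInterval, ?_⟩
  simp

variable {n : ℕ} {M : Type*} [TopologicalSpace M] [ChartedSpace (Eu n) M]

/-- `P` is an (embedded) smooth submanifold of `M`: around each of its points there is a chart
of `M` in which `P` is a linear subspace. -/
def IsSubmanifold (P : Set M) : Prop :=
  ∀ x ∈ P, ∃ ψ ∈ IsManifold.maximalAtlas (𝓡 n) ∞ M, x ∈ ψ.source ∧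
    ∃ W : Submodule ℝ (Eu n), ∀ y ∈ ψ.source, y ∈ P ↔ ψ y ∈ W

/-- The annihilator `TPᵒ` in the cotangent bundle of the tangent bundle of `P`. -/
def conormal (P : Set M) : Set (Cot n M) :=
  {p | p.proj ∈ P ∧ ∀ v ∈ tangentSpaceOf (𝓡 n) P p.proj, p.snd v = (0 : ℝ)}

variable [IsManifold (𝓡 n) ∞ M]

/-! ### The symplectic structure of the cotangent bundle; Hamilton's equations -/

/-- The differential at `p` of the projection of the cotangent bundle. -/
def dproj (p : Cot n M) : TangentSpace (ICot n) p →L[ℝ] TangentSpace (𝓡 n) p.proj :=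
  mfderiv (ICot n) (𝓡 n) (fun m : Cot n M => m.proj) p

/-- The differential at `p` of the chart `(q, p)` of the cotangent bundle that is induced by the
chosen chart `q` of `M` at the base point of `p`. -/
def dchart (p : Cot n M) : TangentSpace (ICot n) p →L[ℝ] (Eu n × EuDual n) :=
  mfderiv (ICot n) 𝓘(ℝ, Eu n × EuDual n) (extChartAt (ICot n) p) p

/-- The canonical symplectic form `ω = -dθ = ∑ dqᵢ ∧ dpᵢ` of the cotangent bundle, read off in
an induced chart `(q, p)` (all such charts are symplectic). -/
def omega (p : Cot n M) (ρ₁ ρ₂ : TangentSpace (ICot n) p) : ℝ :=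
  stdSymp (dchart p ρ₁) (dchart p ρ₂)

/-- `Γ : [a,b] → T*M` is an integral curve of the Hamiltonian vector field of `H`, which is
defined by `dH_t = ω(vec H, ·)`, for a Hamiltonian `H` on the open set `U ⊆ ℝ × T*M`. -/
def IsHamiltonianCurve (H : ℝ × Cot n M → ℝ) (U : Set (ℝ × Cot n M)) (a b : ℝ)
    (Γ : ℝ → Cot n M) : Prop :=
  ∀ t ∈ Icc a b, (t, Γ t) ∈ U ∧
    MDifferentiableWithinAt 𝓘(ℝ, ℝ) (ICot n) Γ (Icc a b) t ∧
    ∀ ρ : TangentSpace (ICot n) (Γ t),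
      (mfderiv (ICot n) 𝓘(ℝ, ℝ) (fun m => H (t, m)) (Γ t) ρ : ℝ) =
        omega (Γ t) (mfderivWithin 𝓘(ℝ, ℝ) (ICot n) Γ (Icc a b) t (1 : ℝ)) ρ

/-- `F t = F_{t,a}` is the flow from time `a` of the Hamiltonian vector field, for times in
`[a,b]` and initial points in a neighbourhood of `m₀`. -/
def IsHamiltonianFlow (H : ℝ × Cot n M → ℝ) (U : Set (ℝ × Cot n M)) (a b : ℝ) (m₀ : Cot n M)
    (F : ℝ → Cot n M → Cot n M) : Prop :=
  ∃ O : Set (Cot n M), IsOpen O ∧ m₀ ∈ O ∧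
    ContMDiffOn (𝓘(ℝ, ℝ).prod (ICot n)) (ICot n) ∞ (fun z : ℝ × Cot n M => F z.1 z.2)
      (Icc a b ×ˢ O) ∧
    ∀ m ∈ O, F a m = m ∧ IsHamiltonianCurve H U a b (fun t => F t m)

/-! ### Hyper-regular Hamiltonians, the Lagrangian and the action functional -/

/-- The derivative at `p ∈ T_xM*` of the restriction of `H_t` to the fibre `T_xM*`: it is an
element of the bidual of `T_xM`, that is, a vector `v ∈ T_xM`. -/
def fiberVelocity (H : ℝ × Cot n M → ℝ) (z : ℝ × Cot n M) : TangentSpace (𝓡 n) z.2.proj :=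
  Classical.epsilon fun v : TangentSpace (𝓡 n) z.2.proj =>
    ∀ α : TangentSpace (𝓡 n) z.2.proj →L[ℝ] Bundle.Trivial M ℝ z.2.proj,
      HasDerivAt (fun s : ℝ => H (z.1, ⟨z.2.proj, z.2.snd + s • α⟩)) (α v : ℝ) 0

/-- The fibre derivative `ℝ × T*M → ℝ × TM` of the Hamiltonian. -/
def fiberDeriv (H : ℝ × Cot n M → ℝ) (z : ℝ × Cot n M) : ℝ × TangentBundle (𝓡 n) M :=
  (z.1, ⟨z.2.proj, fiberVelocity H z⟩)

/-- `H` is hyper-regular on `U`: its fibre derivative is a diffeomorphism of `U` onto an open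
subset of `ℝ × TM`. -/
structure IsHyperRegular (H : ℝ × Cot n M → ℝ) (U : Set (ℝ × Cot n M)) : Prop where
  isOpen_image : IsOpen (fiberDeriv H '' U)
  injOn : InjOn (fiberDeriv H) U
  smooth : ContMDiffOn (𝓘(ℝ, ℝ).prod (ICot n)) (𝓘(ℝ, ℝ).prod (𝓡 n).tangent) ∞ (fiberDeriv H) U
  smooth_inverse : ∃ G : ℝ × TangentBundle (𝓡 n) M → ℝ × Cot n M,
    ContMDiffOn (𝓘(ℝ, ℝ).prod (𝓡 n).tangent) (𝓘(ℝ, ℝ).prod (ICot n)) ∞ G (fiberDeriv H '' U) ∧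
      LeftInvOn G (fiberDeriv H) U

open Classical in
/-- The Lagrangian `L` on `V = fiberDeriv H '' U` that corresponds to `H`:
`L(t, v) = p(v) - H(t, p)`, where `(t, p) ∈ U` is mapped to `(t, v)` by the fibre derivative. -/
def lagrangian (H : ℝ × Cot n M → ℝ) (U : Set (ℝ × Cot n M))
    (w : ℝ × TangentBundle (𝓡 n) M) : ℝ :=
  if h : ∃ z ∈ U, fiberDeriv H z = w then
    (h.choose.2.snd (fiberVelocity H h.choose) : ℝ) - H h.choose
  else 0

/-- The action functional `ϑ ↦ ∫ L(t, ϑ'(t)) dt`. -/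
def action (H : ℝ × Cot n M → ℝ) (U : Set (ℝ × Cot n M)) (a b : ℝ) (ϑ : ℝ → M) : ℝ :=
  ∫ t in a..b, lagrangian H U (t, velocity (𝓡 n) ϑ (Icc a b) t)

/-! ### Vector fields along a curve -/

/-- A smooth trivialization of `TM` along `γ : [a,b] → M`. -/
def IsFrame (γ : ℝ → M) (a b : ℝ) (Z : ∀ t : ℝ, Eu n ≃L[ℝ] TangentSpace (𝓡 n) (γ t)) : Prop :=
  ∀ x : Eu n, ContMDiffOn 𝓘(ℝ, ℝ) (𝓡 n).tangent ∞
    (fun t => (⟨γ t, Z t x⟩ : TangentBundle (𝓡 n) M)) (Icc a b)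

/-- The space of vector fields `v` along `γ : [a,b] → M` of Sobolev class `H¹` with
`v(a) ∈ T_{γ(a)}P` and `v(b) = 0`.  A vector field along `γ` is a function of `t ∈ [a,b]`; it is
extended by zero to the other values of `t`.  It is of class `H¹` if its coordinates in every
(equivalently, in some) smooth frame along `γ` are. -/
def H1Fields (γ : ℝ → M) (P : Set M) (a b : ℝ) (hab : a < b) :
    Submodule ℝ (∀ t : ℝ, TangentSpace (𝓡 n) (γ t)) where
  carrier := {v | (∀ t, t ∉ Icc a b → v t = 0) ∧
    (∀ Z : ∀ t : ℝ, Eu n ≃L[ℝ] TangentSpace (𝓡 n) (γ t), IsFrame γ a b Z →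
      IsH1 a b (fun t => (Z t).symm (v t))) ∧
    v a ∈ tangentSpaceOf (𝓡 n) P (γ a) ∧ v b = 0}
  add_mem' := by
    rintro v w ⟨h1, h2, h3, h4⟩ ⟨k1, k2, k3, k4⟩
    refine ⟨fun t ht => ?_, fun Z hZ => ?_, add_mem h3 k3, ?_⟩
    · rw [Pi.add_apply, h1 t ht, k1 t ht, add_zero]
    · simpa using isH1_add hab.le (h2 Z hZ) (k2 Z hZ)
    · rw [Pi.add_apply, h4, k4, add_zero]
  zero_mem' := by
    refine ⟨fun t ht => rfl, fun Z hZ => ?_, zero_mem _, rfl⟩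
    simpa using isH1_zero
  smul_mem' := by
    rintro c v ⟨h1, h2, h3, h4⟩
    refine ⟨fun t ht => ?_, fun Z hZ => ?_, Submodule.smul_mem _ c h3, ?_⟩
    · rw [Pi.smul_apply, h1 t ht, smul_zero]
    · simpa using isH1_smul hab.le c (h2 Z hZ)
    · rw [Pi.smul_apply, h4, smul_zero]

/-- The subspace of the vector fields of class `C¹`. -/
def C1Fields (γ : ℝ → M) (P : Set M) (a b : ℝ) (hab : a < b) :
    Submodule ℝ (H1Fields (n := n) γ P a b hab) where
  carrier := {v | ∀ Z : ∀ t : ℝ, Eu n ≃L[ℝ] TangentSpace (𝓡 n) (γ t), IsFrame γ a b Z →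
      ContDiffOn ℝ 1 (fun t => (Z t).symm (v.1 t)) (Icc a b)}
  add_mem' := by
    intro v w h k Z hZ
    simpa using (h Z hZ).add (k Z hZ)
  zero_mem' := by
    intro Z hZ
    simpa using contDiffOn_const
  smul_mem' := by
    intro c v h Z hZ
    simpa using (h Z hZ).const_smul c

/-- A bilinear form on the space of `H¹` fields is bounded, with respect to the norm
`v ↦ ‖Z⁻¹v‖_{H¹}` of a smooth frame `Z` along `γ` (different frames give equivalent norms). -/
def IsBoundedForm {γ : ℝ → M} {P : Set M} {a b : ℝ} {hab : a < b}
    (B : LinearMap.BilinForm ℝ (H1Fields (n := n) γ P a b hab)) : Prop :=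
  ∃ Z : ∀ t : ℝ, Eu n ≃L[ℝ] TangentSpace (𝓡 n) (γ t), IsFrame γ a b Z ∧
    ∃ C : ℝ, ∀ v w : H1Fields (n := n) γ P a b hab,
      |B v w| ≤ C * h1Norm a b (fun t => (Z t).symm (v.1 t)) *
        h1Norm a b (fun t => (Z t).symm (w.1 t))

/-! ### The Hessian of the action functional -/

/-- `s ↦ σ s`, `|s| < ε`, is a curve of class `C²` through `γ` with initial velocity `v` in the
Banach manifold of the `C¹` curves `ϑ : [a,b] → M` with `(t, ϑ'(t)) ∈ V = fiberDeriv H '' U`,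
`ϑ(a) ∈ P` and `ϑ(b) = γ(b)`.  (It is `C²` for the `C¹` topology on curves, that is, the curve of
the velocities `(σ s)' : [a,b] → TM` is `C²` for the `C⁰` topology.) -/
structure IsVariation (H : ℝ × Cot n M → ℝ) (U : Set (ℝ × Cot n M)) (γ : ℝ → M) (P : Set M)
    (a b ε : ℝ) (σ : ℝ → ℝ → M) (v : ∀ t : ℝ, TangentSpace (𝓡 n) (γ t)) : Prop where
  pos : 0 < ε
  curve_C1 : ∀ s ∈ Ioo (-ε) ε, ContMDiffOn 𝓘(ℝ, ℝ) (𝓡 n) 1 (σ s) (Icc a b)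
  velocity_mem : ∀ s ∈ Ioo (-ε) ε, ∀ t ∈ Icc a b,
    (t, velocity (𝓡 n) (σ s) (Icc a b) t) ∈ fiberDeriv H '' U
  left_mem : ∀ s ∈ Ioo (-ε) ε, σ s a ∈ P
  right_eq : ∀ s ∈ Ioo (-ε) ε, σ s b = γ b
  family_C2 : IsC2Family (𝓡 n).tangent (Ioo (-ε) ε) (Icc a b)
    (fun s t => velocity (𝓡 n) (σ s) (Icc a b) t)
  zero_eq : ∀ t ∈ Icc a b, σ 0 t = γ t
  initial_velocity : ∀ t ∈ Icc a b,
    velocity (𝓡 n) (fun s => σ s t) univ 0 = (⟨γ t, v t⟩ : TangentBundle (𝓡 n) M)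

/-- The symmetric bilinear form `h` on the space of `C¹` fields is the Hessian at the critical
point `γ` of the action functional on the curves that join `P` to `γ(b)`: for every `C²` curve
`s ↦ σ s` in this manifold of curves through `γ` with velocity `v`, `h(v, v)` is the second
derivative at `0` of the action of `σ s`. -/
structure IsActionHessian (H : ℝ × Cot n M → ℝ) (U : Set (ℝ × Cot n M)) (γ : ℝ → M) (P : Set M)
    (a b : ℝ) (hab : a < b) (h : LinearMap.BilinForm ℝ (C1Fields (n := n) γ P a b hab)) : Prop where
  symm : ∀ v w, h v w = h w v
  second_deriv : ∀ (v : C1Fields (n := n) γ P a b hab) (ε : ℝ) (σ : ℝ → ℝ → M),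
    IsVariation H U γ P a b ε σ v.1.1 →
      ContDiffAt ℝ 2 (fun s => action H U a b (σ s)) 0 ∧
        iteratedDeriv 2 (fun s => action H U a b (σ s)) 0 = h v v

/-! ### The index form -/

/-- `φ` is a symplectic trivialization of the tangent bundle of `T*M` along `Γ : [a,b] → T*M`
that maps `L₀ = {0} ⊕ ℝⁿ*` onto the vertical spaces. -/
structure IsSymplecticTrivialization (Γ : ℝ → Cot n M) (a b : ℝ)
    (φ : ∀ t : ℝ, (Eu n × EuDual n) ≃L[ℝ] TangentSpace (ICot n) (Γ t)) : Prop where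
  smooth : ∀ x : Eu n × EuDual n, ContMDiffOn 𝓘(ℝ, ℝ) (ICot n).tangent ∞
    (fun t => (⟨Γ t, φ t x⟩ : TangentBundle (ICot n) (Cot n M))) (Icc a b)
  symplectic : ∀ t ∈ Icc a b, ∀ x y, omega (Γ t) (φ t x) (φ t y) = stdSymp x y
  vertical : ∀ t ∈ Icc a b, ∀ x, dproj (Γ t) (φ t x) = 0 ↔ x.1 = 0

/-- `X = Ψ' Ψ⁻¹`, where `Ψ(t) = φ(t)⁻¹ ∘ dF_{t,a}(Γ(a)) ∘ φ(a)` and `F` is the Hamiltonian flow. -/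
def IsCoefficient (H : ℝ × Cot n M → ℝ) (U : Set (ℝ × Cot n M)) (Γ : ℝ → Cot n M) (a b : ℝ)
    (φ : ∀ t : ℝ, (Eu n × EuDual n) ≃L[ℝ] TangentSpace (ICot n) (Γ t))
    (X : ℝ → (Eu n × EuDual n) →L[ℝ] (Eu n × EuDual n)) : Prop :=
  ∃ F : ℝ → Cot n M → Cot n M, IsHamiltonianFlow H U a b (Γ a) F ∧
    ∃ Ψ : ℝ → (Eu n × EuDual n) →L[ℝ] (Eu n × EuDual n),
      (∀ t ∈ Icc a b, ∀ x, (⟨Γ t, φ t (Ψ t x)⟩ : TangentBundle (ICot n) (Cot n M)) =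
        tangentMap (ICot n) (ICot n) (F t) ⟨Γ a, φ a x⟩) ∧
      ∀ t ∈ Icc a b, HasDerivWithinAt Ψ (X t ∘L Ψ t) (Icc a b) t

/-- The block `A` of `X = (A B; C -A*)`. -/
def blockA (X : (Eu n × EuDual n) →L[ℝ] (Eu n × EuDual n)) : Eu n →L[ℝ] Eu n :=
  ContinuousLinearMap.fst ℝ (Eu n) (EuDual n) ∘L X ∘L ContinuousLinearMap.inl ℝ (Eu n) (EuDual n)

/-- The block `B` of `X = (A B; C -A*)`. -/
def blockB (X : (Eu n × EuDual n) →L[ℝ] (Eu n × EuDual n)) : EuDual n →L[ℝ] Eu n :=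
  ContinuousLinearMap.fst ℝ (Eu n) (EuDual n) ∘L X ∘L ContinuousLinearMap.inr ℝ (Eu n) (EuDual n)

/-- The block `C` of `X = (A B; C -A*)`. -/
def blockC (X : (Eu n × EuDual n) →L[ℝ] (Eu n × EuDual n)) : Eu n →L[ℝ] EuDual n :=
  ContinuousLinearMap.snd ℝ (Eu n) (EuDual n) ∘L X ∘L ContinuousLinearMap.inl ℝ (Eu n) (EuDual n)

/-- `α_u = B⁻¹(u' - A u)`. -/
def alphaOf (X : ℝ → (Eu n × EuDual n) →L[ℝ] (Eu n × EuDual n)) (u : ℝ → Eu n) (t : ℝ) :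
    EuDual n :=
  (blockB (X t)).inverse (deriv u t - blockA (X t) (u t))

open Classical in
/-- The symmetric bilinear form `S` on `{x | ∃ α, (x, α) ∈ ℓ₀}` of a Lagrangian subspace `ℓ₀`:
`S(x, y) = -α(y)` for `(x, α) ∈ ℓ₀`. -/
def formOf (l₀ : Submodule ℝ (Eu n × EuDual n)) (x y : Eu n) : ℝ :=
  if h : ∃ α : EuDual n, (x, α) ∈ l₀ then -(h.choose y) else 0

/-- The index form `∫ [B(α_u, α_w) + C(u, w)] dt - S(u(a), w(a))` of the pair `(X, ℓ₀)`. -/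
def pairIndexForm (X : ℝ → (Eu n × EuDual n) →L[ℝ] (Eu n × EuDual n))
    (l₀ : Submodule ℝ (Eu n × EuDual n)) (a b : ℝ) (u w : ℝ → Eu n) : ℝ :=
  (∫ t in a..b, (alphaOf X w t (blockB (X t) (alphaOf X u t)) + blockC (X t) (u t) (w t)))
    - formOf l₀ (u a) (w a)

/-- `ℓ₀ = φ(a)⁻¹(T_{Γ(a)} TPᵒ)`. -/
def initialLagrangian (Γ : ℝ → Cot n M) (P : Set M) (a : ℝ)
    (φ : ∀ t : ℝ, (Eu n × EuDual n) ≃L[ℝ] TangentSpace (ICot n) (Γ t)) :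
    Submodule ℝ (Eu n × EuDual n) :=
  (tangentSpaceOf (ICot n) (conormal P) (Γ a)).comap (φ a).toLinearEquiv.toLinearMap

/-- The trivialization of `T(T*M) / vertical` along `Γ` that is induced by `φ`; the quotient is
identified with `TM` by the differential of the projection. -/
def quotTriv (Γ : ℝ → Cot n M)
    (φ : ∀ t : ℝ, (Eu n × EuDual n) ≃L[ℝ] TangentSpace (ICot n) (Γ t)) (t : ℝ) :
    Eu n →L[ℝ] TangentSpace (𝓡 n) (Γ t).proj :=
  dproj (Γ t) ∘L (φ t : (Eu n × EuDual n) →L[ℝ] TangentSpace (ICot n) (Γ t)) ∘L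
    ContinuousLinearMap.inl ℝ (Eu n) (EuDual n)

/-- The index form `I_Γ(v, w) = I(𝒵⁻¹v, 𝒵⁻¹w)` of the Hamiltonian problem, computed with the
symplectic trivialization `φ` and the coefficient matrix `X` that it determines. -/
def indexForm (Γ : ℝ → Cot n M) (P : Set M) (a b : ℝ)
    (φ : ∀ t : ℝ, (Eu n × EuDual n) ≃L[ℝ] TangentSpace (ICot n) (Γ t))
    (X : ℝ → (Eu n × EuDual n) →L[ℝ] (Eu n × EuDual n))
    (v w : ∀ t : ℝ, TangentSpace (𝓡 n) (Γ t).proj) : ℝ :=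
  pairIndexForm X (initialLagrangian Γ P a φ) a b
    (fun t => (quotTriv Γ φ t).inverse (v t)) (fun t => (quotTriv Γ φ t).inverse (w t))

end HamiltonianIndex

end

/-! Everything is reduced to one system of coordinates. Around the graph of `γ` there is a
time-dependent chart `(t, m) ↦ x` of `M` (`TimeChart`, `exists_timeChart`) in which, at time `a`,
the submanifold `P` is a linear subspace `W`. It is obtained by continuing a straightening chart of
`P` at `γ(a)` along the curve. Hence variations of `γ` are families of curves in `ℝⁿ`, the boundary
conditions are linear, and no curvature term of `P` occurs.

In such coordinates the Lagrangian is a smooth function `L(t, x, v)`. The Legendre transformation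
turns Hamilton's equations into the Euler-Lagrange equations `ξ = ∂L/∂v`, `ξ' = ∂L/∂x`
(`TimeChart.euler_lagrange`), where `ξ` is the momentum in the induced coordinates of the cotangent
bundle. Unlike the Hamiltonian, the Lagrangian needs no correction when the coordinates depend on
time. A bootstrap makes the curve smooth.

If `z_s = (x_s, x_s')` is a `C²` variation, the second derivative of `L(t, z_s)` at `s = 0` is
`D²L(z', z') + DL(z'')`, with primes for derivatives in `s`. Since `P` is linear at time `a`, the
first component of `z''` satisfies the same boundary conditions as a variation field; as `(ξ r)' =
DL(r, r')`, as `ξ(a)` annihilates `W` and as `r(b) = 0`, the last term integrates to zero. So the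
Hessian is `∫ D²L((u, u'), (u, u'))` (`TimeChart.second_variation`). Affine variations `x + s u`
realise every `C¹` field, and polarization gives uniqueness. The same formula defines a bounded form
`TimeChart.hessForm` on `H¹` fields, and density of the `C¹` fields (`exists_C1_approx`,
`eq_of_isBoundedForm`) makes it the only bounded extension.

For the index form, `φ` read in phase coordinates is a family `G` of linear symplectomorphisms that
preserve the vertical space. The Hamiltonian flow consists of solutions of the Euler-Lagrange
equations; differentiating these in the initial point shows that `Y = G Ψ x` solves the linearized
equation `Q(Y₁, Y₁')(w, w') = Y₂'(w) + Y₂(w')` with `Q = D²L` (`TimeChart.isJacobiFlow`). The rest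
is linear algebra. The equation and the symplectic identities for `G` and `X` show that `B` is
injective and that `Q`, evaluated on fields expressed in the frame `φ`, is the integrand of the
index form plus the derivative of `r = C_G(w)(A_G u)`, where `A_G` and `C_G` are blocks of `G`
(`IsJacobiFlow.form_eq`). Finally `r(b) = 0` and `r(a) = S(u(a), w(a))` (`IsJacobiFlow.formOf_eq`).
The form `hessForm` does not involve `φ`, so neither does the value of the index form. -/

noncomputable section

namespace HamiltonianIndex

/-! ### Charts of the tangent and cotangent bundles -/

section
section General
variable {E₀ : Type*} [NormedAddCommGroup E₀] [NormedSpace ℝ E₀]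
  {H₀ : Type*} [TopologicalSpace H₀] {I : ModelWithCorners ℝ E₀ H₀}
  {N : Type*} [TopologicalSpace N] [ChartedSpace H₀ N]

variable (I) in
/-- The differential at `m` of the chart at `m₀`. -/
def chartDeriv [IsManifold I 1 N] (m₀ m : N) : TangentSpace I m →L[ℝ] E₀ :=
  (trivializationAt E₀ (TangentSpace I) m₀).continuousLinearMapAt ℝ m

variable (I) in
/-- The inverse of the differential at `m` of the chart at `m₀`. -/
def chartDerivSymm [IsManifold I 1 N] (m₀ m : N) : E₀ →L[ℝ] TangentSpace I m :=
  (trivializationAt E₀ (TangentSpace I) m₀).symmL ℝ m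

variable [IsManifold I 1 N]

theorem chartDeriv_chartDerivSymm {m₀ m : N} (hm : m ∈ (chartAt H₀ m₀).source) (v : E₀) :
    chartDeriv I m₀ m (chartDerivSymm I m₀ m v) = v :=
  Bundle.Trivialization.continuousLinearMapAt_symmL _ hm v

theorem chartDerivSymm_chartDeriv {m₀ m : N} (hm : m ∈ (chartAt H₀ m₀).source)
    (v : TangentSpace I m) :
    chartDerivSymm I m₀ m (chartDeriv I m₀ m v) = v :=
  Bundle.Trivialization.symmL_continuousLinearMapAt _ hm v

theorem hasMFDerivAt_extChartAt {m₀ m : N} (hm : m ∈ (chartAt H₀ m₀).source) :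
    HasMFDerivAt I 𝓘(ℝ, E₀) (extChartAt I m₀) m (chartDeriv I m₀ m) := by
  have h := (mdifferentiableAt_extChartAt (I := I) hm).hasMFDerivAt
  have h2 := TangentBundle.continuousLinearMapAt_trivializationAt (I := I) hm
  exact h.congr_mfderiv h2.symm

theorem hasDerivWithinAt_of_hasMFDerivWithinAt {f : ℝ → E₀} {s : Set ℝ} {t : ℝ} {L : ℝ →L[ℝ] E₀}
    (h : HasMFDerivWithinAt 𝓘(ℝ, ℝ) 𝓘(ℝ, E₀) f s t L) : HasDerivWithinAt f (L 1) s t := by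
  have h' : HasFDerivWithinAt f L s t := hasMFDerivWithinAt_iff_hasFDerivWithinAt.1 h
  exact h'.hasDerivWithinAt

theorem hasDerivWithinAt_extChartAt_comp {c : ℝ → N} {s : Set ℝ} {t : ℝ} {m₀ : N}
    (hc : MDifferentiableWithinAt 𝓘(ℝ, ℝ) I c s t) (hm : c t ∈ (chartAt H₀ m₀).source) :
    HasDerivWithinAt (fun τ => extChartAt I m₀ (c τ))
      (chartDeriv I m₀ (c t) (mfderivWithin 𝓘(ℝ, ℝ) I c s t (1 : ℝ))) s t := by
  have h2 := (hasMFDerivAt_extChartAt (I := I) hm).comp_hasMFDerivWithinAt t hc.hasMFDerivWithinAt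
  exact hasDerivWithinAt_of_hasMFDerivWithinAt h2

theorem trivializationAt_tangent_snd {m₀ m : N} (hm : m ∈ (chartAt H₀ m₀).source)
    (w : TangentSpace I m) :
    (trivializationAt E₀ (TangentSpace I) m₀ (⟨m, w⟩ : TangentBundle I N)).2 =
      chartDeriv I m₀ m w := by
  rw [chartDeriv, Bundle.Trivialization.continuousLinearMapAt_apply,
    Bundle.Trivialization.coe_linearMapAt_of_mem]
  exact hm

theorem extChartAt_tangent_apply {m : N} {p₀ : TangentBundle I N}
    (hm : m ∈ (chartAt H₀ p₀.proj).source) (w : TangentSpace I m) :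
    extChartAt I.tangent p₀ (⟨m, w⟩ : TangentBundle I N) =
      (extChartAt I p₀.proj m, chartDeriv I p₀.proj m w) := by
  rw [← trivializationAt_tangent_snd hm]
  rfl

theorem mem_extChartAt_tangent_source {p₀ p : TangentBundle I N} :
    p ∈ (extChartAt I.tangent p₀).source ↔ p.proj ∈ (chartAt H₀ p₀.proj).source := by
  rw [extChartAt_source]
  exact TangentBundle.mem_chart_source_iff _ _

/-- Smoothness into the total space may be tested in the one trivialization at `c t`, because by
continuity the curve stays in its base set near `t`. -/
theorem contMDiffWithinAt_field_iff {k : WithTop ℕ∞} {c : ℝ → N} {s : Set ℝ} {t : ℝ}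
    {ρ : ∀ t, TangentSpace I (c t)} :
    ContMDiffWithinAt 𝓘(ℝ, ℝ) I.tangent k (fun τ => (⟨c τ, ρ τ⟩ : TangentBundle I N)) s t ↔
      ContMDiffWithinAt 𝓘(ℝ, ℝ) I k c s t ∧
      ContDiffWithinAt ℝ k (fun τ => chartDeriv I (c t) (c τ) (ρ τ)) s t := by
  rw [Bundle.contMDiffWithinAt_totalSpace]
  refine and_congr_right fun h => ?_
  rw [contMDiffWithinAt_iff_contDiffWithinAt]
  have h1 := h.continuousWithinAt.preimage_mem_nhdsWithin
    ((chartAt H₀ (c t)).open_source.mem_nhds (mem_chart_source H₀ (c t)))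
  have h2 : (fun τ => (trivializationAt E₀ (TangentSpace I) (c t)
      (⟨c τ, ρ τ⟩ : TangentBundle I N)).2) =ᶠ[𝓝[s] t] fun τ => chartDeriv I (c t) (c τ) (ρ τ) := by
    filter_upwards [h1] with τ hτ
    exact trivializationAt_tangent_snd hτ _
  have h3 := trivializationAt_tangent_snd (I := I) (mem_chart_source H₀ (c t)) (ρ t)
  exact ⟨fun h => h.congr_of_eventuallyEq h2.symm h3.symm, fun h => h.congr_of_eventuallyEq h2 h3⟩

end General

variable {n : ℕ} {M : Type*} [TopologicalSpace M] [ChartedSpace (Eu n) M] [IsManifold (𝓡 n) ∞ M]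

theorem mem_cot_source {p₀ p : Cot n M} :
    p ∈ (extChartAt (ICot n) p₀).source ↔ p.proj ∈ (chartAt (Eu n) p₀.proj).source := by
  rw [extChartAt_source, FiberBundle.chartedSpace_chartAt]
  simp only [mfld_simps]
  constructor
  · intro h; exact h.1.1
  · intro h; exact ⟨⟨h, trivial⟩, h⟩

/-- The cotangent bundle is here the bundle of homomorphisms into the trivial line bundle, whose
trivializations are the identity; so the momentum coordinate is just `p` composed with the inverse
of the chart differential. -/
theorem extChartAt_cot_apply {p₀ p : Cot n M} :
    extChartAt (ICot n) p₀ p = (extChartAt (𝓡 n) p₀.proj p.proj,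
      p.snd ∘L chartDerivSymm (𝓡 n) p₀.proj p.proj) := by
  have h : (Bundle.Trivialization.continuousLinearMapAt ℝ
      (trivializationAt ℝ (Bundle.Trivial M ℝ) p₀.proj) p.proj : ℝ →L[ℝ] ℝ) =
      ContinuousLinearMap.id ℝ ℝ := by
    ext
    simp
  have h' : ContinuousLinearMap.inCoordinates (Eu n) (fun x : M => TangentSpace (𝓡 n) x) ℝ
      (Bundle.Trivial M ℝ) p₀.proj p.proj p₀.proj p.proj p.snd =
      p.snd ∘L chartDerivSymm (𝓡 n) p₀.proj p.proj := by
    ext v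
    exact congrArg (fun L : ℝ →L[ℝ] ℝ => L (p.snd (chartDerivSymm (𝓡 n) p₀.proj p.proj v))) h
  rw [FiberBundle.extChartAt, ← h']
  rfl

end

/-! ### Time-dependent charts along a curve -/

section
/-- A smooth time-dependent system of coordinates `(t, m) ↦ coord (t, m)` on a manifold, defined on
an open subset of `ℝ × M`, with inverse `(t, x) ↦ param (t, x)`. -/
structure TimeChart (n : ℕ) (M : Type*) [TopologicalSpace M] [ChartedSpace (Eu n) M] where
  /-- the coordinates -/
  coord : ℝ × M → Eu n
  /-- the inverse parametrization -/
  param : ℝ × Eu n → M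
  /-- the domain of the coordinates -/
  source : Set (ℝ × M)
  /-- the domain of the parametrization -/
  target : Set (ℝ × Eu n)
  isOpen_source : IsOpen source
  isOpen_target : IsOpen target
  map_source : ∀ z ∈ source, (z.1, coord z) ∈ target
  map_target : ∀ y ∈ target, (y.1, param y) ∈ source
  left_inv : ∀ z ∈ source, param (z.1, coord z) = z.2
  right_inv : ∀ y ∈ target, coord (y.1, param y) = y.2
  contMDiffOn_coord : ContMDiffOn (𝓘(ℝ, ℝ).prod (𝓡 n)) 𝓘(ℝ, Eu n) ∞ coord source
  contMDiffOn_param : ContMDiffOn 𝓘(ℝ, ℝ × Eu n) (𝓡 n) ∞ param target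

variable {n : ℕ} {M : Type*} [TopologicalSpace M] [ChartedSpace (Eu n) M] [IsManifold (𝓡 n) ∞ M]

-- Past time `s` the old coordinates are used with the clock stopped, after a translation in the
-- chart at `m₀` that brings `γ(t)` back close to `γ(s)`. Both modifications are switched on
-- smoothly just after `s`, so the coordinates at time `a` are untouched.
open Classical in
theorem TimeChart.exists_extend (e : TimeChart n M) {γ : ℝ → M} (hγ : Continuous γ) {a s r : ℝ}
    (has : a ≤ s) (hsr : s ≤ r) (he : ∀ t ∈ Icc a s, (t, γ t) ∈ e.source) {m₀ : M}
    (hm : ∀ t ∈ Icc s r, γ t ∈ (chartAt (Eu n) m₀).source) :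
    ∃ e' : TimeChart n M, (∀ t ∈ Icc a r, (t, γ t) ∈ e'.source) ∧
      ∀ m, (a, m) ∈ e'.source → (a, m) ∈ e.source ∧ e'.coord (a, m) = e.coord (a, m) := by
  set ψ := extChartAt (𝓡 n) m₀ with hψ
  have hsrc : ψ.source = (chartAt (Eu n) m₀).source := extChartAt_source _ _
  have hopS : IsOpen ψ.source := isOpen_extChartAt_source m₀
  have hopT : IsOpen ψ.target := isOpen_extChartAt_target m₀
  have hψc : ContinuousOn ψ ψ.source := continuousOn_extChartAt m₀
  have hψs : ContinuousOn ψ.symm ψ.target := continuousOn_extChartAt_symm m₀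
  set O : Set (ℝ × Eu n) := {z | z.2 ∈ ψ.target ∧ (z.1, ψ.symm z.2) ∈ e.source} with hO
  have hOopen : IsOpen O := by
    have h1 : ContinuousOn (fun z : ℝ × Eu n => (z.1, ψ.symm z.2)) (Prod.snd ⁻¹' ψ.target) :=
      continuousOn_fst.prodMk (hψs.comp continuousOn_snd (fun z hz => hz))
    exact h1.isOpen_inter_preimage (hopT.preimage continuous_snd) e.isOpen_source
  have hγs : γ s ∈ ψ.source := hsrc ▸ hm s ⟨le_rfl, hsr⟩
  have hsO : (s, ψ (γ s)) ∈ O :=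
    ⟨ψ.map_source hγs, by simpa [ψ.left_inv hγs] using he s ⟨has, le_rfl⟩⟩
  -- The rest of the curve, with its time, will be moved into this ball, on which the old
  -- coordinates are defined.
  obtain ⟨ε, hε, hball⟩ := Metric.isOpen_iff.1 hOopen _ hsO
  have hnear : ∀ᶠ t in 𝓝 s, (‖ψ (γ t) - ψ (γ s)‖ < ε / 2 ∧ (t, γ t) ∈ e.source) ∧ |t - s| < ε := by
    have h1 : ContinuousAt (fun t => ψ (γ t)) s :=
      (hψc.continuousAt (hopS.mem_nhds hγs)).comp hγ.continuousAt
    have h2 : ContinuousAt (fun t => (t, γ t)) s := continuousAt_id.prodMk hγ.continuousAt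
    have h3 := Metric.tendsto_nhds.1 h1 (ε / 2) (by positivity)
    refine (Filter.Eventually.and ?_ ?_).and ?_
    · simpa [dist_eq_norm] using h3
    · exact h2.eventually (e.isOpen_source.mem_nhds (he s ⟨has, le_rfl⟩))
    · filter_upwards [Metric.ball_mem_nhds s hε] with t ht
      simpa [Real.dist_eq] using ht
  obtain ⟨δ, hδ, hnear⟩ := Metric.eventually_nhds_iff.1 hnear
  -- The curve is only continuous, while the translation must be smooth in `t`; a smooth
  -- approximation of `ψ ∘ γ` up to `ε / 2` serves instead.
  obtain ⟨y, hy⟩ : ∃ y : ℝ → Eu n, ContDiff ℝ ∞ y ∧ ∀ t ∈ Icc s r, ‖ψ (γ t) - y t‖ < ε / 2 := by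
    have hc : Continuous (fun t => ψ (γ (projIcc s r hsr t))) := by
      refine hψc.comp_continuous (hγ.comp (continuous_subtype_val.comp continuous_projIcc)) ?_
      intro t
      exact hsrc ▸ hm _ (projIcc s r hsr t).2
    obtain ⟨g, hg, -⟩ := hc.exists_contMDiff_approx 𝓘(ℝ, ℝ) (⊤ : ℕ∞)
      (ε := fun _ => ε / 2) continuous_const (fun _ => by positivity)
    refine ⟨g, g.contMDiff.contDiff, fun t ht => ?_⟩
    have := hg t
    rw [dist_comm, dist_eq_norm] at this
    simpa [projIcc_of_mem hsr ht] using this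
  -- The switch happens between `s + δ / 2` and `s + 3δ / 4`, inside the range where `hnear`
  -- controls the curve.
  set χ : ℝ → ℝ := fun t => Real.smoothTransition ((t - (s + δ / 2)) / (δ / 4)) with hχ
  have hχs : ContDiff ℝ ∞ χ :=
    Real.smoothTransition.contDiff.comp ((contDiff_id.sub contDiff_const).div_const _)
  have hχ0 : ∀ t, t ≤ s + δ / 2 → χ t = 0 := fun t ht =>
    Real.smoothTransition.zero_of_nonpos
      (div_nonpos_of_nonpos_of_nonneg (by linarith) (by positivity))
  have hχ1 : ∀ t, s + 3 * δ / 4 ≤ t → χ t = 1 := fun t ht =>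
    Real.smoothTransition.one_of_one_le ((one_le_div (by positivity)).2 (by linarith))
  have hχnn : ∀ t, 0 ≤ χ t := fun t => Real.smoothTransition.nonneg _
  have hχle : ∀ t, χ t ≤ 1 := fun t => Real.smoothTransition.le_one _
  -- The modified clock: `t` before the switch, `s` after it. The translation `k` goes from `0` to
  -- `y t - ψ (γ s)`.
  set θ : ℝ → ℝ := fun t => t + χ t * (s - t) with hθ
  set k : ℝ → Eu n := fun t => χ t • (y t - ψ (γ s)) with hk
  have hθs : ContDiff ℝ ∞ θ := contDiff_id.add (hχs.mul (contDiff_const.sub contDiff_id))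
  have hks : ContDiff ℝ ∞ k := hχs.smul (hy.1.sub contDiff_const)
  have hθ0 : ∀ t, t < s + δ / 2 → θ t = t := fun t ht => by simp [hθ, hχ0 t ht.le]
  have hk0 : ∀ t, t < s + δ / 2 → k t = 0 := fun t ht => by simp [hk, hχ0 t ht.le]
  set f' : ℝ × M → Eu n := fun z => if z.1 < s + δ / 2 then e.coord z else
    e.coord (θ z.1, ψ.symm (ψ z.2 - k z.1)) with hf'
  set g' : ℝ × Eu n → M := fun z => if z.1 < s + δ / 2 then e.param z else
    ψ.symm (ψ (e.param (θ z.1, z.2)) + k z.1) with hg'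
  -- The two open pieces overlap in time between `s + δ / 4` and `s + δ / 2`, where `θ t = t` and `k
  -- t = 0`, so the two formulas agree there and smoothness can be checked on each piece.
  set D₁ : Set (ℝ × M) := e.source ∩ Prod.fst ⁻¹' Iio (s + δ / 2) with hD₁
  set D₂ : Set (ℝ × M) := {z | s + δ / 4 < z.1 ∧ z.2 ∈ ψ.source ∧ (θ z.1, ψ z.2 - k z.1) ∈ O}
    with hD₂
  set T₁ : Set (ℝ × Eu n) := e.target ∩ Prod.fst ⁻¹' Iio (s + δ / 2) with hT₁
  set T₂ : Set (ℝ × Eu n) := {z | s + δ / 4 < z.1 ∧ ((θ z.1, z.2) ∈ e.target ∧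
    e.param (θ z.1, z.2) ∈ ψ.source) ∧ ψ (e.param (θ z.1, z.2)) + k z.1 ∈ ψ.target} with hT₂
  have hfD₁ : ∀ z ∈ D₁, f' z = e.coord z := fun z hz => if_pos hz.2
  have hfD₂ : ∀ z ∈ D₂, f' z = e.coord (θ z.1, ψ.symm (ψ z.2 - k z.1)) := by
    intro z hz
    by_cases h : z.1 < s + δ / 2
    · rw [hf']
      simp only [h, if_true, hθ0 _ h, hk0 _ h, sub_zero, ψ.left_inv hz.2.1]
    · exact if_neg h
  have hgT₁ : ∀ z ∈ T₁, g' z = e.param z := fun z hz => if_pos hz.2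
  have hgT₂ : ∀ z ∈ T₂, g' z = ψ.symm (ψ (e.param (θ z.1, z.2)) + k z.1) := by
    intro z hz
    by_cases h : z.1 < s + δ / 2
    · have h2 := hz.2.1.2
      rw [hθ0 _ h] at h2
      rw [hg']
      simp only [h, if_true, hθ0 _ h, hk0 _ h, add_zero]
      exact (ψ.left_inv h2).symm
    · exact if_neg h
  have hmap₁ : ∀ z ∈ D₁, (z.1, f' z) ∈ T₁ := fun z hz => by
    rw [hfD₁ z hz]
    exact ⟨e.map_source z hz.1, hz.2⟩
  have hmap₂ : ∀ z ∈ D₂, (z.1, f' z) ∈ T₂ := fun z hz => by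
    rw [hfD₂ z hz]
    have h1 := e.map_source _ hz.2.2.2
    have h2 := e.left_inv _ hz.2.2.2
    simp only at h1 h2
    refine ⟨hz.1, ⟨h1, ?_⟩, ?_⟩
    · simp only [h2]
      exact ψ.map_target hz.2.2.1
    · simp only [h2]
      rw [ψ.right_inv hz.2.2.1]
      simpa using ψ.map_source hz.2.1
  have hmap₁' : ∀ z ∈ T₁, (z.1, g' z) ∈ D₁ := fun z hz => by
    rw [hgT₁ z hz]
    exact ⟨e.map_target z hz.1, hz.2⟩
  have hmap₂' : ∀ z ∈ T₂, (z.1, g' z) ∈ D₂ := fun z hz => by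
    rw [hgT₂ z hz]
    refine ⟨hz.1, ψ.map_target hz.2.2, ?_⟩
    simp only [ψ.right_inv hz.2.2, add_sub_cancel_right]
    refine ⟨ψ.map_source hz.2.1.2, ?_⟩
    simp only [ψ.left_inv hz.2.1.2]
    exact e.map_target _ hz.2.1.1
  have hoD₁ : IsOpen D₁ := e.isOpen_source.inter (isOpen_Iio.preimage continuous_fst)
  have hoT₁ : IsOpen T₁ := e.isOpen_target.inter (isOpen_Iio.preimage continuous_fst)
  have hoD₂ : IsOpen D₂ := by
    have h1 : ContinuousOn (fun z : ℝ × M => (θ z.1, ψ z.2 - k z.1)) (Prod.snd ⁻¹' ψ.source) :=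
      (hθs.continuous.comp continuous_fst).continuousOn.prodMk
        ((hψc.comp continuousOn_snd (fun z hz => hz)).sub
          (hks.continuous.comp continuous_fst).continuousOn)
    have h2 := h1.isOpen_inter_preimage (hopS.preimage continuous_snd) hOopen
    exact (isOpen_Ioi.preimage continuous_fst).inter h2
  have hparam_c : ContinuousOn (fun z : ℝ × Eu n => e.param (θ z.1, z.2))
      {z | (θ z.1, z.2) ∈ e.target} :=
    e.contMDiffOn_param.continuousOn.comp
      ((hθs.continuous.comp continuous_fst).prodMk continuous_snd).continuousOn (fun z hz => hz)
  have hoT₂' : IsOpen {z : ℝ × Eu n | (θ z.1, z.2) ∈ e.target} :=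
    e.isOpen_target.preimage ((hθs.continuous.comp continuous_fst).prodMk continuous_snd)
  have hoT₂'' := hparam_c.isOpen_inter_preimage hoT₂' hopS
  have hoT₂ : IsOpen T₂ := by
    have h1 : ContinuousOn (fun z : ℝ × Eu n => ψ (e.param (θ z.1, z.2)) + k z.1)
        ({z : ℝ × Eu n | (θ z.1, z.2) ∈ e.target} ∩
          (fun z : ℝ × Eu n => e.param (θ z.1, z.2)) ⁻¹' ψ.source) :=
      (hψc.comp (hparam_c.mono inter_subset_left) (fun z hz => hz.2)).add
        (hks.continuous.comp continuous_fst).continuousOn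
    exact (isOpen_Ioi.preimage continuous_fst).inter (h1.isOpen_inter_preimage hoT₂'' hopT)
  refine ⟨{ coord := f', param := g', source := D₁ ∪ D₂, target := T₁ ∪ T₂,
            isOpen_source := hoD₁.union hoD₂, isOpen_target := hoT₁.union hoT₂,
            map_source := fun z hz => hz.imp (hmap₁ z) (hmap₂ z),
            map_target := fun z hz => hz.imp (hmap₁' z) (hmap₂' z),
            left_inv := ?_, right_inv := ?_, contMDiffOn_coord := ?_, contMDiffOn_param := ?_ },
    ?_, ?_⟩
  · rintro z (hz | hz)
    · rw [hgT₁ _ (hmap₁ z hz), hfD₁ z hz]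
      exact e.left_inv z hz.1
    · rw [hgT₂ _ (hmap₂ z hz), hfD₂ z hz]
      have h2 := e.left_inv _ hz.2.2.2
      simp only at h2 ⊢
      rw [h2, ψ.right_inv hz.2.2.1, sub_add_cancel, ψ.left_inv hz.2.1]
  · rintro z (hz | hz)
    · rw [hfD₁ _ (hmap₁' z hz), hgT₁ z hz]
      exact e.right_inv z hz.1
    · rw [hfD₂ _ (hmap₂' z hz), hgT₂ z hz]
      simp only [ψ.right_inv hz.2.2, add_sub_cancel_right]
      rw [ψ.left_inv hz.2.1.2]
      exact e.right_inv _ hz.2.1.1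
  · refine ContMDiffOn.union_of_isOpen ?_ ?_ hoD₁ hoD₂
    · exact (e.contMDiffOn_coord.mono inter_subset_left).congr hfD₁
    · refine ContMDiffOn.congr ?_ hfD₂
      refine e.contMDiffOn_coord.comp (t := e.source) ?_ (fun z hz => hz.2.2.2)
      refine ContMDiffOn.prodMk ?_ ?_
      · exact hθs.contMDiff.comp_contMDiffOn contMDiffOn_fst
      · refine (contMDiffOn_extChartAt_symm m₀).comp (t := ψ.target) ?_ (fun z hz => hz.2.2.1)
        refine ContMDiffOn.sub ?_ ?_
        · exact (contMDiffOn_extChartAt (I := 𝓡 n) (x := m₀) (n := ∞)).comp contMDiffOn_snd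
            (fun z hz => hsrc ▸ hz.2.1)
        · exact hks.contMDiff.comp_contMDiffOn contMDiffOn_fst
  · refine ContMDiffOn.union_of_isOpen ?_ ?_ hoT₁ hoT₂
    · exact (e.contMDiffOn_param.mono inter_subset_left).congr hgT₁
    · refine ContMDiffOn.congr ?_ hgT₂
      refine (contMDiffOn_extChartAt_symm m₀).comp (t := ψ.target) ?_ (fun z hz => hz.2.2)
      refine ContMDiffOn.add ?_ ?_
      · refine (contMDiffOn_extChartAt (I := 𝓡 n) (x := m₀) (n := ∞)).comp ?_
            (fun z hz => hsrc ▸ hz.2.1.2)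
        refine e.contMDiffOn_param.comp (t := e.target) ?_ (fun z hz => hz.2.1.1)
        exact ((hθs.comp contDiff_fst).prodMk contDiff_snd).contMDiff.contMDiffOn
      · exact (hks.comp contDiff_fst).contMDiff.contMDiffOn
  · intro t ht
    by_cases h : t < s + δ / 2
    · refine Or.inl ⟨?_, h⟩
      rcases le_total t s with h1 | h1
      · exact he t ⟨ht.1, h1⟩
      · refine (hnear ?_).1.2
        rw [Real.dist_eq, abs_of_nonneg (by linarith)]
        linarith
    · push Not at h
      have htI : t ∈ Icc s r := ⟨by linarith, ht.2⟩
      refine Or.inr ⟨show s + δ / 4 < t by linarith, hsrc ▸ hm t htI, hball ?_⟩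
      have e1 : θ t - s = (1 - χ t) * (t - s) := by simp only [hθ]; ring
      -- A convex combination: the first difference only matters before `s + δ`, where it is less
      -- than `ε / 2`, and the second is the approximation error.
      have e2 : ψ (γ t) - k t - ψ (γ s) =
          (1 - χ t) • (ψ (γ t) - ψ (γ s)) + χ t • (ψ (γ t) - y t) := by
        simp only [hk]
        module
      rw [Metric.mem_ball, Prod.dist_eq, max_lt_iff]
      simp only [dist_eq_norm]
      rw [e1, e2]
      have hA : |(1 - χ t) * (t - s)| < ε ∧ ‖(1 - χ t) • (ψ (γ t) - ψ (γ s))‖ ≤ ε / 2 := by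
        by_cases h3 : t < s + δ
        · have h4 := hnear (y := t) (by rw [Real.dist_eq, abs_of_nonneg (by linarith)]; linarith)
          constructor
          · rw [abs_mul, abs_of_nonneg (by linarith [hχle t])]
            calc (1 - χ t) * |t - s| ≤ 1 * |t - s| := by gcongr; linarith [hχnn t]
              _ < ε := by linarith [h4.2]
          · rw [norm_smul, Real.norm_eq_abs, abs_of_nonneg (by linarith [hχle t])]
            calc (1 - χ t) * ‖ψ (γ t) - ψ (γ s)‖ ≤ 1 * ‖ψ (γ t) - ψ (γ s)‖ := by
                  gcongr; linarith [hχnn t]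
              _ ≤ ε / 2 := by linarith [h4.1.1]
        · rw [hχ1 t (by linarith)]
          simpa [hε] using (half_pos hε).le
      refine ⟨hA.1, (norm_add_le _ _).trans_lt ?_⟩
      have hB : ‖χ t • (ψ (γ t) - y t)‖ < ε / 2 := by
        rw [norm_smul, Real.norm_eq_abs, abs_of_nonneg (hχnn t)]
        calc χ t * ‖ψ (γ t) - y t‖ ≤ 1 * ‖ψ (γ t) - y t‖ := by gcongr; exact hχle t
          _ < ε / 2 := by linarith [hy.2 t htI]
      linarith [hA.2]
  · rintro m (hm' | hm')
    · exact ⟨hm'.1, hfD₁ _ hm'⟩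
    -- The second piece only contains times after `s ≥ a`.
    · exact absurd (show s + δ / 4 < a from hm'.1) (by linarith)

/-- A chart of the manifold, as a time-dependent chart. -/
def TimeChart.ofChart (ψ : OpenPartialHomeomorph M (Eu n))
    (hψ : ψ ∈ IsManifold.maximalAtlas (𝓡 n) ∞ M) : TimeChart n M where
  coord z := ψ z.2
  param y := ψ.symm y.2
  source := Prod.snd ⁻¹' ψ.source
  target := Prod.snd ⁻¹' ψ.target
  isOpen_source := ψ.open_source.preimage continuous_snd
  isOpen_target := ψ.open_target.preimage continuous_snd
  map_source _ hz := ψ.map_source hz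
  map_target _ hy := ψ.map_target hy
  left_inv _ hz := ψ.left_inv hz
  right_inv _ hy := ψ.right_inv hy
  contMDiffOn_coord := (contMDiffOn_of_mem_maximalAtlas hψ).comp contMDiffOn_snd (fun _ hz => hz)
  contMDiffOn_param := (contMDiffOn_symm_of_mem_maximalAtlas hψ).comp
    contDiff_snd.contMDiff.contMDiffOn (fun _ hz => hz)

/-- Along a continuous curve that starts on a submanifold there is a time-dependent chart that
straightens the submanifold at the initial time. -/
theorem exists_timeChart {a b : ℝ} (hab : a < b) {γ : ℝ → M} (hγ : ContinuousOn γ (Icc a b))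
    {P : Set M} (hP : IsSubmanifold (n := n) P) (hγa : γ a ∈ P) :
    ∃ (e : TimeChart n M) (W : Submodule ℝ (Eu n)), (∀ t ∈ Icc a b, (t, γ t) ∈ e.source) ∧
      ∀ m, (a, m) ∈ e.source → (m ∈ P ↔ e.coord (a, m) ∈ W) := by
  obtain ⟨ψ, hψ, hx, W, hW⟩ := hP _ hγa
  set γ' : ℝ → M := IccExtend hab.le ((Icc a b).domRestrict γ) with hγ'
  have hγ'c : Continuous γ' := (continuousOn_iff_continuous_domRestrict.1 hγ).Icc_extend'
  have hγ'e : ∀ t ∈ Icc a b, γ' t = γ t := fun t ht => by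
    rw [hγ', IccExtend_of_mem _ _ ht]; rfl
  -- A partition of `[a, b]` such that each piece of the curve lies in a single chart; it is
  -- constant from index `N` on.
  obtain ⟨τ, hτ0, hτm, ⟨N, hN⟩, hτ⟩ := exists_monotone_Icc_subset_open_cover_Icc hab.le
    (c := fun m : M => {t : Icc a b | γ' t ∈ (chartAt (Eu n) m).source})
    (fun m => (chartAt (Eu n) m).open_source.preimage (hγ'c.comp continuous_subtype_val))
    (fun t _ => mem_iUnion.2 ⟨γ' t, mem_chart_source _ _⟩)
  -- Induction over the pieces, starting from the chart that straightens `P`. Extensions keep the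
  -- coordinates at time `a`, hence also the straightening.
  have key : ∀ k : ℕ, ∃ e : TimeChart n M, (∀ t ∈ Icc a (τ k : ℝ), (t, γ' t) ∈ e.source) ∧
      ∀ m, (a, m) ∈ e.source → (m ∈ P ↔ e.coord (a, m) ∈ W) := by
    intro k
    induction k with
    | zero =>
      refine ⟨TimeChart.ofChart ψ hψ, fun t ht => ?_, fun m hm => hW m hm⟩
      have : t = a := le_antisymm (by simpa [hτ0] using ht.2) ht.1
      subst this
      show γ' t ∈ ψ.source
      rw [hγ'e t ⟨le_rfl, hab.le⟩]
      exact hx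
    | succ k ih =>
      obtain ⟨e, he, heP⟩ := ih
      obtain ⟨m₀, hm₀⟩ := hτ k
      obtain ⟨e', he', h'⟩ := e.exists_extend hγ'c (τ k).2.1
        (show (τ k : ℝ) ≤ τ (k + 1) from hτm (Nat.le_succ k)) he (m₀ := m₀)
        (fun t ht => hm₀ (show (⟨t, (τ k).2.1.trans ht.1, ht.2.trans (τ (k + 1)).2.2⟩ : Icc a b)
          ∈ Icc (τ k) (τ (k + 1)) from ⟨ht.1, ht.2⟩))
      refine ⟨e', he', fun m hm => ?_⟩
      rw [(h' m hm).2]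
      exact heP m (h' m hm).1
  obtain ⟨e, he, heP⟩ := key N
  refine ⟨e, W, fun t ht => ?_, heP⟩
  rw [← hγ'e t ht]
  refine he t ⟨ht.1, ?_⟩
  rw [hN N le_rfl]
  exact ht.2

end

/-! ### Time-dependent charts and velocities, in fixed charts of the manifold -/

section
theorem hasFDerivAt_of_hasMFDerivAt {E F : Type*} [NormedAddCommGroup E] [NormedSpace ℝ E]
    [NormedAddCommGroup F] [NormedSpace ℝ F] {f : E → F} {x : E} {L : E →L[ℝ] F}
    (h : HasMFDerivAt 𝓘(ℝ, E) 𝓘(ℝ, F) f x L) : HasFDerivAt f L x :=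
  hasMFDerivAt_iff_hasFDerivAt.1 h

variable {n : ℕ} {M : Type*} [TopologicalSpace M] [ChartedSpace (Eu n) M]

namespace TimeChart
variable (e : TimeChart n M)

/-- The parametrization, read off in the chart at `m₀`. -/
def paramIn (m₀ : M) (y : ℝ × Eu n) : Eu n := extChartAt (𝓡 n) m₀ (e.param y)

/-- The domain of `paramIn`. -/
def paramDom (m₀ : M) : Set (ℝ × Eu n) := e.target ∩ e.param ⁻¹' (chartAt (Eu n) m₀).source

/-- The coordinates, as functions of the coordinates of the chart at `m₀`. -/
def coordIn (m₀ : M) (z : ℝ × Eu n) : Eu n := e.coord (z.1, (extChartAt (𝓡 n) m₀).symm z.2)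

/-- The domain of `coordIn`. -/
def coordDom (m₀ : M) : Set (ℝ × Eu n) :=
  {z | z.2 ∈ (extChartAt (𝓡 n) m₀).target ∧ (z.1, (extChartAt (𝓡 n) m₀).symm z.2) ∈ e.source}

theorem isOpen_paramDom (m₀ : M) : IsOpen (e.paramDom m₀) :=
  e.contMDiffOn_param.continuousOn.isOpen_inter_preimage e.isOpen_target
    (chartAt (Eu n) m₀).open_source

theorem isOpen_coordDom (m₀ : M) : IsOpen (e.coordDom m₀) := by
  have h1 : ContinuousOn (fun z : ℝ × Eu n => (z.1, (extChartAt (𝓡 n) m₀).symm z.2))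
      (Prod.snd ⁻¹' (extChartAt (𝓡 n) m₀).target) :=
    continuousOn_fst.prodMk ((continuousOn_extChartAt_symm m₀).comp continuousOn_snd
      (fun z hz => hz))
  exact h1.isOpen_inter_preimage ((isOpen_extChartAt_target m₀).preimage continuous_snd)
    e.isOpen_source

theorem mem_coordDom {m₀ m : M} {t : ℝ} (h : (t, m) ∈ e.source)
    (hm : m ∈ (chartAt (Eu n) m₀).source) : (t, extChartAt (𝓡 n) m₀ m) ∈ e.coordDom m₀ := by
  have hm' : m ∈ (extChartAt (𝓡 n) m₀).source := by rwa [extChartAt_source]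
  refine ⟨(extChartAt (𝓡 n) m₀).map_source hm', ?_⟩
  simpa only [(extChartAt (𝓡 n) m₀).left_inv hm'] using h

theorem mem_paramDom {m₀ m : M} {t : ℝ} (h : (t, m) ∈ e.source)
    (hm : m ∈ (chartAt (Eu n) m₀).source) : (t, e.coord (t, m)) ∈ e.paramDom m₀ := by
  refine ⟨e.map_source _ h, ?_⟩
  have := e.left_inv _ h
  simp only at this
  rwa [mem_preimage, this]

theorem coordIn_apply {m₀ m : M} {t : ℝ} (hm : m ∈ (chartAt (Eu n) m₀).source) :
    e.coordIn m₀ (t, extChartAt (𝓡 n) m₀ m) = e.coord (t, m) := by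
  have hm' : m ∈ (extChartAt (𝓡 n) m₀).source := by rwa [extChartAt_source]
  simp only [coordIn, (extChartAt (𝓡 n) m₀).left_inv hm']

theorem paramIn_apply {m₀ m : M} {t : ℝ} (h : (t, m) ∈ e.source) :
    e.paramIn m₀ (t, e.coord (t, m)) = extChartAt (𝓡 n) m₀ m := by
  rw [paramIn, e.left_inv _ h]

theorem paramIn_coordIn {m₀ : M} {z : ℝ × Eu n} (hz : z ∈ e.coordDom m₀) :
    e.paramIn m₀ (z.1, e.coordIn m₀ z) = z.2 := by
  rw [coordIn, e.paramIn_apply hz.2, (extChartAt (𝓡 n) m₀).right_inv hz.1]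

theorem coordIn_paramIn {m₀ : M} {y : ℝ × Eu n} (hy : y ∈ e.paramDom m₀) :
    e.coordIn m₀ (y.1, e.paramIn m₀ y) = y.2 := by
  rw [paramIn, e.coordIn_apply hy.2, e.right_inv _ hy.1]

theorem mem_coordDom_paramIn {m₀ : M} {y : ℝ × Eu n} (hy : y ∈ e.paramDom m₀) :
    (y.1, e.paramIn m₀ y) ∈ e.coordDom m₀ :=
  e.mem_coordDom (e.map_target _ hy.1) hy.2

variable [IsManifold (𝓡 n) ∞ M]

theorem contDiffOn_paramIn (m₀ : M) : ContDiffOn ℝ ∞ (e.paramIn m₀) (e.paramDom m₀) := by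
  refine ContMDiffOn.contDiffOn ?_
  exact (contMDiffOn_extChartAt (I := 𝓡 n) (x := m₀) (n := ∞)).comp
    (e.contMDiffOn_param.mono inter_subset_left) (fun y hy => hy.2)

theorem contDiffOn_coordIn (m₀ : M) : ContDiffOn ℝ ∞ (e.coordIn m₀) (e.coordDom m₀) := by
  refine ContMDiffOn.contDiffOn ?_
  refine e.contMDiffOn_coord.comp (t := e.source) ?_ (fun z hz => hz.2)
  refine ContMDiffOn.prodMk contDiff_fst.contMDiff.contMDiffOn ?_
  exact (contMDiffOn_extChartAt_symm m₀).comp contDiff_snd.contMDiff.contMDiffOn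
    (fun z hz => hz.1)

theorem contDiffAt_paramIn {m₀ : M} {y : ℝ × Eu n} (hy : y ∈ e.paramDom m₀) :
    ContDiffAt ℝ ∞ (e.paramIn m₀) y :=
  (e.contDiffOn_paramIn m₀).contDiffAt ((e.isOpen_paramDom m₀).mem_nhds hy)

theorem contDiffAt_coordIn {m₀ : M} {z : ℝ × Eu n} (hz : z ∈ e.coordDom m₀) :
    ContDiffAt ℝ ∞ (e.coordIn m₀) z :=
  (e.contDiffOn_coordIn m₀).contDiffAt ((e.isOpen_coordDom m₀).mem_nhds hz)

theorem hasFDerivAt_paramIn {m₀ : M} {y : ℝ × Eu n} (hy : y ∈ e.paramDom m₀) :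
    HasFDerivAt (e.paramIn m₀) (fderiv ℝ (e.paramIn m₀) y) y :=
  ((e.contDiffAt_paramIn hy).differentiableAt (by simp)).hasFDerivAt

theorem hasFDerivAt_coordIn {m₀ : M} {z : ℝ × Eu n} (hz : z ∈ e.coordDom m₀) :
    HasFDerivAt (e.coordIn m₀) (fderiv ℝ (e.coordIn m₀) z) z :=
  ((e.contDiffAt_coordIn hz).differentiableAt (by simp)).hasFDerivAt

/-- The chain rule for the identity `coordIn (t, paramIn (t, x)) = x`. The time component of the
direction is kept, since velocities of curves are derivatives in the direction `(1, v)`. -/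
theorem fderiv_coordIn_fderiv_paramIn {m₀ : M} {y : ℝ × Eu n} (hy : y ∈ e.paramDom m₀)
    (d : ℝ × Eu n) :
    fderiv ℝ (e.coordIn m₀) (y.1, e.paramIn m₀ y) (d.1, fderiv ℝ (e.paramIn m₀) y d) = d.2 := by
  have h1 := (e.hasFDerivAt_coordIn (e.mem_coordDom_paramIn hy)).comp y
    (hasFDerivAt_fst.prodMk (e.hasFDerivAt_paramIn hy))
  have h2 : HasFDerivAt (Prod.snd : ℝ × Eu n → Eu n) (ContinuousLinearMap.snd ℝ ℝ (Eu n)) y :=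
    hasFDerivAt_snd
  have h3 := h1.congr_of_eventuallyEq (f₁ := Prod.snd) (by
    filter_upwards [(e.isOpen_paramDom m₀).mem_nhds hy] with y' hy'
    exact (e.coordIn_paramIn hy').symm)
  exact congrArg (fun L => L d) (h3.unique h2)

theorem fderiv_paramIn_fderiv_coordIn {m₀ : M} {z : ℝ × Eu n} (hz : z ∈ e.coordDom m₀)
    (d : ℝ × Eu n) :
    fderiv ℝ (e.paramIn m₀) (z.1, e.coordIn m₀ z) (d.1, fderiv ℝ (e.coordIn m₀) z d) = d.2 := by
  have hy : (z.1, e.coordIn m₀ z) ∈ e.paramDom m₀ := by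
    refine e.mem_paramDom hz.2 ?_
    have := (extChartAt (𝓡 n) m₀).map_target hz.1
    rwa [extChartAt_source] at this
  have h1 := (e.hasFDerivAt_paramIn hy).comp z
    (hasFDerivAt_fst.prodMk (e.hasFDerivAt_coordIn hz))
  have h2 : HasFDerivAt (Prod.snd : ℝ × Eu n → Eu n) (ContinuousLinearMap.snd ℝ ℝ (Eu n)) z :=
    hasFDerivAt_snd
  have h3 := h1.congr_of_eventuallyEq (f₁ := Prod.snd) (by
    filter_upwards [(e.isOpen_coordDom m₀).mem_nhds hz] with y' hy'
    exact (e.paramIn_coordIn hy').symm)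
  exact congrArg (fun L => L d) (h3.unique h2)

/-- The differential of the coordinates at time `t`. -/
def coordDeriv (t : ℝ) (m : M) : TangentSpace (𝓡 n) m →L[ℝ] Eu n :=
  mfderiv (𝓡 n) 𝓘(ℝ, Eu n) (fun m => e.coord (t, m)) m

/-- The inverse of the differential of the coordinates at time `t`. -/
def paramDeriv (t : ℝ) (m : M) : Eu n →L[ℝ] TangentSpace (𝓡 n) m := (e.coordDeriv t m).inverse

theorem hasMFDerivAt_coord_chart {t : ℝ} {m m₀ : M} (h : (t, m) ∈ e.source)
    (hm : m ∈ (chartAt (Eu n) m₀).source) :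
    HasMFDerivAt (𝓡 n) 𝓘(ℝ, Eu n) (fun m => e.coord (t, m)) m
      (fderiv ℝ (e.coordIn m₀) (t, extChartAt (𝓡 n) m₀ m) ∘L
        ContinuousLinearMap.inr ℝ ℝ (Eu n) ∘L chartDeriv (𝓡 n) m₀ m) := by
  have h1 := (e.hasFDerivAt_coordIn (e.mem_coordDom h hm)).comp (extChartAt (𝓡 n) m₀ m)
    ((hasFDerivAt_const t _).prodMk (hasFDerivAt_id _))
  have h2 := h1.hasMFDerivAt.comp m (hasMFDerivAt_extChartAt (I := 𝓡 n) hm)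
  have h3 := h2.congr_of_eventuallyEq (f₁ := fun m => e.coord (t, m)) (by
    filter_upwards [(chartAt (Eu n) m₀).open_source.mem_nhds hm] with m' hm'
    exact (e.coordIn_apply hm').symm)
  exact h3

theorem coordDeriv_apply {t : ℝ} {m m₀ : M} (h : (t, m) ∈ e.source)
    (hm : m ∈ (chartAt (Eu n) m₀).source) (w : TangentSpace (𝓡 n) m) :
    e.coordDeriv t m w =
      fderiv ℝ (e.coordIn m₀) (t, extChartAt (𝓡 n) m₀ m) (0, chartDeriv (𝓡 n) m₀ m w) := by
  rw [coordDeriv, (e.hasMFDerivAt_coord_chart h hm).mfderiv]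
  rfl

theorem hasMFDerivAt_coord {t : ℝ} {m : M} (h : (t, m) ∈ e.source) :
    HasMFDerivAt (𝓡 n) 𝓘(ℝ, Eu n) (fun m => e.coord (t, m)) m (e.coordDeriv t m) :=
  (e.hasMFDerivAt_coord_chart h (mem_chart_source _ m)).mdifferentiableAt.hasMFDerivAt

theorem fderiv_paramIn_coordDeriv {t : ℝ} {m m₀ : M} (h : (t, m) ∈ e.source)
    (hm : m ∈ (chartAt (Eu n) m₀).source) (w : TangentSpace (𝓡 n) m) :
    fderiv ℝ (e.paramIn m₀) (t, e.coord (t, m)) (0, e.coordDeriv t m w) =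
      chartDeriv (𝓡 n) m₀ m w := by
  rw [e.coordDeriv_apply h hm]
  have := e.fderiv_paramIn_fderiv_coordIn (e.mem_coordDom h hm) (0, chartDeriv (𝓡 n) m₀ m w)
  simpa only [e.coordIn_apply hm] using this

/-- The differential of the coordinates at time `t`, as an isomorphism. -/
def coordEquiv {t : ℝ} {m : M} (h : (t, m) ∈ e.source) : TangentSpace (𝓡 n) m ≃L[ℝ] Eu n :=
  ContinuousLinearEquiv.equivOfInverse (e.coordDeriv t m)
    (chartDerivSymm (𝓡 n) m m ∘L fderiv ℝ (e.paramIn m) (t, e.coord (t, m)) ∘L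
      ContinuousLinearMap.inr ℝ ℝ (Eu n))
    (fun w => by
      have hm := mem_chart_source (Eu n) m
      show chartDerivSymm (𝓡 n) m m (fderiv ℝ (e.paramIn m) (t, e.coord (t, m))
        (0, e.coordDeriv t m w)) = w
      rw [e.fderiv_paramIn_coordDeriv h hm, chartDerivSymm_chartDeriv hm])
    (fun v => by
      have hm := mem_chart_source (Eu n) m
      show e.coordDeriv t m (chartDerivSymm (𝓡 n) m m (fderiv ℝ (e.paramIn m)
        (t, e.coord (t, m)) (0, v))) = v
      rw [e.coordDeriv_apply h hm, chartDeriv_chartDerivSymm hm]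
      have := e.fderiv_coordIn_fderiv_paramIn (e.mem_paramDom h hm) (0, v)
      simpa only [e.paramIn_apply h] using this)

theorem coordEquiv_symm_eq {t : ℝ} {m : M} (h : (t, m) ∈ e.source) :
    ((e.coordEquiv h).symm : Eu n →L[ℝ] TangentSpace (𝓡 n) m) = e.paramDeriv t m := by
  have : e.coordDeriv t m = (e.coordEquiv h : TangentSpace (𝓡 n) m →L[ℝ] Eu n) := by
    ext w; rfl
  rw [paramDeriv, this, ContinuousLinearMap.inverse_equiv]

theorem coordDeriv_paramDeriv {t : ℝ} {m : M} (h : (t, m) ∈ e.source) (v : Eu n) :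
    e.coordDeriv t m (e.paramDeriv t m v) = v := by
  rw [← e.coordEquiv_symm_eq h]
  exact (e.coordEquiv h).apply_symm_apply v

theorem paramDeriv_coordDeriv {t : ℝ} {m : M} (h : (t, m) ∈ e.source)
    (w : TangentSpace (𝓡 n) m) : e.paramDeriv t m (e.coordDeriv t m w) = w := by
  rw [← e.coordEquiv_symm_eq h]
  exact (e.coordEquiv h).symm_apply_apply w

theorem chartDeriv_paramDeriv {t : ℝ} {m m₀ : M} (h : (t, m) ∈ e.source)
    (hm : m ∈ (chartAt (Eu n) m₀).source) (v : Eu n) :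
    chartDeriv (𝓡 n) m₀ m (e.paramDeriv t m v) =
      fderiv ℝ (e.paramIn m₀) (t, e.coord (t, m)) (0, v) := by
  rw [← e.fderiv_paramIn_coordDeriv h hm, e.coordDeriv_paramDeriv h]

/-- The velocity of a curve, from its time-dependent coordinates and their derivative. -/
def lift (w : ℝ × Eu n × Eu n) : TangentBundle (𝓡 n) M :=
  ⟨e.param (w.1, w.2.1),
    mfderiv 𝓘(ℝ, ℝ × Eu n) (𝓡 n) e.param (w.1, w.2.1) ((1, w.2.2) : ℝ × Eu n)⟩

theorem extChartAt_lift {p₀ : TangentBundle (𝓡 n) M} {w : ℝ × Eu n × Eu n}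
    (hw : (w.1, w.2.1) ∈ e.paramDom p₀.proj) :
    extChartAt (𝓡 n).tangent p₀ (e.lift w) = (e.paramIn p₀.proj (w.1, w.2.1),
      fderiv ℝ (e.paramIn p₀.proj) (w.1, w.2.1) (1, w.2.2)) := by
  rw [lift, extChartAt_tangent_apply hw.2]
  refine Prod.ext rfl ?_
  have h1 := (e.contMDiffOn_param.contMDiffAt (e.isOpen_target.mem_nhds hw.1)).mdifferentiableAt
    (by simp)
  have h2 := (hasMFDerivAt_extChartAt (I := 𝓡 n) (m₀ := p₀.proj) hw.2).comp (w.1, w.2.1)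
    h1.hasMFDerivAt
  have h3 := hasFDerivAt_of_hasMFDerivAt h2
  exact congrArg (fun L : ℝ × Eu n →L[ℝ] Eu n => L (1, w.2.2))
    (h3.unique (e.hasFDerivAt_paramIn hw))

theorem lift_mem_source {p₀ : TangentBundle (𝓡 n) M} {w : ℝ × Eu n × Eu n}
    (hw : (w.1, w.2.1) ∈ e.paramDom p₀.proj) :
    e.lift w ∈ (extChartAt (𝓡 n).tangent p₀).source :=
  mem_extChartAt_tangent_source.2 hw.2

theorem hasDerivWithinAt_coord {σ : ℝ → M} {s : Set ℝ} {t : ℝ} {m₀ : M} {v : Eu n}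
    (hσ : ContinuousWithinAt σ s t)
    (hm : σ t ∈ (chartAt (Eu n) m₀).source) (h : (t, σ t) ∈ e.source)
    (hv : HasDerivWithinAt (fun τ => extChartAt (𝓡 n) m₀ (σ τ)) v s t) :
    HasDerivWithinAt (fun τ => e.coord (τ, σ τ))
      (fderiv ℝ (e.coordIn m₀) (t, extChartAt (𝓡 n) m₀ (σ t)) (1, v)) s t := by
  have h1 := (e.hasFDerivAt_coordIn (e.mem_coordDom h hm)).comp_hasDerivWithinAt t
    ((hasDerivWithinAt_id t s).prodMk hv)
  refine h1.congr_of_eventuallyEq ?_ (e.coordIn_apply hm).symm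
  filter_upwards [hσ.preimage_mem_nhdsWithin ((chartAt (Eu n) m₀).open_source.mem_nhds hm)]
    with τ hτ
  exact (e.coordIn_apply hτ).symm

/-- The curve is `τ ↦ param (τ, x(τ))`, so its velocity is the derivative of `param` in the
direction `(1, x')`. The two tangent vectors are compared in a chart of the tangent bundle. -/
theorem velocity_eq_lift {σ : ℝ → M} {s : Set ℝ} {t : ℝ}
    (hσ : MDifferentiableWithinAt 𝓘(ℝ, ℝ) (𝓡 n) σ s t) (h : (t, σ t) ∈ e.source) :
    ∃ v : Eu n, HasDerivWithinAt (fun τ => e.coord (τ, σ τ)) v s t ∧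
      velocity (𝓡 n) σ s t = e.lift (t, e.coord (t, σ t), v) := by
  have hm := mem_chart_source (Eu n) (σ t)
  have hd := hasDerivWithinAt_extChartAt_comp (m₀ := σ t) hσ hm
  refine ⟨_, e.hasDerivWithinAt_coord hσ.continuousWithinAt hm h hd, ?_⟩
  have hw := e.mem_paramDom h hm
  set p₀ : TangentBundle (𝓡 n) M := velocity (𝓡 n) σ s t with hp
  refine (extChartAt (𝓡 n).tangent p₀).injOn (mem_extChartAt_source p₀)
    (e.lift_mem_source (p₀ := p₀) (w := (t, e.coord (t, σ t), _)) hw) ?_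
  rw [e.extChartAt_lift (p₀ := p₀) (w := (t, e.coord (t, σ t), _)) hw]
  refine (extChartAt_tangent_apply (p₀ := p₀) hm _).trans ?_
  refine Prod.ext (e.paramIn_apply h).symm ?_
  have := e.fderiv_paramIn_fderiv_coordIn (e.mem_coordDom h hm)
    (1, chartDeriv (𝓡 n) (σ t) (σ t) (mfderivWithin 𝓘(ℝ, ℝ) (𝓡 n) σ s t (1 : ℝ)))
  simp only [e.coordIn_apply hm] at this
  exact this.symm

end TimeChart

end

/-! ### The Legendre transformation in charts -/

section
-- Reflexivity of `ℝⁿ`, through the Riesz isomorphism: it turns a fibre derivative, an element of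
-- the bidual, into a vector.
theorem exists_eq_eval {n : ℕ} (φ : EuDual n →L[ℝ] ℝ) : ∃ v : Eu n, ∀ ζ : EuDual n, φ ζ = ζ v := by
  let ψ : Eu n →ₗ[ℝ] ℝ :=
    { toFun := fun w => φ (InnerProductSpace.toDual ℝ (Eu n) w)
      map_add' := fun v w => by rw [map_add, map_add]
      map_smul' := fun c w => by
        rw [map_smulₛₗ, conj_trivial, map_smul, RingHom.id_apply] }
  refine ⟨(InnerProductSpace.toDual ℝ (Eu n)).symm ψ.toContinuousLinearMap, fun ζ => ?_⟩
  obtain ⟨w, rfl⟩ := (InnerProductSpace.toDual ℝ (Eu n)).surjective ζ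
  rw [InnerProductSpace.toDual_apply_apply, real_inner_comm,
    InnerProductSpace.toDual_symm_apply]
  rfl

variable {n : ℕ} {M : Type*} [TopologicalSpace M] [ChartedSpace (Eu n) M] [IsManifold (𝓡 n) ∞ M]

/-- A function on `ℝ × T*M`, read off in the chart of `T*M` at `p₀`. -/
def hamIn (H : ℝ × Cot n M → ℝ) (p₀ : Cot n M) (z : ℝ × (Eu n × EuDual n)) : ℝ :=
  H (z.1, (extChartAt (ICot n) p₀).symm z.2)

/-- The domain of `hamIn`. -/
def hamDom (U : Set (ℝ × Cot n M)) (p₀ : Cot n M) : Set (ℝ × (Eu n × EuDual n)) :=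
  {z | z.2 ∈ (extChartAt (ICot n) p₀).target ∧ (z.1, (extChartAt (ICot n) p₀).symm z.2) ∈ U}

/-- A function on `ℝ × TM`, read off in the chart of `TM` over the chart at `m₀`. -/
def lagIn (L : ℝ × TangentBundle (𝓡 n) M → ℝ) (m₀ : M) (w : ℝ × Eu n × Eu n) : ℝ :=
  L (w.1, (extChartAt (𝓡 n).tangent (⟨m₀, 0⟩ : TangentBundle (𝓡 n) M)).symm w.2)

/-- The domain of `lagIn`. -/
def lagDom (V : Set (ℝ × TangentBundle (𝓡 n) M)) (m₀ : M) : Set (ℝ × Eu n × Eu n) :=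
  {w | w.2 ∈ (extChartAt (𝓡 n).tangent (⟨m₀, 0⟩ : TangentBundle (𝓡 n) M)).target ∧
    (w.1, (extChartAt (𝓡 n).tangent (⟨m₀, 0⟩ : TangentBundle (𝓡 n) M)).symm w.2) ∈ V}

theorem isOpen_hamDom {U : Set (ℝ × Cot n M)} (hU : IsOpen U) (p₀ : Cot n M) :
    IsOpen (hamDom U p₀) := by
  have h1 : ContinuousOn (fun z : ℝ × (Eu n × EuDual n) =>
      (z.1, (extChartAt (ICot n) p₀).symm z.2))
      (Prod.snd ⁻¹' (extChartAt (ICot n) p₀).target) :=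
    continuousOn_fst.prodMk ((continuousOn_extChartAt_symm p₀).comp continuousOn_snd
      (fun z hz => hz))
  exact h1.isOpen_inter_preimage ((isOpen_extChartAt_target p₀).preimage continuous_snd) hU

theorem isOpen_lagDom {V : Set (ℝ × TangentBundle (𝓡 n) M)} (hV : IsOpen V) (m₀ : M) :
    IsOpen (lagDom V m₀) := by
  have h1 : ContinuousOn (fun z : ℝ × (Eu n × Eu n) =>
      (z.1, (extChartAt (𝓡 n).tangent (⟨m₀, 0⟩ : TangentBundle (𝓡 n) M)).symm z.2))
      (Prod.snd ⁻¹' (extChartAt (𝓡 n).tangent (⟨m₀, 0⟩ : TangentBundle (𝓡 n) M)).target) :=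
    continuousOn_fst.prodMk ((continuousOn_extChartAt_symm _).comp continuousOn_snd
      (fun z hz => hz))
  exact h1.isOpen_inter_preimage ((isOpen_extChartAt_target _).preimage continuous_snd) hV

theorem contDiffOn_hamIn {H : ℝ × Cot n M → ℝ} {U : Set (ℝ × Cot n M)}
    (hH : ContMDiffOn (𝓘(ℝ, ℝ).prod (ICot n)) 𝓘(ℝ, ℝ) ∞ H U) (p₀ : Cot n M) :
    ContDiffOn ℝ ∞ (hamIn H p₀) (hamDom U p₀) := by
  refine ContMDiffOn.contDiffOn ?_
  refine hH.comp (t := U) ?_ (fun z hz => hz.2)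
  refine ContMDiffOn.prodMk contDiff_fst.contMDiff.contMDiffOn ?_
  exact (contMDiffOn_extChartAt_symm p₀).comp contDiff_snd.contMDiff.contMDiffOn
    (fun z hz => hz.1)

theorem hamIn_apply (H : ℝ × Cot n M → ℝ) {p₀ p : Cot n M} (t : ℝ)
    (hp : p.proj ∈ (chartAt (Eu n) p₀.proj).source) :
    hamIn H p₀ (t, extChartAt (ICot n) p₀ p) = H (t, p) := by
  simp only [hamIn, (extChartAt (ICot n) p₀).left_inv (mem_cot_source.2 hp)]

theorem mem_hamDom {U : Set (ℝ × Cot n M)} {p₀ p : Cot n M} {t : ℝ} (h : (t, p) ∈ U)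
    (hp : p.proj ∈ (chartAt (Eu n) p₀.proj).source) :
    (t, extChartAt (ICot n) p₀ p) ∈ hamDom U p₀ := by
  have hp' := mem_cot_source.2 hp
  refine ⟨(extChartAt (ICot n) p₀).map_source hp', ?_⟩
  simpa only [(extChartAt (ICot n) p₀).left_inv hp'] using h

theorem hasFDerivAt_hamIn {H : ℝ × Cot n M → ℝ} {U : Set (ℝ × Cot n M)} (hU : IsOpen U)
    (hH : ContMDiffOn (𝓘(ℝ, ℝ).prod (ICot n)) 𝓘(ℝ, ℝ) ∞ H U) {p₀ : Cot n M}
    {z : ℝ × (Eu n × EuDual n)} (hz : z ∈ hamDom U p₀) :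
    HasFDerivAt (hamIn H p₀) (fderiv ℝ (hamIn H p₀) z) z :=
  (((contDiffOn_hamIn hH p₀).contDiffAt ((isOpen_hamDom hU p₀).mem_nhds hz)).differentiableAt
    (by simp)).hasFDerivAt

theorem hasDerivAt_fiber {H : ℝ × Cot n M → ℝ} {U : Set (ℝ × Cot n M)} (hU : IsOpen U)
    (hH : ContMDiffOn (𝓘(ℝ, ℝ).prod (ICot n)) 𝓘(ℝ, ℝ) ∞ H U) {p₀ : Cot n M}
    {z : ℝ × Cot n M} (hz : z ∈ U) (hp : z.2.proj ∈ (chartAt (Eu n) p₀.proj).source)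
    (α : TangentSpace (𝓡 n) z.2.proj →L[ℝ] Bundle.Trivial M ℝ z.2.proj) :
    HasDerivAt (fun s : ℝ => H (z.1, ⟨z.2.proj, z.2.snd + s • α⟩))
      (fderiv ℝ (hamIn H p₀) (z.1, extChartAt (ICot n) p₀ z.2)
        (0, (0, α ∘L chartDerivSymm (𝓡 n) p₀.proj z.2.proj))) 0 := by
  set A := chartDerivSymm (𝓡 n) p₀.proj z.2.proj
  set ζ : EuDual n := α ∘L A
  have h1 : ∀ s : ℝ, H (z.1, ⟨z.2.proj, z.2.snd + s • α⟩) =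
      hamIn H p₀ (z.1, extChartAt (ICot n) p₀ z.2 + s • ((0, ζ) : Eu n × EuDual n)) := by
    intro s
    rw [← hamIn_apply H (p₀ := p₀) (p := ⟨z.2.proj, z.2.snd + s • α⟩) z.1 hp]
    congr 2
    rw [extChartAt_cot_apply, extChartAt_cot_apply]
    refine Prod.ext ?_ ?_
    · simp
    · ext v
      rfl
  have h2 := (hasFDerivAt_hamIn hU hH (mem_hamDom (p := z.2) (t := z.1) hz hp))
  have h3 : HasDerivAt (fun s : ℝ => ((z.1, extChartAt (ICot n) p₀ z.2 + s • (0, ζ)) :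
      ℝ × (Eu n × EuDual n))) (0, (0, ζ)) 0 := by
    refine (hasDerivAt_const _ _).prodMk ?_
    have := ((hasDerivAt_id (0 : ℝ)).smul_const ((0, ζ) : Eu n × EuDual n)).const_add
      (extChartAt (ICot n) p₀ z.2)
    simpa using this
  have h2' : HasFDerivAt (hamIn H p₀) (fderiv ℝ (hamIn H p₀) (z.1, extChartAt (ICot n) p₀ z.2))
      (z.1, extChartAt (ICot n) p₀ z.2 + (0 : ℝ) • ((0, ζ) : Eu n × EuDual n)) := by
    rw [zero_smul, add_zero]; exact h2
  have h4 := h2'.comp_hasDerivAt (0 : ℝ) h3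
  rw [show (fun s : ℝ => H (z.1, ⟨z.2.proj, z.2.snd + s • α⟩)) = fun s =>
    hamIn H p₀ (z.1, extChartAt (ICot n) p₀ z.2 + s • ((0, ζ) : Eu n × EuDual n)) from funext h1]
  exact h4

/-- The choice in `fiberVelocity` is meaningful on `U`: there the derivative of `H` along the fibre
is a linear function of `α`, hence the evaluation at a vector. -/
theorem fiberVelocity_spec {H : ℝ × Cot n M → ℝ} {U : Set (ℝ × Cot n M)} (hU : IsOpen U)
    (hH : ContMDiffOn (𝓘(ℝ, ℝ).prod (ICot n)) 𝓘(ℝ, ℝ) ∞ H U)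
    {z : ℝ × Cot n M} (hz : z ∈ U)
    (α : TangentSpace (𝓡 n) z.2.proj →L[ℝ] Bundle.Trivial M ℝ z.2.proj) :
    HasDerivAt (fun s : ℝ => H (z.1, ⟨z.2.proj, z.2.snd + s • α⟩))
      (α (fiberVelocity H z) : ℝ) 0 := by
  have hm := mem_chart_source (Eu n) z.2.proj
  obtain ⟨v, hv⟩ := exists_eq_eval
    (fderiv ℝ (hamIn H z.2) (z.1, extChartAt (ICot n) z.2 z.2) ∘L
      ContinuousLinearMap.inr ℝ ℝ (Eu n × EuDual n) ∘L ContinuousLinearMap.inr ℝ (Eu n) (EuDual n))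
  refine Classical.epsilon_spec (p := fun v : TangentSpace (𝓡 n) z.2.proj =>
    ∀ α : TangentSpace (𝓡 n) z.2.proj →L[ℝ] Bundle.Trivial M ℝ z.2.proj,
      HasDerivAt (fun s : ℝ => H (z.1, ⟨z.2.proj, z.2.snd + s • α⟩)) (α v : ℝ) 0)
    ⟨chartDerivSymm (𝓡 n) z.2.proj z.2.proj v, fun α => ?_⟩ α
  have h1 := hasDerivAt_fiber hU hH (p₀ := z.2) hz hm α
  have h2 := hv (α ∘L chartDerivSymm (𝓡 n) z.2.proj z.2.proj)
  convert! h1 using 1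
  exact h2.symm

/-- The relation `v = ∂H/∂p` in coordinates, from two computations of the derivative of `H` along a
line in the fibre. -/
theorem fderiv_hamIn_vertical {H : ℝ × Cot n M → ℝ} {U : Set (ℝ × Cot n M)} (hU : IsOpen U)
    (hH : ContMDiffOn (𝓘(ℝ, ℝ).prod (ICot n)) 𝓘(ℝ, ℝ) ∞ H U) {p₀ : Cot n M}
    {z : ℝ × Cot n M} (hz : z ∈ U) (hp : z.2.proj ∈ (chartAt (Eu n) p₀.proj).source)
    (ζ : EuDual n) :
    fderiv ℝ (hamIn H p₀) (z.1, extChartAt (ICot n) p₀ z.2) (0, (0, ζ)) =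
      ζ (chartDeriv (𝓡 n) p₀.proj z.2.proj (fiberVelocity H z)) := by
  have h1 := fiberVelocity_spec hU hH hz (ζ ∘L chartDeriv (𝓡 n) p₀.proj z.2.proj)
  have h2 := hasDerivAt_fiber hU hH (p₀ := p₀) hz hp (ζ ∘L chartDeriv (𝓡 n) p₀.proj z.2.proj)
  have h3 : (ζ ∘L chartDeriv (𝓡 n) p₀.proj z.2.proj) ∘L
      chartDerivSymm (𝓡 n) p₀.proj z.2.proj = ζ := by
    ext v
    exact congrArg ζ (chartDeriv_chartDerivSymm hp v)
  have h4 := h2.unique h1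
  calc _ = fderiv ℝ (hamIn H p₀) (z.1, extChartAt (ICot n) p₀ z.2)
        (0, (0, (ζ ∘L chartDeriv (𝓡 n) p₀.proj z.2.proj) ∘L
          chartDerivSymm (𝓡 n) p₀.proj z.2.proj)) := by rw [h3]
    _ = _ := h4

/-- Injectivity of the fibre derivative forces the preimage chosen in `lagrangian` to be `z`. -/
theorem lagrangian_fiberDeriv {H : ℝ × Cot n M → ℝ} {U : Set (ℝ × Cot n M)}
    (hreg : IsHyperRegular H U) {z : ℝ × Cot n M} (hz : z ∈ U) :
    lagrangian H U (fiberDeriv H z) = (z.2.snd (fiberVelocity H z) : ℝ) - H z := by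
  have h : ∃ z' ∈ U, fiberDeriv H z' = fiberDeriv H z := ⟨z, hz, rfl⟩
  rw [lagrangian, dif_pos h]
  have h2 : h.choose = z := hreg.injOn h.choose_spec.1 hz h.choose_spec.2
  rw [h2]

section Legendre

variable {H : ℝ × Cot n M → ℝ} {U : Set (ℝ × Cot n M)} (hU : IsOpen U)
  (hH : ContMDiffOn (𝓘(ℝ, ℝ).prod (ICot n)) 𝓘(ℝ, ℝ) ∞ H U) (hreg : IsHyperRegular H U)
include hU hH hreg

/-- The momentum `η` as a smooth function of `(t, x, v)` is the smooth inverse of the fibre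
derivative, read in charts. With it the Lagrangian becomes `η(v) - H(t, x, η)`, which gives its
smoothness and its derivatives. -/
theorem exists_momentum (p₀ : Cot n M) :
    ∃ η : ℝ × Eu n × Eu n → EuDual n,
      ContDiffOn ℝ ∞ η (lagDom (fiberDeriv H '' U) p₀.proj) ∧
      (∀ w ∈ lagDom (fiberDeriv H '' U) p₀.proj,
        (w.1, (w.2.1, η w)) ∈ hamDom U p₀ ∧
        lagIn (lagrangian H U) p₀.proj w = η w w.2.2 - hamIn H p₀ (w.1, (w.2.1, η w)) ∧
        ∀ ζ : EuDual n, fderiv ℝ (hamIn H p₀) (w.1, (w.2.1, η w)) (0, (0, ζ)) = ζ w.2.2) ∧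
      ∀ z ∈ U, z.2.proj ∈ (chartAt (Eu n) p₀.proj).source →
        (z.1, extChartAt (𝓡 n) p₀.proj z.2.proj,
          chartDeriv (𝓡 n) p₀.proj z.2.proj (fiberVelocity H z)) ∈
            lagDom (fiberDeriv H '' U) p₀.proj ∧
        η (z.1, extChartAt (𝓡 n) p₀.proj z.2.proj,
          chartDeriv (𝓡 n) p₀.proj z.2.proj (fiberVelocity H z)) =
            (extChartAt (ICot n) p₀ z.2).2 := by
  obtain ⟨G, hG, hGinv⟩ := hreg.smooth_inverse
  set τ := extChartAt (𝓡 n).tangent (⟨p₀.proj, 0⟩ : TangentBundle (𝓡 n) M) with hτ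
  set Z : ℝ × Eu n × Eu n → ℝ × Cot n M := fun w => G (w.1, τ.symm w.2) with hZ
  set S := lagDom (fiberDeriv H '' U) p₀.proj with hS
  have hZS : ∀ w ∈ S, Z w ∈ U ∧ fiberDeriv H (Z w) = (w.1, τ.symm w.2) := by
    rintro w ⟨hw1, z, hz, hzw⟩
    have h1 : Z w = z := by
      simp only [hZ]
      rw [← hτ] at hzw
      rw [← hzw]
      exact hGinv hz
    rw [h1]
    exact ⟨hz, hzw⟩
  have hproj : ∀ w ∈ S, (Z w).2.proj ∈ (chartAt (Eu n) p₀.proj).source := by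
    intro w hw
    have h1 := congrArg (fun x => x.2.proj) (hZS w hw).2
    have h2 := mem_extChartAt_tangent_source.1 (τ.map_target hw.1)
    rw [← h1] at h2
    exact h2
  have hτZ : ∀ w ∈ S, (extChartAt (𝓡 n) p₀.proj (Z w).2.proj,
      chartDeriv (𝓡 n) p₀.proj (Z w).2.proj (fiberVelocity H (Z w))) = w.2 := by
    intro w hw
    have h1 := congrArg (fun x => τ x.2) (hZS w hw).2
    simp only [τ.right_inv hw.1] at h1
    rw [← h1]
    exact (extChartAt_tangent_apply (p₀ := (⟨p₀.proj, 0⟩ : TangentBundle (𝓡 n) M))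
      (hproj w hw) _).symm
  set η : ℝ × Eu n × Eu n → EuDual n := fun w => (extChartAt (ICot n) p₀ (Z w).2).2 with hη
  have hκ : ∀ w ∈ S, extChartAt (ICot n) p₀ (Z w).2 = (w.2.1, η w) := by
    intro w hw
    refine Prod.ext ?_ rfl
    have h1 := congrArg Prod.fst (hτZ w hw)
    rw [← h1, extChartAt_cot_apply]
  have hZ1 : ∀ w ∈ S, (Z w).1 = w.1 := fun w hw => congrArg Prod.fst (hZS w hw).2
  refine ⟨η, ?_, ?_, ?_⟩
  · refine ContMDiffOn.contDiffOn ?_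
    have hZs : ContMDiffOn 𝓘(ℝ, ℝ × Eu n × Eu n) (𝓘(ℝ, ℝ).prod (ICot n)) ∞ Z S := by
      refine hG.comp (t := fiberDeriv H '' U) ?_ (fun w hw => hw.2)
      refine ContMDiffOn.prodMk contDiff_fst.contMDiff.contMDiffOn ?_
      exact (contMDiffOn_extChartAt_symm _).comp contDiff_snd.contMDiff.contMDiffOn
        (fun z hz => hz.1)
    have h2 := (contMDiffOn_extChartAt (I := ICot n) (x := p₀) (n := ∞)).comp
      (contMDiffOn_snd.comp (t := univ) hZs (fun _ _ => trivial))
      (fun w hw => by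
        have := mem_cot_source.2 (hproj w hw)
        rwa [extChartAt_source] at this)
    exact contDiff_snd.contMDiff.comp_contMDiffOn h2
  · intro w hw
    have hU' : (w.1, (Z w).2) ∈ U := by
      rw [← hZ1 w hw]
      exact (hZS w hw).1
    refine ⟨?_, ?_, ?_⟩
    · rw [← hκ w hw]
      exact mem_hamDom hU' (hproj w hw)
    · rw [← hκ w hw, hamIn_apply H w.1 (hproj w hw), lagIn]
      have h1 := lagrangian_fiberDeriv hreg (hZS w hw).1
      rw [(hZS w hw).2] at h1
      rw [h1]
      have h2 := congrArg Prod.snd (hτZ w hw)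
      rw [← h2]
      simp only [hη, extChartAt_cot_apply]
      have h3 := chartDerivSymm_chartDeriv (I := 𝓡 n) (hproj w hw) (fiberVelocity H (Z w))
      have h4 : H (w.1, (Z w).2) = H (Z w) := by rw [← hZ1 w hw]
      rw [h4]
      congr 1
      exact congrArg (Z w).2.snd h3.symm
    · intro ζ
      have h1 := fderiv_hamIn_vertical hU hH (p₀ := p₀) (hZS w hw).1 (hproj w hw) ζ
      rw [hκ w hw, hZ1 w hw] at h1
      have h2 := congrArg Prod.snd (hτZ w hw)
      rw [h1, ← h2]
  · intro z hz hp
    have hsrc : (⟨z.2.proj, fiberVelocity H z⟩ : TangentBundle (𝓡 n) M) ∈ τ.source :=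
      mem_extChartAt_tangent_source.2 hp
    have h1 := extChartAt_tangent_apply (p₀ := (⟨p₀.proj, 0⟩ : TangentBundle (𝓡 n) M)) hp
      (fiberVelocity H z)
    have h2 : τ.symm (extChartAt (𝓡 n) p₀.proj z.2.proj,
        chartDeriv (𝓡 n) p₀.proj z.2.proj (fiberVelocity H z)) =
        ⟨z.2.proj, fiberVelocity H z⟩ := by
      rw [← τ.left_inv hsrc]
      exact congrArg τ.symm h1.symm
    have h3 : (z.1, τ.symm (extChartAt (𝓡 n) p₀.proj z.2.proj,
        chartDeriv (𝓡 n) p₀.proj z.2.proj (fiberVelocity H z))) = fiberDeriv H z := by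
      rw [h2]; rfl
    refine ⟨⟨?_, ?_⟩, ?_⟩
    · have := τ.map_source hsrc
      rw [hτ, h1] at this
      exact this
    · rw [← hτ]
      simp only
      rw [h3]
      exact ⟨z, hz, rfl⟩
    · simp only [hη, hZ]
      rw [h3, hGinv hz]

theorem contDiffOn_lagIn (p₀ : Cot n M) :
    ContDiffOn ℝ ∞ (lagIn (lagrangian H U) p₀.proj) (lagDom (fiberDeriv H '' U) p₀.proj) := by
  obtain ⟨η, hη, hw, -⟩ := exists_momentum hU hH hreg p₀
  refine ContDiffOn.congr ?_ (fun w h => (hw w h).2.1)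
  refine ContDiffOn.sub (hη.clm_apply contDiff_snd.snd.contDiffOn) ?_
  exact (contDiffOn_hamIn hH p₀).comp (contDiffOn_fst.prodMk
    (contDiff_snd.fst.contDiffOn.prodMk hη)) (fun w h => (hw w h).1)

/-- The envelope argument: in `L = η(v) - H(t, x, η)` the two contributions of the derivative of `η`
cancel because `∂H/∂p = v`. What remains is `∂L/∂v = η` and `∂L/∂(t, x) = -∂H/∂(t, x)`. -/
theorem fderiv_lagIn {p₀ : Cot n M} {z : ℝ × Cot n M} (hz : z ∈ U)
    (hp : z.2.proj ∈ (chartAt (Eu n) p₀.proj).source) (d : ℝ × Eu n × Eu n) :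
    fderiv ℝ (lagIn (lagrangian H U) p₀.proj) (z.1, extChartAt (𝓡 n) p₀.proj z.2.proj,
          chartDeriv (𝓡 n) p₀.proj z.2.proj (fiberVelocity H z)) d =
      (extChartAt (ICot n) p₀ z.2).2 d.2.2 -
        fderiv ℝ (hamIn H p₀) (z.1, extChartAt (ICot n) p₀ z.2) (d.1, (d.2.1, 0)) := by
  obtain ⟨η, hη, hw, hz'⟩ := exists_momentum hU hH hreg p₀
  obtain ⟨hS, hηw⟩ := hz' z hz hp
  set w : ℝ × Eu n × Eu n := (z.1, extChartAt (𝓡 n) p₀.proj z.2.proj,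
          chartDeriv (𝓡 n) p₀.proj z.2.proj (fiberVelocity H z)) with hwdef
  have hopen := isOpen_lagDom hreg.isOpen_image p₀.proj
  have hηd : HasFDerivAt η (fderiv ℝ η w) w :=
    ((hη.contDiffAt (hopen.mem_nhds hS)).differentiableAt (by simp)).hasFDerivAt
  have h1 : HasFDerivAt (fun w : ℝ × Eu n × Eu n => η w w.2.2) _ w :=
    hηd.clm_apply (hasFDerivAt_snd.comp w hasFDerivAt_snd : HasFDerivAt (fun w : ℝ × Eu n × Eu n => w.2.2) _ w)
  have h2 : HasFDerivAt (fun w : ℝ × Eu n × Eu n => hamIn H p₀ (w.1, (w.2.1, η w))) _ w :=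
    (HasFDerivAt.comp (g := hamIn H p₀)
      (f := fun w : ℝ × Eu n × Eu n => ((w.1, (w.2.1, η w)) : ℝ × (Eu n × EuDual n))) w
      (hasFDerivAt_hamIn hU hH (hw w hS).1) (hasFDerivAt_fst.prodMk
    ((hasFDerivAt_fst.comp w hasFDerivAt_snd : HasFDerivAt (fun w : ℝ × Eu n × Eu n => w.2.1) _ w).prodMk hηd)))
  have h3 := (h1.sub h2).congr_of_eventuallyEq (f₁ := lagIn (lagrangian H U) p₀.proj) (by
    filter_upwards [hopen.mem_nhds hS] with w' hw'
    exact (hw w' hw').2.1)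
  rw [h3.fderiv]
  have h4 : extChartAt (ICot n) p₀ z.2 = (w.2.1, η w) := by
    refine Prod.ext ?_ hηw.symm
    rw [extChartAt_cot_apply]
  -- The last summand is the one that cancels against the derivative of `η` in `η w w.2.2`.
  have h5 : fderiv ℝ (hamIn H p₀) (w.1, (w.2.1, η w)) (d.1, (d.2.1, fderiv ℝ η w d)) =
      fderiv ℝ (hamIn H p₀) (w.1, (w.2.1, η w)) (d.1, (d.2.1, 0)) + fderiv ℝ η w d w.2.2 := by
    rw [← (hw w hS).2.2, ← map_add]
    simp
  have h6 : z.1 = w.1 := rfl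
  rw [h4, h6]
  change η w d.2.2 + fderiv ℝ η w d w.2.2 - fderiv ℝ (hamIn H p₀) (w.1, (w.2.1, η w))
    (d.1, (d.2.1, fderiv ℝ η w d)) = _
  rw [h5]
  ring

end Legendre

end

/-! ### Hamilton's equations as Euler-Lagrange equations -/

section
variable {n : ℕ} {M : Type*} [TopologicalSpace M] [ChartedSpace (Eu n) M] [IsManifold (𝓡 n) ∞ M]

theorem eq_of_forall_dual {n : ℕ} {v w : Eu n} (h : ∀ ζ : EuDual n, ζ v = ζ w) : v = w := by
  refine ext_inner_left ℝ fun u => ?_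
  simpa using h (innerSL ℝ u)

namespace TimeChart
variable (e : TimeChart n M)

/-- The coordinates of the cotangent bundle that are induced by a time-dependent chart. -/
def phase (z : ℝ × Cot n M) : Eu n × EuDual n :=
  (e.coord (z.1, z.2.proj), z.2.snd ∘L e.paramDeriv z.1 z.2.proj)

/-- The coordinates `phase`, as functions of the coordinates of a chart of the cotangent bundle. -/
def phaseIn (m₀ : M) (z : ℝ × (Eu n × EuDual n)) : Eu n × EuDual n :=
  (e.coordIn m₀ (z.1, z.2.1), z.2.2 ∘L
    fderiv ℝ (e.paramIn m₀) (z.1, e.coordIn m₀ (z.1, z.2.1)) ∘L ContinuousLinearMap.inr ℝ ℝ (Eu n))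

/-- The domain of `phaseIn`. -/
def phaseDom (m₀ : M) : Set (ℝ × (Eu n × EuDual n)) := {z | (z.1, z.2.1) ∈ e.coordDom m₀}

omit [IsManifold (𝓡 n) ∞ M] in
theorem isOpen_phaseDom (m₀ : M) : IsOpen (e.phaseDom m₀) :=
  (e.isOpen_coordDom m₀).preimage (continuous_fst.prodMk continuous_snd.fst)

theorem phase_eq {p₀ p : Cot n M} {t : ℝ} (h : (t, p.proj) ∈ e.source)
    (hp : p.proj ∈ (chartAt (Eu n) p₀.proj).source) :
    e.phase (t, p) = e.phaseIn p₀.proj (t, extChartAt (ICot n) p₀ p) := by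
  rw [extChartAt_cot_apply]
  refine Prod.ext (e.coordIn_apply hp).symm ?_
  ext v
  simp only [phaseIn, e.coordIn_apply hp]
  show p.snd (e.paramDeriv t p.proj v) = p.snd (chartDerivSymm (𝓡 n) p₀.proj p.proj
    (fderiv ℝ (e.paramIn p₀.proj) (t, e.coord (t, p.proj)) (0, v)))
  rw [← e.chartDeriv_paramDeriv h hp, chartDerivSymm_chartDeriv hp]

theorem mem_phaseDom {p₀ p : Cot n M} {t : ℝ} (h : (t, p.proj) ∈ e.source)
    (hp : p.proj ∈ (chartAt (Eu n) p₀.proj).source) :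
    (t, extChartAt (ICot n) p₀ p) ∈ e.phaseDom p₀.proj := by
  have := e.mem_coordDom h hp
  rw [extChartAt_cot_apply]
  exact this

omit [IsManifold (𝓡 n) ∞ M] in
theorem mem_paramDom_coordIn {m₀ : M} {z : ℝ × Eu n} (hz : z ∈ e.coordDom m₀) :
    (z.1, e.coordIn m₀ z) ∈ e.paramDom m₀ := by
  refine e.mem_paramDom hz.2 ?_
  have := (extChartAt (𝓡 n) m₀).map_target hz.1
  rwa [extChartAt_source] at this

theorem contDiffOn_fderiv_paramIn (m₀ : M) :
    ContDiffOn ℝ ∞ (fderiv ℝ (e.paramIn m₀)) (e.paramDom m₀) :=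
  (e.contDiffOn_paramIn m₀).fderiv_of_isOpen (e.isOpen_paramDom m₀) (by simp)

theorem contDiffOn_phaseIn (m₀ : M) : ContDiffOn ℝ ∞ (e.phaseIn m₀) (e.phaseDom m₀) := by
  have h1 : ContDiffOn ℝ ∞ (fun z : ℝ × (Eu n × EuDual n) => e.coordIn m₀ (z.1, z.2.1))
      (e.phaseDom m₀) :=
    (e.contDiffOn_coordIn m₀).comp (contDiff_fst.prodMk contDiff_snd.fst).contDiffOn
      (fun z hz => hz)
  refine h1.prodMk ?_
  refine contDiff_snd.snd.contDiffOn.clm_comp (ContDiffOn.clm_comp ?_ contDiffOn_const)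
  exact (e.contDiffOn_fderiv_paramIn m₀).comp (contDiff_fst.contDiffOn.prodMk h1)
    (fun z hz => e.mem_paramDom_coordIn hz)

/-- A Lagrangian, in a time-dependent chart. -/
def lag (L : ℝ × TangentBundle (𝓡 n) M → ℝ) (w : ℝ × Eu n × Eu n) : ℝ := L (w.1, e.lift w)

/-- The domain of a Lagrangian, in a time-dependent chart. -/
def lagSet (V : Set (ℝ × TangentBundle (𝓡 n) M)) : Set (ℝ × Eu n × Eu n) :=
  {w | (w.1, w.2.1) ∈ e.target ∧ (w.1, e.lift w) ∈ V}

/-- The coordinates of the lift in the chart of `TM` over the chart at `m₀`. -/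
def liftIn (m₀ : M) (w : ℝ × Eu n × Eu n) : ℝ × Eu n × Eu n :=
  (w.1, e.paramIn m₀ (w.1, w.2.1), fderiv ℝ (e.paramIn m₀) (w.1, w.2.1) (1, w.2.2))

/-- The domain of `liftIn`. -/
def liftDom (m₀ : M) : Set (ℝ × Eu n × Eu n) := {w | (w.1, w.2.1) ∈ e.paramDom m₀}

omit [IsManifold (𝓡 n) ∞ M] in
theorem isOpen_liftDom (m₀ : M) : IsOpen (e.liftDom m₀) :=
  (e.isOpen_paramDom m₀).preimage (continuous_fst.prodMk continuous_snd.fst)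

theorem contDiffOn_liftIn (m₀ : M) : ContDiffOn ℝ ∞ (e.liftIn m₀) (e.liftDom m₀) := by
  have h0 : ContDiffOn ℝ ∞ (fun w : ℝ × Eu n × Eu n => (w.1, w.2.1)) (e.liftDom m₀) :=
    (contDiff_fst.prodMk contDiff_snd.fst).contDiffOn
  refine contDiff_fst.contDiffOn.prodMk (ContDiffOn.prodMk ?_ ?_)
  · exact (e.contDiffOn_paramIn m₀).comp h0 (fun w hw => hw)
  · exact ((e.contDiffOn_fderiv_paramIn m₀).comp h0 (fun w hw => hw)).clm_apply
      (contDiffOn_const.prodMk contDiff_snd.snd.contDiffOn)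

theorem lift_eq {m₀ : M} {w : ℝ × Eu n × Eu n} (hw : w ∈ e.liftDom m₀) :
    e.lift w = (extChartAt (𝓡 n).tangent (⟨m₀, 0⟩ : TangentBundle (𝓡 n) M)).symm
      (e.liftIn m₀ w).2 := by
  have h1 := e.extChartAt_lift (p₀ := (⟨m₀, 0⟩ : TangentBundle (𝓡 n) M)) (w := w) hw
  have h2 := e.lift_mem_source (p₀ := (⟨m₀, 0⟩ : TangentBundle (𝓡 n) M)) (w := w) hw
  rw [← (extChartAt (𝓡 n).tangent (⟨m₀, 0⟩ : TangentBundle (𝓡 n) M)).left_inv h2, h1]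
  rfl

theorem lag_eq (L : ℝ × TangentBundle (𝓡 n) M → ℝ) {m₀ : M} {w : ℝ × Eu n × Eu n}
    (hw : w ∈ e.liftDom m₀) : e.lag L w = lagIn L m₀ (e.liftIn m₀ w) := by
  rw [lag, lagIn, e.lift_eq hw]
  rfl

theorem liftIn_mem_lagDom {V : Set (ℝ × TangentBundle (𝓡 n) M)} {m₀ : M}
    {w : ℝ × Eu n × Eu n} (hw : w ∈ e.liftDom m₀) :
    e.liftIn m₀ w ∈ lagDom V m₀ ↔ w ∈ e.lagSet V := by
  have h1 := e.extChartAt_lift (p₀ := (⟨m₀, 0⟩ : TangentBundle (𝓡 n) M)) (w := w) hw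
  have h2 := e.lift_mem_source (p₀ := (⟨m₀, 0⟩ : TangentBundle (𝓡 n) M)) (w := w) hw
  have h3 := (extChartAt (𝓡 n).tangent (⟨m₀, 0⟩ : TangentBundle (𝓡 n) M)).map_source h2
  rw [h1] at h3
  constructor
  · intro h
    refine ⟨hw.1, ?_⟩
    rw [e.lift_eq hw]
    exact h.2
  · intro h
    refine ⟨h3, ?_⟩
    rw [← e.lift_eq hw]
    exact h.2

omit [IsManifold (𝓡 n) ∞ M] in
theorem mem_liftDom {w : ℝ × Eu n × Eu n} (hw : (w.1, w.2.1) ∈ e.target) :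
    w ∈ e.liftDom (e.param (w.1, w.2.1)) := ⟨hw, mem_chart_source _ _⟩

theorem isOpen_lagSet {V : Set (ℝ × TangentBundle (𝓡 n) M)} (hV : IsOpen V) :
    IsOpen (e.lagSet V) := by
  rw [isOpen_iff_mem_nhds]
  intro w hw
  set m₀ := e.param (w.1, w.2.1)
  have hw' : w ∈ e.liftDom m₀ := e.mem_liftDom hw.1
  have h1 := (e.contDiffOn_liftIn m₀).continuousOn.isOpen_inter_preimage (e.isOpen_liftDom m₀)
    (isOpen_lagDom hV m₀)
  refine Filter.mem_of_superset (h1.mem_nhds ⟨hw', (e.liftIn_mem_lagDom hw').2 hw⟩) ?_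
  rintro w' ⟨h2, h3⟩
  exact (e.liftIn_mem_lagDom h2).1 h3

section Legendre

variable {H : ℝ × Cot n M → ℝ} {U : Set (ℝ × Cot n M)} (hU : IsOpen U)
  (hH : ContMDiffOn (𝓘(ℝ, ℝ).prod (ICot n)) 𝓘(ℝ, ℝ) ∞ H U) (hreg : IsHyperRegular H U)
include hU hH hreg

theorem contDiffOn_lag :
    ContDiffOn ℝ ∞ (e.lag (lagrangian H U)) (e.lagSet (fiberDeriv H '' U)) := by
  intro w hw
  refine ContDiffAt.contDiffWithinAt ?_
  set m₀ := e.param (w.1, w.2.1)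
  have hw' : w ∈ e.liftDom m₀ := e.mem_liftDom hw.1
  have h1 := (contDiffOn_lagIn hU hH hreg (⟨m₀, 0⟩ : Cot n M)).contDiffAt
    ((isOpen_lagDom hreg.isOpen_image m₀).mem_nhds ((e.liftIn_mem_lagDom hw').2 hw))
  have h2 := (e.contDiffOn_liftIn m₀).contDiffAt ((e.isOpen_liftDom m₀).mem_nhds hw')
  refine (h1.comp w h2).congr_of_eventuallyEq ?_
  filter_upwards [(e.isOpen_liftDom m₀).mem_nhds hw'] with w' h3
  exact e.lag_eq _ h3

-- At each time Hamilton's equations are read in the chart at the very point `c t`, which is the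
-- chart used in the definition of `omega`; so no invariance of the symplectic form is needed here.
omit hreg in
theorem fderiv_hamIn_of_isHamiltonianCurve {a b : ℝ} {c : ℝ → Cot n M}
    (hc : IsHamiltonianCurve H U a b c) {t : ℝ} (ht : t ∈ Icc a b) (δ : Eu n × EuDual n) :
    fderiv ℝ (hamIn H (c t)) (t, extChartAt (ICot n) (c t) (c t)) (0, δ) =
      stdSymp (chartDeriv (ICot n) (c t) (c t)
        (mfderivWithin 𝓘(ℝ, ℝ) (ICot n) c (Icc a b) t (1 : ℝ))) δ := by
  have hsrc := mem_chart_source (ModelProd (Eu n) (EuDual n)) (c t)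
  obtain ⟨h1, h2, h3⟩ := hc t ht
  have h4 := h3 (chartDerivSymm (ICot n) (c t) (c t) δ)
  have hd : dchart (c t) = chartDeriv (ICot n) (c t) (c t) :=
    (hasMFDerivAt_extChartAt (I := ICot n) hsrc).mfderiv
  rw [omega, hd, chartDeriv_chartDerivSymm hsrc] at h4
  rw [← h4]
  have h5 := (hasFDerivAt_hamIn hU hH (mem_hamDom (p₀ := c t) h1 (mem_chart_source _ _))).comp
    (extChartAt (ICot n) (c t) (c t)) ((hasFDerivAt_const t _).prodMk (hasFDerivAt_id _))
  have h6 := h5.hasMFDerivAt.comp (c t) (hasMFDerivAt_extChartAt (I := ICot n) hsrc)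
  have h7 := h6.congr_of_eventuallyEq (f₁ := fun m => H (t, m)) (by
    filter_upwards [(isOpen_extChartAt_source (I := ICot n) (c t)).mem_nhds
      (mem_extChartAt_source (c t))] with m' hm'
    exact (hamIn_apply H t (mem_cot_source.1 hm')).symm)
  rw [h7.mfderiv]
  have h8 := chartDeriv_chartDerivSymm (I := ICot n) hsrc δ
  exact congrArg (fun δ => fderiv ℝ (hamIn H (c t)) (t, extChartAt (ICot n) (c t) (c t)) (0, δ))
    h8.symm

/-- In a fixed chart one has `∂L/∂v = η` and `∂L/∂q = -∂H/∂q = η'`. With `g` the parametrization in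
that chart, the momentum in the new coordinates is `ξ = η ∘ D_x g` and the new Lagrangian is `L(t,
g, Dg(1, v))`; the chain rule carries the equations over. The time dependence of the coordinates
only enters through the direction `(1, v)`. -/
theorem euler_lagrange {a b : ℝ} {c : ℝ → Cot n M}
    (hc : IsHamiltonianCurve H U a b c) {t : ℝ} (ht : t ∈ Icc a b)
    (hs : (t, (c t).proj) ∈ e.source) :
    ∃ (v : Eu n) (ξ' : EuDual n),
      HasDerivWithinAt (fun τ => e.phase (τ, c τ)) (v, ξ') (Icc a b) t ∧
      (t, (e.phase (t, c t)).1, v) ∈ e.lagSet (fiberDeriv H '' U) ∧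
      (∀ d : Eu n × Eu n, fderiv ℝ (e.lag (lagrangian H U)) (t, (e.phase (t, c t)).1, v)
        (0, d.1, d.2) = ξ' d.1 + (e.phase (t, c t)).2 d.2) ∧
      fiberDeriv H (t, c t) = (t, e.lift (t, (e.phase (t, c t)).1, v)) := by
  set p₀ := c t with hp₀
  set m₀ := p₀.proj with hm₀
  have hm : m₀ ∈ (chartAt (Eu n) m₀).source := mem_chart_source _ _
  obtain ⟨hcU, hcd, -⟩ := hc t ht
  have hκd := hasDerivWithinAt_extChartAt_comp (m₀ := p₀) hcd (mem_chart_source _ _)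
  have hham := fderiv_hamIn_of_isHamiltonianCurve hU hH hc ht
  set δ := chartDeriv (ICot n) p₀ p₀ (mfderivWithin 𝓘(ℝ, ℝ) (ICot n) c (Icc a b) t (1 : ℝ))
    with hδ
  obtain ⟨y', η'⟩ := δ
  -- the velocity of the projected curve is the fibre derivative of the Hamiltonian
  have hv : chartDeriv (𝓡 n) m₀ m₀ (fiberVelocity H (t, p₀)) = y' := by
    refine eq_of_forall_dual fun ζ => ?_
    have h1 := fderiv_hamIn_vertical hU hH (p₀ := p₀) (z := (t, p₀)) hcU hm ζ
    have h2 := hham (0, ζ)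
    simp only [stdSymp, map_zero, sub_zero] at h2
    exact h1.symm.trans h2
  have hcont : ContinuousWithinAt (fun τ => (c τ).proj) (Icc a b) t :=
    (FiberBundle.continuous_proj (EuDual n)
      (fun x : M => TangentSpace (𝓡 n) x →L[ℝ] Bundle.Trivial M ℝ x)).continuousAt.comp_continuousWithinAt hcd.continuousWithinAt
  have hqd : HasDerivWithinAt (fun τ => extChartAt (𝓡 n) m₀ (c τ).proj) y' (Icc a b) t := by
    have h1 := hκd.fst
    simp only [extChartAt_cot_apply] at h1
    exact h1
  have hηd : HasDerivWithinAt (fun τ => (extChartAt (ICot n) p₀ (c τ)).2) η' (Icc a b) t := hκd.snd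
  have hxd := e.hasDerivWithinAt_coord hcont hm hs hqd
  set x₀ := e.coord (t, m₀) with hx₀
  set v := fderiv ℝ (e.coordIn m₀) (t, extChartAt (𝓡 n) m₀ m₀) (1, y') with hvdef
  set g := e.paramIn m₀ with hg
  set η₀ := (extChartAt (ICot n) p₀ p₀).2 with hη₀
  have hx₀dom : (t, x₀) ∈ e.paramDom m₀ := e.mem_paramDom hs hm
  have hgx : g (t, x₀) = extChartAt (𝓡 n) m₀ m₀ := e.paramIn_apply hs
  have hgv : fderiv ℝ g (t, x₀) (1, v) = y' := by
    have := e.fderiv_paramIn_fderiv_coordIn (e.mem_coordDom hs hm) (1, y')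
    simpa only [e.coordIn_apply hm] using this
  have hg2 : HasFDerivAt (fderiv ℝ g) (fderiv ℝ (fderiv ℝ g) (t, x₀)) (t, x₀) :=
    (((e.contDiffOn_fderiv_paramIn m₀).contDiffAt
      ((e.isOpen_paramDom m₀).mem_nhds hx₀dom)).differentiableAt (by simp)).hasFDerivAt
  -- The derivative of `ξ` produces `D²g` in the order `(1, v)`, `(0, dx)`, and `∂L/∂x` produces it
  -- in the opposite order.
  have hsymm : ∀ d d', fderiv ℝ (fderiv ℝ g) (t, x₀) d d' = fderiv ℝ (fderiv ℝ g) (t, x₀) d' d :=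
    fun d d' => ((e.contDiffAt_paramIn hx₀dom).isSymmSndFDerivAt
      (by rw [minSmoothness_of_isRCLikeNormedField]; exact WithTop.coe_le_coe.2 (le_top : (2 : ℕ∞) ≤ ⊤))).eq d d'
  have hξd : HasDerivWithinAt (fun τ => (e.phase (τ, c τ)).2)
      (η' ∘L fderiv ℝ g (t, x₀) ∘L ContinuousLinearMap.inr ℝ ℝ (Eu n) +
        η₀ ∘L (fderiv ℝ (fderiv ℝ g) (t, x₀) (1, v)) ∘L ContinuousLinearMap.inr ℝ ℝ (Eu n))
      (Icc a b) t := by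
    have h1 : HasDerivWithinAt (fun τ => fderiv ℝ g (τ, e.coord (τ, (c τ).proj)))
        (fderiv ℝ (fderiv ℝ g) (t, x₀) (1, v)) (Icc a b) t :=
      HasFDerivAt.comp_hasDerivWithinAt (f := fun τ => (τ, e.coord (τ, (c τ).proj))) t hg2
        ((hasDerivWithinAt_id t _).prodMk hxd)
    have h2 := hηd.clm_comp (h1.clm_comp (hasDerivWithinAt_const t _
      (ContinuousLinearMap.inr ℝ ℝ (Eu n))))
    simp only [ContinuousLinearMap.comp_zero, add_zero] at h2
    have hs' : ∀ᶠ τ in 𝓝[Icc a b] t, (τ, (c τ).proj) ∈ e.source :=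
      (continuousWithinAt_id.prodMk hcont) (e.isOpen_source.mem_nhds hs)
    have hev : (fun τ => (e.phase (τ, c τ)).2) =ᶠ[𝓝[Icc a b] t] fun τ =>
        (extChartAt (ICot n) p₀ (c τ)).2 ∘L fderiv ℝ g (τ, e.coord (τ, (c τ).proj)) ∘L
          ContinuousLinearMap.inr ℝ ℝ (Eu n) := by
      filter_upwards [hs', hcont.preimage_mem_nhdsWithin
        ((chartAt (Eu n) m₀).open_source.mem_nhds hm)] with τ h3 h4
      rw [e.phase_eq (p₀ := p₀) h3 h4]
      simp only [phaseIn]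
      have h5 : (extChartAt (ICot n) p₀ (c τ)).1 = extChartAt (𝓡 n) m₀ (c τ).proj := by
        rw [extChartAt_cot_apply]
      rw [h5, e.coordIn_apply h4]
    exact h2.congr_of_eventuallyEq_of_mem hev ht
  have hlift : (t, x₀, v) ∈ e.liftDom m₀ := hx₀dom
  have hliftIn : e.liftIn m₀ (t, x₀, v) = (t, extChartAt (𝓡 n) m₀ m₀,
      chartDeriv (𝓡 n) m₀ m₀ (fiberVelocity H (t, p₀))) := by
    rw [hv]
    simp only [liftIn]
    rw [← hg, hgx, hgv]
  have hlagdom : e.liftIn m₀ (t, x₀, v) ∈ lagDom (fiberDeriv H '' U) m₀ := by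
    obtain ⟨η, -, -, h3⟩ := exists_momentum hU hH hreg p₀
    rw [hliftIn]
    exact (h3 (t, p₀) hcU hm).1
  refine ⟨v, _, hxd.prodMk hξd, (e.liftIn_mem_lagDom hlift).1 hlagdom, ?_, ?_⟩
  · rintro ⟨dx, dv⟩
    have hd1 : HasFDerivAt (lagIn (lagrangian H U) m₀)
        (fderiv ℝ (lagIn (lagrangian H U) m₀) (e.liftIn m₀ (t, x₀, v))) (e.liftIn m₀ (t, x₀, v)) :=
      (((contDiffOn_lagIn hU hH hreg p₀).contDiffAt
        ((isOpen_lagDom hreg.isOpen_image m₀).mem_nhds hlagdom)).differentiableAt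
          (by simp)).hasFDerivAt
    have hsnd : HasFDerivAt (fun w : ℝ × Eu n × Eu n => w.2)
        (ContinuousLinearMap.snd ℝ ℝ (Eu n × Eu n)) (t, x₀, v) := hasFDerivAt_snd
    have hp1 : HasFDerivAt (fun w : ℝ × Eu n × Eu n => (w.1, w.2.1)) _ (t, x₀, v) :=
      hasFDerivAt_fst.prodMk hsnd.fst
    have hp2 : HasFDerivAt (fun w : ℝ × Eu n × Eu n => ((1 : ℝ), w.2.2)) _ (t, x₀, v) :=
      (hasFDerivAt_const _ _).prodMk hsnd.snd
    have hd2 : HasFDerivAt (e.liftIn m₀) _ (t, x₀, v) :=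
      hasFDerivAt_fst.prodMk (HasFDerivAt.prodMk
        (HasFDerivAt.comp (g := g) (t, x₀, v) (e.hasFDerivAt_paramIn hx₀dom) hp1)
        ((HasFDerivAt.comp (g := fderiv ℝ g) (t, x₀, v) hg2 hp1).clm_apply hp2))
    have hd3 := (hd1.comp (t, x₀, v) hd2).congr_of_eventuallyEq
      (f₁ := e.lag (lagrangian H U)) (by
        filter_upwards [(e.isOpen_liftDom m₀).mem_nhds hlift] with w' hw'
        exact e.lag_eq _ hw')
    have hd4 : fderiv ℝ (e.lag (lagrangian H U)) (t, x₀, v) (0, dx, dv) =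
        fderiv ℝ (lagIn (lagrangian H U) m₀) (e.liftIn m₀ (t, x₀, v))
          (0, fderiv ℝ g (t, x₀) (0, dx),
            fderiv ℝ g (t, x₀) (0, dv) + fderiv ℝ (fderiv ℝ g) (t, x₀) (0, dx) (1, v)) := by
      rw [hd3.fderiv]
      rfl
    have hd5 := fderiv_lagIn hU hH hreg (p₀ := p₀) (z := (t, p₀)) hcU hm
      (0, fderiv ℝ g (t, x₀) (0, dx),
            fderiv ℝ g (t, x₀) (0, dv) + fderiv ℝ (fderiv ℝ g) (t, x₀) (0, dx) (1, v))
    have hd6 := hham (fderiv ℝ g (t, x₀) (0, dx), 0)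
    have hξ₀ : (e.phase (t, p₀)).2 = η₀ ∘L fderiv ℝ g (t, x₀) ∘L
          ContinuousLinearMap.inr ℝ ℝ (Eu n) := by
      rw [e.phase_eq (p₀ := p₀) hs hm]
      simp only [phaseIn]
      have h5 : (extChartAt (ICot n) p₀ p₀).1 = extChartAt (𝓡 n) m₀ m₀ := by
        rw [extChartAt_cot_apply]
      rw [h5, e.coordIn_apply hm]
    simp only [stdSymp, zero_apply, zero_sub] at hd6
    rw [hξ₀]
    refine hd4.trans ?_
    rw [hliftIn]
    refine hd5.trans ?_
    simp only
    rw [hd6, hsymm]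
    simp only [map_add, add_apply, ContinuousLinearMap.comp_apply,
      ContinuousLinearMap.inr_apply]
    ring
  · refine Prod.ext rfl ?_
    show (⟨m₀, fiberVelocity H (t, p₀)⟩ : TangentBundle (𝓡 n) M) = e.lift (t, x₀, v)
    rw [e.lift_eq hlift, hliftIn]
    have hsrc : (⟨m₀, fiberVelocity H (t, p₀)⟩ : TangentBundle (𝓡 n) M) ∈
      (extChartAt (𝓡 n).tangent (⟨m₀, 0⟩ : TangentBundle (𝓡 n) M)).source :=
      mem_extChartAt_tangent_source.2 hm
    rw [← (extChartAt (𝓡 n).tangent (⟨m₀, 0⟩ : TangentBundle (𝓡 n) M)).left_inv hsrc]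
    exact congrArg _ (extChartAt_tangent_apply (p₀ := (⟨m₀, 0⟩ : TangentBundle (𝓡 n) M)) hm _)

end Legendre
end TimeChart

end

/-! ### Integrals with a parameter and families of class `C²` -/

section
section ParametricIntegral

variable {F : Type*} [NormedAddCommGroup F] [NormedSpace ℝ F]

omit [NormedSpace ℝ F] in
theorem intervalIntegrable_of_continuousOn {a b : ℝ} (hab : a ≤ b) {f : ℝ → F}
    (hf : ContinuousOn f (Icc a b)) : IntervalIntegrable f volume a b :=
  ContinuousOn.intervalIntegrable (by rwa [uIcc_of_le hab])

omit [NormedSpace ℝ F] in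
theorem exists_nhds_bound {J : Set ℝ} (hJ : IsOpen J) {a b : ℝ} {f : ℝ → ℝ → F}
    (hf : ContinuousOn (fun p : ℝ × ℝ => f p.1 p.2) (J ×ˢ Icc a b)) {s : ℝ} (hs : s ∈ J) :
    ∃ O ∈ 𝓝 s, O ⊆ J ∧ ∃ C : ℝ, ∀ s' ∈ O, ∀ t ∈ Icc a b, ‖f s' t‖ ≤ C := by
  obtain ⟨r, hr, hrJ⟩ := Metric.nhds_basis_closedBall.mem_iff.1 (hJ.mem_nhds hs)
  obtain ⟨C, hC⟩ := ((isCompact_closedBall s r).prod (isCompact_Icc (a := a) (b := b))).exists_bound_of_continuousOn (hf.mono (prod_mono hrJ Subset.rfl))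
  exact ⟨_, Metric.closedBall_mem_nhds s hr, hrJ, C, fun s' hs' t ht => hC (s', t) ⟨hs', ht⟩⟩

omit [NormedSpace ℝ F] in
theorem continuousOn_slice {J : Set ℝ} {K : Set ℝ} {f : ℝ → ℝ → F}
    (hf : ContinuousOn (fun p : ℝ × ℝ => f p.1 p.2) (J ×ˢ K)) {s : ℝ} (hs : s ∈ J) :
    ContinuousOn (f s) K :=
  hf.comp (f := fun t => (s, t)) (continuousOn_const.prodMk continuousOn_id) (fun _ ht => ⟨hs, ht⟩)

omit [NormedSpace ℝ F] in
theorem aestronglyMeasurable_slice {J : Set ℝ} {a b : ℝ} (hab : a ≤ b) {f : ℝ → ℝ → F}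
    (hf : ContinuousOn (fun p : ℝ × ℝ => f p.1 p.2) (J ×ˢ Icc a b)) {s : ℝ} (hs : s ∈ J) :
    AEStronglyMeasurable (f s) (volume.restrict (Set.uIoc a b)) := by
  rw [uIoc_of_le hab]
  exact ((continuousOn_slice hf hs).mono Ioc_subset_Icc_self).aestronglyMeasurable
    measurableSet_Ioc

theorem hasDerivAt_integral_param {J : Set ℝ} (hJ : IsOpen J) {a b : ℝ} (hab : a ≤ b)
    {f f' : ℝ → ℝ → F} (hf : ContinuousOn (fun p : ℝ × ℝ => f p.1 p.2) (J ×ˢ Icc a b))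
    (hf' : ContinuousOn (fun p : ℝ × ℝ => f' p.1 p.2) (J ×ˢ Icc a b))
    (hd : ∀ s ∈ J, ∀ t ∈ Icc a b, HasDerivAt (fun s => f s t) (f' s t) s) {s : ℝ} (hs : s ∈ J) :
    HasDerivAt (fun s => ∫ t in a..b, f s t) (∫ t in a..b, f' s t) s := by
  obtain ⟨O, hO, hOJ, C, hC⟩ := exists_nhds_bound hJ hf' hs
  have hI : Set.uIoc a b ⊆ Icc a b := by rw [uIoc_of_le hab]; exact Ioc_subset_Icc_self
  refine (intervalIntegral.hasDerivAt_integral_of_dominated_loc_of_deriv_le (F := f) (F' := f')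
    (bound := fun _ => C) hO ?_ ?_ ?_ ?_ ?_ ?_).2
  · filter_upwards [hO] with s' hs'
    exact aestronglyMeasurable_slice hab hf (hOJ hs')
  · exact intervalIntegrable_of_continuousOn hab (continuousOn_slice hf hs)
  · exact aestronglyMeasurable_slice hab hf' hs
  · exact Filter.Eventually.of_forall fun t ht s' hs' => hC s' hs' t (hI ht)
  · exact intervalIntegrable_const
  · exact Filter.Eventually.of_forall fun t ht s' hs' => hd s' (hOJ hs') t (hI ht)

theorem continuousOn_integral_param {J : Set ℝ} (hJ : IsOpen J) {a b : ℝ} (hab : a ≤ b)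
    {f : ℝ → ℝ → F} (hf : ContinuousOn (fun p : ℝ × ℝ => f p.1 p.2) (J ×ˢ Icc a b)) :
    ContinuousOn (fun s => ∫ t in a..b, f s t) J := by
  intro s hs
  obtain ⟨O, hO, hOJ, C, hC⟩ := exists_nhds_bound hJ hf hs
  have hI : Set.uIoc a b ⊆ Icc a b := by rw [uIoc_of_le hab]; exact Ioc_subset_Icc_self
  refine intervalIntegral.continuousWithinAt_of_dominated_interval (bound := fun _ => C)
    ?_ ?_ intervalIntegrable_const ?_
  · filter_upwards [mem_nhdsWithin_of_mem_nhds hO] with s' hs'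
    exact aestronglyMeasurable_slice hab hf (hOJ hs')
  · filter_upwards [mem_nhdsWithin_of_mem_nhds hO] with s' hs'
    exact Filter.Eventually.of_forall fun t ht => hC s' hs' t (hI ht)
  · refine Filter.Eventually.of_forall fun t ht => ?_
    exact (hf (s, t) ⟨hs, hI ht⟩).comp (f := fun s => (s, t))
      (continuousWithinAt_id.prodMk continuousWithinAt_const) (fun s' hs' => ⟨hs', hI ht⟩)

theorem hasDerivWithinAt_integral_Icc [CompleteSpace F] {a b : ℝ} (hab : a ≤ b) {g : ℝ → F}
    (hg : ContinuousOn g (Icc a b)) {t : ℝ} (ht : t ∈ Icc a b) :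
    HasDerivWithinAt (fun t => ∫ τ in a..t, g τ) (g t) (Icc a b) t := by
  -- A continuous extension beyond the interval makes the one-sided derivatives at the endpoints
  -- restrictions of two-sided ones.
  set g' : ℝ → F := IccExtend hab ((Icc a b).domRestrict g) with hg'
  have hc : Continuous g' := (continuousOn_iff_continuous_domRestrict.1 hg).Icc_extend'
  have he : ∀ t ∈ Icc a b, g' t = g t := fun t ht => by
    rw [hg', IccExtend_of_mem _ _ ht]; rfl
  have h1 := (hc.integral_hasStrictDerivAt a t).hasDerivAt.hasDerivWithinAt (s := Icc a b)
  rw [he t ht] at h1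
  refine h1.congr_of_mem (fun τ hτ => ?_) ht
  refine intervalIntegral.integral_congr fun x hx => (he x ?_).symm
  rw [uIcc_of_le hτ.1] at hx
  exact ⟨hx.1, hx.2.trans hτ.2⟩

theorem integral_eq_sub_of_hasDerivWithinAt [CompleteSpace F] {a b : ℝ} {f f' : ℝ → F}
    (hf : ∀ t ∈ Icc a b, HasDerivWithinAt f (f' t) (Icc a b) t)
    (hf' : ContinuousOn f' (Icc a b)) {t : ℝ} (ht : t ∈ Icc a b) :
    ∫ τ in a..t, f' τ = f t - f a := by
  have hsub : Icc a t ⊆ Icc a b := Icc_subset_Icc_right ht.2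
  refine intervalIntegral.integral_eq_sub_of_hasDerivAt_of_le ht.1
    (fun τ hτ => ((hf τ (hsub hτ)).continuousWithinAt).mono hsub) (fun τ hτ => ?_)
    (intervalIntegrable_of_continuousOn ht.1 (hf'.mono hsub))
  exact (hf τ (hsub (Ioo_subset_Icc_self hτ))).hasDerivAt
    (Icc_mem_nhds hτ.1 (hτ.2.trans_le ht.2))

/-- Exchange of the derivatives with respect to the time and to a parameter. -/
theorem hasDerivWithinAt_deriv_param [CompleteSpace F] {J : Set ℝ} (hJ : IsOpen J) {a b : ℝ}
    {x y x' y' : ℝ → ℝ → F}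
    (hx : ∀ s ∈ J, ∀ t ∈ Icc a b, HasDerivWithinAt (x s) (y s t) (Icc a b) t)
    (hy : ContinuousOn (fun p : ℝ × ℝ => y p.1 p.2) (J ×ˢ Icc a b))
    (hy' : ContinuousOn (fun p : ℝ × ℝ => y' p.1 p.2) (J ×ˢ Icc a b))
    (hdx : ∀ s ∈ J, ∀ t ∈ Icc a b, HasDerivAt (fun s => x s t) (x' s t) s)
    (hdy : ∀ s ∈ J, ∀ t ∈ Icc a b, HasDerivAt (fun s => y s t) (y' s t) s)
    {s t : ℝ} (hs : s ∈ J) (ht : t ∈ Icc a b) :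
    HasDerivWithinAt (x' s) (y' s t) (Icc a b) t := by
  have hab : a ≤ b := ht.1.trans ht.2
  -- Integrate in time first and differentiate `x s τ = x s a + ∫ y s` under the integral; no joint
  -- second derivative of `x` is needed.
  have key : ∀ τ ∈ Icc a b, x' s τ = x' s a + ∫ r in a..τ, y' s r := by
    intro τ hτ
    have hsub : J ×ˢ Icc a τ ⊆ J ×ˢ Icc a b := prod_mono Subset.rfl (Icc_subset_Icc_right hτ.2)
    have h1 := hasDerivAt_integral_param hJ hτ.1 (hy.mono hsub) (hy'.mono hsub)
      (fun s hs t ht => hdy s hs t ⟨ht.1, ht.2.trans hτ.2⟩) hs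
    have h2 := (hdx s hs a ⟨le_rfl, hab⟩).add h1
    refine (hdx s hs τ hτ).unique (h2.congr_of_eventuallyEq ?_)
    filter_upwards [hJ.mem_nhds hs] with s' hs'
    have := integral_eq_sub_of_hasDerivWithinAt (hx s' hs') (continuousOn_slice hy hs') hτ
    simp [this]
  exact ((hasDerivWithinAt_integral_Icc hab (continuousOn_slice hy' hs) ht).const_add
    (x' s a)).congr_of_mem key ht

end ParametricIntegral

/-- A family `z s` of functions on `K` that, together with its first two derivatives in `s`, is
jointly continuous. -/
structure IsC2In {F : Type*} [NormedAddCommGroup F] [NormedSpace ℝ F] (z : ℝ → ℝ → F)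
    (J K : Set ℝ) : Prop where
  diff : ∀ s ∈ J, ∀ t ∈ K, DifferentiableAt ℝ (fun s => z s t) s
  diff' : ∀ s ∈ J, ∀ t ∈ K, DifferentiableAt ℝ (deriv fun s => z s t) s
  cont : ContinuousOn (fun p : ℝ × ℝ => z p.1 p.2) (J ×ˢ K)
  cont' : ContinuousOn (fun p : ℝ × ℝ => deriv (fun s => z s p.2) p.1) (J ×ˢ K)
  cont'' : ContinuousOn (fun p : ℝ × ℝ => deriv (deriv fun s => z s p.2) p.1) (J ×ˢ K)

namespace IsC2In

variable {E F : Type*} [NormedAddCommGroup E] [NormedSpace ℝ E]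
  [NormedAddCommGroup F] [NormedSpace ℝ F] {z : ℝ → ℝ → F} {J K : Set ℝ}

theorem mono (h : IsC2In z J K) {J' K' : Set ℝ} (hJ : J' ⊆ J) (hK : K' ⊆ K) : IsC2In z J' K' :=
  ⟨fun s hs t ht => h.diff s (hJ hs) t (hK ht), fun s hs t ht => h.diff' s (hJ hs) t (hK ht),
    h.cont.mono (prod_mono hJ hK), h.cont'.mono (prod_mono hJ hK),
    h.cont''.mono (prod_mono hJ hK)⟩

theorem of_locally (h : ∀ s₀ ∈ J, ∀ t₀ ∈ K, ∃ O ∈ 𝓝 s₀, ∃ W ∈ 𝓝[K] t₀, t₀ ∈ W ∧ IsC2In z O W) :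
    IsC2In z J K := by
  refine ⟨fun s hs t ht => ?_, fun s hs t ht => ?_, ?_, ?_, ?_⟩
  · obtain ⟨O, hO, W, hW, htW, h1⟩ := h s hs t ht
    exact h1.diff s (mem_of_mem_nhds hO) t htW
  · obtain ⟨O, hO, W, hW, htW, h1⟩ := h s hs t ht
    exact h1.diff' s (mem_of_mem_nhds hO) t htW
  all_goals
    rintro ⟨s, t⟩ ⟨hs, ht⟩
    obtain ⟨O, hO, W, hW, htW, h1⟩ := h s hs t ht
    have hmem : O ×ˢ W ∈ 𝓝[J ×ˢ K] (s, t) := by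
      rw [nhdsWithin_prod_eq]
      exact Filter.prod_mem_prod (mem_nhdsWithin_of_mem_nhds hO) hW
    have hst : (s, t) ∈ O ×ˢ W := ⟨mem_of_mem_nhds hO, htW⟩
  · exact (h1.cont _ hst).mono_of_mem_nhdsWithin hmem
  · exact (h1.cont' _ hst).mono_of_mem_nhdsWithin hmem
  · exact (h1.cont'' _ hst).mono_of_mem_nhdsWithin hmem

theorem congr {z' : ℝ → ℝ → F} (h : IsC2In z J K) (hJ : IsOpen J)
    (he : ∀ s ∈ J, ∀ t ∈ K, z' s t = z s t) : IsC2In z' J K := by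
  have h0 : ∀ s ∈ J, ∀ t ∈ K, (fun s => z' s t) =ᶠ[𝓝 s] fun s => z s t := fun s hs t ht => by
    filter_upwards [hJ.mem_nhds hs] with s' hs'
    exact he s' hs' t ht
  have h1 : ∀ s ∈ J, ∀ t ∈ K, (deriv fun s => z' s t) =ᶠ[𝓝 s] deriv fun s => z s t :=
    fun s hs t ht => (h0 s hs t ht).deriv
  refine ⟨fun s hs t ht => (h.diff s hs t ht).congr_of_eventuallyEq (h0 s hs t ht),
    fun s hs t ht => (h.diff' s hs t ht).congr_of_eventuallyEq (h1 s hs t ht),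
    h.cont.congr fun p hp => he _ hp.1 _ hp.2,
    h.cont'.congr fun p hp => (h1 _ hp.1 _ hp.2).eq_of_nhds,
    h.cont''.congr fun p hp => (h1 _ hp.1 _ hp.2).deriv_eq⟩

theorem of_hasDerivAt {z' z'' : ℝ → ℝ → F} (hJ : IsOpen J)
    (h1 : ∀ s ∈ J, ∀ t ∈ K, HasDerivAt (fun s => z s t) (z' s t) s)
    (h2 : ∀ s ∈ J, ∀ t ∈ K, HasDerivAt (fun s => z' s t) (z'' s t) s)
    (c0 : ContinuousOn (fun p : ℝ × ℝ => z p.1 p.2) (J ×ˢ K))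
    (c1 : ContinuousOn (fun p : ℝ × ℝ => z' p.1 p.2) (J ×ˢ K))
    (c2 : ContinuousOn (fun p : ℝ × ℝ => z'' p.1 p.2) (J ×ˢ K)) :
    IsC2In z J K ∧ ∀ s ∈ J, ∀ t ∈ K,
      deriv (fun s => z s t) s = z' s t ∧ deriv (deriv fun s => z s t) s = z'' s t := by
  have e1 : ∀ s ∈ J, ∀ t ∈ K, (deriv fun s => z s t) =ᶠ[𝓝 s] fun s => z' s t :=
    fun s hs t ht => by
      filter_upwards [hJ.mem_nhds hs] with s' hs'
      exact (h1 s' hs' t ht).deriv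
  have e2 : ∀ s ∈ J, ∀ t ∈ K, deriv (deriv fun s => z s t) s = z'' s t := fun s hs t ht =>
    (e1 s hs t ht).deriv_eq.trans (h2 s hs t ht).deriv
  refine ⟨⟨fun s hs t ht => (h1 s hs t ht).differentiableAt, fun s hs t ht => ?_, c0,
    c1.congr fun p hp => (h1 _ hp.1 _ hp.2).deriv, c2.congr fun p hp => e2 _ hp.1 _ hp.2⟩,
    fun s hs t ht => ⟨(h1 s hs t ht).deriv, e2 s hs t ht⟩⟩
  exact (h2 s hs t ht).differentiableAt.congr_of_eventuallyEq (e1 s hs t ht)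

/-- Besides stability under smooth maps, the second-order chain rule is recorded here: it splits
into a term quadratic in the first derivative, which becomes the Hessian, and a term linear in the
second, which the first variation formula removes. -/
theorem comp {z : ℝ → ℝ → E} (h : IsC2In z J K) (hJ : IsOpen J) {Θ : ℝ × E → F}
    {S : Set (ℝ × E)} (hS : IsOpen S) (hΘ : ContDiffOn ℝ ∞ Θ S)
    (hz : ∀ s ∈ J, ∀ t ∈ K, (t, z s t) ∈ S) :
    IsC2In (fun s t => Θ (t, z s t)) J K ∧ ∀ s ∈ J, ∀ t ∈ K,
      deriv (fun s => Θ (t, z s t)) s = fderiv ℝ Θ (t, z s t) (0, deriv (fun s => z s t) s) ∧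
      deriv (deriv fun s => Θ (t, z s t)) s =
        fderiv ℝ (fderiv ℝ Θ) (t, z s t) (0, deriv (fun s => z s t) s)
          (0, deriv (fun s => z s t) s) +
        fderiv ℝ Θ (t, z s t) (0, deriv (deriv fun s => z s t) s) := by
  have hΘ' : ContDiffOn ℝ ∞ (fderiv ℝ Θ) S := hΘ.fderiv_of_isOpen hS (by simp)
  have hΘ'' : ContDiffOn ℝ ∞ (fderiv ℝ (fderiv ℝ Θ)) S := hΘ'.fderiv_of_isOpen hS (by simp)
  have hd : ∀ s ∈ J, ∀ t ∈ K, HasDerivAt (fun s => ((t, z s t) : ℝ × E))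
      (0, deriv (fun s => z s t) s) s := fun s hs t ht =>
    (hasDerivAt_const _ _).prodMk (h.diff s hs t ht).hasDerivAt
  have hd' : ∀ s ∈ J, ∀ t ∈ K, HasDerivAt (fun s => ((0, deriv (fun s => z s t) s) : ℝ × E))
      (0, deriv (deriv fun s => z s t) s) s := fun s hs t ht =>
    (hasDerivAt_const _ _).prodMk (h.diff' s hs t ht).hasDerivAt
  have hc : ContinuousOn (fun p : ℝ × ℝ => ((p.2, z p.1 p.2) : ℝ × E)) (J ×ˢ K) :=
    continuousOn_snd.prodMk h.cont
  have hmaps : MapsTo (fun p : ℝ × ℝ => ((p.2, z p.1 p.2) : ℝ × E)) (J ×ˢ K) S :=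
    fun p hp => hz _ hp.1 _ hp.2
  have hc' : ContinuousOn (fun p : ℝ × ℝ => ((0, deriv (fun s => z s p.2) p.1) : ℝ × E))
      (J ×ˢ K) := continuousOn_const.prodMk h.cont'
  have hc'' : ContinuousOn (fun p : ℝ × ℝ => ((0, deriv (deriv fun s => z s p.2) p.1) : ℝ × E))
      (J ×ˢ K) := continuousOn_const.prodMk h.cont''
  have hcΘ' := hΘ'.continuousOn.comp hc hmaps
  refine of_hasDerivAt (z := fun s t => Θ (t, z s t))
    (z' := fun s t => fderiv ℝ Θ (t, z s t) (0, deriv (fun s => z s t) s))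
    (z'' := fun s t => fderiv ℝ (fderiv ℝ Θ) (t, z s t) (0, deriv (fun s => z s t) s)
          (0, deriv (fun s => z s t) s) +
        fderiv ℝ Θ (t, z s t) (0, deriv (deriv fun s => z s t) s)) hJ ?_ ?_ ?_ ?_ ?_
  · intro s hs t ht
    exact (((hΘ.contDiffAt (hS.mem_nhds (hz s hs t ht))).differentiableAt
      (by simp)).hasFDerivAt).comp_hasDerivAt s (hd s hs t ht)
  · intro s hs t ht
    have h1 := (((hΘ'.contDiffAt (hS.mem_nhds (hz s hs t ht))).differentiableAt
      (by simp)).hasFDerivAt).comp_hasDerivAt s (hd s hs t ht)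
    exact h1.clm_apply (hd' s hs t ht)
  · exact hΘ.continuousOn.comp hc hmaps
  · exact hcΘ'.clm_apply hc'
  · exact (((hΘ''.continuousOn.comp hc hmaps).clm_apply hc').clm_apply hc').add
      (hcΘ'.clm_apply hc'')

theorem of_iteratedDeriv (hJ : IsOpen J) (h1 : ∀ t ∈ K, ContDiffOn ℝ 2 (fun s => z s t) J)
    (h2 : ∀ j : ℕ, j ≤ 2 → ContinuousOn
      (fun p : ℝ × ℝ => iteratedDeriv j (fun s => z s p.2) p.1) (J ×ˢ K)) : IsC2In z J K := by
  have h3 : ∀ t ∈ K, ContDiffOn ℝ 1 (deriv fun s => z s t) J := fun t ht =>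
    ((contDiffOn_succ_iff_deriv_of_isOpen (n := 1) hJ).1
      (by simpa [one_add_one_eq_two] using h1 t ht)).2.2
  refine ⟨fun s hs t ht => ((h1 t ht).contDiffAt (hJ.mem_nhds hs)).differentiableAt (by simp),
    fun s hs t ht => ((h3 t ht).contDiffAt (hJ.mem_nhds hs)).differentiableAt (by simp), ?_, ?_, ?_⟩
  · simpa using h2 0 (by norm_num)
  · simpa using h2 1 (by norm_num)
  · simpa [iteratedDeriv_succ] using h2 2 (by norm_num)

theorem contDiffOn (h : IsC2In z J K) (hJ : IsOpen J) {t : ℝ} (ht : t ∈ K) :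
    ContDiffOn ℝ 2 (fun s => z s t) J := by
  rw [show (2 : WithTop ℕ∞) = 1 + 1 from one_add_one_eq_two.symm,
    contDiffOn_succ_iff_deriv_of_isOpen hJ]
  refine ⟨fun s hs => (h.diff s hs t ht).differentiableWithinAt, by simp, ?_⟩
  rw [show (1 : WithTop ℕ∞) = 0 + 1 from (zero_add 1).symm,
    contDiffOn_succ_iff_deriv_of_isOpen hJ]
  refine ⟨fun s hs => (h.diff' s hs t ht).differentiableWithinAt, by simp, ?_⟩
  rw [contDiffOn_zero]
  exact h.cont''.comp (f := fun s => (s, t)) (continuousOn_id.prodMk continuousOn_const)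
    (fun s hs => ⟨hs, ht⟩)

theorem continuousOn_iteratedDeriv (h : IsC2In z J K) (j : ℕ) (hj : j ≤ 2) : ContinuousOn
      (fun p : ℝ × ℝ => iteratedDeriv j (fun s => z s p.2) p.1) (J ×ˢ K) := by
  interval_cases j
  · simpa using h.cont
  · simpa using h.cont'
  · simpa [iteratedDeriv_succ] using h.cont''

theorem hasDerivAt (h : IsC2In z J K) {s t : ℝ} (hs : s ∈ J) (ht : t ∈ K) :
    HasDerivAt (fun s => z s t) (deriv (fun s => z s t) s) s := (h.diff s hs t ht).hasDerivAt

theorem hasDerivAt' (h : IsC2In z J K) {s t : ℝ} (hs : s ∈ J) (ht : t ∈ K) :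
    HasDerivAt (deriv fun s => z s t) (deriv (deriv fun s => z s t) s) s :=
  (h.diff' s hs t ht).hasDerivAt

theorem integral {a b : ℝ} (hab : a ≤ b) (hJ : IsOpen J) (h : IsC2In z J (Icc a b)) {s : ℝ}
    (hs : s ∈ J) :
    ContDiffAt ℝ 2 (fun s => ∫ t in a..b, z s t) s ∧
      iteratedDeriv 2 (fun s => ∫ t in a..b, z s t) s =
        ∫ t in a..b, deriv (deriv fun s => z s t) s := by
  have h1 : ∀ s ∈ J, HasDerivAt (fun s => ∫ t in a..b, z s t)
      (∫ t in a..b, deriv (fun s => z s t) s) s := fun s hs =>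
    hasDerivAt_integral_param (f := z) (f' := fun s t => deriv (fun s => z s t) s)
      hJ hab h.cont h.cont' (fun s hs t ht => h.hasDerivAt hs ht) hs
  have h2 : ∀ s ∈ J, HasDerivAt (fun s => ∫ t in a..b, deriv (fun s => z s t) s)
      (∫ t in a..b, deriv (deriv fun s => z s t) s) s := fun s hs =>
    hasDerivAt_integral_param (f := fun s t => deriv (fun s => z s t) s)
      (f' := fun s t => deriv (deriv fun s => z s t) s)
      hJ hab h.cont' h.cont'' (fun s hs t ht => h.hasDerivAt' hs ht) hs
  have h3 := continuousOn_integral_param (f := fun s t => deriv (deriv fun s => z s t) s)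
    hJ hab h.cont''
  have e1 : EqOn (deriv fun s => ∫ t in a..b, z s t)
      (fun s => ∫ t in a..b, deriv (fun s => z s t) s) J := fun s hs => (h1 s hs).deriv
  have e1' : ∀ s ∈ J, (deriv fun s => ∫ t in a..b, z s t) =ᶠ[𝓝 s]
      fun s => ∫ t in a..b, deriv (fun s => z s t) s := fun s hs =>
    Filter.eventually_of_mem (hJ.mem_nhds hs) e1
  have e2 : EqOn (deriv (deriv fun s => ∫ t in a..b, z s t))
      (fun s => ∫ t in a..b, deriv (deriv fun s => z s t) s) J := fun s hs =>
    ((e1' s hs).deriv_eq).trans (h2 s hs).deriv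
  refine ⟨ContDiffOn.contDiffAt ?_ (hJ.mem_nhds hs), ?_⟩
  · rw [show (2 : WithTop ℕ∞) = 1 + 1 from one_add_one_eq_two.symm,
      contDiffOn_succ_iff_deriv_of_isOpen hJ]
    refine ⟨fun s hs => (h1 s hs).differentiableAt.differentiableWithinAt, by simp, ?_⟩
    rw [show (1 : WithTop ℕ∞) = 0 + 1 from (zero_add 1).symm,
      contDiffOn_succ_iff_deriv_of_isOpen hJ]
    refine ⟨fun s hs => ((h2 s hs).differentiableAt.congr_of_eventuallyEq
      (e1' s hs)).differentiableWithinAt, by simp, ?_⟩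
    rw [contDiffOn_zero]
    exact h3.congr e2
  · rw [show (2 : ℕ) = 1 + 1 from rfl, iteratedDeriv_succ, iteratedDeriv_one]
    exact e2 hs

end IsC2In

end

/-! ### Smoothness of Hamiltonian curves -/

section
variable {n : ℕ} {M : Type*} [TopologicalSpace M] [ChartedSpace (Eu n) M] [IsManifold (𝓡 n) ∞ M]

theorem continuous_cot_proj : Continuous fun p : Cot n M => p.proj :=
  FiberBundle.continuous_proj (EuDual n)
    (fun x : M => TangentSpace (𝓡 n) x →L[ℝ] Bundle.Trivial M ℝ x)

theorem IsHamiltonianCurve.continuousWithinAt_proj {H : ℝ × Cot n M → ℝ} {U : Set (ℝ × Cot n M)}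
    {a b : ℝ} {c : ℝ → Cot n M} (hc : IsHamiltonianCurve H U a b c) {t : ℝ} (ht : t ∈ Icc a b) :
    ContinuousWithinAt (fun τ => (c τ).proj) (Icc a b) t :=
  continuous_cot_proj.continuousAt.comp_continuousWithinAt (hc t ht).2.1.continuousWithinAt

namespace TimeChart
variable (e : TimeChart n M)

/-- The inverse of `phaseIn`. -/
def phaseInvIn (m₀ : M) (w : ℝ × (Eu n × EuDual n)) : Eu n × EuDual n :=
  (e.paramIn m₀ (w.1, w.2.1), w.2.2 ∘L
    fderiv ℝ (e.coordIn m₀) (w.1, e.paramIn m₀ (w.1, w.2.1)) ∘L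
      ContinuousLinearMap.inr ℝ ℝ (Eu n))

/-- The domain of `phaseInvIn`. -/
def phaseInvDom (m₀ : M) : Set (ℝ × (Eu n × EuDual n)) := {w | (w.1, w.2.1) ∈ e.paramDom m₀}

omit [IsManifold (𝓡 n) ∞ M] in
theorem isOpen_phaseInvDom (m₀ : M) : IsOpen (e.phaseInvDom m₀) :=
  (e.isOpen_paramDom m₀).preimage (continuous_fst.prodMk continuous_snd.fst)

theorem contDiffOn_fderiv_coordIn (m₀ : M) :
    ContDiffOn ℝ ∞ (fderiv ℝ (e.coordIn m₀)) (e.coordDom m₀) :=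
  (e.contDiffOn_coordIn m₀).fderiv_of_isOpen (e.isOpen_coordDom m₀) (by simp)

theorem contDiffOn_phaseInvIn (m₀ : M) :
    ContDiffOn ℝ ∞ (e.phaseInvIn m₀) (e.phaseInvDom m₀) := by
  have h1 : ContDiffOn ℝ ∞ (fun z : ℝ × (Eu n × EuDual n) => e.paramIn m₀ (z.1, z.2.1))
      (e.phaseInvDom m₀) :=
    (e.contDiffOn_paramIn m₀).comp (contDiff_fst.prodMk contDiff_snd.fst).contDiffOn
      (fun z hz => hz)
  refine h1.prodMk ?_
  refine contDiff_snd.snd.contDiffOn.clm_comp (ContDiffOn.clm_comp ?_ contDiffOn_const)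
  exact (e.contDiffOn_fderiv_coordIn m₀).comp (contDiff_fst.contDiffOn.prodMk h1)
    (fun z hz => e.mem_coordDom_paramIn hz)

theorem extChartAt_cot_eq {p₀ p : Cot n M} {t : ℝ} (h : (t, p.proj) ∈ e.source)
    (hp : p.proj ∈ (chartAt (Eu n) p₀.proj).source) :
    extChartAt (ICot n) p₀ p = e.phaseInvIn p₀.proj (t, e.phase (t, p)) := by
  rw [extChartAt_cot_apply]
  refine Prod.ext (e.paramIn_apply h).symm ?_
  ext v
  simp only [phaseInvIn, phase, e.paramIn_apply h]
  show p.snd (chartDerivSymm (𝓡 n) p₀.proj p.proj v) = p.snd (e.paramDeriv t p.proj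
    (fderiv ℝ (e.coordIn p₀.proj) (t, extChartAt (𝓡 n) p₀.proj p.proj) (0, v)))
  have h1 := e.coordDeriv_apply h hp (chartDerivSymm (𝓡 n) p₀.proj p.proj v)
  rw [chartDeriv_chartDerivSymm hp] at h1
  rw [← h1, e.paramDeriv_coordDeriv h]

omit [IsManifold (𝓡 n) ∞ M] in
theorem mem_phaseInvDom {p : Cot n M} {m₀ : M} {t : ℝ} (h : (t, p.proj) ∈ e.source)
    (hp : p.proj ∈ (chartAt (Eu n) m₀).source) :
    (t, e.phase (t, p)) ∈ e.phaseInvDom m₀ := e.mem_paramDom h hp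

/-- The derivative of the coordinates inverts that of the parametrization, which recovers `v` from
its lift; in this form `v` depends smoothly on chart data. -/
theorem chartDeriv_of_eq_lift {m m₀ : M} {t : ℝ} {v : Eu n} {u : TangentSpace (𝓡 n) m}
    (h : (t, m) ∈ e.source) (hm : m ∈ (chartAt (Eu n) m₀).source)
    (hu : (⟨m, u⟩ : TangentBundle (𝓡 n) M) = e.lift (t, e.coord (t, m), v)) :
    v = fderiv ℝ (e.coordIn m₀) (t, extChartAt (𝓡 n) m₀ m) (1, chartDeriv (𝓡 n) m₀ m u) := by
  have hd := e.mem_paramDom h hm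
  have h1 := extChartAt_tangent_apply (p₀ := (⟨m₀, 0⟩ : TangentBundle (𝓡 n) M)) hm u
  rw [hu, e.extChartAt_lift (p₀ := (⟨m₀, 0⟩ : TangentBundle (𝓡 n) M))
    (w := (t, e.coord (t, m), v)) hd] at h1
  have h2 : fderiv ℝ (e.paramIn m₀) (t, e.coord (t, m)) (1, v) = chartDeriv (𝓡 n) m₀ m u :=
    congrArg Prod.snd h1
  have h3 := e.fderiv_coordIn_fderiv_paramIn hd (1, v)
  rw [← h2]
  simpa only [e.paramIn_apply h] using h3.symm

section Hamiltonian

variable {H : ℝ × Cot n M → ℝ} {U : Set (ℝ × Cot n M)} (hU : IsOpen U)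
  (hH : ContMDiffOn (𝓘(ℝ, ℝ).prod (ICot n)) 𝓘(ℝ, ℝ) ∞ H U) (hreg : IsHyperRegular H U)
  {a b : ℝ} (hab : a < b) {c : ℝ → Cot n M} (hc : IsHamiltonianCurve H U a b c)
  (he : ∀ t ∈ Icc a b, (t, (c t).proj) ∈ e.source)

/-- The velocity, in a time-dependent chart, of the projection of a curve in `T*M`. -/
def coordVelocity (a b : ℝ) (c : ℝ → Cot n M) (t : ℝ) : Eu n :=
  derivWithin (fun τ => e.coord (τ, (c τ).proj)) (Icc a b) t

include hU hH hreg hab hc he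

/-- The Euler-Lagrange equations with `v` and `ξ'` expressed by functions of `t`, in the form of a
differential equation to which a bootstrap applies. -/
theorem hasDerivWithinAt_phase {t : ℝ} (ht : t ∈ Icc a b) :
    HasDerivWithinAt (fun τ => e.phase (τ, c τ)) (e.coordVelocity a b c t,
      fderiv ℝ (e.lag (lagrangian H U)) (t, (e.phase (t, c t)).1, e.coordVelocity a b c t) ∘L
        ContinuousLinearMap.inr ℝ ℝ (Eu n × Eu n) ∘L ContinuousLinearMap.inl ℝ (Eu n) (Eu n))
      (Icc a b) t ∧
    (t, (e.phase (t, c t)).1, e.coordVelocity a b c t) ∈ e.lagSet (fiberDeriv H '' U) ∧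
    (∀ d : Eu n, fderiv ℝ (e.lag (lagrangian H U))
      (t, (e.phase (t, c t)).1, e.coordVelocity a b c t) (0, 0, d) = (e.phase (t, c t)).2 d) ∧
    (⟨(c t).proj, fiberVelocity H (t, c t)⟩ : TangentBundle (𝓡 n) M) =
      e.lift (t, (e.phase (t, c t)).1, e.coordVelocity a b c t) := by
  obtain ⟨v, ξ', h1, h2, h3, h4⟩ := e.euler_lagrange hU hH hreg hc ht (he t ht)
  have hv : e.coordVelocity a b c t = v :=
    HasDerivWithinAt.derivWithin (f' := v) h1.fst (uniqueDiffOn_Icc hab t ht)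
  rw [hv]
  refine ⟨?_, h2, fun d => by simpa using h3 (0, d), congrArg Prod.snd h4⟩
  convert! h1 using 2
  ext d
  simpa using h3 (d, 0)

/-- The velocity is `∂H/∂p` along the curve, transported to the coordinates of `e`, hence a smooth
function of `t` and the phase coordinates; it is as regular as they are. -/
theorem contDiffOn_coordVelocity {k : ℕ}
    (hk : ContDiffOn ℝ k (fun t => e.phase (t, c t)) (Icc a b)) :
    ContDiffOn ℝ k (e.coordVelocity a b c) (Icc a b) := by
  intro t₀ ht₀
  set p₀ := c t₀
  set m₀ := p₀.proj with hm₀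
  have hev : ∀ᶠ τ in 𝓝[Icc a b] t₀, τ ∈ Icc a b ∧ (c τ).proj ∈ (chartAt (Eu n) m₀).source := by
    filter_upwards [self_mem_nhdsWithin, (hc.continuousWithinAt_proj ht₀).preimage_mem_nhdsWithin
        ((chartAt (Eu n) m₀).open_source.mem_nhds (mem_chart_source _ m₀))] with τ h1 h2
    exact ⟨h1, h2⟩
  have hin : (fun τ : ℝ => ((τ, e.phase (τ, c τ)) : ℝ × (Eu n × EuDual n))) t₀ ∈
      e.phaseInvDom m₀ := e.mem_phaseInvDom (he t₀ ht₀) (mem_chart_source _ _)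
  have hκ : ContDiffWithinAt ℝ k (fun τ => extChartAt (ICot n) p₀ (c τ)) (Icc a b) t₀ := by
    have h1 : ContDiffWithinAt ℝ k (fun τ => e.phaseInvIn m₀ (τ, e.phase (τ, c τ)))
        (Icc a b) t₀ :=
      ContDiffAt.comp_contDiffWithinAt (g := e.phaseInvIn m₀) (f := fun τ => (τ, e.phase (τ, c τ))) t₀
        (((e.contDiffOn_phaseInvIn m₀).contDiffAt
          ((e.isOpen_phaseInvDom m₀).mem_nhds hin)).of_le (by exact_mod_cast le_top)) (contDiffWithinAt_id.prodMk (hk t₀ ht₀))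
    refine h1.congr_of_eventuallyEq_of_mem ?_ ht₀
    filter_upwards [hev] with τ hτ
    exact e.extChartAt_cot_eq (p₀ := p₀) (he τ hτ.1) hτ.2
  have hD : ContDiffOn ℝ ∞ (fderiv ℝ (hamIn H p₀)) (hamDom U p₀) :=
    (contDiffOn_hamIn hH p₀).fderiv_of_isOpen (isOpen_hamDom hU p₀) (by simp)
  have hu : ContDiffWithinAt ℝ k
      (fun τ => chartDeriv (𝓡 n) m₀ (c τ).proj (fiberVelocity H (τ, c τ))) (Icc a b) t₀ := by
    rw [contDiffWithinAt_euclidean]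
    intro i
    have h1 : ContDiffWithinAt ℝ k (fun τ => fderiv ℝ (hamIn H p₀)
        (τ, extChartAt (ICot n) p₀ (c τ)) (0, (0, EuclideanSpace.proj i))) (Icc a b) t₀ := by
      refine ContDiffWithinAt.clm_apply ?_ contDiffWithinAt_const
      exact ContDiffAt.comp_contDiffWithinAt (g := fderiv ℝ (hamIn H p₀))
        (f := fun τ => (τ, extChartAt (ICot n) p₀ (c τ))) t₀
        ((hD.contDiffAt ((isOpen_hamDom hU p₀).mem_nhds (mem_hamDom (p₀ := p₀) (hc t₀ ht₀).1
        (mem_chart_source _ _)))).of_le (by exact_mod_cast le_top))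
          (contDiffWithinAt_id.prodMk hκ)
    refine h1.congr_of_eventuallyEq_of_mem ?_ ht₀
    filter_upwards [hev] with τ hτ
    exact (fderiv_hamIn_vertical hU hH (p₀ := p₀) (z := (τ, c τ)) (hc τ hτ.1).1 hτ.2
      (EuclideanSpace.proj i)).symm
  have hq : ContDiffWithinAt ℝ k (fun τ => extChartAt (𝓡 n) m₀ (c τ).proj) (Icc a b) t₀ := by
    have h1 := hκ.fst
    simp only [extChartAt_cot_apply] at h1
    exact h1
  have hv : ContDiffWithinAt ℝ k (fun τ => fderiv ℝ (e.coordIn m₀)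
      (τ, extChartAt (𝓡 n) m₀ (c τ).proj)
        (1, chartDeriv (𝓡 n) m₀ (c τ).proj (fiberVelocity H (τ, c τ)))) (Icc a b) t₀ := by
    refine ContDiffWithinAt.clm_apply ?_ (contDiffWithinAt_const.prodMk hu)
    exact ContDiffAt.comp_contDiffWithinAt (g := fderiv ℝ (e.coordIn m₀))
      (f := fun τ => (τ, extChartAt (𝓡 n) m₀ (c τ).proj)) t₀
      (((e.contDiffOn_fderiv_coordIn m₀).contDiffAt ((e.isOpen_coordDom m₀).mem_nhds
      (e.mem_coordDom (he t₀ ht₀) (mem_chart_source _ _)))).of_le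
        (by exact_mod_cast le_top)) (contDiffWithinAt_id.prodMk hq)
  refine hv.congr_of_eventuallyEq_of_mem ?_ ht₀
  filter_upwards [hev] with τ hτ
  exact e.chartDeriv_of_eq_lift (he τ hτ.1) hτ.2
    (e.hasDerivWithinAt_phase hU hH hreg hab hc he hτ.1).2.2.2

/-- Bootstrap: integral curves are only assumed to be differentiable, but the derivative of the
phase coordinates is a smooth function of `t`, of these coordinates and of the velocity, so `C^k`
implies `C^(k+1)`. -/
theorem contDiffOn_phase : ContDiffOn ℝ ∞ (fun t => e.phase (t, c t)) (Icc a b) := by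
  rw [contDiffOn_infty]
  have hd := fun t (ht : t ∈ Icc a b) => (e.hasDerivWithinAt_phase hU hH hreg hab hc he ht)
  have hL := e.contDiffOn_lag hU hH hreg
  have hO := e.isOpen_lagSet hreg.isOpen_image
  have hL' : ContDiffOn ℝ ∞ (fderiv ℝ (e.lag (lagrangian H U))) (e.lagSet (fiberDeriv H '' U)) :=
    hL.fderiv_of_isOpen hO (by simp)
  intro k
  induction k with
  | zero =>
    exact contDiffOn_zero.2 fun t ht => (hd t ht).1.continuousWithinAt
  | succ k ih =>
    have h1 := e.contDiffOn_coordVelocity hU hH hreg hab hc he ih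
    push_cast
    rw [contDiffOn_succ_iff_derivWithin (uniqueDiffOn_Icc hab)]
    refine ⟨fun t ht => (hd t ht).1.differentiableWithinAt, by simp, ?_⟩
    refine ContDiffOn.congr (h1.prodMk ?_)
      fun t ht => (hd t ht).1.derivWithin (uniqueDiffOn_Icc hab t ht)
    refine ContDiffOn.clm_comp ?_ contDiffOn_const
    exact (hL'.of_le (by exact_mod_cast le_top)).comp
      (contDiffOn_id.prodMk (ih.fst.prodMk h1)) (fun t ht => (hd t ht).2.1)

theorem contDiffOn_coordVelocity_infty : ContDiffOn ℝ ∞ (e.coordVelocity a b c) (Icc a b) :=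
  contDiffOn_infty.2 fun k => e.contDiffOn_coordVelocity hU hH hreg hab hc he
    (contDiffOn_infty.1 (e.contDiffOn_phase hU hH hreg hab hc he) k)

theorem contMDiffOn_proj :
    ContMDiffOn 𝓘(ℝ, ℝ) (𝓡 n) ∞ (fun t => (c t).proj) (Icc a b) := by
  have h1 : ContDiffOn ℝ ∞ (fun t : ℝ => ((t, e.coord (t, (c t).proj)) : ℝ × Eu n)) (Icc a b) :=
    contDiffOn_id.prodMk (e.contDiffOn_phase hU hH hreg hab hc he).fst
  refine (e.contMDiffOn_param.comp h1.contMDiffOn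
    (fun t ht => e.map_source _ (he t ht))).congr fun t ht => ?_
  exact (e.left_inv _ (he t ht)).symm

end Hamiltonian
end TimeChart

end

section
/-! ### Absolutely continuous functions and functions of class `H¹` -/

/-- The sums that define absolute continuity of `g` are dominated by those of `f` and `h`. This
covers products as well as functions that agree on the interval. -/
theorem absolutelyContinuous_of_dist_le {X Y Z : Type*} [PseudoMetricSpace X]
    [PseudoMetricSpace Y] [PseudoMetricSpace Z] {f : ℝ → X} {h : ℝ → Y} {g : ℝ → Z} {a b K : ℝ}
    (hf : AbsolutelyContinuousOnInterval f a b) (hh : AbsolutelyContinuousOnInterval h a b)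
    (hd : ∀ s ∈ uIcc a b, ∀ t ∈ uIcc a b,
      dist (g s) (g t) ≤ K * (dist (f s) (f t) + dist (h s) (h t))) :
    AbsolutelyContinuousOnInterval g a b := by
  have h1 := (Filter.Tendsto.add hf hh).const_mul K
  rw [add_zero, mul_zero] at h1
  refine squeeze_zero' (Filter.Eventually.of_forall fun E =>
    Finset.sum_nonneg fun i _ => dist_nonneg) ?_ h1
  -- The principal part of the filter says that the subintervals lie in the given interval, where
  -- `hd` applies.
  filter_upwards [Filter.mem_inf_of_right (Filter.mem_principal_self _)] with E hE
  rw [← Finset.sum_add_distrib, Finset.mul_sum]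
  exact Finset.sum_le_sum fun i hi => hd _ (hE.1 i hi).1 _ (hE.1 i hi).2

theorem absolutelyContinuous_clm_apply {E F : Type*} [NormedAddCommGroup E] [NormedSpace ℝ E]
    [NormedAddCommGroup F] [NormedSpace ℝ F] {N : ℝ → E →L[ℝ] F} {u : ℝ → E} {a b : ℝ}
    (hN : AbsolutelyContinuousOnInterval N a b) (hu : AbsolutelyContinuousOnInterval u a b) :
    AbsolutelyContinuousOnInterval (fun t => N t (u t)) a b := by
  obtain ⟨C, hC⟩ := hN.exists_bound
  obtain ⟨D, hD⟩ := hu.exists_bound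
  refine absolutelyContinuous_of_dist_le (K := max C D) hN hu fun s hs t ht => ?_
  have h1 : N s (u s) - N t (u t) = (N s - N t) (u s) + N t (u s - u t) := by
    simp
  rw [dist_eq_norm, dist_eq_norm, dist_eq_norm, h1, mul_add]
  refine (norm_add_le _ _).trans (add_le_add ?_ ?_)
  · refine ((N s - N t).le_opNorm _).trans ?_
    rw [mul_comm]
    exact mul_le_mul_of_nonneg_right ((hD s hs).trans (le_max_right _ _)) (norm_nonneg _)
  · exact ((N t).le_opNorm _).trans
      (mul_le_mul_of_nonneg_right ((hC t ht).trans (le_max_left _ _)) (norm_nonneg _))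

theorem absolutelyContinuous_bilin {E F G : Type*} [NormedAddCommGroup E] [NormedSpace ℝ E]
    [NormedAddCommGroup F] [NormedSpace ℝ F] [NormedAddCommGroup G] [NormedSpace ℝ G]
    {N : ℝ → E →L[ℝ] F →L[ℝ] G} {u : ℝ → E} {w : ℝ → F} {a b : ℝ}
    (hN : AbsolutelyContinuousOnInterval N a b) (hu : AbsolutelyContinuousOnInterval u a b)
    (hw : AbsolutelyContinuousOnInterval w a b) :
    AbsolutelyContinuousOnInterval (fun t => N t (u t) (w t)) a b :=
  absolutelyContinuous_clm_apply (absolutelyContinuous_clm_apply hN hu) hw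

section H1

variable {n : ℕ} {a b : ℝ}

theorem IsH1.continuousOn {u : ℝ → Eu n} (hab : a ≤ b) (hu : IsH1 a b u) :
    ContinuousOn u (Icc a b) := by
  simpa [uIcc_of_le hab] using hu.1.continuousOn

theorem IsH1.memLp {u : ℝ → Eu n} (hab : a ≤ b) (hu : IsH1 a b u) :
    MemLp u 2 (volume.restrict (Icc a b)) := by
  obtain ⟨C, hC⟩ := isCompact_Icc.exists_bound_of_continuousOn (hu.continuousOn hab)
  refine MemLp.of_bound ((hu.continuousOn hab).aestronglyMeasurable measurableSet_Icc) C ?_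
  filter_upwards [ae_restrict_mem measurableSet_Icc] with t ht using hC t ht

/-- The value and the derivative of a function. -/
def jet (u : ℝ → Eu n) (t : ℝ) : Eu n × Eu n := (u t, deriv u t)

theorem IsH1.memLp_jet {u : ℝ → Eu n} (hab : a ≤ b) (hu : IsH1 a b u) :
    MemLp (jet u) 2 (volume.restrict (Icc a b)) := by
  refine ((hu.memLp hab).norm.add hu.2.norm).mono' ((hu.memLp hab).1.prodMk hu.2.1)
    (Filter.Eventually.of_forall fun t => ?_)
  exact max_le (le_add_of_nonneg_right (norm_nonneg _)) (le_add_of_nonneg_left (norm_nonneg _))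

theorem norm_jet_sq_le (u : ℝ → Eu n) (t : ℝ) : ‖jet u t‖ ^ 2 ≤ ‖u t‖ ^ 2 + ‖deriv u t‖ ^ 2 := by
  rw [jet, Prod.norm_def]
  rcases max_choice ‖u t‖ ‖deriv u t‖ with h | h <;> rw [h] <;> nlinarith [sq_nonneg ‖u t‖, sq_nonneg ‖deriv u t‖]

theorem IsH1.integrable_sq {u : ℝ → Eu n} (hab : a ≤ b) (hu : IsH1 a b u) :
    Integrable (fun t => ‖u t‖ ^ 2 + ‖deriv u t‖ ^ 2) (volume.restrict (Icc a b)) :=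
  ((memLp_two_iff_integrable_sq_norm (hu.memLp hab).1).1 (hu.memLp hab)).add
    ((memLp_two_iff_integrable_sq_norm hu.2.1).1 hu.2)

theorem integral_eq_setIntegral_Icc {F : Type*} [NormedAddCommGroup F] [NormedSpace ℝ F]
    (hab : a ≤ b) (f : ℝ → F) :
    ∫ t in a..b, f t = ∫ t in Icc a b, f t := by
  rw [intervalIntegral.integral_of_le hab, integral_Icc_eq_integral_Ioc]

theorem h1Norm_nonneg (u : ℝ → Eu n) : 0 ≤ h1Norm a b u := Real.sqrt_nonneg _

theorem h1Norm_sq (hab : a ≤ b) (u : ℝ → Eu n) :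
    h1Norm a b u ^ 2 = ∫ t in Icc a b, (‖u t‖ ^ 2 + ‖deriv u t‖ ^ 2) := by
  rw [h1Norm, integral_eq_setIntegral_Icc hab, Real.sq_sqrt]
  exact integral_nonneg fun t => by positivity

/-- The Cauchy-Schwarz inequality; the norm of the jet is a maximum, so its square is at most the
integrand of the `H¹` norm. -/
theorem integral_norm_jet_mul_le {u w : ℝ → Eu n} (hab : a ≤ b) (hu : IsH1 a b u)
    (hw : IsH1 a b w) :
    ∫ t in Icc a b, ‖jet u t‖ * ‖jet w t‖ ≤ h1Norm a b u * h1Norm a b w := by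
  have key : ∀ {u : ℝ → Eu n}, IsH1 a b u →
      (∫ t in Icc a b, ‖jet u t‖ ^ (2 : ℝ)) ^ (1 / 2 : ℝ) ≤ h1Norm a b u := by
    intro u hu
    rw [← Real.sqrt_eq_rpow, h1Norm, integral_eq_setIntegral_Icc hab]
    refine Real.sqrt_le_sqrt (integral_mono ?_ (hu.integrable_sq hab) fun t => ?_)
    · simp only [Real.rpow_two]
      exact (memLp_two_iff_integrable_sq_norm (hu.memLp_jet hab).1).1 (hu.memLp_jet hab)
    · simp only [Real.rpow_two]
      exact norm_jet_sq_le u t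
  have h1 : ENNReal.ofReal 2 = 2 := by norm_num
  refine (integral_mul_le_Lp_mul_Lq_of_nonneg (p := 2) (q := 2)
    ⟨by norm_num, by norm_num, by norm_num⟩
    (Filter.Eventually.of_forall fun t => norm_nonneg _)
    (Filter.Eventually.of_forall fun t => norm_nonneg _)
    (by rw [h1]; exact (hu.memLp_jet hab).norm) (by rw [h1]; exact (hw.memLp_jet hab).norm)).trans ?_
  exact mul_le_mul (key hu) (key hw) (by positivity) (h1Norm_nonneg _)

theorem integrable_norm_jet_mul {u w : ℝ → Eu n} (hab : a ≤ b) (hu : IsH1 a b u)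
    (hw : IsH1 a b w) :
    Integrable (fun t => ‖jet u t‖ * ‖jet w t‖) (volume.restrict (Icc a b)) :=
  (hu.memLp_jet hab).norm.integrable_mul (hw.memLp_jet hab).norm

variable {Q : ℝ → (Eu n × Eu n) →L[ℝ] (Eu n × Eu n) →L[ℝ] ℝ}

theorem exists_form_bound (hQ : ContinuousOn Q (Icc a b)) :
    ∃ K : ℝ, 0 ≤ K ∧ ∀ (u w : ℝ → Eu n), ∀ t ∈ Icc a b,
      ‖Q t (jet u t) (jet w t)‖ ≤ K * (‖jet u t‖ * ‖jet w t‖) := by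
  obtain ⟨C, hC⟩ := isCompact_Icc.exists_bound_of_continuousOn
    (E := (Eu n × Eu n) →L[ℝ] (Eu n × Eu n) →L[ℝ] ℝ) hQ
  refine ⟨max C 0, le_max_right _ _, fun u w t ht => ?_⟩
  refine ((Q t).le_opNorm₂ _ _).trans ?_
  rw [mul_assoc]
  exact mul_le_mul_of_nonneg_right ((hC t ht).trans (le_max_left _ _)) (by positivity)

theorem integrable_form (hab : a ≤ b) (hQ : ContinuousOn Q (Icc a b)) {u w : ℝ → Eu n}
    (hu : IsH1 a b u) (hw : IsH1 a b w) :
    Integrable (fun t => Q t (jet u t) (jet w t)) (volume.restrict (Icc a b)) := by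
  obtain ⟨K, -, hK⟩ := exists_form_bound (n := n) hQ
  refine ((integrable_norm_jet_mul hab hu hw).const_mul K).mono' ?_ ?_
  · have h1 : AEStronglyMeasurable Q (volume.restrict (Icc a b)) :=
      hQ.aestronglyMeasurable measurableSet_Icc
    have h2 : Continuous fun p : ((Eu n × Eu n) →L[ℝ] (Eu n × Eu n) →L[ℝ] ℝ) × (Eu n × Eu n) ×
        (Eu n × Eu n) => p.1 p.2.1 p.2.2 :=
      (continuous_fst.clm_apply continuous_snd.fst).clm_apply continuous_snd.snd
    exact h2.comp_aestronglyMeasurable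
      (h1.prodMk ((hu.memLp_jet hab).1.prodMk (hw.memLp_jet hab).1))
  · filter_upwards [ae_restrict_mem measurableSet_Icc] with t ht using hK u w t ht

/-- The bilinear form `∫ Q((u, u'), (w, w'))`. -/
def jetForm (Q : ℝ → (Eu n × Eu n) →L[ℝ] (Eu n × Eu n) →L[ℝ] ℝ) (a b : ℝ) (u w : ℝ → Eu n) : ℝ :=
  ∫ t in a..b, Q t (jet u t) (jet w t)

theorem exists_jetForm_bound (hab : a ≤ b) (hQ : ContinuousOn Q (Icc a b)) :
    ∃ K : ℝ, ∀ u w : ℝ → Eu n, IsH1 a b u → IsH1 a b w →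
      |jetForm Q a b u w| ≤ K * h1Norm a b u * h1Norm a b w := by
  obtain ⟨K, hK0, hK⟩ := exists_form_bound (n := n) hQ
  refine ⟨K, fun u w hu hw => ?_⟩
  rw [jetForm, integral_eq_setIntegral_Icc hab, ← Real.norm_eq_abs, mul_assoc]
  refine (norm_integral_le_of_norm_le ((integrable_norm_jet_mul hab hu hw).const_mul K) ?_).trans ?_
  · filter_upwards [ae_restrict_mem measurableSet_Icc] with t ht using hK u w t ht
  · rw [integral_const_mul]
    exact mul_le_mul_of_nonneg_left (integral_norm_jet_mul_le hab hu hw) hK0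

theorem jet_add_ae (hab : a ≤ b) {u w : ℝ → Eu n} (hu : IsH1 a b u) (hw : IsH1 a b w) :
    ∀ᵐ t ∂(volume.restrict (Icc a b)), jet (fun t => u t + w t) t = jet u t + jet w t := by
  filter_upwards [ae_differentiableAt_of_ac hab hu.1, ae_differentiableAt_of_ac hab hw.1]
    with t h1 h2
  exact Prod.ext rfl (deriv_fun_add h1 h2)

theorem jet_smul_ae (hab : a ≤ b) (c : ℝ) {u : ℝ → Eu n} (hu : IsH1 a b u) :
    ∀ᵐ t ∂(volume.restrict (Icc a b)), jet (fun t => c • u t) t = c • jet u t := by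
  filter_upwards [ae_differentiableAt_of_ac hab hu.1] with t h1
  exact Prod.ext rfl (deriv_fun_const_smul c h1)

theorem jetForm_add_left (hab : a ≤ b) (hQ : ContinuousOn Q (Icc a b)) {u u' w : ℝ → Eu n}
    (hu : IsH1 a b u) (hu' : IsH1 a b u') (hw : IsH1 a b w) :
    jetForm Q a b (fun t => u t + u' t) w = jetForm Q a b u w + jetForm Q a b u' w := by
  simp only [jetForm, integral_eq_setIntegral_Icc hab]
  rw [← integral_add (integrable_form hab hQ hu hw) (integrable_form hab hQ hu' hw)]
  refine integral_congr_ae ?_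
  filter_upwards [jet_add_ae hab hu hu'] with t ht
  simp [ht]

theorem jetForm_smul_left (hab : a ≤ b) (c : ℝ) {u w : ℝ → Eu n} (hu : IsH1 a b u) :
    jetForm Q a b (fun t => c • u t) w = c * jetForm Q a b u w := by
  simp only [jetForm, integral_eq_setIntegral_Icc hab]
  rw [← integral_const_mul]
  refine integral_congr_ae ?_
  filter_upwards [jet_smul_ae hab c hu] with t ht
  simp [ht]

theorem jetForm_symm (hQ : ∀ t ∈ Icc a b, ∀ x y, Q t x y = Q t y x) (hab : a ≤ b)
    (u w : ℝ → Eu n) : jetForm Q a b u w = jetForm Q a b w u := by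
  refine intervalIntegral.integral_congr fun t ht => ?_
  rw [uIcc_of_le hab] at ht
  exact hQ t ht _ _

theorem deriv_clm_apply_ae (hab : a ≤ b) {N : ℝ → Eu n →L[ℝ] Eu n}
    (hN : ContDiffOn ℝ 1 N (Icc a b)) {u : ℝ → Eu n} (hu : IsH1 a b u) :
    ∀ᵐ t ∂(volume.restrict (Icc a b)), HasDerivAt (fun t => N t (u t))
      (derivWithin N (Icc a b) t (u t) + N t (deriv u t)) t := by
  -- The endpoints are discarded: `deriv` is two-sided, while `N` is differentiable only within the
  -- interval.
  have h0 : ∀ᵐ t ∂(volume.restrict (Icc a b)), t ∈ Ioo a b := by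
    rw [← Measure.restrict_congr_set (Ioo_ae_eq_Icc (a := a) (b := b))]
    exact ae_restrict_mem measurableSet_Ioo
  filter_upwards [ae_differentiableAt_of_ac hab hu.1, h0] with t h1 h2
  have h3 := ((hN.differentiableOn (by simp)) t (Ioo_subset_Icc_self h2)).hasDerivWithinAt.hasDerivAt
    (Icc_mem_nhds h2.1 h2.2)
  exact h3.clm_apply h1.hasDerivAt

theorem isH1_clm_apply (hab : a < b) {N : ℝ → Eu n →L[ℝ] Eu n}
    (hN : ContDiffOn ℝ 1 N (Icc a b)) {u : ℝ → Eu n} (hu : IsH1 a b u) :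
    IsH1 a b (fun t => N t (u t)) := by
  have hN' : ContinuousOn (derivWithin N (Icc a b)) (Icc a b) :=
    hN.continuousOn_derivWithin (uniqueDiffOn_Icc hab) le_rfl
  obtain ⟨C, hC⟩ := isCompact_Icc.exists_bound_of_continuousOn hN.continuousOn
  obtain ⟨D, hD⟩ := isCompact_Icc.exists_bound_of_continuousOn hN'
  refine ⟨absolutelyContinuous_clm_apply (ContDiffOn.absolutelyContinuousOnInterval
    (by rwa [uIcc_of_le hab.le])) hu.1, ?_⟩
  have h1 : MemLp (fun t => D * ‖u t‖ + C * ‖deriv u t‖) 2 (volume.restrict (Icc a b)) :=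
    ((hu.memLp hab.le).norm.const_mul D).add (hu.2.norm.const_mul C)
  refine h1.mono' (aestronglyMeasurable_deriv _ _) ?_
  filter_upwards [deriv_clm_apply_ae hab.le hN hu, ae_restrict_mem measurableSet_Icc] with t h2 h3
  rw [h2.deriv]
  refine (norm_add_le _ _).trans (add_le_add ?_ ?_)
  · exact ((derivWithin N (Icc a b) t).le_opNorm _).trans
      (mul_le_mul_of_nonneg_right (hD t h3) (norm_nonneg _))
  · exact ((N t).le_opNorm _).trans (mul_le_mul_of_nonneg_right (hC t h3) (norm_nonneg _))

/-- Changes of frame act boundedly on `H¹`; this makes the boundedness of a form independent of the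
frame. -/
theorem exists_h1Norm_clm_le (hab : a < b) {N : ℝ → Eu n →L[ℝ] Eu n}
    (hN : ContDiffOn ℝ 1 N (Icc a b)) :
    ∃ K : ℝ, 0 ≤ K ∧ ∀ u : ℝ → Eu n, IsH1 a b u →
      h1Norm a b (fun t => N t (u t)) ≤ K * h1Norm a b u := by
  have hN' : ContinuousOn (derivWithin N (Icc a b)) (Icc a b) :=
    hN.continuousOn_derivWithin (uniqueDiffOn_Icc hab) le_rfl
  obtain ⟨C, hC⟩ := isCompact_Icc.exists_bound_of_continuousOn hN.continuousOn
  obtain ⟨D, hD⟩ := isCompact_Icc.exists_bound_of_continuousOn hN'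
  -- From `|N u|² ≤ C² |u|²` and `|N' u + N u'|² ≤ 2 D² |u|² + 2 C² |u'|²`.
  refine ⟨√(C ^ 2 + 2 * D ^ 2 + 2 * C ^ 2), Real.sqrt_nonneg _, fun u hu => ?_⟩
  refine abs_le_of_sq_le_sq' ?_ (mul_nonneg (Real.sqrt_nonneg _) (h1Norm_nonneg _)) |>.2
  rw [mul_pow, Real.sq_sqrt (by positivity), h1Norm_sq hab.le, h1Norm_sq hab.le,
    ← integral_const_mul]
  refine integral_mono_ae ((isH1_clm_apply hab hN hu).integrable_sq hab.le)
    ((hu.integrable_sq hab.le).const_mul _) ?_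
  filter_upwards [deriv_clm_apply_ae hab.le hN hu, ae_restrict_mem measurableSet_Icc] with t h2 h3
  simp only [h2.deriv]
  have h4 : ‖N t (u t)‖ ≤ C * ‖u t‖ :=
    ((N t).le_opNorm _).trans (mul_le_mul_of_nonneg_right (hC t h3) (norm_nonneg _))
  have h5 : ‖derivWithin N (Icc a b) t (u t) + N t (deriv u t)‖ ≤
      D * ‖u t‖ + C * ‖deriv u t‖ := by
    refine (norm_add_le _ _).trans (add_le_add ?_ ?_)
    · exact ((derivWithin N (Icc a b) t).le_opNorm _).trans
        (mul_le_mul_of_nonneg_right (hD t h3) (norm_nonneg _))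
    · exact ((N t).le_opNorm _).trans (mul_le_mul_of_nonneg_right (hC t h3) (norm_nonneg _))
  have h6 := pow_le_pow_left₀ (norm_nonneg _) h4 2
  have h7 := pow_le_pow_left₀ (norm_nonneg _) h5 2
  nlinarith [sq_nonneg (D * ‖u t‖ - C * ‖deriv u t‖), sq_nonneg (C * ‖deriv u t‖),
    sq_nonneg (D * ‖deriv u t‖)]

theorem integral_deriv_eq_sub_of_ac (hab : a ≤ b) {u : ℝ → Eu n}
    (hu : AbsolutelyContinuousOnInterval u a b)
    (hi : IntervalIntegrable (deriv u) volume a b) {t : ℝ} (ht : t ∈ Icc a b) :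
    ∫ τ in a..t, deriv u τ = u t - u a := by
  have hsub : Icc a t ⊆ Icc a b := Icc_subset_Icc_right ht.2
  have hi' : IntervalIntegrable (deriv u) volume a t :=
    hi.mono_set (by rwa [uIcc_of_le ht.1, uIcc_of_le hab])
  -- Tested against linear functionals, the claim becomes the fundamental theorem for real-valued
  -- absolutely continuous functions.
  refine eq_of_forall_dual fun ζ => ?_
  rw [← ζ.intervalIntegral_comp_comm hi', map_sub]
  have hac : AbsolutelyContinuousOnInterval (fun τ => ζ (u τ)) a t :=
    absolutelyContinuous_clm_apply (N := fun _ => ζ)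
      (contDiffOn_const.absolutelyContinuousOnInterval)
      (hu.mono (by rwa [uIcc_of_le ht.1, uIcc_of_le hab]))
  rw [← hac.integral_deriv_eq_sub]
  refine intervalIntegral.integral_congr_ae ?_
  have h1 := (ae_restrict_iff' measurableSet_Icc).1 (ae_differentiableAt_of_ac hab hu)
  filter_upwards [h1] with τ h2 h3
  rw [uIoc_of_le ht.1] at h3
  have h4 := h2 (hsub (Ioc_subset_Icc_self h3))
  exact ((ζ.hasFDerivAt.comp_hasDerivAt τ h4.hasDerivAt).deriv).symm

end H1

end

/-! ### Density of `C¹` functions in `H¹`, and frames along a curve -/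

section
section Density

variable {n : ℕ} {a b : ℝ}

theorem jet_congr_ae {u w : ℝ → Eu n} (h : ∀ t ∈ Icc a b, u t = w t) :
    ∀ᵐ t ∂(volume.restrict (Icc a b)), jet u t = jet w t := by
  rw [← Measure.restrict_congr_set (Ioo_ae_eq_Icc (a := a) (b := b))]
  filter_upwards [ae_restrict_mem measurableSet_Ioo] with t ht
  refine Prod.ext (h t (Ioo_subset_Icc_self ht)) (Filter.EventuallyEq.deriv_eq ?_)
  filter_upwards [isOpen_Ioo.mem_nhds ht] with τ hτ using h τ (Ioo_subset_Icc_self hτ)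

theorem h1Norm_congr (hab : a ≤ b) {u w : ℝ → Eu n} (h : ∀ t ∈ Icc a b, u t = w t) :
    h1Norm a b u = h1Norm a b w := by
  rw [h1Norm, h1Norm, integral_eq_setIntegral_Icc hab, integral_eq_setIntegral_Icc hab]
  congr 1
  refine integral_congr_ae ?_
  filter_upwards [jet_congr_ae h] with t ht
  rw [show u t = w t from congrArg Prod.fst ht,
    show deriv u t = deriv w t from congrArg Prod.snd ht]

theorem jetForm_congr (hab : a ≤ b) (Q : ℝ → (Eu n × Eu n) →L[ℝ] (Eu n × Eu n) →L[ℝ] ℝ)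
    {u u' w w' : ℝ → Eu n} (h : ∀ t ∈ Icc a b, u t = u' t) (h' : ∀ t ∈ Icc a b, w t = w' t) :
    jetForm Q a b u w = jetForm Q a b u' w' := by
  rw [jetForm, jetForm, integral_eq_setIntegral_Icc hab, integral_eq_setIntegral_Icc hab]
  refine integral_congr_ae ?_
  filter_upwards [jet_congr_ae h, jet_congr_ae h'] with t ht ht'
  rw [ht, ht']

theorem isH1_of_contDiffOn (hab : a < b) {u : ℝ → Eu n} (hu : ContDiffOn ℝ 1 u (Icc a b)) :
    IsH1 a b u := by
  refine ⟨ContDiffOn.absolutelyContinuousOnInterval (by rwa [uIcc_of_le hab.le]), ?_⟩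
  have hd : ContinuousOn (derivWithin u (Icc a b)) (Icc a b) :=
    hu.continuousOn_derivWithin (uniqueDiffOn_Icc hab) le_rfl
  obtain ⟨C, hC⟩ := isCompact_Icc.exists_bound_of_continuousOn hd
  have hm : MemLp (derivWithin u (Icc a b)) 2 (volume.restrict (Icc a b)) := by
    refine MemLp.of_bound (hd.aestronglyMeasurable measurableSet_Icc) C ?_
    filter_upwards [ae_restrict_mem measurableSet_Icc] with t ht using hC t ht
  refine hm.ae_eq ?_
  rw [← Measure.restrict_congr_set (Ioo_ae_eq_Icc (a := a) (b := b))]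
  filter_upwards [ae_restrict_mem measurableSet_Ioo] with t ht
  exact derivWithin_of_mem_nhds (Icc_mem_nhds ht.1 ht.2)

/-- The variance of `‖f‖` about its mean `m` is nonnegative. -/
theorem sq_integral_norm_le (hab : a < b) {f : ℝ → Eu n}
    (hf : MemLp f 2 (volume.restrict (Icc a b))) :
    (∫ t in Icc a b, ‖f t‖) ^ 2 ≤ (b - a) * ∫ t in Icc a b, ‖f t‖ ^ 2 := by
  have hba : 0 < b - a := sub_pos.2 hab
  set m := (∫ t in Icc a b, ‖f t‖) / (b - a) with hm
  have h1 : Integrable (fun t => ‖f t‖) (volume.restrict (Icc a b)) :=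
    (hf.integrable (by norm_num)).norm
  have h2 : Integrable (fun t => ‖f t‖ ^ 2) (volume.restrict (Icc a b)) :=
    (memLp_two_iff_integrable_sq_norm hf.1).1 hf
  have h3 : 0 ≤ ∫ t in Icc a b, (‖f t‖ - m) ^ 2 := integral_nonneg fun t => sq_nonneg _
  have h4 : ∫ t in Icc a b, (‖f t‖ - m) ^ 2 =
      (∫ t in Icc a b, ‖f t‖ ^ 2) - 2 * m * (∫ t in Icc a b, ‖f t‖) + m ^ 2 * (b - a) := by
    have h5 : ∀ t, (‖f t‖ - m) ^ 2 = (‖f t‖ ^ 2 - 2 * m * ‖f t‖) + m ^ 2 := fun t => by ring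
    simp only [h5]
    have h8 : Integrable (fun t => ‖f t‖ ^ 2 - 2 * m * ‖f t‖) (volume.restrict (Icc a b)) :=
      h2.sub (h1.const_mul _)
    rw [integral_add h8 (integrable_const _),
      integral_sub h2 (h1.const_mul _), integral_const_mul, setIntegral_const]
    simp only [measureReal_def, Real.volume_Icc, ENNReal.toReal_ofReal hba.le, smul_eq_mul]
    ring
  have h6 : m * (b - a) = ∫ t in Icc a b, ‖f t‖ := div_mul_cancel₀ _ hba.ne'
  rw [h4, ← h6] at h3
  rw [← h6]
  nlinarith

/-- Approximate `u'` in `L²` by a continuous `g` and integrate `g - k` from the value `u(a)`, the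
constant `k` being chosen so that the primitive vanishes at `b`. Then `k` is small because `u(b) =
0`, and the `L¹` norm of the error of the derivative bounds the error of the function. -/
theorem exists_C1_approx (hab : a < b) {u : ℝ → Eu n} (hu : IsH1 a b u) (hub : u b = 0) {ε : ℝ}
    (hε : 0 < ε) :
    ∃ w : ℝ → Eu n, ContDiff ℝ 1 w ∧ w a = u a ∧ w b = 0 ∧
      h1Norm a b (fun t => u t - w t) ≤ ε := by
  have hba : 0 < b - a := sub_pos.2 hab
  -- The squared `L²` error of the derivative will be at most `4δ`, that of the function at most `(b
  -- - a)² 4δ`; the sum is `ε²`.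
  set δ := ε ^ 2 / (4 * ((b - a) ^ 2 + 1)) with hδ
  have hδ0 : 0 < δ := by positivity
  obtain ⟨g, -, hg, hgc, -⟩ := MemLp.exists_hasCompactSupport_integral_rpow_sub_le
    (p := 2) (by norm_num) (f := deriv u) (μ := volume.restrict (Icc a b)) (by simpa using hu.2) hδ0
  simp only [Real.rpow_two] at hg
  have hgm : MemLp g 2 (volume.restrict (Icc a b)) := by
    obtain ⟨C, hC⟩ := isCompact_Icc.exists_bound_of_continuousOn hgc.continuousOn
    refine MemLp.of_bound hgc.aestronglyMeasurable C ?_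
    filter_upwards [ae_restrict_mem measurableSet_Icc] with t ht using hC t ht
  have hi : IntervalIntegrable (deriv u) volume a b :=
    (intervalIntegrable_iff_integrableOn_Icc_of_le hab.le).2 (hu.2.integrable (by norm_num))
  have hgi : ∀ t, IntervalIntegrable g volume a t := fun t => hgc.intervalIntegrable _ _
  set k : Eu n := (b - a)⁻¹ • (u a + ∫ t in a..b, g t) with hk
  set w : ℝ → Eu n := fun t => u a + ∫ τ in a..t, (g τ - k) with hw
  have hgk : Continuous fun τ => g τ - k := hgc.sub continuous_const
  have hwd : ∀ t, HasDerivAt w (g t - k) t := fun t =>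
    ((hgk.integral_hasStrictDerivAt a t).hasDerivAt).const_add (u a)
  have hwd' : deriv w = fun t => g t - k := funext fun t => (hwd t).deriv
  have hwC : ContDiff ℝ 1 w := by
    rw [contDiff_one_iff_deriv, hwd']
    exact ⟨fun t => (hwd t).differentiableAt, hgk⟩
  have hwa : w a = u a := by simp [hw]
  have hwb : w b = 0 := by
    simp only [hw]
    rw [intervalIntegral.integral_sub (hgi b) intervalIntegrable_const,
      intervalIntegral.integral_const, hk, smul_smul, mul_inv_cancel₀ hba.ne', one_smul]
    abel
  refine ⟨w, hwC, hwa, hwb, ?_⟩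
  have hwi : IsH1 a b w := ⟨hwC.contDiffOn.absolutelyContinuousOnInterval, by
    rw [hwd']; exact hgm.sub (memLp_const k)⟩
  set f : ℝ → Eu n := fun t => deriv u t - (g t - k) with hf
  have hfm : MemLp f 2 (volume.restrict (Icc a b)) := hu.2.sub (hgm.sub (memLp_const k))
  have hDd : ∀ᵐ t ∂(volume.restrict (Icc a b)), deriv (fun t => u t - w t) t = f t := by
    filter_upwards [ae_differentiableAt_of_ac hab.le hu.1] with t h1
    rw [deriv_fun_sub h1 (hwd t).differentiableAt, (hwd t).deriv]
  have hD : ∀ t ∈ Icc a b, ‖u t - w t‖ ≤ ∫ τ in Icc a b, ‖f τ‖ := by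
    intro t ht
    have hit : IntervalIntegrable (deriv u) volume a t := hi.mono_set (by
      rw [uIcc_of_le ht.1, uIcc_of_le hab.le]; exact Icc_subset_Icc_right ht.2)
    have h1 : u t - w t = ∫ τ in a..t, f τ := by
      simp only [hf, hw]
      rw [intervalIntegral.integral_sub hit ((hgi t).sub intervalIntegrable_const),
        integral_deriv_eq_sub_of_ac hab.le hu.1 hi ht]
      abel
    rw [h1, intervalIntegral.integral_of_le ht.1]
    refine (norm_integral_le_integral_norm _).trans ?_
    refine setIntegral_mono_set ((hfm.integrable (by norm_num)).norm)
      (Filter.Eventually.of_forall fun t => norm_nonneg _)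
      (LE.le.eventuallyLE (Ioc_subset_Icc_self.trans (Icc_subset_Icc_right ht.2)))
  have hkn : ‖k‖ ^ 2 * (b - a) ≤ δ := by
    -- Since `u(b) = 0`, one has `u(a) = -∫ u'`, so `k` is the mean of the approximation error.
    have h1 : k = (b - a)⁻¹ • ∫ t in Icc a b, (g t - deriv u t) := by
      rw [← integral_eq_setIntegral_Icc hab.le, intervalIntegral.integral_sub (hgi b) hi,
        integral_deriv_eq_sub_of_ac hab.le hu.1 hi ⟨hab.le, le_rfl⟩, hub, hk]
      congr 1
      abel
    have h2 : ‖k‖ * (b - a) ≤ ∫ t in Icc a b, ‖deriv u t - g t‖ := by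
      rw [h1, norm_smul, Real.norm_of_nonneg (inv_nonneg.2 hba.le), mul_comm, ← mul_assoc,
        mul_inv_cancel₀ hba.ne', one_mul]
      refine (norm_integral_le_integral_norm _).trans (le_of_eq ?_)
      simp only [norm_sub_rev]
    have h3 := sq_integral_norm_le hab (hu.2.sub hgm)
    simp only [Pi.sub_apply] at h3
    have h4 := pow_le_pow_left₀ (by positivity) h2 2
    have h5 : (b - a) * (‖k‖ ^ 2 * (b - a)) ≤ (b - a) * δ := by
      calc _ = (‖k‖ * (b - a)) ^ 2 := by ring
        _ ≤ _ := h4.trans (h3.trans (mul_le_mul_of_nonneg_left hg hba.le))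
    exact le_of_mul_le_mul_left h5 hba
  have hfn : ∫ t in Icc a b, ‖f t‖ ^ 2 ≤ 4 * δ := by
    have h1 : Integrable (fun t => ‖deriv u t - g t‖ ^ 2) (volume.restrict (Icc a b)) :=
      (memLp_two_iff_integrable_sq_norm (hu.2.sub hgm).1).1 (hu.2.sub hgm)
    have h2 : ∫ t in Icc a b, ‖f t‖ ^ 2 ≤
        ∫ t in Icc a b, (2 * ‖deriv u t - g t‖ ^ 2 + 2 * ‖k‖ ^ 2) := by
      refine integral_mono ((memLp_two_iff_integrable_sq_norm hfm.1).1 hfm)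
        ((h1.const_mul 2).add (integrable_const _)) fun t => ?_
      have h3 : ‖f t‖ ≤ ‖deriv u t - g t‖ + ‖k‖ := by
        have : f t = (deriv u t - g t) + k := by simp only [hf]; abel
        rw [this]
        exact norm_add_le _ _
      have h4 := pow_le_pow_left₀ (norm_nonneg _) h3 2
      simp only
      nlinarith [sq_nonneg (‖deriv u t - g t‖ - ‖k‖)]
    rw [integral_add (h1.const_mul 2) (integrable_const _), integral_const_mul,
      setIntegral_const] at h2
    simp only [measureReal_def, Real.volume_Icc, ENNReal.toReal_ofReal hba.le, smul_eq_mul] at h2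
    nlinarith
  have hsq : h1Norm a b (fun t => u t - w t) ^ 2 ≤ ε ^ 2 := by
    rw [h1Norm_sq hab.le]
    have h1 : ∫ t in Icc a b, (‖u t - w t‖ ^ 2 + ‖deriv (fun t => u t - w t) t‖ ^ 2) ≤
        ∫ t in Icc a b, ((∫ τ in Icc a b, ‖f τ‖) ^ 2 + ‖f t‖ ^ 2) := by
      have h2 : IsH1 a b (fun t => u t - w t) := by
        have := isH1_add hab.le hu (isH1_smul hab.le (-1) hwi)
        simpa [sub_eq_add_neg] using this
      refine integral_mono_ae (h2.integrable_sq hab.le)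
        ((integrable_const _).add ((memLp_two_iff_integrable_sq_norm hfm.1).1 hfm)) ?_
      filter_upwards [hDd, ae_restrict_mem measurableSet_Icc] with t h3 h4
      rw [h3]
      exact add_le_add (pow_le_pow_left₀ (norm_nonneg _) (hD t h4) 2) le_rfl
    rw [integral_add (integrable_const _) ((memLp_two_iff_integrable_sq_norm hfm.1).1 hfm),
      setIntegral_const] at h1
    simp only [measureReal_def, Real.volume_Icc, ENNReal.toReal_ofReal hba.le, smul_eq_mul] at h1
    have h5 := mul_le_mul_of_nonneg_left (sq_integral_norm_le hab hfm) hba.le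
    have h6 : (4 * ((b - a) ^ 2 + 1)) * δ = ε ^ 2 := by
      rw [hδ]
      field_simp
    nlinarith [mul_le_mul_of_nonneg_left hfn (sq_nonneg (b - a))]
  exact (abs_le_of_sq_le_sq' hsq hε.le).2

end Density

/-! ### Frames -/

variable {n : ℕ} {M : Type*} [TopologicalSpace M] [ChartedSpace (Eu n) M] [IsManifold (𝓡 n) ∞ M]

section Frames

variable {γ : ℝ → M} {a b : ℝ} {Z Z' : ∀ t : ℝ, Eu n ≃L[ℝ] TangentSpace (𝓡 n) (γ t)}

/-- A frame in a chart. -/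
def frameIn (Z : ∀ t : ℝ, Eu n ≃L[ℝ] TangentSpace (𝓡 n) (γ t)) (m₀ : M) (t : ℝ) :
    Eu n →L[ℝ] Eu n := chartDeriv (𝓡 n) m₀ (γ t) ∘L (Z t : Eu n →L[ℝ] TangentSpace (𝓡 n) (γ t))

theorem contDiffWithinAt_clm_of_apply {E F : Type*} [NormedAddCommGroup E] [NormedSpace ℝ E]
    [FiniteDimensional ℝ E] [NormedAddCommGroup F] [NormedSpace ℝ F] {k : WithTop ℕ∞}
    {f : ℝ → E →L[ℝ] F} {s : Set ℝ} {t : ℝ}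
    (h : ∀ x, ContDiffWithinAt ℝ k (fun t => f t x) s t) : ContDiffWithinAt ℝ k f s t := by
  let d := Module.finrank ℝ E
  have hd : d = Module.finrank ℝ (Fin d → ℝ) := (Module.finrank_fin_fun ℝ).symm
  let e₁ := ContinuousLinearEquiv.ofFinrankEq hd
  let e₂ := (e₁.arrowCongr (1 : F ≃L[ℝ] F)).trans (ContinuousLinearEquiv.piRing (Fin d))
  rw [← Function.id_comp f, ← e₂.symm_comp_self]
  exact e₂.symm.contDiff.contDiffAt.comp_contDiffWithinAt t
    (contDiffWithinAt_pi.mpr fun i => h _)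

theorem isFrame_iff (hγ : ContMDiffOn 𝓘(ℝ, ℝ) (𝓡 n) ∞ γ (Icc a b)) :
    IsFrame γ a b Z ↔ ∀ t₀ ∈ Icc a b,
      ContDiffWithinAt ℝ ∞ (frameIn Z (γ t₀)) (Icc a b) t₀ := by
  constructor
  · intro h t₀ ht₀
    refine contDiffWithinAt_clm_of_apply fun x => ?_
    exact (contMDiffWithinAt_field_iff.1 (h x t₀ ht₀)).2
  · intro h x t₀ ht₀
    exact contMDiffWithinAt_field_iff.2 ⟨hγ t₀ ht₀, (h t₀ ht₀).clm_apply contDiffWithinAt_const⟩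

/-- Near each time the transition map is the inverse of one frame, read in a chart, composed with
the other; the chart differential cancels, and inversion of linear maps is smooth. -/
theorem IsFrame.change (hγ : ContMDiffOn 𝓘(ℝ, ℝ) (𝓡 n) ∞ γ (Icc a b)) (hZ : IsFrame γ a b Z)
    (hZ' : IsFrame γ a b Z') :
    ContDiffOn ℝ ∞ (fun t => ((Z' t).symm : TangentSpace (𝓡 n) (γ t) →L[ℝ] Eu n) ∘L
      (Z t : Eu n →L[ℝ] TangentSpace (𝓡 n) (γ t))) (Icc a b) := by
  intro t₀ ht₀
  have h1 := (isFrame_iff hγ).1 hZ t₀ ht₀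
  have h2 := (isFrame_iff hγ).1 hZ' t₀ ht₀
  have hinv : ∀ t, γ t ∈ (chartAt (Eu n) (γ t₀)).source →
      ∃ N : Eu n ≃L[ℝ] Eu n, (N : Eu n →L[ℝ] Eu n) = frameIn Z' (γ t₀) t ∧
        (N.symm : Eu n →L[ℝ] Eu n) ∘L frameIn Z (γ t₀) t =
          ((Z' t).symm : TangentSpace (𝓡 n) (γ t) →L[ℝ] Eu n) ∘L
            (Z t : Eu n →L[ℝ] TangentSpace (𝓡 n) (γ t)) := by
    intro t ht
    refine ⟨ContinuousLinearEquiv.equivOfInverse (frameIn Z' (γ t₀) t)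
      (((Z' t).symm : TangentSpace (𝓡 n) (γ t) →L[ℝ] Eu n) ∘L chartDerivSymm (𝓡 n) (γ t₀) (γ t))
      (fun x => ?_) (fun x => ?_), ?_, ?_⟩
    · simp [frameIn, chartDerivSymm_chartDeriv ht]
    · simp [frameIn, chartDeriv_chartDerivSymm ht]
    · ext1 x; rfl
    · ext1 x
      show (Z' t).symm (chartDerivSymm (𝓡 n) (γ t₀) (γ t) (chartDeriv (𝓡 n) (γ t₀) (γ t)
        (Z t x))) = (Z' t).symm (Z t x)
      rw [chartDerivSymm_chartDeriv ht]
  have hev : ∀ᶠ t in 𝓝[Icc a b] t₀, γ t ∈ (chartAt (Eu n) (γ t₀)).source :=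
    (hγ t₀ ht₀).continuousWithinAt.preimage_mem_nhdsWithin
      ((chartAt (Eu n) (γ t₀)).open_source.mem_nhds (mem_chart_source _ _))
  have h3 : ContDiffWithinAt ℝ ∞ (fun t => (frameIn Z' (γ t₀) t).inverse ∘L frameIn Z (γ t₀) t)
      (Icc a b) t₀ := by
    refine ContDiffWithinAt.clm_comp ?_ h1
    obtain ⟨N, hN, -⟩ := hinv t₀ (mem_chart_source _ _)
    have h4 := contDiffAt_map_inverse (n := ∞) (𝕜 := ℝ) N
    rw [hN] at h4
    exact h4.comp_contDiffWithinAt t₀ h2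
  refine h3.congr_of_eventuallyEq_of_mem ?_ ht₀
  filter_upwards [hev] with t ht
  obtain ⟨N, hN, hN'⟩ := hinv t ht
  rw [← hN, ContinuousLinearMap.inverse_equiv, hN']

variable {P : Set M} {hab : a < b}

theorem IsFrame.isH1_change (hab : a < b) (hγ : ContMDiffOn 𝓘(ℝ, ℝ) (𝓡 n) ∞ γ (Icc a b)) (hZ : IsFrame γ a b Z)
    (hZ' : IsFrame γ a b Z') {v : ∀ t : ℝ, TangentSpace (𝓡 n) (γ t)}
    (hv : IsH1 a b fun t => (Z t).symm (v t)) : IsH1 a b fun t => (Z' t).symm (v t) := by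
  have h1 := isH1_clm_apply hab ((hZ.change hγ hZ').of_le (by exact_mod_cast le_top)) hv
  simpa using h1

theorem IsFrame.contDiffOn_change (hγ : ContMDiffOn 𝓘(ℝ, ℝ) (𝓡 n) ∞ γ (Icc a b))
    (hZ : IsFrame γ a b Z) (hZ' : IsFrame γ a b Z') {v : ∀ t : ℝ, TangentSpace (𝓡 n) (γ t)}
    (hv : ContDiffOn ℝ 1 (fun t => (Z t).symm (v t)) (Icc a b)) :
    ContDiffOn ℝ 1 (fun t => (Z' t).symm (v t)) (Icc a b) := by
  have h1 := ((hZ.change hγ hZ').of_le (by exact_mod_cast le_top)).clm_apply hv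
  simpa using h1

theorem mem_H1Fields_of_frame (hγ : ContMDiffOn 𝓘(ℝ, ℝ) (𝓡 n) ∞ γ (Icc a b))
    (hZ : IsFrame γ a b Z) {v : ∀ t : ℝ, TangentSpace (𝓡 n) (γ t)}
    (h0 : ∀ t, t ∉ Icc a b → v t = 0) (hv : IsH1 a b fun t => (Z t).symm (v t))
    (hva : v a ∈ tangentSpaceOf (𝓡 n) P (γ a)) (hvb : v b = 0) :
    v ∈ H1Fields (n := n) γ P a b hab :=
  ⟨h0, fun _ hZ' => hZ.isH1_change hab hγ hZ' hv, hva, hvb⟩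

/-- Boundedness is defined by the existence of one suitable frame; this transfers the estimate to
any prescribed frame, so that two forms can be compared. -/
theorem isBoundedForm_frame (hγ : ContMDiffOn 𝓘(ℝ, ℝ) (𝓡 n) ∞ γ (Icc a b))
    {B : LinearMap.BilinForm ℝ (H1Fields (n := n) γ P a b hab)} (hB : IsBoundedForm B)
    (hZ : IsFrame γ a b Z) :
    ∃ C : ℝ, 0 ≤ C ∧ ∀ v w : H1Fields (n := n) γ P a b hab,
      |B v w| ≤ C * h1Norm a b (fun t => (Z t).symm (v.1 t)) *
        h1Norm a b (fun t => (Z t).symm (w.1 t)) := by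
  obtain ⟨Z', hZ', C, hC⟩ := hB
  obtain ⟨K, hK0, hK⟩ := exists_h1Norm_clm_le hab
    ((hZ.change hγ hZ').of_le (by exact_mod_cast le_top))
  have hK' : ∀ v : H1Fields (n := n) γ P a b hab, h1Norm a b (fun t => (Z' t).symm (v.1 t)) ≤
      K * h1Norm a b (fun t => (Z t).symm (v.1 t)) := fun v => by
    simpa using hK _ (v.2.2.1 Z hZ)
  refine ⟨max C 0 * K * K, by positivity, fun v w => (hC v w).trans ?_⟩
  have e1 := h1Norm_nonneg (a := a) (b := b) (fun t => (Z' t).symm (v.1 t))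
  have e2 := h1Norm_nonneg (a := a) (b := b) (fun t => (Z' t).symm (w.1 t))
  have e3 := h1Norm_nonneg (a := a) (b := b) (fun t => (Z t).symm (v.1 t))
  calc _ ≤ max C 0 * h1Norm a b (fun t => (Z' t).symm (v.1 t)) *
        h1Norm a b (fun t => (Z' t).symm (w.1 t)) := by gcongr; exact le_max_left _ _
    _ ≤ max C 0 * (K * h1Norm a b (fun t => (Z t).symm (v.1 t))) *
        (K * h1Norm a b (fun t => (Z t).symm (w.1 t))) := by
      gcongr
      · exact hK' v
      · exact hK' w
    _ = _ := by ring

/-- Fields of class `H¹` can be approximated by fields of class `C¹`. -/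
theorem exists_C1Fields_approx (hγ : ContMDiffOn 𝓘(ℝ, ℝ) (𝓡 n) ∞ γ (Icc a b))
    (hZ : IsFrame γ a b Z) (v : H1Fields (n := n) γ P a b hab) {ε : ℝ} (hε : 0 < ε) :
    ∃ w : C1Fields (n := n) γ P a b hab,
      h1Norm a b (fun t => (Z t).symm ((v - w.1).1 t)) ≤ ε := by
  classical
  obtain ⟨h0, h1, h2, h3⟩ := v.2
  obtain ⟨w, hw, hwa, hwb, hwε⟩ := exists_C1_approx hab (h1 Z hZ) (by simp [h3]) hε
  set w' : ∀ t : ℝ, TangentSpace (𝓡 n) (γ t) := fun t => if t ∈ Icc a b then Z t (w t) else 0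
    with hw'
  have he : ∀ t ∈ Icc a b, (Z t).symm (w' t) = w t := fun t ht => by
    simp only [hw', if_pos ht, ContinuousLinearEquiv.symm_apply_apply]
  have hC : ContDiffOn ℝ 1 (fun t => (Z t).symm (w' t)) (Icc a b) := hw.contDiffOn.congr he
  have hH : IsH1 a b fun t => (Z t).symm (w' t) := isH1_of_contDiffOn hab hC
  have hmem : w' ∈ H1Fields (n := n) γ P a b hab := by
    refine mem_H1Fields_of_frame hγ hZ (fun t ht => by simp only [hw', if_neg ht]) hH ?_ ?_
    · have : w' a = v.1 a := by simp [hw', hab.le, hwa]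
      rw [this]
      exact h2
    · simp [hw', hwb]
  refine ⟨⟨⟨w', hmem⟩, fun Z' hZ' => hZ.contDiffOn_change hγ hZ' hC⟩, ?_⟩
  refine le_trans (le_of_eq (h1Norm_congr hab.le fun t ht => ?_)) hwε
  have h4 : (v - (⟨w', hmem⟩ : H1Fields (n := n) γ P a b hab)).1 t = v.1 t - w' t := rfl
  rw [h4, map_sub, he t ht]

end Frames

end

/-! ### Bounded forms on the space of `H¹` fields -/

section
variable {n : ℕ} {M : Type*} [TopologicalSpace M] [ChartedSpace (Eu n) M] [IsManifold (𝓡 n) ∞ M]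

section RightLinear

variable {a b : ℝ} {Q : ℝ → (Eu n × Eu n) →L[ℝ] (Eu n × Eu n) →L[ℝ] ℝ}

theorem jetForm_add_right (hab : a ≤ b) (hQ : ContinuousOn Q (Icc a b)) {u w w' : ℝ → Eu n}
    (hu : IsH1 a b u) (hw : IsH1 a b w) (hw' : IsH1 a b w') :
    jetForm Q a b u (fun t => w t + w' t) = jetForm Q a b u w + jetForm Q a b u w' := by
  simp only [jetForm, integral_eq_setIntegral_Icc hab]
  rw [← integral_add (integrable_form hab hQ hu hw) (integrable_form hab hQ hu hw')]
  refine integral_congr_ae ?_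
  filter_upwards [jet_add_ae hab hw hw'] with t ht
  simp [ht]

theorem jetForm_smul_right (hab : a ≤ b) (c : ℝ) {u w : ℝ → Eu n} (hw : IsH1 a b w) :
    jetForm Q a b u (fun t => c • w t) = c * jetForm Q a b u w := by
  simp only [jetForm, integral_eq_setIntegral_Icc hab]
  rw [← integral_const_mul]
  refine integral_congr_ae ?_
  filter_upwards [jet_smul_ae hab c hw] with t ht
  simp [ht]

end RightLinear

section Uniqueness

variable {γ : ℝ → M} {a b : ℝ} {Z : ∀ t : ℝ, Eu n ≃L[ℝ] TangentSpace (𝓡 n) (γ t)}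
  {P : Set M} {hab : a < b}

/-- Bounded bilinear forms that agree on the fields of class `C¹` are equal. -/
theorem eq_of_isBoundedForm (hγ : ContMDiffOn 𝓘(ℝ, ℝ) (𝓡 n) ∞ γ (Icc a b))
    (hZ : IsFrame γ a b Z) {B B' : LinearMap.BilinForm ℝ (H1Fields (n := n) γ P a b hab)}
    (hB : IsBoundedForm B) (hB' : IsBoundedForm B')
    (h : ∀ v w : C1Fields (n := n) γ P a b hab, B v.1 w.1 = B' v.1 w.1) : B = B' := by
  obtain ⟨C, hC0, hC⟩ := isBoundedForm_frame hγ hB hZ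
  obtain ⟨C', hC0', hC'⟩ := isBoundedForm_frame hγ hB' hZ
  set N : H1Fields (n := n) γ P a b hab → ℝ := fun v => h1Norm a b fun t => (Z t).symm (v.1 t)
    with hN
  have hN0 : ∀ v, 0 ≤ N v := fun v => h1Norm_nonneg _
  have hD : ∀ v w, |(B - B') v w| ≤ (C + C') * N v * N w := fun v w => by
    have h1 : (B - B') v w = B v w - B' v w := rfl
    rw [h1]
    refine (abs_sub _ _).trans ?_
    have := add_le_add (hC v w) (hC' v w)
    calc _ ≤ _ := this
      _ = _ := by ring
  refine LinearMap.ext₂ fun v w => ?_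
  rw [← sub_eq_zero]
  have h0 : B v w - B' v w = (B - B') v w := rfl
  rw [h0, ← abs_nonpos_iff]
  refine le_of_forall_pos_le_add fun ε hε => ?_
  set K := (C + C') * (N v + N w + 1) with hK
  have hK0 : 0 ≤ K := mul_nonneg (add_nonneg hC0 hC0') (by linarith [hN0 v, hN0 w])
  obtain ⟨δ, hδ0, hδ1, hδ⟩ : ∃ δ : ℝ, 0 < δ ∧ δ ≤ 1 ∧ K * δ ≤ ε := by
    refine ⟨min 1 (ε / (K + 1)), by positivity, min_le_left _ _, ?_⟩
    calc K * min 1 (ε / (K + 1)) ≤ (K + 1) * (ε / (K + 1)) := by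
          gcongr
          · linarith
          · exact min_le_right _ _
      _ = ε := by field_simp
  obtain ⟨v', hv'⟩ := exists_C1Fields_approx hγ hZ v hδ0
  obtain ⟨w', hw'⟩ := exists_C1Fields_approx hγ hZ w hδ0
  -- Bilinear expansion around the approximations `v'`, `w'`, on which the difference of the forms
  -- vanishes.
  have h1 : (B - B') v w = (B - B') (v - v'.1) w + (B - B') v (w - w'.1) -
      (B - B') (v - v'.1) (w - w'.1) := by
    have h2 : (B - B') v'.1 w'.1 = 0 := sub_eq_zero.2 (h v' w')
    simp only [map_sub, LinearMap.sub_apply] at h2 ⊢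
    linarith
  rw [h1, zero_add]
  have e1 := hD (v - v'.1) w
  have e2 := hD v (w - w'.1)
  have e3 := hD (v - v'.1) (w - w'.1)
  have f1 : (C + C') * N (v - v'.1) * N w ≤ (C + C') * δ * N w := by
    gcongr
    exact hN0 w
  have f2 : (C + C') * N v * N (w - w'.1) ≤ (C + C') * N v * δ := by
    gcongr
    exact mul_nonneg (add_nonneg hC0 hC0') (hN0 v)
  have f3 : (C + C') * N (v - v'.1) * N (w - w'.1) ≤ (C + C') * 1 * δ := by
    gcongr
    · exact hN0 _
    · exact hv'.trans hδ1
  calc _ ≤ |(B - B') (v - v'.1) w| + |(B - B') v (w - w'.1)| +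
        |(B - B') (v - v'.1) (w - w'.1)| :=
        (abs_sub _ _).trans (add_le_add (abs_add_le _ _) le_rfl)
    _ ≤ (C + C') * δ * N w + (C + C') * N v * δ + (C + C') * 1 * δ :=
        add_le_add (add_le_add (e1.trans f1) (e2.trans f2)) (e3.trans f3)
    _ = K * δ := by rw [hK]; ring
    _ ≤ ε := hδ

end Uniqueness

namespace TimeChart
variable (e : TimeChart n M)

open Classical in
/-- The frame of the tangent spaces that is given by a time-dependent chart. -/
def frame (γ : ℝ → M) (t : ℝ) : Eu n ≃L[ℝ] TangentSpace (𝓡 n) (γ t) :=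
  if h : (t, γ t) ∈ e.source then (e.coordEquiv h).symm else
    -- A default value for times outside the domain; it only has to be an isomorphism.
    ContinuousLinearEquiv.equivOfInverse (chartDerivSymm (𝓡 n) (γ t) (γ t))
      (chartDeriv (𝓡 n) (γ t) (γ t))
      (fun v => chartDeriv_chartDerivSymm (mem_chart_source _ _) v)
      (fun v => chartDerivSymm_chartDeriv (mem_chart_source _ _) v)

theorem frame_apply {γ : ℝ → M} {t : ℝ} (h : (t, γ t) ∈ e.source) (x : Eu n) :
    e.frame γ t x = e.paramDeriv t (γ t) x := by
  rw [frame, dif_pos h, ← e.coordEquiv_symm_eq h]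
  rfl

theorem frame_symm_apply {γ : ℝ → M} {t : ℝ} (h : (t, γ t) ∈ e.source)
    (w : TangentSpace (𝓡 n) (γ t)) : (e.frame γ t).symm w = e.coordDeriv t (γ t) w := by
  rw [frame, dif_pos h]
  rfl

variable {γ : ℝ → M} {a b : ℝ} (he : ∀ t ∈ Icc a b, (t, γ t) ∈ e.source)

include he in
omit [IsManifold (𝓡 n) ∞ M] in
theorem contDiffOn_coord_comp (hγ : ContMDiffOn 𝓘(ℝ, ℝ) (𝓡 n) ∞ γ (Icc a b)) :
    ContDiffOn ℝ ∞ (fun t => e.coord (t, γ t)) (Icc a b) := by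
  refine ContMDiffOn.contDiffOn ?_
  exact e.contMDiffOn_coord.comp (ContMDiffOn.prodMk contMDiffOn_id hγ) he

include he in
theorem isFrame_frame (hγ : ContMDiffOn 𝓘(ℝ, ℝ) (𝓡 n) ∞ γ (Icc a b)) :
    IsFrame γ a b (e.frame γ) := by
  rw [isFrame_iff hγ]
  intro t₀ ht₀
  refine contDiffWithinAt_clm_of_apply fun x => ?_
  have h1 : ContDiffWithinAt ℝ ∞ (fun t => fderiv ℝ (e.paramIn (γ t₀)) (t, e.coord (t, γ t)) (0, x))
      (Icc a b) t₀ := by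
    refine ContDiffWithinAt.clm_apply ?_ contDiffWithinAt_const
    exact ContDiffAt.comp_contDiffWithinAt (g := fderiv ℝ (e.paramIn (γ t₀)))
      (f := fun t => (t, e.coord (t, γ t))) t₀
      ((e.contDiffOn_fderiv_paramIn (γ t₀)).contDiffAt ((e.isOpen_paramDom (γ t₀)).mem_nhds
        (e.mem_paramDom (he t₀ ht₀) (mem_chart_source _ _))))
      (contDiffWithinAt_id.prodMk (e.contDiffOn_coord_comp he hγ t₀ ht₀))
  refine h1.congr_of_eventuallyEq_of_mem ?_ ht₀
  filter_upwards [(hγ t₀ ht₀).continuousWithinAt.preimage_mem_nhdsWithin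
      ((chartAt (Eu n) (γ t₀)).open_source.mem_nhds (mem_chart_source _ _)), self_mem_nhdsWithin]
    with t h2 h3
  rw [← e.chartDeriv_paramDeriv (he t h3) h2, ← e.frame_apply (he t h3)]
  rfl

/-- The coordinates of a vector field along a curve. -/
def fieldCoord (v : ∀ t : ℝ, TangentSpace (𝓡 n) (γ t)) (t : ℝ) : Eu n :=
  (e.frame γ t).symm (v t)

theorem fieldCoord_apply {v : ∀ t : ℝ, TangentSpace (𝓡 n) (γ t)} {t : ℝ}
    (h : (t, γ t) ∈ e.source) : e.fieldCoord v t = e.coordDeriv t (γ t) (v t) :=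
  e.frame_symm_apply h _

section Form

variable {P : Set M} {hab : a < b} {Q : ℝ → (Eu n × Eu n) →L[ℝ] (Eu n × Eu n) →L[ℝ] ℝ}
  (hQ : ContinuousOn Q (Icc a b)) (hγ : ContMDiffOn 𝓘(ℝ, ℝ) (𝓡 n) ∞ γ (Icc a b))

include he hγ in
theorem isH1_fieldCoord (v : H1Fields (n := n) γ P a b hab) : IsH1 a b (e.fieldCoord v.1) :=
  v.2.2.1 _ (e.isFrame_frame he hγ)

include he hγ in
theorem contDiffOn_fieldCoord (v : C1Fields (n := n) γ P a b hab) :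
    ContDiffOn ℝ 1 (e.fieldCoord v.1.1) (Icc a b) :=
  v.2 _ (e.isFrame_frame he hγ)

/-- The bilinear form `∫ Q((u, u'), (w, w'))` of the coordinates `u`, `w` of vector fields along a
curve. -/
def fieldForm : LinearMap.BilinForm ℝ (H1Fields (n := n) γ P a b hab) :=
  LinearMap.mk₂ ℝ (fun v w => jetForm Q a b (e.fieldCoord v.1) (e.fieldCoord w.1))
    (fun v v' w => by
      rw [← jetForm_add_left hab.le hQ (e.isH1_fieldCoord he hγ v) (e.isH1_fieldCoord he hγ v')
        (e.isH1_fieldCoord he hγ w)]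
      exact jetForm_congr hab.le Q (fun t _ => map_add (e.frame γ t).symm (v.1 t) (v'.1 t))
        fun t _ => rfl)
    (fun c v w => by
      rw [smul_eq_mul, ← jetForm_smul_left hab.le c (e.isH1_fieldCoord he hγ v)]
      exact jetForm_congr hab.le Q (fun t _ => map_smul (e.frame γ t).symm c (v.1 t))
        fun t _ => rfl)
    (fun v w w' => by
      rw [← jetForm_add_right hab.le hQ (e.isH1_fieldCoord he hγ v) (e.isH1_fieldCoord he hγ w)
        (e.isH1_fieldCoord he hγ w')]
      exact jetForm_congr hab.le Q (fun t _ => rfl)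
        fun t _ => map_add (e.frame γ t).symm (w.1 t) (w'.1 t))
    (fun c v w => by
      rw [smul_eq_mul, ← jetForm_smul_right hab.le c (e.isH1_fieldCoord he hγ w)]
      exact jetForm_congr hab.le Q (fun t _ => rfl)
        fun t _ => map_smul (e.frame γ t).symm c (w.1 t))

theorem isBoundedForm_fieldForm :
    IsBoundedForm (e.fieldForm (P := P) (hab := hab) he hQ hγ) := by
  obtain ⟨K, hK⟩ := exists_jetForm_bound hab.le hQ
  exact ⟨_, e.isFrame_frame he hγ, K, fun v w =>
    hK _ _ (e.isH1_fieldCoord he hγ v) (e.isH1_fieldCoord he hγ w)⟩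

end Form
end TimeChart

end

/-! ### Tangent spaces of `P` and of its conormal bundle; symplectic coordinates -/

section
section TangentSpaces

/-- Difference quotients lie in `W`, and finite-dimensional subspaces are closed. Applied twice,
this passes the condition at `P` to the second derivative of a variation. -/
theorem mem_of_hasDerivAt_of_eventually_mem {F : Type*} [NormedAddCommGroup F] [NormedSpace ℝ F]
    [FiniteDimensional ℝ F] {W : Submodule ℝ F} {f : ℝ → F} {f' : F} {t : ℝ}
    (hf : HasDerivAt f f' t) (hW : ∀ᶠ s in 𝓝 t, f s ∈ W) : f' ∈ W := by
  have h1 := hasDerivAt_iff_tendsto_slope.1 hf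
  refine W.closed_of_finiteDimensional.mem_of_tendsto h1 ?_
  filter_upwards [mem_nhdsWithin_of_mem_nhds hW] with s hs
  exact W.smul_mem _ (W.sub_mem hs hW.self_of_nhds)

variable {E₀ : Type*} [NormedAddCommGroup E₀] [NormedSpace ℝ E₀]
  {H₀ : Type*} [TopologicalSpace H₀] {I : ModelWithCorners ℝ E₀ H₀}
  {N : Type*} [TopologicalSpace N] [ChartedSpace H₀ N]

theorem hasDerivAt_comp_velocity {F : Type*} [NormedAddCommGroup F] [NormedSpace ℝ F]
    {f : N → F} {c : ℝ → N} {D : ∀ x, TangentSpace I x →L[ℝ] F} {x : N} {v : TangentSpace I x}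
    {t : ℝ} (hc : MDifferentiableAt 𝓘(ℝ, ℝ) I c t)
    (hv : velocity I c univ t = (⟨x, v⟩ : TangentBundle I N))
    (hf : HasMFDerivAt I 𝓘(ℝ, F) f x (D x)) : HasDerivAt (fun s => f (c s)) (D x v) t := by
  have h0 : c t = x := congrArg Bundle.TotalSpace.proj hv
  subst h0
  have h1 : (mfderivWithin 𝓘(ℝ, ℝ) I c univ t (1 : ℝ)) = v := by
    have := hv
    simp only [velocity] at this
    exact eq_of_heq (Bundle.TotalSpace.mk.inj this).2
  rw [mfderivWithin_univ] at h1
  have h2 := hf.comp t hc.hasMFDerivAt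
  have h3 := hasDerivWithinAt_of_hasMFDerivWithinAt (s := univ) h2.hasMFDerivWithinAt
  rw [hasDerivWithinAt_univ] at h3
  rw [← h1]
  exact h3

theorem velocity_eq_of_hasDerivAt {F : Type*} [NormedAddCommGroup F] [NormedSpace ℝ F]
    {f : N → F} {c : ℝ → N} {D : ∀ x, TangentSpace I x →L[ℝ] F} {x : N} {v : TangentSpace I x}
    {t : ℝ} (hc : MDifferentiableAt 𝓘(ℝ, ℝ) I c t) (h0 : c t = x)
    (hf : HasMFDerivAt I 𝓘(ℝ, F) f x (D x)) (hD : Function.Injective (D x))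
    (hd : HasDerivAt (fun s => f (c s)) (D x v) t) :
    velocity I c univ t = (⟨x, v⟩ : TangentBundle I N) := by
  subst h0
  have h1 := hasDerivAt_comp_velocity (D := D) hc (x := c t) rfl hf
  exact congrArg (fun w => (⟨c t, w⟩ : TangentBundle I N)) (hD (h1.unique hd))

/-- If `f` straightens `S` to `W`, curves in `S` have derivatives in `W`, and conversely the line in
a direction of `W`, carried back by `g`, is a curve in `S` with that velocity. Stated in general,
since it serves for `P` and for its conormal bundle. -/
theorem mem_tangentSpaceOf_iff {F : Type*} [NormedAddCommGroup F] [NormedSpace ℝ F]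
    [FiniteDimensional ℝ F] {f : N → F} {g : F → N} {D : ∀ x, TangentSpace I x →L[ℝ] F} {x : N}
    (hf : HasMFDerivAt I 𝓘(ℝ, F) f x (D x)) (hD : Function.Injective (D x))
    (hg : ContMDiffAt 𝓘(ℝ, F) I ∞ g (f x)) (hgf : g (f x) = x)
    (hfg : ∀ᶠ y in 𝓝 (f x), f (g y) = y) {S : Set N} {W : Submodule ℝ F}
    (hS : ∀ᶠ p in 𝓝 x, p ∈ S ↔ f p ∈ W) (hx : x ∈ S) (v : TangentSpace I x) :
    v ∈ tangentSpaceOf I S x ↔ D x v ∈ W := by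
  constructor
  · intro hv
    have h1 : tangentSpaceOf I S x ≤ W.comap (D x : TangentSpace I x →ₗ[ℝ] F) := by
      refine Submodule.span_le.2 ?_
      rintro v ⟨c, hc, hcS, hcv⟩
      have h0 : c 0 = x := congrArg Bundle.TotalSpace.proj hcv
      have hc' : MDifferentiableAt 𝓘(ℝ, ℝ) I c 0 := hc.mdifferentiableAt (by simp)
      refine mem_of_hasDerivAt_of_eventually_mem (W := W)
        (hasDerivAt_comp_velocity (D := D) hc' hcv hf) ?_
      have h2 : ∀ᶠ s in 𝓝 (0 : ℝ), c s ∈ S ↔ f (c s) ∈ W := by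
        have h3 := hc'.continuousAt
        rw [ContinuousAt, h0] at h3
        exact h3.eventually hS
      filter_upwards [hcS, h2] with s h4 h5 using h5.1 h4
    exact h1 hv
  · intro hv
    refine Submodule.subset_span ?_
    set l : ℝ → F := fun s => f x + s • D x v with hl
    have hl0 : l 0 = f x := by simp [hl]
    have hlc : ContDiff ℝ ∞ l := contDiff_const.add (contDiff_id.smul contDiff_const)
    have hlt : Filter.Tendsto l (𝓝 0) (𝓝 (f x)) := by
      have := hlc.continuous.tendsto 0
      rwa [hl0] at this
    have hc : ContMDiffAt 𝓘(ℝ, ℝ) I ∞ (fun s => g (l s)) 0 := by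
      refine ContMDiffAt.comp (g := g) 0 ?_ hlc.contMDiff.contMDiffAt
      rwa [hl0]
    have hc0 : g (l 0) = x := by rw [hl0, hgf]
    have hflg : (fun s => f (g (l s))) =ᶠ[𝓝 0] l := hlt.eventually hfg
    have hfW : f x ∈ W := hS.self_of_nhds.1 hx
    refine ⟨fun s => g (l s), hc, ?_, ?_⟩
    · have h1 : ∀ᶠ s in 𝓝 (0 : ℝ), g (l s) ∈ S ↔ f (g (l s)) ∈ W := by
        have h2 := hc.continuousAt
        rw [ContinuousAt, hc0] at h2
        exact h2.eventually hS
      filter_upwards [h1, hflg] with s h2 h3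
      rw [h2, h3]
      exact W.add_mem hfW (W.smul_mem _ hv)
    · refine velocity_eq_of_hasDerivAt (D := D) (hc.mdifferentiableAt (by simp)) hc0 hf hD ?_
      refine HasDerivAt.congr_of_eventuallyEq ?_ hflg
      have h1 := ((hasDerivAt_id (0 : ℝ)).smul_const (D x v)).const_add (f x)
      rw [one_smul] at h1
      exact h1

end TangentSpaces

theorem stdSymp_nondegenerate {n : ℕ} {x : Eu n × EuDual n} (h : ∀ y, stdSymp x y = 0) :
    x = 0 := by
  refine Prod.ext (eq_of_forall_dual fun ζ => ?_) ?_
  · simpa [stdSymp] using h (0, ζ)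
  · ext v
    simpa [stdSymp] using h (v, 0)

variable {n : ℕ} {M : Type*} [TopologicalSpace M] [ChartedSpace (Eu n) M] [IsManifold (𝓡 n) ∞ M]

namespace TimeChart
variable (e : TimeChart n M)

theorem coordDeriv_injective {t : ℝ} {m : M} (h : (t, m) ∈ e.source) :
    Function.Injective (e.coordDeriv t m) := (e.coordEquiv h).injective

omit [IsManifold (𝓡 n) ∞ M] in
theorem contMDiffAt_param {t : ℝ} {y : Eu n} (h : (t, y) ∈ e.target) :
    ContMDiffAt 𝓘(ℝ, Eu n) (𝓡 n) ∞ (fun y => e.param (t, y)) y :=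
  ContMDiffAt.comp (g := e.param) y
    (e.contMDiffOn_param.contMDiffAt (e.isOpen_target.mem_nhds h))
    (contDiff_const.prodMk contDiff_id).contMDiff.contMDiffAt

theorem mem_tangentSpaceOf_iff {a : ℝ} {P : Set M} {W : Submodule ℝ (Eu n)}
    (hW : ∀ m, (a, m) ∈ e.source → (m ∈ P ↔ e.coord (a, m) ∈ W)) {m : M} (h : (a, m) ∈ e.source)
    (hm : m ∈ P) (v : TangentSpace (𝓡 n) m) :
    v ∈ tangentSpaceOf (𝓡 n) P m ↔ e.coordDeriv a m v ∈ W := by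
  refine HamiltonianIndex.mem_tangentSpaceOf_iff (f := fun m => e.coord (a, m))
    (g := fun y => e.param (a, y)) (D := e.coordDeriv a) (e.hasMFDerivAt_coord h)
    (e.coordDeriv_injective h) (e.contMDiffAt_param (e.map_source _ h)) (e.left_inv _ h) ?_ ?_ hm v
  · have h1 : ∀ᶠ y in 𝓝 (e.coord (a, m)), (a, y) ∈ e.target :=
      (Continuous.prodMk_right a).continuousAt (e.isOpen_target.mem_nhds (e.map_source _ h))
    filter_upwards [h1] with y hy using e.right_inv _ hy
  · have h1 : ∀ᶠ p in 𝓝 m, (a, p) ∈ e.source :=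
      (Continuous.prodMk_right a).continuousAt (e.isOpen_source.mem_nhds h)
    filter_upwards [h1] with p hp using hW p hp

theorem symm_fderiv_paramIn {m₀ : M} {y : ℝ × Eu n} (hy : y ∈ e.paramDom m₀) (d d' : ℝ × Eu n) :
    fderiv ℝ (fderiv ℝ (e.paramIn m₀)) y d d' = fderiv ℝ (fderiv ℝ (e.paramIn m₀)) y d' d :=
  ((e.contDiffAt_paramIn hy).isSymmSndFDerivAt (by
    rw [minSmoothness_of_isRCLikeNormedField]
    exact WithTop.coe_le_coe.2 (le_top : (2 : ℕ∞) ≤ ⊤))).eq d d'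

theorem hasFDerivAt_phaseIn {m₀ : M} {z : ℝ × (Eu n × EuDual n)} (hz : z ∈ e.phaseDom m₀) :
    HasFDerivAt (e.phaseIn m₀) (fderiv ℝ (e.phaseIn m₀) z) z :=
  (((e.contDiffOn_phaseIn m₀).contDiffAt ((e.isOpen_phaseDom m₀).mem_nhds hz)).differentiableAt
    (by simp)).hasFDerivAt

theorem fderiv_phaseIn_fst {m₀ : M} {z : ℝ × (Eu n × EuDual n)} (hz : z ∈ e.phaseDom m₀)
    (d : ℝ × (Eu n × EuDual n)) : (fderiv ℝ (e.phaseIn m₀) z d).1 =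
      fderiv ℝ (e.coordIn m₀) (z.1, z.2.1) (d.1, d.2.1) := by
  have hsnd : HasFDerivAt (fun w : ℝ × (Eu n × EuDual n) => w.2)
    (ContinuousLinearMap.snd ℝ ℝ (Eu n × EuDual n)) z := hasFDerivAt_snd
  have hp1 : HasFDerivAt (fun w : ℝ × (Eu n × EuDual n) => (w.1, w.2.1)) _ z :=
    hasFDerivAt_fst.prodMk hsnd.fst
  have h2 : HasFDerivAt (fun w : ℝ × (Eu n × EuDual n) => e.coordIn m₀ (w.1, w.2.1)) _ z :=
    HasFDerivAt.comp (g := e.coordIn m₀) z (e.hasFDerivAt_coordIn hz) hp1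
  exact congrArg (fun L : ℝ × (Eu n × EuDual n) →L[ℝ] Eu n => L d)
    ((e.hasFDerivAt_phaseIn hz).fst.unique h2)

/-- The product rule for `η ∘ D_x g`. The term with the second derivative of `g` is symmetric in
spatial directions, which is why the symplectic form does not see it. -/
theorem fderiv_phaseIn_snd {m₀ : M} {z : ℝ × (Eu n × EuDual n)} (hz : z ∈ e.phaseDom m₀)
    (d : ℝ × (Eu n × EuDual n)) (w : Eu n) : (fderiv ℝ (e.phaseIn m₀) z d).2 w =
      d.2.2 (fderiv ℝ (e.paramIn m₀) (z.1, e.coordIn m₀ (z.1, z.2.1)) (0, w)) +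
      z.2.2 (fderiv ℝ (fderiv ℝ (e.paramIn m₀)) (z.1, e.coordIn m₀ (z.1, z.2.1))
        (d.1, (fderiv ℝ (e.phaseIn m₀) z d).1) (0, w)) := by
  have hsnd : HasFDerivAt (fun w : ℝ × (Eu n × EuDual n) => w.2)
    (ContinuousLinearMap.snd ℝ ℝ (Eu n × EuDual n)) z := hasFDerivAt_snd
  have hp1 : HasFDerivAt (fun w : ℝ × (Eu n × EuDual n) => (w.1, w.2.1)) _ z :=
    hasFDerivAt_fst.prodMk hsnd.fst
  have h2 : HasFDerivAt (fun w : ℝ × (Eu n × EuDual n) => e.coordIn m₀ (w.1, w.2.1)) _ z :=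
    HasFDerivAt.comp (g := e.coordIn m₀) z (e.hasFDerivAt_coordIn hz) hp1
  have hy : (z.1, e.coordIn m₀ (z.1, z.2.1)) ∈ e.paramDom m₀ := e.mem_paramDom_coordIn hz
  have hg2 : HasFDerivAt (fderiv ℝ (e.paramIn m₀)) (fderiv ℝ (fderiv ℝ (e.paramIn m₀))
      (z.1, e.coordIn m₀ (z.1, z.2.1))) (z.1, e.coordIn m₀ (z.1, z.2.1)) :=
    (((e.contDiffOn_fderiv_paramIn m₀).contDiffAt
      ((e.isOpen_paramDom m₀).mem_nhds hy)).differentiableAt (by simp)).hasFDerivAt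
  have h3 : HasFDerivAt (fun w : ℝ × (Eu n × EuDual n) => (w.1, e.coordIn m₀ (w.1, w.2.1))) _ z :=
    hasFDerivAt_fst.prodMk h2
  have h4 : HasFDerivAt (fun w : ℝ × (Eu n × EuDual n) =>
      fderiv ℝ (e.paramIn m₀) (w.1, e.coordIn m₀ (w.1, w.2.1))) _ z :=
    HasFDerivAt.comp (g := fderiv ℝ (e.paramIn m₀)) z hg2 h3
  have h5 := hsnd.snd.clm_apply (h4.clm_apply (hasFDerivAt_const ((0, w) : ℝ × Eu n) z))
  have h6 : HasFDerivAt (fun z' : ℝ × (Eu n × EuDual n) => (e.phaseIn m₀ z').2 w) _ z :=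
    (e.hasFDerivAt_phaseIn hz).snd.clm_apply (hasFDerivAt_const w z)
  have h7 := congrArg (fun L : ℝ × (Eu n × EuDual n) →L[ℝ] ℝ => L d) (h6.unique h5)
  rw [e.fderiv_phaseIn_fst hz]
  refine Eq.trans ?_ (h7.trans ?_)
  · simp
  · simp
    ring

/-- Induced coordinates of the cotangent bundle are symplectic. -/
theorem stdSymp_fderiv_phaseIn {m₀ : M} {z : ℝ × (Eu n × EuDual n)} (hz : z ∈ e.phaseDom m₀)
    (d d' : Eu n × EuDual n) :
    stdSymp (fderiv ℝ (e.phaseIn m₀) z (0, d)) (fderiv ℝ (e.phaseIn m₀) z (0, d')) =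
      stdSymp d d' := by
  have hy : (z.1, e.coordIn m₀ (z.1, z.2.1)) ∈ e.paramDom m₀ := e.mem_paramDom_coordIn hz
  have h1 : ∀ d : Eu n × EuDual n, fderiv ℝ (e.paramIn m₀) (z.1, e.coordIn m₀ (z.1, z.2.1))
      (0, (fderiv ℝ (e.phaseIn m₀) z (0, d)).1) = d.1 := fun d => by
    rw [e.fderiv_phaseIn_fst hz]
    exact e.fderiv_paramIn_fderiv_coordIn (z := (z.1, z.2.1)) hz (0, d.1)
  -- At fixed time the second derivatives of `paramIn` occur in two terms of opposite sign and
  -- cancel by symmetry.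
  rw [stdSymp, e.fderiv_phaseIn_snd hz, e.fderiv_phaseIn_snd hz, h1, h1, e.symm_fderiv_paramIn hy,
    stdSymp]
  ring

/-- The differential of the coordinates `phase` at time `t`. -/
def phaseDeriv (t : ℝ) (p : Cot n M) : TangentSpace (ICot n) p →L[ℝ] (Eu n × EuDual n) :=
  mfderiv (ICot n) 𝓘(ℝ, Eu n × EuDual n) (fun p => e.phase (t, p)) p

theorem hasMFDerivAt_phase_chart {t : ℝ} {p p₀ : Cot n M} (h : (t, p.proj) ∈ e.source)
    (hp : p.proj ∈ (chartAt (Eu n) p₀.proj).source) :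
    HasMFDerivAt (ICot n) 𝓘(ℝ, Eu n × EuDual n) (fun p => e.phase (t, p)) p
      (fderiv ℝ (e.phaseIn p₀.proj) (t, extChartAt (ICot n) p₀ p) ∘L
        ContinuousLinearMap.inr ℝ ℝ (Eu n × EuDual n) ∘L chartDeriv (ICot n) p₀ p) := by
  have hsrc : p ∈ (extChartAt (ICot n) p₀).source := mem_cot_source.2 hp
  have hsrc' := hsrc
  rw [extChartAt_source] at hsrc'
  have h1 := (e.hasFDerivAt_phaseIn (e.mem_phaseDom (p₀ := p₀) h hp)).comp
    (extChartAt (ICot n) p₀ p) ((hasFDerivAt_const t _).prodMk (hasFDerivAt_id _))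
  have h2 := h1.hasMFDerivAt.comp p (hasMFDerivAt_extChartAt (I := ICot n) hsrc')
  have h3 := h2.congr_of_eventuallyEq (f₁ := fun p => e.phase (t, p)) (by
    have h4 : ∀ᶠ p' in 𝓝 p, (t, p'.proj) ∈ e.source :=
      (Continuous.prodMk continuous_const continuous_cot_proj).continuousAt
        (e.isOpen_source.mem_nhds h)
    filter_upwards [(isOpen_extChartAt_source (I := ICot n) p₀).mem_nhds hsrc, h4] with m' hm' h5
    exact e.phase_eq (p₀ := p₀) h5 (mem_cot_source.1 hm'))
  exact h3

theorem phaseDeriv_apply {t : ℝ} {p p₀ : Cot n M} (h : (t, p.proj) ∈ e.source)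
    (hp : p.proj ∈ (chartAt (Eu n) p₀.proj).source) (ρ : TangentSpace (ICot n) p) :
    e.phaseDeriv t p ρ = fderiv ℝ (e.phaseIn p₀.proj) (t, extChartAt (ICot n) p₀ p)
      (0, chartDeriv (ICot n) p₀ p ρ) := by
  rw [phaseDeriv, (e.hasMFDerivAt_phase_chart (p₀ := p₀) h hp).mfderiv]
  rfl

theorem hasMFDerivAt_phase {t : ℝ} {p : Cot n M} (h : (t, p.proj) ∈ e.source) :
    HasMFDerivAt (ICot n) 𝓘(ℝ, Eu n × EuDual n) (fun p => e.phase (t, p)) p (e.phaseDeriv t p) :=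
  (e.hasMFDerivAt_phase_chart (p₀ := p) h (mem_chart_source _ _)).mdifferentiableAt.hasMFDerivAt

theorem dchart_eq (p : Cot n M) : dchart p = chartDeriv (ICot n) p p :=
  (hasMFDerivAt_extChartAt (I := ICot n)
    (mem_chart_source (ModelProd (Eu n) (EuDual n)) p)).mfderiv

theorem stdSymp_phaseDeriv {t : ℝ} {p : Cot n M} (h : (t, p.proj) ∈ e.source)
    (ρ ρ' : TangentSpace (ICot n) p) :
    stdSymp (e.phaseDeriv t p ρ) (e.phaseDeriv t p ρ') = omega p ρ ρ' := by
  rw [e.phaseDeriv_apply (p₀ := p) h (mem_chart_source _ _),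
    e.phaseDeriv_apply (p₀ := p) h (mem_chart_source _ _),
    e.stdSymp_fderiv_phaseIn (e.mem_phaseDom (p₀ := p) h (mem_chart_source _ _)), omega, dchart_eq]

/-- A linear map that preserves a nondegenerate form has no kernel. -/
theorem phaseDeriv_injective {t : ℝ} {p : Cot n M} (h : (t, p.proj) ∈ e.source) :
    Function.Injective (e.phaseDeriv t p) := by
  have hsrc := mem_chart_source (ModelProd (Eu n) (EuDual n)) p
  rw [injective_iff_map_eq_zero]
  intro ρ hρ
  have h1 : chartDeriv (ICot n) p p ρ = 0 := by
    refine stdSymp_nondegenerate fun y => ?_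
    have h2 := e.stdSymp_phaseDeriv h ρ (chartDerivSymm (ICot n) p p y)
    rw [hρ, omega, dchart_eq, chartDeriv_chartDerivSymm hsrc] at h2
    rw [← h2]
    simp [stdSymp]
  rw [← chartDerivSymm_chartDeriv (I := ICot n) hsrc ρ, h1, map_zero]

theorem phaseIn_phaseInvIn {m₀ : M} {w : ℝ × (Eu n × EuDual n)} (hw : w ∈ e.phaseInvDom m₀) :
    e.phaseIn m₀ (w.1, e.phaseInvIn m₀ w) = w.2 := by
  have h1 : e.coordIn m₀ (w.1, e.paramIn m₀ (w.1, w.2.1)) = w.2.1 := e.coordIn_paramIn hw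
  refine Prod.ext h1 ?_
  ext v
  simp only [phaseIn, phaseInvIn, h1]
  show w.2.2 (fderiv ℝ (e.coordIn m₀) (w.1, e.paramIn m₀ (w.1, w.2.1))
    (0, fderiv ℝ (e.paramIn m₀) (w.1, w.2.1) (0, v))) = w.2.2 v
  have := e.fderiv_coordIn_fderiv_paramIn hw (0, v)
  simp only at this
  rw [this]

/-- The subspace of `ℝⁿ ⊕ ℝⁿ*` that corresponds to the conormal bundle of a subspace of `ℝⁿ`. -/
def conormalModel (W : Submodule ℝ (Eu n)) : Submodule ℝ (Eu n × EuDual n) where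
  carrier := {z | z.1 ∈ W ∧ ∀ w ∈ W, z.2 w = 0}
  add_mem' := fun hx hy => ⟨W.add_mem hx.1 hy.1, fun w hw => by simp [hx.2 w hw, hy.2 w hw]⟩
  zero_mem' := ⟨W.zero_mem, fun w _ => rfl⟩
  smul_mem' := fun c x hx => ⟨W.smul_mem c hx.1, fun w hw => by simp [hx.2 w hw]⟩

section Conormal

variable {a : ℝ} {P : Set M} {W : Submodule ℝ (Eu n)}
  (hW : ∀ m, (a, m) ∈ e.source → (m ∈ P ↔ e.coord (a, m) ∈ W))
include hW

theorem mem_conormal_iff {p : Cot n M} (h : (a, p.proj) ∈ e.source) :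
    p ∈ conormal P ↔ e.phase (a, p) ∈ conormalModel W := by
  refine ⟨fun ⟨hp, h1⟩ => ⟨(hW _ h).1 hp, fun w hw => ?_⟩,
    fun ⟨hp, h1⟩ => ⟨(hW _ h).2 hp, fun v hv => ?_⟩⟩
  · refine h1 (e.paramDeriv a p.proj w) ?_
    rw [e.mem_tangentSpaceOf_iff hW h hp, e.coordDeriv_paramDeriv h]
    exact hw
  · rw [e.mem_tangentSpaceOf_iff hW h ((hW _ h).2 hp)] at hv
    have h2 := h1 _ hv
    have h3 : p.snd (e.paramDeriv a p.proj (e.coordDeriv a p.proj v)) = (0 : ℝ) := h2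
    rwa [e.paramDeriv_coordDeriv h] at h3

/-- At time `a` the phase coordinates straighten the conormal bundle to `W ⊕ W°`, so the general
description of tangent spaces applies; `phaseInvIn` provides the local inverse. -/
theorem mem_tangentSpaceOf_conormal_iff {p : Cot n M} (h : (a, p.proj) ∈ e.source)
    (hp : p ∈ conormal P) (ρ : TangentSpace (ICot n) p) :
    ρ ∈ tangentSpaceOf (ICot n) (conormal P) p ↔ e.phaseDeriv a p ρ ∈ conormalModel W := by
  have hm := mem_chart_source (Eu n) p.proj
  have hd := e.mem_phaseInvDom h hm
  have hnd : ∀ᶠ y in 𝓝 (e.phase (a, p)), (a, y) ∈ e.phaseInvDom p.proj :=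
    (Continuous.prodMk_right a).continuousAt ((e.isOpen_phaseInvDom p.proj).mem_nhds hd)
  have hκ := e.extChartAt_cot_eq (p₀ := p) h hm
  have hci : ContDiffAt ℝ ∞ (fun y => e.phaseInvIn p.proj (a, y)) (e.phase (a, p)) :=
    ((e.contDiffOn_phaseInvIn p.proj).contDiffAt ((e.isOpen_phaseInvDom p.proj).mem_nhds hd)).comp _
      (contDiff_const.prodMk contDiff_id).contDiffAt
  have htgt₀ : (extChartAt (ICot n) p).target ∈ 𝓝 (e.phaseInvIn p.proj (a, e.phase (a, p))) := by
    rw [← hκ]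
    exact extChartAt_target_mem_nhds p
  have htgt : ∀ᶠ y in 𝓝 (e.phase (a, p)),
      e.phaseInvIn p.proj (a, y) ∈ (extChartAt (ICot n) p).target :=
    hci.continuousAt htgt₀
  refine HamiltonianIndex.mem_tangentSpaceOf_iff (f := fun p => e.phase (a, p))
    (g := fun y => (extChartAt (ICot n) p).symm (e.phaseInvIn p.proj (a, y)))
    (D := e.phaseDeriv a) (e.hasMFDerivAt_phase h) (e.phaseDeriv_injective h) ?_ ?_ ?_ ?_ hp ρ
  · refine ContMDiffAt.comp (g := (extChartAt (ICot n) p).symm) (f := fun y => e.phaseInvIn p.proj (a, y)) _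
      ((contMDiffOn_extChartAt_symm p).contMDiffAt htgt₀) hci.contMDiffAt
  · show (extChartAt (ICot n) p).symm (e.phaseInvIn p.proj (a, e.phase (a, p))) = p
    rw [← hκ]
    exact extChartAt_to_inv p
  · filter_upwards [hnd, htgt] with y hy hyt
    set q := (extChartAt (ICot n) p).symm (e.phaseInvIn p.proj (a, y)) with hq
    have hqs : q.proj ∈ (chartAt (Eu n) p.proj).source :=
      mem_cot_source.1 ((extChartAt (ICot n) p).map_target hyt)
    have hqκ : extChartAt (ICot n) p q = e.phaseInvIn p.proj (a, y) :=
      (extChartAt (ICot n) p).right_inv hyt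
    have hqc : (a, q.proj) ∈ e.source := by
      have h1 : extChartAt (𝓡 n) p.proj q.proj = e.paramIn p.proj (a, y.1) := by
        have := congrArg Prod.fst hqκ
        rwa [extChartAt_cot_apply] at this
      have h2 := (e.mem_coordDom_paramIn hy).2
      simp only at h2
      rw [← h1, (extChartAt (𝓡 n) p.proj).left_inv (by rwa [extChartAt_source])] at h2
      exact h2
    rw [e.phase_eq (p₀ := p) hqc hqs, hqκ]
    exact e.phaseIn_phaseInvIn hy
  · have h4 : ∀ᶠ p' in 𝓝 p, (a, p'.proj) ∈ e.source :=
      (Continuous.prodMk continuous_const continuous_cot_proj).continuousAt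
        (e.isOpen_source.mem_nhds h)
    filter_upwards [h4] with q hq using e.mem_conormal_iff hW hq

end Conormal
end TimeChart

end

/-! ### Variations in coordinates -/

section
variable {n : ℕ} {M : Type*} [TopologicalSpace M] [ChartedSpace (Eu n) M] [IsManifold (𝓡 n) ∞ M]

theorem IsC2Family.continuousOn {E₀ : Type*} [NormedAddCommGroup E₀] [NormedSpace ℝ E₀]
    {H₀ : Type*} [TopologicalSpace H₀] {I : ModelWithCorners ℝ E₀ H₀}
    {N : Type*} [TopologicalSpace N] [ChartedSpace H₀ N] {J K : Set ℝ} {τ : ℝ → ℝ → N}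
    (h : IsC2Family I J K τ) : ContinuousOn (fun z : ℝ × ℝ => τ z.1 z.2) (J ×ˢ K) := by
  rintro ⟨s₀, t₀⟩ ⟨hs₀, ht₀⟩
  obtain ⟨O, hO, hsO, hOJ, W, hW, hWK, h1, -, h3⟩ := h s₀ hs₀ t₀ ht₀
  have h4 := h3 0 (by norm_num)
  simp only [iteratedDeriv_zero] at h4
  have htW : t₀ ∈ W := mem_of_mem_nhdsWithin ht₀ hW
  have hmem : O ×ˢ W ∈ 𝓝[J ×ˢ K] (s₀, t₀) := by
    rw [nhdsWithin_prod_eq]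
    exact Filter.prod_mem_prod (mem_nhdsWithin_of_mem_nhds (hO.mem_nhds hsO)) hW
  have h5 : ContinuousWithinAt (fun z : ℝ × ℝ => (extChartAt I (τ s₀ t₀)).symm
      (extChartAt I (τ s₀ t₀) (τ z.1 z.2))) (O ×ˢ W) (s₀, t₀) :=
    ContinuousAt.comp_continuousWithinAt (g := (extChartAt I (τ s₀ t₀)).symm)
      (f := fun z : ℝ × ℝ => extChartAt I (τ s₀ t₀) (τ z.1 z.2))
      (continuousAt_extChartAt_symm (I := I) (τ s₀ t₀)) (h4 _ ⟨hsO, htW⟩)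
  refine (h5.congr (fun z hz => ?_) ?_).mono_of_mem_nhdsWithin hmem
  · exact ((extChartAt I (τ s₀ t₀)).left_inv (h1 _ hz.1 _ hz.2)).symm
  · exact ((extChartAt I (τ s₀ t₀)).left_inv (h1 _ hsO _ htW)).symm

namespace TimeChart
variable (e : TimeChart n M)

/-- The second derivative of a function `L(t, x, y)` with respect to `(x, y)`. -/
def secondDeriv (L : ℝ × Eu n × Eu n → ℝ) (p : ℝ × Eu n × Eu n) :
    (Eu n × Eu n) →L[ℝ] (Eu n × Eu n) →L[ℝ] ℝ :=
  ((ContinuousLinearMap.compL ℝ (Eu n × Eu n) (ℝ × Eu n × Eu n) ℝ).flip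
    (ContinuousLinearMap.inr ℝ ℝ (Eu n × Eu n))) ∘L
      (fderiv ℝ (fderiv ℝ L) p ∘L ContinuousLinearMap.inr ℝ ℝ (Eu n × Eu n))

/-- The velocity of a family of curves in a time-dependent chart. -/
def pairIn (m₀ : M) (w : ℝ × (Eu n × Eu n)) : Eu n × Eu n :=
  (e.coordIn m₀ (w.1, w.2.1), fderiv ℝ (e.coordIn m₀) (w.1, w.2.1) (1, w.2.2))

/-- The domain of `pairIn`. -/
def pairDom (m₀ : M) : Set (ℝ × (Eu n × Eu n)) := {w | (w.1, w.2.1) ∈ e.coordDom m₀}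

omit [IsManifold (𝓡 n) ∞ M] in
theorem isOpen_pairDom (m₀ : M) : IsOpen (e.pairDom m₀) :=
  (e.isOpen_coordDom m₀).preimage (continuous_fst.prodMk continuous_snd.fst)

theorem contDiffOn_pairIn (m₀ : M) : ContDiffOn ℝ ∞ (e.pairIn m₀) (e.pairDom m₀) := by
  have h0 : ContDiffOn ℝ ∞ (fun w : ℝ × Eu n × Eu n => (w.1, w.2.1)) (e.pairDom m₀) :=
    (contDiff_fst.prodMk contDiff_snd.fst).contDiffOn
  refine ContDiffOn.prodMk ?_ ?_
  · exact (e.contDiffOn_coordIn m₀).comp h0 (fun w hw => hw)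
  · exact ((e.contDiffOn_fderiv_coordIn m₀).comp h0 (fun w hw => hw)).clm_apply
      (contDiffOn_const.prodMk contDiff_snd.snd.contDiffOn)

/-- The coordinates and their time derivatives of a family of curves. -/
def familyCoord (a b : ℝ) (σ : ℝ → ℝ → M) (s t : ℝ) : Eu n × Eu n :=
  (e.coord (t, σ s t), derivWithin (fun τ => e.coord (τ, σ s τ)) (Icc a b) t)

section Variation

variable {H : ℝ × Cot n M → ℝ} {U : Set (ℝ × Cot n M)} {a b ε : ℝ} {γ : ℝ → M} {P : Set M}
  {σ : ℝ → ℝ → M} {v : ∀ t : ℝ, TangentSpace (𝓡 n) (γ t)}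

theorem familyCoord_spec (hab : a < b) {s t : ℝ}
    (h1 : MDifferentiableWithinAt 𝓘(ℝ, ℝ) (𝓡 n) (σ s) (Icc a b) t) (ht : t ∈ Icc a b)
    (h : (t, σ s t) ∈ e.source) :
    HasDerivWithinAt (fun τ => (e.familyCoord a b σ s τ).1) (e.familyCoord a b σ s t).2
      (Icc a b) t ∧
    velocity (𝓡 n) (σ s) (Icc a b) t = e.lift (t, e.familyCoord a b σ s t) := by
  obtain ⟨w, h2, h3⟩ := e.velocity_eq_lift h1 h
  have h4 : (e.familyCoord a b σ s t).2 = w := h2.derivWithin (uniqueDiffOn_Icc hab t ht)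
  refine ⟨?_, ?_⟩
  · rw [h4]
    exact h2
  · rw [h3, ← h4]
    rfl

/-- Joint continuity of the family and compactness of `[a, b]`: nearby curves stay in the domain of
the coordinates for all times. -/
theorem exists_forall_mem_source (hv : IsVariation H U γ P a b ε σ v)
    (he : ∀ t ∈ Icc a b, (t, γ t) ∈ e.source) :
    ∃ δ : ℝ, 0 < δ ∧ δ ≤ ε ∧ ∀ s ∈ Ioo (-δ) δ, ∀ t ∈ Icc a b, (t, σ s t) ∈ e.source := by
  have hc : ContinuousOn (fun z : ℝ × ℝ => σ z.1 z.2) (Ioo (-ε) ε ×ˢ Icc a b) :=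
    (FiberBundle.continuous_proj (Eu n) (TangentSpace (𝓡 n) : M → Type _)).comp_continuousOn
      hv.family_C2.continuousOn
  have h0 : (0 : ℝ) ∈ Ioo (-ε) ε := ⟨neg_lt_zero.2 hv.pos, hv.pos⟩
  have h1 : ∀ᶠ s in 𝓝 (0 : ℝ), ∀ t ∈ Icc a b, t ∈ Icc a b → (t, σ s t) ∈ e.source := by
    refine isCompact_Icc.eventually_forall_of_forall_eventually fun t ht => ?_
    have h2 : ContinuousWithinAt (fun z : ℝ × ℝ => (z.2, σ z.1 z.2)) (Ioo (-ε) ε ×ˢ Icc a b)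
        (0, t) := continuousWithinAt_snd.prodMk (hc _ ⟨h0, ht⟩)
    have h3 := h2.preimage_mem_nhdsWithin (e.isOpen_source.mem_nhds (by
      simp only [hv.zero_eq t ht]; exact he t ht))
    rw [mem_nhdsWithin_iff_eventually] at h3
    have h4 : ∀ᶠ z : ℝ × ℝ in 𝓝 (0, t), z.1 ∈ Ioo (-ε) ε :=
      continuous_fst.continuousAt (isOpen_Ioo.mem_nhds h0)
    filter_upwards [h3, h4] with z h5 h6 h7 using h5 ⟨h6, h7⟩
  obtain ⟨r, hr, h2⟩ := Metric.eventually_nhds_iff.1 h1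
  refine ⟨min r ε, lt_min hr hv.pos, min_le_right _ _, fun s hs t ht => h2 ?_ t ht ht⟩
  rw [Real.dist_eq, sub_zero, abs_lt]
  exact ⟨by linarith [hs.1, min_le_left r ε], by linarith [hs.2, min_le_left r ε]⟩

/-- In a chart of the tangent bundle the velocities are pairs `(q, q')`, and the smooth map `pairIn`
takes them to `(x, x')`. So a `C²` curve of velocities is a `C²` family of coordinates together with
their time derivatives. -/
theorem isC2In_familyCoord (hab : a < b) (hv : IsVariation H U γ P a b ε σ v) {δ : ℝ}
    (hδ : δ ≤ ε) (hsrc : ∀ s ∈ Ioo (-δ) δ, ∀ t ∈ Icc a b, (t, σ s t) ∈ e.source) :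
    IsC2In (e.familyCoord a b σ) (Ioo (-δ) δ) (Icc a b) := by
  refine IsC2In.of_locally fun s₀ hs₀ t₀ ht₀ => ?_
  have hsub : Ioo (-δ) δ ⊆ Ioo (-ε) ε := Ioo_subset_Ioo (neg_le_neg hδ) hδ
  obtain ⟨O, hO, hsO, hOJ, W, hW, hWK, h1, h2, h3⟩ := hv.family_C2 s₀ (hsub hs₀) t₀ ht₀
  set p₀ := velocity (𝓡 n) (σ s₀) (Icc a b) t₀ with hp₀
  refine ⟨O ∩ Ioo (-δ) δ, (hO.inter isOpen_Ioo).mem_nhds ⟨hsO, hs₀⟩, W, hW,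
    mem_of_mem_nhdsWithin ht₀ hW, ?_⟩
  have h4 := (IsC2In.of_iteratedDeriv (z := fun s t => extChartAt (𝓡 n).tangent p₀
    (velocity (𝓡 n) (σ s) (Icc a b) t)) hO h2 h3).mono (inter_subset_left (t := Ioo (-δ) δ))
      (Subset.refl W)
  have hm : ∀ s ∈ O ∩ Ioo (-δ) δ, ∀ t ∈ W, σ s t ∈ (chartAt (Eu n) p₀.proj).source :=
    fun s hs t ht => mem_extChartAt_tangent_source.1 (h1 s hs.1 t ht)
  have hval : ∀ s ∈ O ∩ Ioo (-δ) δ, ∀ t ∈ W, extChartAt (𝓡 n).tangent p₀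
      (velocity (𝓡 n) (σ s) (Icc a b) t) = (extChartAt (𝓡 n) p₀.proj (σ s t),
        chartDeriv (𝓡 n) p₀.proj (σ s t)
          (mfderivWithin 𝓘(ℝ, ℝ) (𝓡 n) (σ s) (Icc a b) t (1 : ℝ))) :=
    fun s hs t ht => extChartAt_tangent_apply (hm s hs t ht) _
  have hO' := hO.inter (isOpen_Ioo (a := -δ) (b := δ))
  have h5 := (h4.comp hO' (e.isOpen_pairDom p₀.proj) (e.contDiffOn_pairIn p₀.proj)
    (fun s hs t ht => by
      rw [hval s hs t ht]
      exact e.mem_coordDom (hsrc s hs.2 t (hWK ht)) (hm s hs t ht))).1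
  refine h5.congr hO' fun s hs t ht => ?_
  have hd : MDifferentiableWithinAt 𝓘(ℝ, ℝ) (𝓡 n) (σ s) (Icc a b) t :=
    (hv.curve_C1 s (hsub hs.2)).mdifferentiableOn (by simp) t (hWK ht)
  rw [hval s hs t ht]
  refine Prod.ext (e.coordIn_apply (hm s hs t ht)).symm ?_
  exact (e.hasDerivWithinAt_coord hd.continuousWithinAt (hm s hs t ht) (hsrc s hs.2 t (hWK ht))
    (hasDerivWithinAt_extChartAt_comp hd (hm s hs t ht))).derivWithin
      (uniqueDiffOn_Icc hab t (hWK ht))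

theorem hasDerivAt_familyCoord_zero (hab : a < b) (hv : IsVariation H U γ P a b ε σ v) {δ : ℝ}
    (hδ : δ ≤ ε) (hδ0 : 0 < δ)
    (hsrc : ∀ s ∈ Ioo (-δ) δ, ∀ t ∈ Icc a b, (t, σ s t) ∈ e.source) {t : ℝ} (ht : t ∈ Icc a b) :
    HasDerivAt (fun s => (e.familyCoord a b σ s t).1) (e.fieldCoord v t) 0 := by
  have h0 : (0 : ℝ) ∈ Ioo (-δ) δ := ⟨neg_lt_zero.2 hδ0, hδ0⟩
  have hs0 := hsrc 0 h0 t ht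
  have h1 := (((e.isC2In_familyCoord hab hv hδ hsrc).contDiffOn isOpen_Ioo ht).contDiffAt
    (isOpen_Ioo.mem_nhds h0)).fst
  have h2 : ContMDiffAt 𝓘(ℝ, ℝ) (𝓡 n) 2 (fun s => e.param (t, (e.familyCoord a b σ s t).1)) 0 :=
    ContMDiffAt.comp (g := fun y => e.param (t, y)) 0
      ((e.contMDiffAt_param (e.map_source _ hs0)).of_le (WithTop.coe_le_coe.2 (le_top : (2 : ℕ∞) ≤ ⊤)))
      h1.contMDiffAt
  -- `velocity` has a default value at points where a curve is not differentiable, so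
  -- differentiability in `s` must be established before the initial velocity can be used.
  have h3 : MDifferentiableAt 𝓘(ℝ, ℝ) (𝓡 n) (fun s => σ s t) 0 := by
    refine (h2.mdifferentiableAt (by simp)).congr_of_eventuallyEq ?_
    filter_upwards [isOpen_Ioo.mem_nhds h0] with s hs
    exact (e.left_inv _ (hsrc s hs t ht)).symm
  have hγ : (t, γ t) ∈ e.source := by rwa [hv.zero_eq t ht] at hs0
  have h4 := hasDerivAt_comp_velocity (D := e.coordDeriv t) h3 (hv.initial_velocity t ht)
    (e.hasMFDerivAt_coord hγ)
  rw [e.fieldCoord_apply hγ]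
  exact h4

end Variation
end TimeChart

end

/-! ### The second variation of the action -/

section
variable {n : ℕ} {M : Type*} [TopologicalSpace M] [ChartedSpace (Eu n) M] [IsManifold (𝓡 n) ∞ M]

namespace TimeChart
variable (e : TimeChart n M)

section SecondVariation

variable {H : ℝ × Cot n M → ℝ} {U : Set (ℝ × Cot n M)} (hU : IsOpen U)
  (hH : ContMDiffOn (𝓘(ℝ, ℝ).prod (ICot n)) 𝓘(ℝ, ℝ) ∞ H U) (hreg : IsHyperRegular H U)
  {a b : ℝ} (hab : a < b) {Γ : ℝ → Cot n M} (hΓ : IsHamiltonianCurve H U a b Γ)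
  (he : ∀ t ∈ Icc a b, (t, (Γ t).proj) ∈ e.source)

/-- The second derivative of the Lagrangian along the projection of a curve in `T*M`. -/
def lagHess (H : ℝ × Cot n M → ℝ) (U : Set (ℝ × Cot n M)) (a b : ℝ) (Γ : ℝ → Cot n M) (t : ℝ) :
    (Eu n × Eu n) →L[ℝ] (Eu n × Eu n) →L[ℝ] ℝ :=
  secondDeriv (e.lag (lagrangian H U)) (t, (e.phase (t, Γ t)).1, e.coordVelocity a b Γ t)

include hU hH hreg

theorem contDiffOn_fderiv_lag : ContDiffOn ℝ ∞ (fderiv ℝ (e.lag (lagrangian H U)))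
    (e.lagSet (fiberDeriv H '' U)) :=
  (e.contDiffOn_lag hU hH hreg).fderiv_of_isOpen (e.isOpen_lagSet hreg.isOpen_image) (by simp)

theorem secondDeriv_lag_symm {p : ℝ × Eu n × Eu n} (hp : p ∈ e.lagSet (fiberDeriv H '' U))
    (d d' : Eu n × Eu n) : secondDeriv (e.lag (lagrangian H U)) p d d' =
      secondDeriv (e.lag (lagrangian H U)) p d' d :=
  (((e.contDiffOn_lag hU hH hreg).contDiffAt
    ((e.isOpen_lagSet hreg.isOpen_image).mem_nhds hp)).isSymmSndFDerivAt (by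
      rw [minSmoothness_of_isRCLikeNormedField]
      exact WithTop.coe_le_coe.2 (le_top : (2 : ℕ∞) ≤ ⊤))).eq _ _

include hab hΓ he

theorem contDiffOn_lagHess : ContDiffOn ℝ ∞ (e.lagHess H U a b Γ) (Icc a b) := by
  have h2 := (e.contDiffOn_fderiv_lag hU hH hreg).fderiv_of_isOpen (m := ∞)
    (e.isOpen_lagSet hreg.isOpen_image) (by simp)
  refine contDiffOn_const.clm_comp (ContDiffOn.clm_comp ?_ contDiffOn_const)
  exact h2.comp (contDiffOn_id.prodMk ((e.contDiffOn_phase hU hH hreg hab hΓ he).fst.prodMk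
    (e.contDiffOn_coordVelocity_infty hU hH hreg hab hΓ he)))
    fun t ht => (e.hasDerivWithinAt_phase hU hH hreg hab hΓ he ht).2.1

theorem lagHess_symm {t : ℝ} (ht : t ∈ Icc a b) (d d' : Eu n × Eu n) :
    e.lagHess H U a b Γ t d d' = e.lagHess H U a b Γ t d' d :=
  e.secondDeriv_lag_symm hU hH hreg (e.hasDerivWithinAt_phase hU hH hreg hab hΓ he ht).2.1 d d'

variable {P : Set M} {W : Submodule ℝ (Eu n)}
  (hW : ∀ m, (a, m) ∈ e.source → (m ∈ P ↔ e.coord (a, m) ∈ W)) (hΓa : Γ a ∈ conormal P)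
include hW hΓa

/-- The first variation of the action vanishes. -/
theorem integral_fderiv_lag_eq_zero {r r' : ℝ → Eu n}
    (hr : ∀ t ∈ Icc a b, HasDerivWithinAt r (r' t) (Icc a b) t)
    (hr' : ContinuousOn r' (Icc a b)) (hra : r a ∈ W) (hrb : r b = 0) :
    ∫ t in a..b, fderiv ℝ (e.lag (lagrangian H U))
      (t, (e.phase (t, Γ t)).1, e.coordVelocity a b Γ t) (0, r t, r' t) = 0 := by
  have hd := fun t (ht : t ∈ Icc a b) => e.hasDerivWithinAt_phase hU hH hreg hab hΓ he ht
  have hL : ContinuousOn (fun t => fderiv ℝ (e.lag (lagrangian H U))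
      (t, (e.phase (t, Γ t)).1, e.coordVelocity a b Γ t)) (Icc a b) :=
    (e.contDiffOn_fderiv_lag hU hH hreg).continuousOn.comp
      (continuousOn_id.prodMk ((e.contDiffOn_phase hU hH hreg hab hΓ he).fst.continuousOn.prodMk
        (e.contDiffOn_coordVelocity_infty hU hH hreg hab hΓ he).continuousOn))
      fun t ht => (hd t ht).2.1
  have hrc : ContinuousOn r (Icc a b) := fun t ht => (hr t ht).continuousWithinAt
  -- By the Euler-Lagrange equations the integrand is the derivative of `ξ(r)`. The boundary terms
  -- vanish because `r(b) = 0` and `ξ(a)` annihilates `W`.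
  have h1 : ∀ t ∈ Icc a b, HasDerivWithinAt (fun t => (e.phase (t, Γ t)).2 (r t))
      (fderiv ℝ (e.lag (lagrangian H U))
        (t, (e.phase (t, Γ t)).1, e.coordVelocity a b Γ t) (0, r t, r' t)) (Icc a b) t := by
    intro t ht
    have h2 := (hd t ht).1.snd
    have h3 : HasDerivWithinAt (fun τ => (e.phase (τ, Γ τ)).2)
        (fderiv ℝ (e.lag (lagrangian H U)) (t, (e.phase (t, Γ t)).1, e.coordVelocity a b Γ t) ∘L
          ContinuousLinearMap.inr ℝ ℝ (Eu n × Eu n) ∘L ContinuousLinearMap.inl ℝ (Eu n) (Eu n))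
        (Icc a b) t := h2
    have h4 := h3.clm_apply (hr t ht)
    convert! h4 using 1
    rw [← (hd t ht).2.2.1]
    simp only [ContinuousLinearMap.comp_apply, ContinuousLinearMap.inl_apply,
      ContinuousLinearMap.inr_apply]
    rw [← map_add]
    congr 1
    simp
  rw [integral_eq_sub_of_hasDerivWithinAt h1
    (hL.clm_apply (continuousOn_const.prodMk (hrc.prodMk hr'))) ⟨hab.le, le_rfl⟩, hrb, map_zero,
    ((e.mem_conormal_iff hW (he a ⟨le_rfl, hab.le⟩)).1 hΓa).2 _ hra, sub_zero]

/-- The second variation of the action. -/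
theorem second_variation {ε : ℝ} {σ : ℝ → ℝ → M}
    {v : ∀ t : ℝ, TangentSpace (𝓡 n) (Γ t).proj}
    (hv : IsVariation H U (fun t => (Γ t).proj) P a b ε σ v) :
    ContDiffAt ℝ 2 (fun s => action H U a b (σ s)) 0 ∧
      iteratedDeriv 2 (fun s => action H U a b (σ s)) 0 =
        jetForm (e.lagHess H U a b Γ) a b (e.fieldCoord v) (e.fieldCoord v) := by
  obtain ⟨δ, hδ0, hδ, hsrc⟩ := e.exists_forall_mem_source hv he
  set J := Ioo (-δ) δ with hJ
  have hJo : IsOpen J := isOpen_Ioo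
  have h0 : (0 : ℝ) ∈ J := ⟨neg_lt_zero.2 hδ0, hδ0⟩
  have hsub : J ⊆ Ioo (-ε) ε := Ioo_subset_Ioo (neg_le_neg hδ) hδ
  set z := e.familyCoord a b σ with hz
  set L := e.lag (lagrangian H U) with hLdef
  have hz2 : IsC2In z J (Icc a b) := e.isC2In_familyCoord hab hv hδ hsrc
  have hdiff : ∀ s ∈ J, ∀ t ∈ Icc a b,
      MDifferentiableWithinAt 𝓘(ℝ, ℝ) (𝓡 n) (σ s) (Icc a b) t := fun s hs t ht =>
    (hv.curve_C1 s (hsub hs)).mdifferentiableOn (by simp) t ht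
  have hspec : ∀ s ∈ J, ∀ t ∈ Icc a b, _ := fun s hs t ht =>
    e.familyCoord_spec hab (hdiff s hs t ht) ht (hsrc s hs t ht)
  have hmem : ∀ s ∈ J, ∀ t ∈ Icc a b, (t, z s t) ∈ e.lagSet (fiberDeriv H '' U) := by
    intro s hs t ht
    refine ⟨e.map_source _ (hsrc s hs t ht), ?_⟩
    have h1 := hv.velocity_mem s (hsub hs) t ht
    rw [(hspec s hs t ht).2] at h1
    exact h1
  have hz0 : ∀ t ∈ Icc a b, z 0 t = ((e.phase (t, Γ t)).1, e.coordVelocity a b Γ t) := by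
    intro t ht
    have h1 : ∀ τ ∈ Icc a b, e.coord (τ, σ 0 τ) = e.coord (τ, (Γ τ).proj) := fun τ hτ => by
      rw [hv.zero_eq τ hτ]
    exact Prod.ext (h1 t ht) (derivWithin_congr h1 (h1 t ht))
  have hact : ∀ s ∈ J, action H U a b (σ s) = ∫ t in a..b, L (t, z s t) := by
    intro s hs
    refine intervalIntegral.integral_congr fun t ht => ?_
    rw [uIcc_of_le hab.le] at ht
    simp only [(hspec s hs t ht).2]
    rfl
  obtain ⟨hL2, hLd⟩ := hz2.comp hJo (e.isOpen_lagSet hreg.isOpen_image)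
    (e.contDiffOn_lag hU hH hreg) hmem
  obtain ⟨h1, h2⟩ := hL2.integral hab.le hJo h0
  have hev : (fun s => action H U a b (σ s)) =ᶠ[𝓝 0] fun s => ∫ t in a..b, L (t, z s t) := by
    filter_upwards [hJo.mem_nhds h0] with s hs using hact s hs
  refine ⟨h1.congr_of_eventuallyEq hev, ?_⟩
  rw [hev.iteratedDeriv_eq, h2]
  -- time derivatives of the derivatives with respect to the parameter
  have hz' : ∀ s ∈ J, ∀ t ∈ Icc a b, HasDerivWithinAt
      (fun t => (deriv (fun s => z s t) s).1) (deriv (fun s => z s t) s).2 (Icc a b) t :=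
    fun s hs t ht => hasDerivWithinAt_deriv_param (x := fun s t => (z s t).1)
      (y := fun s t => (z s t).2) (x' := fun s t => (deriv (fun s => z s t) s).1)
      (y' := fun s t => (deriv (fun s => z s t) s).2) hJo (fun s hs t ht => (hspec s hs t ht).1)
      hz2.cont.snd hz2.cont'.snd (fun s hs t ht => (hz2.hasDerivAt hs ht).fst)
      (fun s hs t ht => (hz2.hasDerivAt hs ht).snd) hs ht
  have hz'' : ∀ s ∈ J, ∀ t ∈ Icc a b, HasDerivWithinAt
      (fun t => (deriv (deriv fun s => z s t) s).1) (deriv (deriv fun s => z s t) s).2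
        (Icc a b) t :=
    fun s hs t ht => hasDerivWithinAt_deriv_param
      (x := fun s t => (deriv (fun s => z s t) s).1)
      (y := fun s t => (deriv (fun s => z s t) s).2)
      (x' := fun s t => (deriv (deriv fun s => z s t) s).1)
      (y' := fun s t => (deriv (deriv fun s => z s t) s).2) hJo hz'
      hz2.cont'.snd hz2.cont''.snd (fun s hs t ht => (hz2.hasDerivAt' hs ht).fst)
      (fun s hs t ht => (hz2.hasDerivAt' hs ht).snd) hs ht
  have hu : ∀ t ∈ Icc a b, (deriv (fun s => z s t) 0).1 = e.fieldCoord v t := fun t ht =>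
    HasDerivAt.unique (hz2.hasDerivAt h0 ht).fst
      (e.hasDerivAt_familyCoord_zero hab hv hδ hδ0 hsrc ht)
  -- the boundary conditions
  have hWa : ∀ s ∈ J, (deriv (fun s => z s a) s).1 ∈ W := fun s hs => by
    refine mem_of_hasDerivAt_of_eventually_mem (hz2.hasDerivAt hs ⟨le_rfl, hab.le⟩).fst ?_
    filter_upwards [hJo.mem_nhds hs] with s hs
    exact (hW _ (hsrc s hs a ⟨le_rfl, hab.le⟩)).1 (hv.left_mem s (hsub hs))
  -- Here the linearity of `P` in the chart is essential: the second derivative still satisfies the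
  -- boundary condition.
  have hWa' : (deriv (deriv fun s => z s a) 0).1 ∈ W := by
    refine mem_of_hasDerivAt_of_eventually_mem (hz2.hasDerivAt' h0 ⟨le_rfl, hab.le⟩).fst ?_
    filter_upwards [hJo.mem_nhds h0] with s hs using hWa s hs
  have hb : ∀ s ∈ J, (deriv (fun s => z s b) s).1 = 0 := fun s hs => by
    refine HasDerivAt.unique (hz2.hasDerivAt hs ⟨hab.le, le_rfl⟩).fst ?_
    refine (hasDerivAt_const s (e.coord (b, (Γ b).proj))).congr_of_eventuallyEq ?_
    filter_upwards [hJo.mem_nhds hs] with s hs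
    show e.coord (b, σ s b) = _
    rw [hv.right_eq s (hsub hs)]
  have hb' : (deriv (deriv fun s => z s b) 0).1 = 0 := by
    refine HasDerivAt.unique (hz2.hasDerivAt' h0 ⟨hab.le, le_rfl⟩).fst ?_
    refine (hasDerivAt_const (0 : ℝ) (0 : Eu n)).congr_of_eventuallyEq ?_
    filter_upwards [hJo.mem_nhds h0] with s hs using hb s hs
  -- The second derivative of the family is an admissible variation field, so the part linear in it
  -- does not contribute.
  have hI2 := e.integral_fderiv_lag_eq_zero hU hH hreg hab hΓ he hW hΓa (hz'' 0 h0)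
    (continuousOn_slice (f := fun s t => (deriv (deriv fun s => z s t) s).2) hz2.cont''.snd h0)
    hWa' hb'
  have hval : ∀ t ∈ Icc a b, deriv (deriv fun s => L (t, z s t)) 0 =
      e.lagHess H U a b Γ t (deriv (fun s => z s t) 0) (deriv (fun s => z s t) 0) +
        fderiv ℝ L (t, (e.phase (t, Γ t)).1, e.coordVelocity a b Γ t)
          (0, (deriv (deriv fun s => z s t) 0).1, (deriv (deriv fun s => z s t) 0).2) := by
    intro t ht
    rw [(hLd 0 h0 t ht).2, hz0 t ht]
    rfl
  have hc1 : ContinuousOn (fun t => e.lagHess H U a b Γ t (deriv (fun s => z s t) 0)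
      (deriv (fun s => z s t) 0)) (Icc a b) := by
    have h3 := continuousOn_slice (f := fun s t => deriv (fun s => z s t) s) hz2.cont' h0
    exact ((e.contDiffOn_lagHess hU hH hreg hab hΓ he).continuousOn.clm_apply h3).clm_apply h3
  have hc2 : ContinuousOn (fun t => deriv (deriv fun s => L (t, z s t)) 0) (Icc a b) :=
    continuousOn_slice (f := fun s t => deriv (deriv fun s => L (t, z s t)) s) hL2.cont'' h0
  have hc3 : ContinuousOn (fun t => fderiv ℝ L (t, (e.phase (t, Γ t)).1, e.coordVelocity a b Γ t)
          (0, (deriv (deriv fun s => z s t) 0).1, (deriv (deriv fun s => z s t) 0).2))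
      (Icc a b) := by
    refine (hc2.sub hc1).congr fun t ht => ?_
    exact eq_sub_of_add_eq' (hval t ht).symm
  have hsplit : ∫ t in a..b, deriv (deriv fun s => L (t, z s t)) 0 =
      (∫ t in a..b, e.lagHess H U a b Γ t (deriv (fun s => z s t) 0) (deriv (fun s => z s t) 0)) +
        ∫ t in a..b, fderiv ℝ L (t, (e.phase (t, Γ t)).1, e.coordVelocity a b Γ t)
          (0, (deriv (deriv fun s => z s t) 0).1, (deriv (deriv fun s => z s t) 0).2) := by
    rw [← intervalIntegral.integral_add (intervalIntegrable_of_continuousOn hab.le hc1)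
      (intervalIntegrable_of_continuousOn hab.le hc3)]
    refine intervalIntegral.integral_congr fun t ht => ?_
    rw [uIcc_of_le hab.le] at ht
    exact hval t ht
  rw [hsplit, hI2, add_zero, jetForm, integral_eq_setIntegral_Icc hab.le,
    integral_eq_setIntegral_Icc hab.le]
  refine integral_congr_ae ?_
  -- `jet` uses the two-sided derivative, which is controlled only in the open interval.
  rw [← Measure.restrict_congr_set (Ioo_ae_eq_Icc (a := a) (b := b))]
  filter_upwards [ae_restrict_mem measurableSet_Ioo] with t ht
  have htc := Ioo_subset_Icc_self ht
  have hjet : deriv (fun s => z s t) 0 = jet (e.fieldCoord v) t := by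
    refine Prod.ext (hu t htc) ?_
    have h3 := (hz' 0 h0 t htc).hasDerivAt (Icc_mem_nhds ht.1 ht.2)
    rw [← h3.deriv]
    refine Filter.EventuallyEq.deriv_eq ?_
    filter_upwards [isOpen_Ioo.mem_nhds ht] with τ hτ using hu τ (Ioo_subset_Icc_self hτ)
  rw [hjet]

end SecondVariation
end TimeChart

end

/-! ### Existence and uniqueness of the Hessian -/

section
variable {n : ℕ} {M : Type*} [TopologicalSpace M] [ChartedSpace (Eu n) M] [IsManifold (𝓡 n) ∞ M]

theorem isC2In_affine {F : Type*} [NormedAddCommGroup F] [NormedSpace ℝ F] {x u : ℝ → F}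
    {J K : Set ℝ} (hJ : IsOpen J) (hx : ContinuousOn x K) (hu : ContinuousOn u K) :
    IsC2In (fun s t => x t + s • u t) J K := by
  have hx' : ContinuousOn (fun p : ℝ × ℝ => x p.2) (J ×ˢ K) :=
    hx.comp continuousOn_snd fun p hp => hp.2
  have hu' : ContinuousOn (fun p : ℝ × ℝ => u p.2) (J ×ˢ K) :=
    hu.comp continuousOn_snd fun p hp => hp.2
  refine (IsC2In.of_hasDerivAt (z' := fun _ t => u t) (z'' := fun _ _ => 0) hJ
    (fun s _ t _ => ?_) (fun s _ t _ => hasDerivAt_const _ _) (hx'.add (continuousOn_fst.smul hu'))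
    hu' continuousOn_const).1
  have h1 := ((hasDerivAt_id s).smul_const (u t)).const_add (x t)
  rw [one_smul] at h1
  exact h1

namespace TimeChart
variable (e : TimeChart n M)

section HessForm

variable {H : ℝ × Cot n M → ℝ} {U : Set (ℝ × Cot n M)} (hU : IsOpen U)
  (hH : ContMDiffOn (𝓘(ℝ, ℝ).prod (ICot n)) 𝓘(ℝ, ℝ) ∞ H U) (hreg : IsHyperRegular H U)
  {a b : ℝ} {hab : a < b} {Γ : ℝ → Cot n M} (hΓ : IsHamiltonianCurve H U a b Γ)
  (he : ∀ t ∈ Icc a b, (t, (Γ t).proj) ∈ e.source)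

/-- The form `∫ D²L((0, v, v'), (0, w, w')) dt` on the space of `H¹` fields. -/
def hessForm (P : Set M) : LinearMap.BilinForm ℝ (H1Fields (n := n) (fun t => (Γ t).proj) P a b hab) :=
  e.fieldForm (hab := hab) (P := P) he
    (e.contDiffOn_lagHess hU hH hreg hab hΓ he).continuousOn
    (e.contMDiffOn_proj hU hH hreg hab hΓ he)

end HessForm

section Existence

variable {H : ℝ × Cot n M → ℝ} {U : Set (ℝ × Cot n M)} (hU : IsOpen U)
  (hH : ContMDiffOn (𝓘(ℝ, ℝ).prod (ICot n)) 𝓘(ℝ, ℝ) ∞ H U) (hreg : IsHyperRegular H U)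
  {a b : ℝ} {hab : a < b} {Γ : ℝ → Cot n M} (hΓ : IsHamiltonianCurve H U a b Γ)
  (he : ∀ t ∈ Icc a b, (t, (Γ t).proj) ∈ e.source)
  {P : Set M} {W : Submodule ℝ (Eu n)}
  (hW : ∀ m, (a, m) ∈ e.source → (m ∈ P ↔ e.coord (a, m) ∈ W)) (hΓa : Γ a ∈ conormal P)
include hU hH hreg hΓ he hW hΓa

/-- Every field of class `C¹` is the initial velocity of a variation. -/
theorem exists_isVariation (v : C1Fields (n := n) (fun t => (Γ t).proj) P a b hab) :
    ∃ (ε : ℝ) (σ : ℝ → ℝ → M), IsVariation H U (fun t => (Γ t).proj) P a b ε σ v.1.1 := by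
  have hγ : ContMDiffOn 𝓘(ℝ, ℝ) (𝓡 n) ∞ (fun t => (Γ t).proj) (Icc a b) :=
    e.contMDiffOn_proj hU hH hreg hab hΓ he
  set x : ℝ → Eu n := fun t => e.coord (t, (Γ t).proj) with hx
  set y : ℝ → Eu n := e.coordVelocity a b Γ with hy
  set u : ℝ → Eu n := e.fieldCoord v.1.1 with hu
  set u' : ℝ → Eu n := derivWithin u (Icc a b) with hu'
  have hxC : ContDiffOn ℝ ∞ x (Icc a b) := e.contDiffOn_coord_comp he hγ
  have hyc : ContinuousOn y (Icc a b) :=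
    (e.contDiffOn_coordVelocity_infty hU hH hreg hab hΓ he).continuousOn
  have huC : ContDiffOn ℝ 1 u (Icc a b) := e.contDiffOn_fieldCoord he hγ v
  have huc' : ContinuousOn u' (Icc a b) :=
    huC.continuousOn_derivWithin (uniqueDiffOn_Icc hab) le_rfl
  have hd := fun t (ht : t ∈ Icc a b) => e.hasDerivWithinAt_phase hU hH hreg hab hΓ he ht
  have hxd : ∀ t ∈ Icc a b, HasDerivWithinAt x (y t) (Icc a b) t := fun t ht => (hd t ht).1.fst
  have hud : ∀ t ∈ Icc a b, HasDerivWithinAt u (u' t) (Icc a b) t := fun t ht =>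
    ((huC.differentiableOn (by simp)) t ht).hasDerivWithinAt
  -- The affine variation in coordinates. It is admissible because `x(a)` and `u(a)` lie in the
  -- linear space `W` and `u(b) = 0`.
  set z : ℝ → ℝ → Eu n × Eu n := fun s t => (x t, y t) + s • (u t, u' t) with hz
  have hz2 : ∀ J : Set ℝ, IsOpen J → IsC2In z J (Icc a b) := fun J hJ =>
    isC2In_affine hJ (hxC.continuousOn.prodMk hyc) (huC.continuousOn.prodMk huc')
  have hzc : ContinuousOn (fun p : ℝ × ℝ => (p.2, z p.1 p.2)) (univ ×ˢ Icc a b) :=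
    continuousOn_snd.prodMk (hz2 univ isOpen_univ).cont
  have hz0 : ∀ t, z 0 t = (x t, y t) := fun t => by simp [hz]
  -- The domain of the Lagrangian is open and `[a, b]` is compact.
  obtain ⟨ε, hε, hmem⟩ : ∃ ε : ℝ, 0 < ε ∧ ∀ s ∈ Ioo (-ε) ε, ∀ t ∈ Icc a b,
      (t, z s t) ∈ e.lagSet (fiberDeriv H '' U) := by
    have h1 : ∀ᶠ s in 𝓝 (0 : ℝ), ∀ t ∈ Icc a b, t ∈ Icc a b →
        (t, z s t) ∈ e.lagSet (fiberDeriv H '' U) := by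
      refine isCompact_Icc.eventually_forall_of_forall_eventually fun t ht => ?_
      have h3 := (hzc (0, t) ⟨mem_univ _, ht⟩).preimage_mem_nhdsWithin
        ((e.isOpen_lagSet hreg.isOpen_image).mem_nhds (by
          simp only [hz0]; exact (hd t ht).2.1))
      rw [mem_nhdsWithin_iff_eventually] at h3
      filter_upwards [h3] with z h5 h7 using h5 ⟨mem_univ _, h7⟩
    obtain ⟨r, hr, h2⟩ := Metric.eventually_nhds_iff.1 h1
    refine ⟨r, hr, fun s hs t ht => h2 ?_ t ht ht⟩
    rw [Real.dist_eq, sub_zero, abs_lt]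
    exact hs
  set σ : ℝ → ℝ → M := fun s t => e.param (t, (z s t).1) with hσ
  have htgt : ∀ s ∈ Ioo (-ε) ε, ∀ t ∈ Icc a b, (t, (z s t).1) ∈ e.target := fun s hs t ht =>
    (hmem s hs t ht).1
  have hsrc : ∀ s ∈ Ioo (-ε) ε, ∀ t ∈ Icc a b, (t, σ s t) ∈ e.source := fun s hs t ht =>
    e.map_target _ (htgt s hs t ht)
  have hcoord : ∀ s ∈ Ioo (-ε) ε, ∀ t ∈ Icc a b, e.coord (t, σ s t) = (z s t).1 :=
    fun s hs t ht => e.right_inv _ (htgt s hs t ht)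
  have hC1 : ∀ s ∈ Ioo (-ε) ε, ContMDiffOn 𝓘(ℝ, ℝ) (𝓡 n) 1 (σ s) (Icc a b) := by
    intro s hs
    have h1 : ContDiffOn ℝ 1 (fun t : ℝ => ((t, (z s t).1) : ℝ × Eu n)) (Icc a b) :=
      contDiffOn_id.prodMk ((hxC.of_le (by exact_mod_cast le_top)).add (huC.const_smul s))
    exact (e.contMDiffOn_param.of_le (by exact_mod_cast le_top)).comp h1.contMDiffOn
      (fun t ht => htgt s hs t ht)
  have hvel : ∀ s ∈ Ioo (-ε) ε, ∀ t ∈ Icc a b,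
      velocity (𝓡 n) (σ s) (Icc a b) t = e.lift (t, z s t) := by
    intro s hs t ht
    obtain ⟨w, h2, h3⟩ := e.velocity_eq_lift
      ((hC1 s hs).mdifferentiableOn (by simp) t ht) (hsrc s hs t ht)
    have h4 : HasDerivWithinAt (fun τ => e.coord (τ, σ s τ)) (z s t).2 (Icc a b) t :=
      ((hxd t ht).add ((hud t ht).const_smul s)).congr_of_mem (hcoord s hs) ht
    rw [h3, hcoord s hs t ht, (uniqueDiffOn_Icc hab t ht).eq_deriv _ h2 h4]
  have h0 : (0 : ℝ) ∈ Ioo (-ε) ε := ⟨neg_lt_zero.2 hε, hε⟩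
  have hσ0 : ∀ t ∈ Icc a b, σ 0 t = (Γ t).proj := fun t ht => by
    simp only [hσ, hz0]
    exact e.left_inv _ (he t ht)
  refine ⟨ε, σ, hε, hC1, fun s hs t ht => ?_, fun s hs => ?_, fun s hs => ?_, ?_, hσ0,
    fun t ht => ?_⟩
  · rw [hvel s hs t ht]
    exact (hmem s hs t ht).2
  · have ha : a ∈ Icc a b := ⟨le_rfl, hab.le⟩
    rw [hW _ (hsrc s hs a ha), hcoord s hs a ha]
    refine W.add_mem ((hW _ (he a ha)).1 hΓa.1) (W.smul_mem s ?_)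
    have h1 := v.1.2.2.2.1
    rw [e.mem_tangentSpaceOf_iff hW (he a ha) hΓa.1] at h1
    rwa [← e.fieldCoord_apply (v := v.1.1) (he a ha)] at h1
  · have hb : b ∈ Icc a b := ⟨hab.le, le_rfl⟩
    have h1 : u b = 0 := by
      have h2 : v.1.1 b = 0 := v.1.2.2.2.2
      rw [hu, fieldCoord, h2, map_zero]
    have h2 : (z s b).1 = x b := by simp [hz, h1]
    show e.param (b, (z s b).1) = (Γ b).proj
    rw [h2]
    exact e.left_inv _ (he b hb)
  · intro s₀ hs₀ t₀ ht₀
    set p₀ := velocity (𝓡 n) (σ s₀) (Icc a b) t₀ with hp₀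
    have hp₀m : p₀.proj = σ s₀ t₀ := rfl
    have h1 : (fun p : ℝ × ℝ => (p.2, z p.1 p.2)) ⁻¹' e.liftDom p₀.proj ∈
        𝓝[univ ×ˢ Icc a b] (s₀, t₀) :=
      (hzc (s₀, t₀) ⟨mem_univ _, ht₀⟩).preimage_mem_nhdsWithin
        ((e.isOpen_liftDom p₀.proj).mem_nhds ⟨htgt s₀ hs₀ t₀ ht₀, mem_chart_source _ _⟩)
    rw [nhdsWithin_prod_eq, nhdsWithin_univ, Filter.mem_prod_iff] at h1
    obtain ⟨O, hO, T, hT, hOT⟩ := h1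
    obtain ⟨O', hO'O, hO', hsO'⟩ := mem_nhds_iff.1 hO
    have hOo : IsOpen (O' ∩ Ioo (-ε) ε) := hO'.inter isOpen_Ioo
    have hdom : ∀ s ∈ O' ∩ Ioo (-ε) ε, ∀ t ∈ T ∩ Icc a b, (t, z s t) ∈ e.liftDom p₀.proj :=
      fun s hs t ht => hOT (show (s, t) ∈ O ×ˢ T from ⟨hO'O hs.1, ht.1⟩)
    have hI := (((hz2 _ hOo).mono Subset.rfl (inter_subset_right (s := T))).comp hOo
      (e.isOpen_liftDom p₀.proj) (e.contDiffOn_liftIn p₀.proj).snd hdom).1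
    have hI' : IsC2In (fun s t => extChartAt (𝓡 n).tangent p₀
        (velocity (𝓡 n) (σ s) (Icc a b) t)) (O' ∩ Ioo (-ε) ε) (T ∩ Icc a b) := by
      refine hI.congr hOo fun s hs t ht => ?_
      rw [hvel s hs.2 t ht.2, e.extChartAt_lift (p₀ := p₀) (w := (t, z s t)) (hdom s hs t ht)]
      rfl
    refine ⟨O' ∩ Ioo (-ε) ε, hOo, ⟨hsO', hs₀⟩, inter_subset_right, T ∩ Icc a b,
      Filter.inter_mem hT self_mem_nhdsWithin, inter_subset_right, fun s hs t ht => ?_,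
      fun t ht => hI'.contDiffOn hOo ht, fun j hj => hI'.continuousOn_iteratedDeriv j hj⟩
    show velocity (𝓡 n) (σ s) (Icc a b) t ∈ _
    rw [hvel s hs.2 t ht.2]
    exact e.lift_mem_source (p₀ := p₀) (w := (t, z s t)) (hdom s hs t ht)
  · have hc : ContMDiffAt 𝓘(ℝ, ℝ) (𝓡 n) ∞ (fun s => σ s t) 0 := by
      refine ContMDiffAt.comp (g := fun y => e.param (t, y)) (f := fun s => (z s t).1) 0
        (e.contMDiffAt_param (htgt 0 h0 t ht)) ?_
      exact (contDiff_const.add (contDiff_id.smul contDiff_const)).contDiffAt.contMDiffAt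
    refine velocity_eq_of_hasDerivAt (D := e.coordDeriv t) (hc.mdifferentiableAt (by simp))
      (hσ0 t ht) (e.hasMFDerivAt_coord (he t ht)) (e.coordDeriv_injective (he t ht)) ?_
    rw [← e.fieldCoord_apply (v := v.1.1) (he t ht)]
    have h1 := ((hasDerivAt_id (0 : ℝ)).smul_const (u t)).const_add (x t)
    rw [one_smul] at h1
    refine h1.congr_of_eventuallyEq ?_
    filter_upwards [isOpen_Ioo.mem_nhds h0] with s hs using hcoord s hs t ht

end Existence

section Hessian

variable {H : ℝ × Cot n M → ℝ} {U : Set (ℝ × Cot n M)} (hU : IsOpen U)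
  (hH : ContMDiffOn (𝓘(ℝ, ℝ).prod (ICot n)) 𝓘(ℝ, ℝ) ∞ H U) (hreg : IsHyperRegular H U)
  {a b : ℝ} {hab : a < b} {Γ : ℝ → Cot n M} (hΓ : IsHamiltonianCurve H U a b Γ)
  (he : ∀ t ∈ Icc a b, (t, (Γ t).proj) ∈ e.source)
  {P : Set M} {W : Submodule ℝ (Eu n)}
  (hW : ∀ m, (a, m) ∈ e.source → (m ∈ P ↔ e.coord (a, m) ∈ W)) (hΓa : Γ a ∈ conormal P)

theorem isSymm_hessForm :
    (e.hessForm (hab := hab) hU hH hreg hΓ he P).IsSymm := by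
  refine ⟨fun v w => ?_⟩
  exact jetForm_symm (fun t ht d d' => e.lagHess_symm hU hH hreg hab hΓ he ht d d') hab.le _ _

include hW hΓa in
theorem isActionHessian_hessForm : IsActionHessian H U (fun t => (Γ t).proj) P a b hab
    ((e.hessForm (hab := hab) hU hH hreg hΓ he P).restrict (C1Fields _ P a b hab)) where
  symm _ _ := (e.isSymm_hessForm hU hH hreg hΓ he).eq _ _
  second_deriv _ _ _ hv := e.second_variation hU hH hreg hab hΓ he hW hΓa hv

-- Every `C¹` field is realised by a variation, so the quadratic form is prescribed; symmetric forms
-- with the same quadratic form are equal by polarization.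
include hU hH hreg hΓ he hW hΓa in
theorem _root_.HamiltonianIndex.IsActionHessian.unique
    {h h' : LinearMap.BilinForm ℝ (C1Fields (n := n) (fun t => (Γ t).proj) P a b hab)}
    (hh : IsActionHessian H U (fun t => (Γ t).proj) P a b hab h)
    (hh' : IsActionHessian H U (fun t => (Γ t).proj) P a b hab h') : h = h' := by
  have h1 : ∀ v, h v v = h' v v := fun v => by
    obtain ⟨ε, σ, hσ⟩ := e.exists_isVariation hU hH hreg hΓ he hW hΓa v
    rw [← (hh.second_deriv v ε σ hσ).2, (hh'.second_deriv v ε σ hσ).2]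
  refine LinearMap.ext₂ fun v w => ?_
  have h2 := h1 (v + w)
  simp only [map_add, LinearMap.add_apply] at h2
  linarith [h1 v, h1 w, hh.symm v w, hh'.symm v w]

end Hessian
end TimeChart

end

/-! ### Linear algebra of the index form -/

section
variable {n : ℕ}

section Symplectic

theorem stdSymp_hasDerivWithinAt {x y : ℝ → Eu n × EuDual n} {x' y' : Eu n × EuDual n}
    {s : Set ℝ} {t : ℝ} (hx : HasDerivWithinAt x x' s t) (hy : HasDerivWithinAt y y' s t) :
    HasDerivWithinAt (fun τ => stdSymp (x τ) (y τ)) (stdSymp x' (y t) + stdSymp (x t) y') s t := by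
  have hx2 : HasDerivWithinAt (fun τ => (x τ).2) x'.2 s t := hx.snd
  have hy2 : HasDerivWithinAt (fun τ => (y τ).2) y'.2 s t := hy.snd
  have hx1 : HasDerivWithinAt (fun τ => (x τ).1) x'.1 s t := hx.fst
  have hy1 : HasDerivWithinAt (fun τ => (y τ).1) y'.1 s t := hy.fst
  have h := (hy2.clm_apply hx1).sub (hx2.clm_apply hy1)
  convert! h using 1
  simp only [stdSymp]
  ring

theorem finrank_euDual : Module.finrank ℝ (EuDual n) = Module.finrank ℝ (Eu n) := by
  rw [← (LinearMap.toContinuousLinearMap : (Eu n →ₗ[ℝ] ℝ) ≃ₗ[ℝ] EuDual n).finrank_eq]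
  exact Subspace.dual_finrank_eq

/-- A linear map that preserves the canonical symplectic form is surjective. -/
theorem surjective_of_stdSymp {f : (Eu n × EuDual n) →L[ℝ] (Eu n × EuDual n)}
    (hf : ∀ x y, stdSymp (f x) (f y) = stdSymp x y) : Function.Surjective f := by
  have h1 : Function.Injective (f : (Eu n × EuDual n) →ₗ[ℝ] (Eu n × EuDual n)) := by
    rw [injective_iff_map_eq_zero]
    intro x hx
    refine stdSymp_nondegenerate fun y => ?_
    have hx' : f x = 0 := hx
    rw [← hf, hx']
    simp [stdSymp]
  exact LinearMap.injective_iff_surjective.1 h1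

/-- `ContinuousLinearMap.inverse` is zero unless the map is invertible; equal finite dimensions make
injectivity sufficient. -/
theorem apply_inverse_of_injective {E F : Type*} [NormedAddCommGroup E] [NormedSpace ℝ E]
    [NormedAddCommGroup F] [NormedSpace ℝ F] [FiniteDimensional ℝ E] [FiniteDimensional ℝ F]
    (h : Module.finrank ℝ E = Module.finrank ℝ F) {B : E →L[ℝ] F} (hB : Function.Injective B)
    (x : F) : B (B.inverse x) = x := by
  have h1 : Function.Surjective (B : E →ₗ[ℝ] F) :=
    (LinearMap.injective_iff_surjective_of_finrank_eq_finrank h).1 hB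
  set L : E ≃L[ℝ] F := (LinearEquiv.ofBijective (B : E →ₗ[ℝ] F) ⟨hB, h1⟩).toContinuousLinearEquiv
  have h2 : B = (L : E →L[ℝ] F) := by
    ext α
    rfl
  rw [h2, ContinuousLinearMap.inverse_equiv]
  exact L.apply_symm_apply x

end Symplectic

/-- A family of linear symplectomorphisms of `ℝⁿ ⊕ ℝⁿ*` that preserve `{0} ⊕ ℝⁿ*`. -/
structure IsSymplecticFamily (G : ℝ → (Eu n × EuDual n) →L[ℝ] (Eu n × EuDual n)) (a b : ℝ) :
    Prop where
  contDiffOn : ContDiffOn ℝ 1 G (Icc a b)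
  symplectic : ∀ t ∈ Icc a b, ∀ x y, stdSymp (G t x) (G t y) = stdSymp x y
  vertical : ∀ t ∈ Icc a b, ∀ x, (G t x).1 = 0 ↔ x.1 = 0

/-- In the symplectic frame `G`, the linear flow `Ψ`, with coefficient matrix `X`, describes the
solutions of the linearized Euler-Lagrange equation of the quadratic Lagrangian `Q`. -/
structure IsJacobiFlow (Q : ℝ → (Eu n × Eu n) →L[ℝ] (Eu n × Eu n) →L[ℝ] ℝ)
    (G Ψ X : ℝ → (Eu n × EuDual n) →L[ℝ] (Eu n × EuDual n)) (a b : ℝ) : Prop where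
  initial : ∀ x, Ψ a x = x
  hasDerivWithinAt : ∀ t ∈ Icc a b, HasDerivWithinAt Ψ (X t ∘L Ψ t) (Icc a b) t
  euler_lagrange : ∀ t ∈ Ioo a b, ∀ (x y' : Eu n × EuDual n),
    HasDerivAt (fun τ => G τ (Ψ τ x)) y' t → ∀ w w' : Eu n,
      Q t ((G t (Ψ t x)).1, y'.1) (w, w') = y'.2 w + (G t (Ψ t x)).2 w'

section JacobiFlow

variable {a b : ℝ} (hab : a < b) {Q : ℝ → (Eu n × Eu n) →L[ℝ] (Eu n × Eu n) →L[ℝ] ℝ}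
  (hQs : ∀ t ∈ Icc a b, ∀ x y, Q t x y = Q t y x)
  {G Ψ X : ℝ → (Eu n × EuDual n) →L[ℝ] (Eu n × EuDual n)}
  (hG : IsSymplecticFamily G a b) (hΨ : IsJacobiFlow Q G Ψ X a b)

theorem blockA_apply (X : (Eu n × EuDual n) →L[ℝ] (Eu n × EuDual n)) (x : Eu n) :
    blockA X x = (X (x, 0)).1 := rfl

theorem blockB_apply (X : (Eu n × EuDual n) →L[ℝ] (Eu n × EuDual n)) (α : EuDual n) :
    blockB X α = (X (0, α)).1 := rfl

theorem blockC_apply (X : (Eu n × EuDual n) →L[ℝ] (Eu n × EuDual n)) (x : Eu n) :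
    blockC X x = (X (x, 0)).2 := rfl

theorem contDiffOn_blockA {k : WithTop ℕ∞} {G : ℝ → (Eu n × EuDual n) →L[ℝ] (Eu n × EuDual n)}
    {s : Set ℝ} (hG : ContDiffOn ℝ k G s) : ContDiffOn ℝ k (fun t => blockA (G t)) s :=
  contDiffOn_const.clm_comp (hG.clm_comp contDiffOn_const)

theorem contDiffOn_blockC {k : WithTop ℕ∞} {G : ℝ → (Eu n × EuDual n) →L[ℝ] (Eu n × EuDual n)}
    {s : Set ℝ} (hG : ContDiffOn ℝ k G s) : ContDiffOn ℝ k (fun t => blockC (G t)) s :=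
  contDiffOn_const.clm_comp (hG.clm_comp contDiffOn_const)

theorem absolutelyContinuous_clm {E F : Type*} [NormedAddCommGroup E] [NormedSpace ℝ E]
    [NormedAddCommGroup F] [NormedSpace ℝ F] {N : ℝ → E →L[ℝ] F} {a b : ℝ} (hab : a ≤ b)
    (hN : ContDiffOn ℝ 1 N (Icc a b)) : AbsolutelyContinuousOnInterval N a b :=
  ContDiffOn.absolutelyContinuousOnInterval (by rwa [uIcc_of_le hab])

theorem hasDerivWithinAt_clm_apply {E F : Type*} [NormedAddCommGroup E] [NormedSpace ℝ E]
    [NormedAddCommGroup F] [NormedSpace ℝ F] {N : ℝ → E →L[ℝ] F} {s : Set ℝ} {t : ℝ} {x : ℝ → E}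
    {x' : E} (hN : ContDiffOn ℝ 1 N s) (ht : t ∈ s) (hx : HasDerivWithinAt x x' s t) :
    HasDerivWithinAt (fun τ => N τ (x τ)) (derivWithin N s t (x t) + N t x') s t :=
  (hN.differentiableOn (by simp) t ht).hasDerivWithinAt.clm_apply hx

theorem apply_eq_add (X : (Eu n × EuDual n) →L[ℝ] (Eu n × EuDual n)) (z : Eu n × EuDual n) :
    X z = X (z.1, 0) + X (0, z.2) := by
  rw [← map_add]
  simp

namespace IsSymplecticFamily
include hG

theorem fst_apply {t : ℝ} (ht : t ∈ Icc a b) (z : Eu n × EuDual n) :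
    (G t z).1 = blockA (G t) z.1 := by
  have h1 := (hG.vertical t ht (0, z.2)).2 rfl
  rw [apply_eq_add, Prod.fst_add, h1, add_zero]
  rfl

/-- `G` is block triangular, and pairing with `G (x, 0)` expresses its lower row by the blocks `A`
and `C` alone. -/
theorem snd_apply {t : ℝ} (ht : t ∈ Icc a b) (z : Eu n × EuDual n) (x : Eu n) :
    (G t z).2 (blockA (G t) x) = z.2 x + blockC (G t) x (blockA (G t) z.1) := by
  have h := hG.symplectic t ht (x, 0) z
  simp only [stdSymp, hG.fst_apply ht] at h
  rw [blockC_apply]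
  simp only [zero_apply, sub_zero] at h
  linarith

theorem injective_blockA {t : ℝ} (ht : t ∈ Icc a b) : Function.Injective (blockA (G t)) := by
  rw [injective_iff_map_eq_zero]
  intro x hx
  exact (hG.vertical t ht (x, 0)).1 hx

theorem surjective_blockA {t : ℝ} (ht : t ∈ Icc a b) : Function.Surjective (blockA (G t)) :=
  LinearMap.injective_iff_surjective.1
    (show Function.Injective (blockA (G t) : Eu n →ₗ[ℝ] Eu n) from hG.injective_blockA ht)

theorem hasDerivWithinAt_apply {t : ℝ} (ht : t ∈ Icc a b) {x : ℝ → Eu n × EuDual n}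
    {x' : Eu n × EuDual n} (hx : HasDerivWithinAt x x' (Icc a b) t) :
    HasDerivWithinAt (fun τ => G τ (x τ)) (derivWithin G (Icc a b) t (x t) + G t x')
      (Icc a b) t :=
  hasDerivWithinAt_clm_apply hG.contDiffOn ht hx

include hab

theorem derivWithin_fst_apply {t : ℝ} (ht : t ∈ Icc a b) (z : Eu n × EuDual n) :
    (derivWithin G (Icc a b) t z).1 = blockA (derivWithin G (Icc a b) t) z.1 := by
  have h1 : HasDerivWithinAt (fun τ => (G τ (0, z.2)).1) (derivWithin G (Icc a b) t (0, z.2)).1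
      (Icc a b) t := by
    have := hG.hasDerivWithinAt_apply ht (hasDerivWithinAt_const t (Icc a b) ((0 : Eu n), z.2))
    rw [map_zero, add_zero] at this
    exact this.fst
  have h2 : HasDerivWithinAt (fun τ => (G τ (0, z.2)).1) 0 (Icc a b) t :=
    (hasDerivWithinAt_const t (Icc a b) (0 : Eu n)).congr_of_mem
      (fun τ hτ => (hG.vertical τ hτ _).2 rfl) ht
  rw [apply_eq_add, Prod.fst_add, (uniqueDiffOn_Icc hab t ht).eq_deriv _ h1 h2, add_zero]
  rfl

theorem stdSymp_derivWithin {t : ℝ} (ht : t ∈ Icc a b) (x y : Eu n × EuDual n) :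
    stdSymp (derivWithin G (Icc a b) t x) (G t y) +
      stdSymp (G t x) (derivWithin G (Icc a b) t y) = 0 := by
  have h1 : ∀ x, HasDerivWithinAt (fun τ => G τ x) (derivWithin G (Icc a b) t x)
      (Icc a b) t := fun x => by
    have := hG.hasDerivWithinAt_apply ht (hasDerivWithinAt_const t (Icc a b) x)
    rwa [map_zero, add_zero] at this
  have h2 := stdSymp_hasDerivWithinAt (h1 x) (h1 y)
  have h3 : HasDerivWithinAt (fun τ => stdSymp (G τ x) (G τ y)) 0 (Icc a b) t :=
    (hasDerivWithinAt_const t (Icc a b) (stdSymp x y)).congr_of_mem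
      (fun τ hτ => hG.symplectic τ hτ x y) ht
  exact (uniqueDiffOn_Icc hab t ht).eq_deriv _ h2 h3

end IsSymplecticFamily

namespace IsJacobiFlow
include hΨ hG hab

omit hab in
theorem hasDerivWithinAt_apply {t : ℝ} (ht : t ∈ Icc a b) (x : Eu n × EuDual n) :
    HasDerivWithinAt (fun τ => G τ (Ψ τ x))
      (derivWithin G (Icc a b) t (Ψ t x) + G t (X t (Ψ t x))) (Icc a b) t := by
  have h1 : HasDerivWithinAt (fun τ => Ψ τ x) (X t (Ψ t x)) (Icc a b) t := by
    have := (hΨ.hasDerivWithinAt t ht).clm_apply (hasDerivWithinAt_const t (Icc a b) x)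
    rwa [map_zero, add_zero] at this
  exact hG.hasDerivWithinAt_apply ht h1

include hQs

/-- Conservation of the Wronskian: by the linearized Euler-Lagrange equation the derivative of the
symplectic product of two solutions is a difference of two values of `Q` with exchanged arguments.
-/
theorem stdSymp_flow {t : ℝ} (ht : t ∈ Icc a b) (x y : Eu n × EuDual n) :
    stdSymp (Ψ t x) (Ψ t y) = stdSymp x y := by
  have hd := fun x t ht => hΨ.hasDerivWithinAt_apply hG (t := t) ht x
  set f : ℝ → ℝ := fun τ => stdSymp (G τ (Ψ τ x)) (G τ (Ψ τ y)) with hf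
  have h1 : ∀ τ ∈ Icc a b, HasDerivWithinAt f _ (Icc a b) τ := fun τ hτ =>
    stdSymp_hasDerivWithinAt (hd x τ hτ) (hd y τ hτ)
  have h2 : ∀ τ ∈ Ioo a b, HasDerivAt f 0 τ := by
    intro τ hτ
    have hn : Icc a b ∈ 𝓝 τ := Icc_mem_nhds hτ.1 hτ.2
    have hτ' := Ioo_subset_Icc_self hτ
    have h3 := (h1 τ hτ').hasDerivAt hn
    refine h3.congr_deriv ?_
    have hx := hΨ.euler_lagrange τ hτ x _ ((hd x τ hτ').hasDerivAt hn) (G τ (Ψ τ y)).1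
      (derivWithin G (Icc a b) τ (Ψ τ y) + G τ (X τ (Ψ τ y))).1
    have hy := hΨ.euler_lagrange τ hτ y _ ((hd y τ hτ').hasDerivAt hn) (G τ (Ψ τ x)).1
      (derivWithin G (Icc a b) τ (Ψ τ x) + G τ (X τ (Ψ τ x))).1
    rw [hQs τ hτ'] at hx
    simp only [stdSymp]
    linarith
  have hcont : ContinuousOn f (Icc a b) := fun τ hτ => (h1 τ hτ).continuousWithinAt
  have hdiff : DifferentiableOn ℝ f (interior (Icc a b)) := fun τ hτ => by
    rw [interior_Icc] at hτ
    exact (h2 τ hτ).differentiableAt.differentiableWithinAt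
  have ha : a ∈ Icc a b := ⟨le_rfl, hab.le⟩
  -- The derivative is known to vanish only in the interior; with continuity up to the endpoints,
  -- `f` is both monotone and antitone.
  have h3 : f t = f a := by
    refine le_antisymm ?_ ?_
    · refine antitoneOn_of_deriv_nonpos (convex_Icc a b) hcont hdiff (fun τ hτ => ?_) ha ht ht.1
      rw [interior_Icc] at hτ
      exact (h2 τ hτ).deriv.le
    · refine monotoneOn_of_deriv_nonneg (convex_Icc a b) hcont hdiff (fun τ hτ => ?_) ha ht ht.1
      rw [interior_Icc] at hτ
      exact (h2 τ hτ).deriv.ge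
  simp only [hf] at h3
  rwa [hG.symplectic t ht, hG.symplectic a ha, hΨ.initial, hΨ.initial] at h3

theorem surjective_flow {t : ℝ} (ht : t ∈ Icc a b) : Function.Surjective (Ψ t) :=
  surjective_of_stdSymp (hΨ.stdSymp_flow hab hQs hG ht)

/-- The derivative of a family of symplectic maps, composed with the inverse, lies in the symplectic
Lie algebra; this yields the symmetry of `B` and `C` and the block `-A*`. -/
theorem stdSymp_coefficient {t : ℝ} (ht : t ∈ Icc a b) (x y : Eu n × EuDual n) :
    stdSymp (X t x) y + stdSymp x (X t y) = 0 := by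
  obtain ⟨x, rfl⟩ := hΨ.surjective_flow hab hQs hG ht x
  obtain ⟨y, rfl⟩ := hΨ.surjective_flow hab hQs hG ht y
  have h1 : ∀ x, HasDerivWithinAt (fun τ => Ψ τ x) (X t (Ψ t x)) (Icc a b) t := fun x => by
    have := (hΨ.hasDerivWithinAt t ht).clm_apply (hasDerivWithinAt_const t (Icc a b) x)
    rwa [map_zero, add_zero] at this
  have h2 := stdSymp_hasDerivWithinAt (h1 x) (h1 y)
  have h3 : HasDerivWithinAt (fun τ => stdSymp (Ψ τ x) (Ψ τ y)) 0 (Icc a b) t :=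
    (hasDerivWithinAt_const t (Icc a b) (stdSymp x y)).congr_of_mem
      (fun τ hτ => hΨ.stdSymp_flow hab hQs hG hτ x y) ht
  exact (uniqueDiffOn_Icc hab t ht).eq_deriv _ h2 h3

/-- As `Ψ t` is surjective, every vector `z` is the value at `t` of a solution, so the linearized
equation becomes a pointwise identity in `z`. -/
theorem form_apply {t : ℝ} (ht : t ∈ Ioo a b) (z : Eu n × EuDual n) (w w' : Eu n) :
    Q t (blockA (G t) z.1, blockA (derivWithin G (Icc a b) t) z.1 + blockA (G t) (X t z).1)
      (w, w') = (derivWithin G (Icc a b) t z).2 w + (G t (X t z)).2 w + (G t z).2 w' := by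
  have ht' := Ioo_subset_Icc_self ht
  obtain ⟨x, rfl⟩ := hΨ.surjective_flow hab hQs hG ht' z
  have h := hΨ.euler_lagrange t ht x _
    ((hΨ.hasDerivWithinAt_apply hG ht' x).hasDerivAt (Icc_mem_nhds ht.1 ht.2)) w w'
  rw [Prod.fst_add, hG.derivWithin_fst_apply hab ht', hG.fst_apply ht', hG.fst_apply ht'] at h
  rw [h]
  simp

/-- Let `B α = 0`. In the linearized equation at `z = (0, α)`, tested with `(0, A_G u)`, the left
side vanishes, while the right side is `α(u)`. -/
theorem injective_blockB {t : ℝ} (ht : t ∈ Ioo a b) : Function.Injective (blockB (X t)) := by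
  have ht' := Ioo_subset_Icc_self ht
  rw [injective_iff_map_eq_zero]
  intro α hα
  ext u
  have h1 := hΨ.form_apply hab hQs hG ht (0, α) 0 (blockA (G t) u)
  have h2 : (X t (0, α)).1 = 0 := hα
  rw [hG.snd_apply ht', h2] at h1
  simpa [← Prod.zero_eq_mk] using h1.symm

/-- The quadratic Lagrangian is, up to a total derivative, the integrand of the index form. -/
theorem form_eq {t : ℝ} (ht : t ∈ Ioo a b) (u u' w w' : Eu n) {α β : EuDual n}
    (hα : α = (blockB (X t)).inverse (u' - blockA (X t) u))
    (hβ : β = (blockB (X t)).inverse (w' - blockA (X t) w)) :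
    Q t (blockA (G t) u, blockA (derivWithin G (Icc a b) t) u + blockA (G t) u')
      (blockA (G t) w, blockA (derivWithin G (Icc a b) t) w + blockA (G t) w') =
    (β (blockB (X t) α) + blockC (X t) u w) +
      ((blockC (derivWithin G (Icc a b) t) w + blockC (G t) w') (blockA (G t) u) +
        blockC (G t) w (blockA (derivWithin G (Icc a b) t) u + blockA (G t) u')) := by
  have ht' := Ioo_subset_Icc_self ht
  have hB := hΨ.injective_blockB hab hQs hG ht
  have hu' : u' = blockA (X t) u + blockB (X t) α := by
    rw [hα, apply_inverse_of_injective finrank_euDual hB]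
    abel
  have hw' : w' = blockA (X t) w + blockB (X t) β := by
    rw [hβ, apply_inverse_of_injective finrank_euDual hB]
    abel
  have hX1 : (X t (u, α)).1 = u' := by
    rw [apply_eq_add, hu']
    rfl
  have hX2 : (X t (w, β)).1 = w' := by
    rw [apply_eq_add, hw']
    rfl
  -- With `u' = A u + B α`, the first arguments of `Q` are those of the solution through `(u, α)`.
  -- The derivative of the symplectic identity for `G` and the infinitesimal symplectic identities
  -- for `X` then remove the terms with `α` that are not in the claim.
  have h1 := hΨ.form_apply hab hQs hG ht (u, α) (blockA (G t) w)
    (blockA (derivWithin G (Icc a b) t) w + blockA (G t) w')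
  rw [hX1] at h1
  have h2 := hG.stdSymp_derivWithin hab ht' (w, 0) (u, α)
  simp only [stdSymp, hG.derivWithin_fst_apply hab ht', hG.fst_apply ht'] at h2
  have h3 := hΨ.stdSymp_coefficient hab hQs hG ht' (0, β) (0, α)
  have h4 := hΨ.stdSymp_coefficient hab hQs hG ht' (w, 0) (u, α)
  have h5 := hΨ.stdSymp_coefficient hab hQs hG ht' (w, 0) (u, 0)
  rw [hG.snd_apply ht', hX1] at h1
  have h6 := hG.snd_apply ht' (u, α) w'
  have h7 : α w' = α (blockA (X t) w) + α (blockB (X t) β) := by rw [← map_add, ← hw']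
  simp only [stdSymp, map_zero, zero_apply, sub_zero, zero_sub] at h3 h4 h5
  simp only [map_add, add_apply, blockA_apply, blockB_apply, blockC_apply] at *
  linarith

-- A pair `(u, α)` belongs to `ℓ₀` only if its momentum in the coordinates vanishes on `W`, that is
-- `α(w) + C_G(w)(A_G u) = 0` whenever `A_G w ∈ W`. So `-α(w)` does not depend on the chosen `α`.
omit hab hG hΨ hQs in
theorem formOf_eq {l₀ : Submodule ℝ (Eu n × EuDual n)} {W : Submodule ℝ (Eu n)} {a b : ℝ}
    (hG : IsSymplecticFamily G a b) (ha : a ∈ Icc a b)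
    (hl₀ : ∀ z, z ∈ l₀ ↔ G a z ∈ TimeChart.conormalModel W) {u w : Eu n}
    (hu : blockA (G a) u ∈ W) (hw : blockA (G a) w ∈ W) :
    formOf l₀ u w = blockC (G a) w (blockA (G a) u) := by
  have h : ∃ α : EuDual n, (u, α) ∈ l₀ := by
    -- This `α` makes the momentum of `G a (u, α)` zero.
    refine ⟨-((blockC (G a)).flip (blockA (G a) u)), (hl₀ _).2 ⟨?_, fun y _ => ?_⟩⟩
    · rwa [hG.fst_apply ha]
    · obtain ⟨x, rfl⟩ := hG.surjective_blockA ha y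
      rw [hG.snd_apply ha]
      simp
  rw [formOf, dif_pos h]
  have h1 := ((hl₀ _).1 h.choose_spec).2 _ hw
  rw [hG.snd_apply ha] at h1
  linarith

/-- The second variation, in the coordinates given by a symplectic frame, is the index form. -/
theorem jetForm_eq_pairIndexForm (hQ : ContinuousOn Q (Icc a b))
    {l₀ : Submodule ℝ (Eu n × EuDual n)} {W : Submodule ℝ (Eu n)}
    (hl₀ : ∀ z, z ∈ l₀ ↔ G a z ∈ TimeChart.conormalModel W) {u w : ℝ → Eu n}
    (hu : IsH1 a b u) (hw : IsH1 a b w) (hua : blockA (G a) (u a) ∈ W)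
    (hwa : blockA (G a) (w a) ∈ W) (hwb : w b = 0) :
    jetForm Q a b (fun t => blockA (G t) (u t)) (fun t => blockA (G t) (w t)) =
      pairIndexForm X l₀ a b u w := by
  have hZ := contDiffOn_blockA hG.contDiffOn
  -- The function whose derivative is the difference of the two integrands. It is absolutely
  -- continuous, so its derivative integrates to `r(b) - r(a)`; here `r(b) = 0` and `r(a)` is the
  -- boundary term `S`.
  set r : ℝ → ℝ := fun t => blockC (G t) (w t) (blockA (G t) (u t)) with hr
  have hrac : AbsolutelyContinuousOnInterval r a b :=
    absolutelyContinuous_bilin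
      (absolutelyContinuous_clm hab.le (contDiffOn_blockC hG.contDiffOn))
      hw.1 (isH1_clm_apply hab hZ hu).1
  have hri : IntegrableOn (deriv r) (Icc a b) := by
    have := hrac.intervalIntegrable_deriv
    rwa [intervalIntegrable_iff_integrableOn_Icc_of_le hab.le] at this
  have hri2 : ∫ t in Icc a b, deriv r t = r b - r a := by
    rw [← integral_eq_setIntegral_Icc hab.le, hrac.integral_deriv_eq_sub]
  have hrb : r b = 0 := by simp [hr, hwb]
  have hS := formOf_eq hG ⟨le_rfl, hab.le⟩ hl₀ hua hwa
  rw [jetForm, pairIndexForm, hS, integral_eq_setIntegral_Icc hab.le,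
    integral_eq_setIntegral_Icc hab.le]
  have key : ∀ᵐ t ∂(volume.restrict (Icc a b)),
      alphaOf X w t (blockB (X t) (alphaOf X u t)) + blockC (X t) (u t) (w t) =
      Q t (jet (fun t => blockA (G t) (u t)) t) (jet (fun t => blockA (G t) (w t)) t)
        - deriv r t := by
    have h0 : ∀ᵐ t ∂(volume.restrict (Icc a b)), t ∈ Ioo a b := by
      rw [← Measure.restrict_congr_set (Ioo_ae_eq_Icc (a := a) (b := b))]
      exact ae_restrict_mem measurableSet_Ioo
    filter_upwards [h0, ae_differentiableAt_of_ac hab.le hu.1, ae_differentiableAt_of_ac hab.le hw.1]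
      with t ht hut hwt
    have hn : Icc a b ∈ 𝓝 t := Icc_mem_nhds ht.1 ht.2
    have ht' := Ioo_subset_Icc_self ht
    have hGu : ∀ {u : ℝ → Eu n}, DifferentiableAt ℝ u t → HasDerivAt (fun τ => G τ (u τ, 0))
        (derivWithin G (Icc a b) t (u t, 0) + G t (deriv u t, 0)) t := fun hu =>
      (hG.hasDerivWithinAt_apply ht' (hu.hasDerivAt.prodMk
        (hasDerivAt_const t (0 : EuDual n))).hasDerivWithinAt).hasDerivAt hn
    have hAu : HasDerivAt (fun τ => blockA (G τ) (u τ)) (blockA (derivWithin G (Icc a b) t) (u t)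
      + blockA (G t) (deriv u t)) t := (hGu hut).fst
    have hAw : HasDerivAt (fun τ => blockA (G τ) (w τ)) (blockA (derivWithin G (Icc a b) t) (w t)
      + blockA (G t) (deriv w t)) t := (hGu hwt).fst
    have hCw : HasDerivAt (fun τ => blockC (G τ) (w τ)) (blockC (derivWithin G (Icc a b) t) (w t)
      + blockC (G t) (deriv w t)) t := (hGu hwt).snd
    have hrd : HasDerivAt r _ t := hCw.clm_apply hAu
    have h2 := hΨ.form_eq hab hQs hG ht (u t) (deriv u t) (w t) (deriv w t)
      (α := alphaOf X u t) (β := alphaOf X w t) rfl rfl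
    rw [hrd.deriv, jet, jet, hAu.deriv, hAw.deriv, h2]
    ring
  have hint := integral_congr_ae key
  rw [integral_sub (integrable_form hab.le hQ (isH1_clm_apply hab hZ hu)
    (isH1_clm_apply hab hZ hw)) hri, hri2, hrb] at hint
  rw [hint]
  simp only [hr]
  ring

end IsJacobiFlow
end JacobiFlow

end

/-! ### The symplectic trivialization and the Hamiltonian flow in coordinates -/

section
variable {n : ℕ} {M : Type*} [TopologicalSpace M] [ChartedSpace (Eu n) M] [IsManifold (𝓡 n) ∞ M]

section Line

variable {E₀ : Type*} [NormedAddCommGroup E₀] [NormedSpace ℝ E₀]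
  {N : Type*} [TopologicalSpace N] {H₀ : Type*} [TopologicalSpace H₀]
  {I : ModelWithCorners ℝ E₀ H₀} [I.Boundaryless] [ChartedSpace H₀ N] [IsManifold I ∞ N]
  [IsManifold I 1 N]

/-- The curve through `x` that is a line with velocity `ρ` in the chart at `x`. -/
def chartLine (I : ModelWithCorners ℝ E₀ H₀) [IsManifold I 1 N] (x : N) (ρ : TangentSpace I x)
    (s : ℝ) : N :=
  (extChartAt I x).symm (extChartAt I x x + s • chartDeriv I x x ρ)

omit [I.Boundaryless] [IsManifold I ∞ N] in
theorem chartLine_zero (x : N) (ρ : TangentSpace I x) : chartLine I x ρ 0 = x := by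
  rw [chartLine, zero_smul, add_zero]
  exact extChartAt_to_inv x

omit [IsManifold I 1 N] in
theorem contDiff_line (x δ : E₀) : ContDiff ℝ ∞ fun s : ℝ => x + s • δ :=
  contDiff_const.add (contDiff_id.smul contDiff_const)

theorem mdifferentiableAt_chartLine (x : N) (ρ : TangentSpace I x) :
    MDifferentiableAt 𝓘(ℝ, ℝ) I (chartLine I x ρ) 0 := by
  refine (ContMDiffAt.comp (n := ∞) (g := (extChartAt I x).symm)
    (f := fun s : ℝ => extChartAt I x x + s • chartDeriv I x x ρ) 0 ?_
      (contDiff_line _ _).contMDiff.contMDiffAt).mdifferentiableAt (by simp)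
  rw [zero_smul, add_zero]
  exact (contMDiffOn_extChartAt_symm x).contMDiffAt (extChartAt_target_mem_nhds x)

theorem velocity_chartLine (x : N) (ρ : TangentSpace I x) :
    velocity I (chartLine I x ρ) univ 0 = (⟨x, ρ⟩ : TangentBundle I N) := by
  have hm := mem_chart_source H₀ x
  have hinj : Function.Injective (chartDeriv I x x) := fun v w hvw => by
    rw [← chartDerivSymm_chartDeriv (I := I) hm v, hvw, chartDerivSymm_chartDeriv hm]
  refine velocity_eq_of_hasDerivAt (D := chartDeriv I x) (mdifferentiableAt_chartLine x ρ)
    (chartLine_zero x ρ) (hasMFDerivAt_extChartAt (I := I) hm) hinj ?_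
  have h1 := ((hasDerivAt_id (0 : ℝ)).smul_const (chartDeriv I x x ρ)).const_add (extChartAt I x x)
  rw [one_smul] at h1
  refine h1.congr_of_eventuallyEq ?_
  have h2 : ∀ᶠ s in 𝓝 (0 : ℝ), extChartAt I x x + s • chartDeriv I x x ρ ∈
      (extChartAt I x).target := by
    have h3 := (contDiff_line (extChartAt I x x) (chartDeriv I x x ρ)).continuous.continuousAt
      (x := (0 : ℝ))
    rw [ContinuousAt, zero_smul, add_zero] at h3
    exact h3 (extChartAt_target_mem_nhds x)
  filter_upwards [h2] with s hs using (extChartAt I x).right_inv hs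

end Line

namespace TimeChart
variable (e : TimeChart n M)

theorem fst_phaseDeriv {t : ℝ} {p : Cot n M} (h : (t, p.proj) ∈ e.source)
    (ρ : TangentSpace (ICot n) p) :
    (e.phaseDeriv t p ρ).1 = e.coordDeriv t p.proj (dproj p ρ) := by
  have hproj : MDifferentiableAt (ICot n) (𝓡 n) (fun m : Cot n M => m.proj) p :=
    (Bundle.contMDiff_proj (n := ∞) (IB := 𝓡 n) (F := EuDual n)
      (fun x : M => TangentSpace (𝓡 n) x →L[ℝ] Bundle.Trivial M ℝ x)).mdifferentiableAt (by simp)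
  have h1 := (e.hasMFDerivAt_coord h).comp p hproj.hasMFDerivAt
  have h2 := (ContinuousLinearMap.fst ℝ (Eu n) (EuDual n)).hasMFDerivAt.comp p
    (e.hasMFDerivAt_phase h)
  exact congrArg (fun L : TangentSpace (ICot n) p →L[ℝ] Eu n => L ρ) (hasMFDerivAt_unique h2 h1)

section Trivialization

variable {a b : ℝ} {Γ : ℝ → Cot n M} (he : ∀ t ∈ Icc a b, (t, (Γ t).proj) ∈ e.source)
  {φ : ∀ t : ℝ, (Eu n × EuDual n) ≃L[ℝ] TangentSpace (ICot n) (Γ t)}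
  (hφ : IsSymplecticTrivialization Γ a b φ)

/-- The trivialization `φ`, in the coordinates `phase`. -/
def trivIn (φ : ∀ t : ℝ, (Eu n × EuDual n) ≃L[ℝ] TangentSpace (ICot n) (Γ t)) (t : ℝ) :
    (Eu n × EuDual n) →L[ℝ] (Eu n × EuDual n) :=
  e.phaseDeriv t (Γ t) ∘L (φ t : (Eu n × EuDual n) →L[ℝ] TangentSpace (ICot n) (Γ t))

theorem trivIn_apply (t : ℝ) (x : Eu n × EuDual n) :
    e.trivIn φ t x = e.phaseDeriv t (Γ t) (φ t x) := rfl

include he hφ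

theorem contDiffWithinAt_trivIn_apply {t : ℝ} (ht : t ∈ Icc a b) (x : Eu n × EuDual n) :
    ContDiffWithinAt ℝ ∞ (fun τ => e.trivIn φ τ x) (Icc a b) t := by
  set p₀ := Γ t with hp₀
  obtain ⟨hΓ, hρ⟩ := contMDiffWithinAt_field_iff.1 (hφ.smooth x t ht)
  have hκ : ContDiffWithinAt ℝ ∞ (fun τ => extChartAt (ICot n) p₀ (Γ τ)) (Icc a b) t := by
    rw [← contMDiffWithinAt_iff_contDiffWithinAt]
    exact ContMDiffAt.comp_contMDiffWithinAt (g := extChartAt (ICot n) p₀) t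
      (contMDiffAt_extChartAt (I := ICot n) (x := p₀)) hΓ
  have hdom := e.mem_phaseDom (p₀ := p₀) (he t ht) (mem_chart_source _ _)
  have hD : ContDiffAt ℝ ∞ (fderiv ℝ (e.phaseIn p₀.proj)) (t, extChartAt (ICot n) p₀ (Γ t)) :=
    ((e.contDiffOn_phaseIn p₀.proj).fderiv_of_isOpen (e.isOpen_phaseDom p₀.proj)
      (by simp)).contDiffAt ((e.isOpen_phaseDom p₀.proj).mem_nhds hdom)
  have h1 : ContDiffWithinAt ℝ ∞ (fun τ => fderiv ℝ (e.phaseIn p₀.proj)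
      (τ, extChartAt (ICot n) p₀ (Γ τ)) (0, chartDeriv (ICot n) p₀ (Γ τ) (φ τ x)))
      (Icc a b) t := by
    refine ContDiffWithinAt.clm_apply ?_ (contDiffWithinAt_const.prodMk hρ)
    exact ContDiffAt.comp_contDiffWithinAt (g := fderiv ℝ (e.phaseIn p₀.proj))
      (f := fun τ => (τ, extChartAt (ICot n) p₀ (Γ τ))) t hD (contDiffWithinAt_id.prodMk hκ)
  refine h1.congr_of_eventuallyEq_of_mem ?_ ht
  filter_upwards [self_mem_nhdsWithin, hΓ.continuousWithinAt.preimage_mem_nhdsWithin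
    ((isOpen_extChartAt_source (I := ICot n) p₀).mem_nhds (mem_extChartAt_source p₀))] with τ h2 h3
  exact e.phaseDeriv_apply (p₀ := p₀) (he τ h2) (mem_cot_source.1 h3) (φ τ x)

/-- Phase coordinates are symplectic and their first component covers the coordinates of `M`, so the
properties of `φ` carry over. -/
theorem isSymplecticFamily_trivIn : IsSymplecticFamily (e.trivIn φ) a b where
  contDiffOn t ht := (contDiffWithinAt_clm_of_apply
    fun x => e.contDiffWithinAt_trivIn_apply he hφ ht x).of_le (by exact_mod_cast le_top)
  symplectic t ht x y := by
    rw [trivIn_apply, trivIn_apply, e.stdSymp_phaseDeriv (he t ht), hφ.symplectic t ht]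
  vertical t ht x := by
    rw [trivIn_apply, e.fst_phaseDeriv (he t ht), ← hφ.vertical t ht]
    exact map_eq_zero_iff _ (e.coordDeriv_injective (he t ht))

omit hφ in
theorem coordDeriv_quotTriv {t : ℝ} (ht : t ∈ Icc a b) (x : Eu n) :
    e.coordDeriv t (Γ t).proj (quotTriv Γ φ t x) = blockA (e.trivIn φ t) x := by
  rw [blockA_apply, trivIn_apply, e.fst_phaseDeriv (he t ht)]
  rfl

end Trivialization

section Flow

variable {H : ℝ × Cot n M → ℝ} {U : Set (ℝ × Cot n M)} (hU : IsOpen U)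
  (hH : ContMDiffOn (𝓘(ℝ, ℝ).prod (ICot n)) 𝓘(ℝ, ℝ) ∞ H U) (hreg : IsHyperRegular H U)
  {a b : ℝ} (hab : a < b) {Γ : ℝ → Cot n M} (hΓ : IsHamiltonianCurve H U a b Γ)
  (he : ∀ t ∈ Icc a b, (t, (Γ t).proj) ∈ e.source)
  {φ : ∀ t : ℝ, (Eu n × EuDual n) ≃L[ℝ] TangentSpace (ICot n) (Γ t)}
  {F : ℝ → Cot n M → Cot n M} {Ψ : ℝ → (Eu n × EuDual n) →L[ℝ] (Eu n × EuDual n)}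
  (hF : IsHamiltonianFlow H U a b (Γ a) F)
  (hΨ : ∀ t ∈ Icc a b, ∀ x, (⟨Γ t, φ t (Ψ t x)⟩ : TangentBundle (ICot n) (Cot n M)) =
    tangentMap (ICot n) (ICot n) (F t) ⟨Γ a, φ a x⟩)

/-- The flow `F`, from the chart at `p₀` to the coordinates `phase`. -/
def flowIn (F : ℝ → Cot n M → Cot n M) (p₀ : Cot n M) (z : ℝ × (Eu n × EuDual n)) :
    Eu n × EuDual n :=
  e.phase (z.1, F z.1 ((extChartAt (ICot n) p₀).symm z.2))

include hF

omit e hF in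
theorem mdifferentiableAt_flow (hF : IsHamiltonianFlow H U a b (Γ a) F) {t : ℝ}
    (ht : t ∈ Icc a b) : MDifferentiableAt (ICot n) (ICot n) (F t) (Γ a) := by
  obtain ⟨O, hO, hmem, hsm, -⟩ := hF
  have h1 : ContMDiffOn (ICot n) (ICot n) ∞ (F t) O :=
    ContMDiffOn.comp (g := fun z : ℝ × Cot n M => F z.1 z.2) (f := fun m : Cot n M => (t, m)) hsm
      (contMDiffOn_const.prodMk contMDiffOn_id) fun m hm => ⟨ht, hm⟩
  exact (h1.contMDiffAt (hO.mem_nhds hmem)).mdifferentiableAt (by simp)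

include hΨ he

/-- The vector `φ a x` is the velocity of a line in the chart at `Γ a`; thus `G Ψ x` is a
directional derivative, in the initial point, of the flow read in coordinates. -/
theorem hasDerivAt_flowIn_line {t : ℝ} (ht : t ∈ Icc a b) (x : Eu n × EuDual n) :
    HasDerivAt (fun s : ℝ => e.flowIn F (Γ a) (t, extChartAt (ICot n) (Γ a) (Γ a) +
      s • chartDeriv (ICot n) (Γ a) (Γ a) (φ a x))) (e.trivIn φ t (Ψ t x)) 0 := by
  set c := chartLine (ICot n) (Γ a) (φ a x) with hc
  have hcs : MDifferentiableAt 𝓘(ℝ, ℝ) (ICot n) c 0 := mdifferentiableAt_chartLine _ _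
  have hcv : velocity (ICot n) c univ 0 = (⟨Γ a, φ a x⟩ : TangentBundle (ICot n) (Cot n M)) :=
    velocity_chartLine _ _
  have hc0 : c 0 = Γ a := chartLine_zero _ _
  have hFt := mdifferentiableAt_flow (Γ := Γ) hF ht
  have hFt' : MDifferentiableAt (ICot n) (ICot n) (F t) (c 0) := by rwa [hc0]
  have hv : velocity (ICot n) (fun s => F t (c s)) univ 0 =
      (⟨Γ t, φ t (Ψ t x)⟩ : TangentBundle (ICot n) (Cot n M)) := by
    rw [hΨ t ht x, ← hcv]
    have h1 := mfderiv_comp (0 : ℝ) hFt' hcs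
    refine congrArg (fun w => (⟨F t (c 0), w⟩ : TangentBundle (ICot n) (Cot n M))) ?_
    rw [mfderivWithin_univ, velocity, mfderivWithin_univ]
    exact congrArg (fun L => L (1 : ℝ)) h1
  exact hasDerivAt_comp_velocity (f := fun p => e.phase (t, p)) (D := e.phaseDeriv t)
    (hFt'.comp (0 : ℝ) hcs) hv (e.hasMFDerivAt_phase (he t ht))

omit e he hF in
theorem flow_apply {t : ℝ} (ht : t ∈ Icc a b) : F t (Γ a) = Γ t :=
  (congrArg Bundle.TotalSpace.proj (hΨ t ht 0)).symm

include hab in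
theorem flow_initial (x : Eu n × EuDual n) : Ψ a x = x := by
  have ha : a ∈ Icc a b := ⟨le_rfl, hab.le⟩
  have h1 := e.hasDerivAt_flowIn_line he hF hΨ ha x
  have h2 := hasDerivAt_comp_velocity (f := fun p => e.phase (a, p)) (D := e.phaseDeriv a)
    (mdifferentiableAt_chartLine (I := ICot n) (Γ a) (φ a x)) (velocity_chartLine _ _)
    (e.hasMFDerivAt_phase (he a ha))
  refine (e.phaseDeriv_injective (he a ha)).comp (φ a).injective (h1.unique ?_)
  refine h2.congr_of_eventuallyEq ?_
  obtain ⟨O, hO, hmem, -, hFO⟩ := hF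
  have h3 : ∀ᶠ s in 𝓝 (0 : ℝ), chartLine (ICot n) (Γ a) (φ a x) s ∈ O := by
    have h4 := (mdifferentiableAt_chartLine (I := ICot n) (Γ a) (φ a x)).continuousAt
    rw [ContinuousAt, chartLine_zero] at h4
    exact h4 (hO.mem_nhds hmem)
  filter_upwards [h3] with s hs
  show e.phase (a, F a (chartLine (ICot n) (Γ a) (φ a x) s)) = _
  rw [(hFO _ hs).1]

theorem eventually_flowIn_mem {t : ℝ} (ht : t ∈ Ioo a b) :
    ContMDiffAt 𝓘(ℝ, ℝ × (Eu n × EuDual n)) (ICot n) ∞ (fun z : ℝ × (Eu n × EuDual n) =>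
      F z.1 ((extChartAt (ICot n) (Γ a)).symm z.2)) (t, extChartAt (ICot n) (Γ a) (Γ a)) ∧
    ∀ᶠ z in 𝓝 (t, extChartAt (ICot n) (Γ a) (Γ a)),
      IsHamiltonianCurve H U a b (fun τ => F τ ((extChartAt (ICot n) (Γ a)).symm z.2)) ∧
      z.1 ∈ Ioo a b ∧ (z.1, (F z.1 ((extChartAt (ICot n) (Γ a)).symm z.2)).proj) ∈ e.source ∧
      (F z.1 ((extChartAt (ICot n) (Γ a)).symm z.2)).proj ∈
        (chartAt (Eu n) (Γ t).proj).source := by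
  have ht' := Ioo_subset_Icc_self ht
  have hFt := flow_apply hΨ ht'
  set p₀ := Γ a with hp₀
  set κ := extChartAt (ICot n) p₀ with hκ
  have hinv : κ.symm (κ p₀) = p₀ := extChartAt_to_inv p₀
  obtain ⟨O, hO, hmem, hsm, hFO⟩ := hF
  have htgt : κ.target ∈ 𝓝 (t, κ p₀).2 := extChartAt_target_mem_nhds (I := ICot n) p₀
  have hs : ContMDiffAt 𝓘(ℝ, ℝ × (Eu n × EuDual n)) (ICot n) ∞
      (fun z : ℝ × (Eu n × EuDual n) => κ.symm z.2) (t, κ p₀) :=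
    ContMDiffAt.comp (g := κ.symm) (f := Prod.snd) (t, κ p₀)
      ((contMDiffOn_extChartAt_symm p₀).contMDiffAt htgt)
      contDiff_snd.contMDiff.contMDiffAt
  have hfl : ContMDiffAt 𝓘(ℝ, ℝ × (Eu n × EuDual n)) (ICot n) ∞
      (fun z : ℝ × (Eu n × EuDual n) => F z.1 (κ.symm z.2)) (t, κ p₀) := by
    refine ContMDiffAt.comp (g := fun z : ℝ × Cot n M => F z.1 z.2)
      (f := fun z : ℝ × (Eu n × EuDual n) => (z.1, κ.symm z.2)) (t, κ p₀)
      (hsm.contMDiffAt ?_) (contDiff_fst.contMDiff.contMDiffAt.prodMk hs)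
    simp only [hinv]
    -- The flow is smooth on `[a, b] × O`, which is a neighbourhood only at interior times.
    exact prod_mem_nhds (Icc_mem_nhds ht.1 ht.2) (hO.mem_nhds hmem)
  refine ⟨hfl, ?_⟩
  have h1 : ∀ᶠ z in 𝓝 (t, κ p₀), κ.symm z.2 ∈ O := by
    refine hs.continuousAt (hO.mem_nhds ?_)
    simpa only [hinv] using hmem
  have h2 : ∀ᶠ z in 𝓝 (t, κ p₀), z.1 ∈ Ioo a b :=
    continuous_fst.continuousAt (isOpen_Ioo.mem_nhds ht)
  have hpc : ContinuousAt (fun z : ℝ × (Eu n × EuDual n) => (F z.1 (κ.symm z.2)).proj)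
      (t, κ p₀) := ContinuousAt.comp (g := fun p : Cot n M => p.proj)
        continuous_cot_proj.continuousAt hfl.continuousAt
  have h3 : ∀ᶠ z in 𝓝 (t, κ p₀), (z.1, (F z.1 (κ.symm z.2)).proj) ∈ e.source := by
    refine (continuous_fst.continuousAt.prodMk hpc) (e.isOpen_source.mem_nhds ?_)
    simp only [hinv, hFt]
    exact he t ht'
  have h4 : ∀ᶠ z in 𝓝 (t, κ p₀), (F z.1 (κ.symm z.2)).proj ∈
      (chartAt (Eu n) (Γ t).proj).source := by
    refine hpc ((chartAt (Eu n) (Γ t).proj).open_source.mem_nhds ?_)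
    simp only [hinv, hFt]
    exact mem_chart_source _ _
  filter_upwards [h1, h2, h3, h4] with z h5 h6 h7 h8 using ⟨(hFO _ h5).2, h6, h7, h8⟩

theorem contDiffAt_flowIn {t : ℝ} (ht : t ∈ Ioo a b) :
    ContDiffAt ℝ ∞ (e.flowIn F (Γ a)) (t, extChartAt (ICot n) (Γ a) (Γ a)) := by
  have ht' := Ioo_subset_Icc_self ht
  have hFt := flow_apply hΨ ht'
  obtain ⟨h1, h2⟩ := e.eventually_flowIn_mem he hF hΨ ht
  have hinv : (extChartAt (ICot n) (Γ a)).symm (extChartAt (ICot n) (Γ a) (Γ a)) = Γ a :=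
    extChartAt_to_inv _
  have h3 : ContDiffAt ℝ ∞ (fun z : ℝ × (Eu n × EuDual n) => extChartAt (ICot n) (Γ t)
      (F z.1 ((extChartAt (ICot n) (Γ a)).symm z.2))) (t, extChartAt (ICot n) (Γ a) (Γ a)) := by
    rw [← contMDiffAt_iff_contDiffAt]
    refine ContMDiffAt.comp (g := extChartAt (ICot n) (Γ t)) _ ?_ h1
    simp only [hinv, hFt]
    exact contMDiffAt_extChartAt
  have hdom := e.mem_phaseDom (p₀ := Γ t) (he t ht') (mem_chart_source _ _)
  have h4 : ContDiffAt ℝ ∞ (fun z : ℝ × (Eu n × EuDual n) => e.phaseIn (Γ t).proj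
      (z.1, extChartAt (ICot n) (Γ t) (F z.1 ((extChartAt (ICot n) (Γ a)).symm z.2))))
      (t, extChartAt (ICot n) (Γ a) (Γ a)) := by
    refine ContDiffAt.comp (g := e.phaseIn (Γ t).proj) _ ?_ (contDiffAt_fst.prodMk h3)
    simp only [hinv, hFt]
    exact (e.contDiffOn_phaseIn _).contDiffAt ((e.isOpen_phaseDom _).mem_nhds hdom)
  refine h4.congr_of_eventuallyEq ?_
  filter_upwards [h2] with z hz
  exact e.phase_eq (p₀ := Γ t) hz.2.2.1 hz.2.2.2

-- All nearby flow lines are Hamiltonian curves. Their Euler-Lagrange equations form an identity on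
-- an open set of times and initial points, which may therefore be differentiated in the initial
-- point.
include hU hH hreg in
theorem eventually_euler_lagrange {t : ℝ} (ht : t ∈ Ioo a b) :
    ∀ᶠ z in 𝓝 (t, extChartAt (ICot n) (Γ a) (Γ a)),
      ∀ d : Eu n × Eu n, fderiv ℝ (e.lag (lagrangian H U)) (z.1, (e.flowIn F (Γ a) z).1,
        (fderiv ℝ (e.flowIn F (Γ a)) z (1, 0)).1) (0, d) =
          (fderiv ℝ (e.flowIn F (Γ a)) z (1, 0)).2 d.1 + (e.flowIn F (Γ a) z).2 d.2 := by
  have hY := (e.contDiffAt_flowIn he hF hΨ ht).of_le (m := 1) (by exact_mod_cast le_top)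
  filter_upwards [hY.eventually (by simp), (e.eventually_flowIn_mem he hF hΨ ht).2] with z h1 h2 d
  obtain ⟨hc, hz, hs, -⟩ := h2
  obtain ⟨v, ξ', h3, -, h4, -⟩ := e.euler_lagrange hU hH hreg hc (Ioo_subset_Icc_self hz) hs
  have h5 := h3.hasDerivAt (Icc_mem_nhds hz.1 hz.2)
  have h6 : HasDerivAt (fun τ => e.flowIn F (Γ a) (τ, z.2))
      (fderiv ℝ (e.flowIn F (Γ a)) z (1, 0)) z.1 :=
    HasFDerivAt.comp_hasDerivAt (l := e.flowIn F (Γ a)) z.1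
      (h1.differentiableAt (by simp)).hasFDerivAt
      ((hasDerivAt_id z.1).prodMk (hasDerivAt_const z.1 z.2))
  rw [h6.unique h5]
  exact h4 d

end Flow

end TimeChart

end

/-! ### The Jacobi equation, and the Hessian as the index form -/

section
variable {n : ℕ} {M : Type*} [TopologicalSpace M] [ChartedSpace (Eu n) M] [IsManifold (𝓡 n) ∞ M]

theorem IsH1.congr {a b : ℝ} {u w : ℝ → Eu n} (hu : IsH1 a b u) (hab : a ≤ b)
    (h : ∀ t ∈ Icc a b, u t = w t) : IsH1 a b w := by
  have hac : AbsolutelyContinuousOnInterval w a b := by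
    refine absolutelyContinuous_of_dist_le (K := 1) hu.1 hu.1 fun s hs t ht => ?_
    rw [uIcc_of_le hab] at hs ht
    rw [h s hs, h t ht, one_mul]
    exact le_add_of_nonneg_right dist_nonneg
  refine ⟨hac, hu.2.ae_eq ?_⟩
  filter_upwards [jet_congr_ae h] with t ht using congrArg Prod.snd ht

namespace TimeChart
variable (e : TimeChart n M)

/-- The linearization of the Euler-Lagrange equation along a family of solutions. -/
theorem secondDeriv_of_eventually_euler_lagrange {L : ℝ × Eu n × Eu n → ℝ}
    {Y : ℝ × (Eu n × EuDual n) → Eu n × EuDual n} {z : ℝ × (Eu n × EuDual n)}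
    (hY : ContDiffAt ℝ 2 Y z)
    (hL : DifferentiableAt ℝ (fderiv ℝ L) (z.1, (Y z).1, (fderiv ℝ Y z (1, 0)).1))
    (hEL : ∀ᶠ z in 𝓝 z, ∀ d : Eu n × Eu n,
      fderiv ℝ L (z.1, (Y z).1, (fderiv ℝ Y z (1, 0)).1) (0, d) =
        (fderiv ℝ Y z (1, 0)).2 d.1 + (Y z).2 d.2) (δ : Eu n × EuDual n) (d : Eu n × Eu n) :
    secondDeriv L (z.1, (Y z).1, (fderiv ℝ Y z (1, 0)).1)
      ((fderiv ℝ Y z (0, δ)).1, (fderiv ℝ (fderiv ℝ Y) z (1, 0) (0, δ)).1) d =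
      (fderiv ℝ (fderiv ℝ Y) z (1, 0) (0, δ)).2 d.1 + (fderiv ℝ Y z (0, δ)).2 d.2 := by
  -- The derivative in the initial point of the velocity is the velocity of the derivative.
  have hsymm : fderiv ℝ (fderiv ℝ Y) z (1, 0) (0, δ) = fderiv ℝ (fderiv ℝ Y) z (0, δ) (1, 0) :=
    (hY.isSymmSndFDerivAt (by rw [minSmoothness_of_isRCLikeNormedField])).eq _ _
  have hD : DifferentiableAt ℝ (fderiv ℝ Y) z :=
    (hY.fderiv_right (m := 1) (by norm_num)).differentiableAt (by simp)
  set l : ℝ → ℝ × (Eu n × EuDual n) := fun s => z + s • (0, δ) with hl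
  have hl0 : l 0 = z := by simp [hl]
  have hld : HasDerivAt l (0, δ) 0 := by
    have h1 := ((hasDerivAt_id (0 : ℝ)).smul_const ((0, δ) : ℝ × (Eu n × EuDual n))).const_add z
    rwa [one_smul] at h1
  have hYl : HasDerivAt (fun s => Y (l s)) (fderiv ℝ Y z (0, δ)) 0 := by
    refine HasFDerivAt.comp_hasDerivAt (l := Y) 0 ?_ hld
    rw [hl0]
    exact (hY.differentiableAt (by simp)).hasFDerivAt
  have hDl : HasDerivAt (fun s => fderiv ℝ Y (l s) (1, 0))
      (fderiv ℝ (fderiv ℝ Y) z (1, 0) (0, δ)) 0 := by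
    have h1 : HasDerivAt (fun s => fderiv ℝ Y (l s)) (fderiv ℝ (fderiv ℝ Y) z (0, δ)) 0 := by
      refine HasFDerivAt.comp_hasDerivAt (l := fderiv ℝ Y) 0 ?_ hld
      rw [hl0]
      exact hD.hasFDerivAt
    have h2 := h1.clm_apply (hasDerivAt_const (0 : ℝ) ((1, 0) : ℝ × (Eu n × EuDual n)))
    rwa [map_zero, add_zero, ← hsymm] at h2
  have hP : HasDerivAt (fun s => ((l s).1, (Y (l s)).1, (fderiv ℝ Y (l s) (1, 0)).1))
      (0, (fderiv ℝ Y z (0, δ)).1, (fderiv ℝ (fderiv ℝ Y) z (1, 0) (0, δ)).1) 0 :=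
    hld.fst.prodMk (hYl.fst.prodMk hDl.fst)
  have hLl : HasDerivAt (fun s => fderiv ℝ L
      ((l s).1, (Y (l s)).1, (fderiv ℝ Y (l s) (1, 0)).1) (0, d))
      (secondDeriv L (z.1, (Y z).1, (fderiv ℝ Y z (1, 0)).1)
      ((fderiv ℝ Y z (0, δ)).1, (fderiv ℝ (fderiv ℝ Y) z (1, 0) (0, δ)).1) d) 0 := by
    have h1 := HasFDerivAt.comp_hasDerivAt (l := fderiv ℝ L) 0
      (by simp only [hl0]; exact hL.hasFDerivAt) hP
    have h2 := h1.clm_apply (hasDerivAt_const (0 : ℝ) ((0, d) : ℝ × Eu n × Eu n))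
    rw [map_zero, add_zero] at h2
    exact h2
  have h2 : HasDerivAt (fun s => (fderiv ℝ Y (l s) (1, 0)).2) _ 0 := hDl.snd
  have h3 : HasDerivAt (fun s => (Y (l s)).2) _ 0 := hYl.snd
  have h4 := (h2.clm_apply (hasDerivAt_const (0 : ℝ) d.1)).add
    (h3.clm_apply (hasDerivAt_const (0 : ℝ) d.2))
  rw [map_zero, map_zero, add_zero, add_zero] at h4
  refine hLl.unique (h4.congr_of_eventuallyEq ?_)
  have h5 : Filter.Tendsto l (𝓝 0) (𝓝 z) := by
    have := hld.continuousAt.tendsto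
    rwa [hl0] at this
  filter_upwards [h5.eventually hEL] with s hs using hs d

section Flow

variable {H : ℝ × Cot n M → ℝ} {U : Set (ℝ × Cot n M)} (hU : IsOpen U)
  (hH : ContMDiffOn (𝓘(ℝ, ℝ).prod (ICot n)) 𝓘(ℝ, ℝ) ∞ H U) (hreg : IsHyperRegular H U)
  {a b : ℝ} (hab : a < b) {Γ : ℝ → Cot n M} (hΓ : IsHamiltonianCurve H U a b Γ)
  (he : ∀ t ∈ Icc a b, (t, (Γ t).proj) ∈ e.source)
  {φ : ∀ t : ℝ, (Eu n × EuDual n) ≃L[ℝ] TangentSpace (ICot n) (Γ t)}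

include hU hH hreg hab hΓ he

/-- With `Y` the flow in coordinates, `G Ψ x` is a derivative of `Y` in the initial point and its
time derivative is a mixed second derivative of `Y`; so the linearization of the Euler-Lagrange
equation along flow lines is the required identity. -/
theorem isJacobiFlow {F : ℝ → Cot n M → Cot n M}
    {Ψ X : ℝ → (Eu n × EuDual n) →L[ℝ] (Eu n × EuDual n)}
    (hF : IsHamiltonianFlow H U a b (Γ a) F)
    (hΨ : ∀ t ∈ Icc a b, ∀ x, (⟨Γ t, φ t (Ψ t x)⟩ : TangentBundle (ICot n) (Cot n M)) =
      tangentMap (ICot n) (ICot n) (F t) ⟨Γ a, φ a x⟩)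
    (hX : ∀ t ∈ Icc a b, HasDerivWithinAt Ψ (X t ∘L Ψ t) (Icc a b) t) :
    IsJacobiFlow (e.lagHess H U a b Γ) (e.trivIn φ) Ψ X a b where
  initial := e.flow_initial hab he hF hΨ
  hasDerivWithinAt := hX
  euler_lagrange t ht x y' hy' w w' := by
    have ht' := Ioo_subset_Icc_self ht
    have hn : Icc a b ∈ 𝓝 t := Icc_mem_nhds ht.1 ht.2
    have hY := (e.contDiffAt_flowIn he hF hΨ ht).of_le (m := 2)
      (WithTop.coe_le_coe.2 (le_top : (2 : ℕ∞) ≤ ⊤))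
    have hEL := e.eventually_euler_lagrange hU hH hreg he hF hΨ ht
    have hline := fun τ hτ => e.hasDerivAt_flowIn_line he hF hΨ (t := τ) hτ x
    set Y := e.flowIn F (Γ a) with hYdef
    set ζ := extChartAt (ICot n) (Γ a) (Γ a) with hζ
    set δ := chartDeriv (ICot n) (Γ a) (Γ a) (φ a x) with hδ
    have hYτ : ∀ τ ∈ Icc a b, Y (τ, ζ) = e.phase (τ, Γ τ) := fun τ hτ => by
      have hinv : (extChartAt (ICot n) (Γ a)).symm ζ = Γ a := extChartAt_to_inv _
      rw [hYdef, flowIn, hinv, flow_apply hΨ hτ]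
    have hdY : DifferentiableAt ℝ Y (t, ζ) := hY.differentiableAt (by simp)
    have hvel : (fderiv ℝ Y (t, ζ) (1, 0)).1 = e.coordVelocity a b Γ t := by
      have h1 : HasDerivAt (fun τ => Y (τ, ζ)) (fderiv ℝ Y (t, ζ) (1, 0)) t :=
        HasFDerivAt.comp_hasDerivAt (l := Y) t hdY.hasFDerivAt
          ((hasDerivAt_id t).prodMk (hasDerivAt_const t ζ))
      have h2 := ((e.hasDerivWithinAt_phase hU hH hreg hab hΓ he ht').1.congr_of_mem hYτ
        ht').hasDerivAt hn
      rw [h1.unique h2]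
    have hG : ∀ᶠ τ in 𝓝 t, e.trivIn φ τ (Ψ τ x) = fderiv ℝ Y (τ, ζ) (0, δ) := by
      have h1 : ∀ᶠ τ in 𝓝 t, ContDiffAt ℝ 2 Y (τ, ζ) :=
        (Continuous.prodMk_left ζ).continuousAt.eventually (hY.eventually (by simp))
      filter_upwards [h1, hn] with τ h2 hτ
      refine (hline τ hτ).unique ?_
      have h3 := ((hasDerivAt_id (0 : ℝ)).smul_const δ).const_add ζ
      rw [one_smul] at h3
      have h4 : HasDerivAt (fun s : ℝ => (τ, ζ + s • δ)) (0, δ) 0 :=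
        (hasDerivAt_const 0 τ).prodMk h3
      refine HasFDerivAt.comp_hasDerivAt (l := Y) 0 ?_ h4
      rw [zero_smul, add_zero]
      exact (h2.differentiableAt (by simp)).hasFDerivAt
    have hy : y' = fderiv ℝ (fderiv ℝ Y) (t, ζ) (1, 0) (0, δ) := by
      have h1 : HasDerivAt (fun τ => fderiv ℝ Y (τ, ζ)) (fderiv ℝ (fderiv ℝ Y) (t, ζ) (1, 0)) t :=
        HasFDerivAt.comp_hasDerivAt (l := fderiv ℝ Y) t
          ((hY.fderiv_right (m := 1) (by norm_num)).differentiableAt (by simp)).hasFDerivAt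
          ((hasDerivAt_id t).prodMk (hasDerivAt_const t ζ))
      have h2 := h1.clm_apply (hasDerivAt_const t ((0, δ) : ℝ × (Eu n × EuDual n)))
      rw [map_zero, add_zero] at h2
      exact hy'.unique (h2.congr_of_eventuallyEq hG)
    have hmem := (e.hasDerivWithinAt_phase hU hH hreg hab hΓ he ht').2.1
    have hL : DifferentiableAt ℝ (fderiv ℝ (e.lag (lagrangian H U)))
        (t, (Y (t, ζ)).1, (fderiv ℝ Y (t, ζ) (1, 0)).1) := by
      rw [hvel, hYτ t ht']
      exact ((e.contDiffOn_fderiv_lag hU hH hreg).contDiffAt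
        ((e.isOpen_lagSet hreg.isOpen_image).mem_nhds hmem)).differentiableAt (by simp)
    have key := secondDeriv_of_eventually_euler_lagrange hY hL hEL δ (w, w')
    rw [hG.self_of_nhds, hy, lagHess, ← hvel, ← hYτ t ht']
    exact key

end Flow

section IndexForm

variable {H : ℝ × Cot n M → ℝ} {U : Set (ℝ × Cot n M)} (hU : IsOpen U)
  (hH : ContMDiffOn (𝓘(ℝ, ℝ).prod (ICot n)) 𝓘(ℝ, ℝ) ∞ H U) (hreg : IsHyperRegular H U)
  {a b : ℝ} {hab : a < b} {Γ : ℝ → Cot n M} (hΓ : IsHamiltonianCurve H U a b Γ)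
  (he : ∀ t ∈ Icc a b, (t, (Γ t).proj) ∈ e.source)
  {φ : ∀ t : ℝ, (Eu n × EuDual n) ≃L[ℝ] TangentSpace (ICot n) (Γ t)}
  (hφ : IsSymplecticTrivialization Γ a b φ)

include he hφ in
theorem blockA_inverse_quotTriv {t : ℝ} (ht : t ∈ Icc a b)
    (x : TangentSpace (𝓡 n) (Γ t).proj) :
    blockA (e.trivIn φ t) ((quotTriv Γ φ t).inverse x) = e.coordDeriv t (Γ t).proj x := by
  have h1 : Function.Injective (quotTriv Γ φ t) := fun x y hxy => by
    refine (e.isSymplecticFamily_trivIn he hφ).injective_blockA ht ?_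
    rw [← e.coordDeriv_quotTriv he ht, hxy, e.coordDeriv_quotTriv he ht]
  have h2 : quotTriv Γ φ t ((quotTriv Γ φ t).inverse x) = x :=
    apply_inverse_of_injective (E := Eu n) (F := Eu n) rfl h1 x
  rw [← e.coordDeriv_quotTriv he ht, h2]

-- The `𝒵`-coordinates arise from the coordinates in the frame of `e` by the inverses of the `C¹`
-- family `A_G`.
include hU hH hreg hΓ he hφ in
theorem isH1_inverse_quotTriv {P : Set M}
    (v : H1Fields (n := n) (fun t => (Γ t).proj) P a b hab) :
    IsH1 a b (fun t => (quotTriv Γ φ t).inverse (v.1 t)) := by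
  have hG := e.isSymplecticFamily_trivIn he hφ
  have hN : ContDiffOn ℝ 1 (fun t => (blockA (e.trivIn φ t)).inverse) (Icc a b) := by
    intro t ht
    set L : Eu n ≃L[ℝ] Eu n := (LinearEquiv.ofBijective (blockA (e.trivIn φ t) : Eu n →ₗ[ℝ] Eu n)
      ⟨hG.injective_blockA ht, hG.surjective_blockA ht⟩).toContinuousLinearEquiv
    have h1 : blockA (e.trivIn φ t) = (L : Eu n →L[ℝ] Eu n) := by
      ext x
      rfl
    refine ContDiffAt.comp_contDiffWithinAt (g := ContinuousLinearMap.inverse) t ?_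
      (contDiffOn_blockA hG.contDiffOn t ht)
    rw [h1]
    exact contDiffAt_map_inverse L
  refine (isH1_clm_apply hab hN (e.isH1_fieldCoord he
    (e.contMDiffOn_proj hU hH hreg hab hΓ he) v)).congr hab.le fun t ht => ?_
  refine hG.injective_blockA ht ?_
  rw [apply_inverse_of_injective rfl (hG.injective_blockA ht), e.fieldCoord_apply (he t ht),
    e.blockA_inverse_quotTriv he hφ ht]

/-- The extension of the Hessian of the action to the `H¹` fields is the index form. -/
theorem hessForm_eq_indexForm {P : Set M} {W : Submodule ℝ (Eu n)}
    (hW : ∀ m, (a, m) ∈ e.source → (m ∈ P ↔ e.coord (a, m) ∈ W)) (hΓa : Γ a ∈ conormal P)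
    {X : ℝ → (Eu n × EuDual n) →L[ℝ] (Eu n × EuDual n)}
    (hφ : IsSymplecticTrivialization Γ a b φ) (hX : IsCoefficient H U Γ a b φ X)
    (v w : H1Fields (n := n) (fun t => (Γ t).proj) P a b hab) :
    e.hessForm hU hH hreg hΓ he P v w = indexForm Γ P a b φ X v.1 w.1 := by
  obtain ⟨F, hF, Ψ, hΨ, hΨX⟩ := hX
  have hJ := e.isJacobiFlow hU hH hreg hab hΓ he hF hΨ hΨX
  have hG := e.isSymplecticFamily_trivIn he hφ
  have ha : a ∈ Icc a b := ⟨le_rfl, hab.le⟩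
  have hv : ∀ (v : H1Fields (n := n) (fun t => (Γ t).proj) P a b hab), ∀ t ∈ Icc a b,
      e.fieldCoord v.1 t = blockA (e.trivIn φ t) ((quotTriv Γ φ t).inverse (v.1 t)) :=
    fun v t ht => by
      rw [e.fieldCoord_apply (he t ht), e.blockA_inverse_quotTriv he hφ ht]
  have hva : ∀ (v : H1Fields (n := n) (fun t => (Γ t).proj) P a b hab),
      blockA (e.trivIn φ a) ((quotTriv Γ φ a).inverse (v.1 a)) ∈ W := fun v => by
    rw [e.blockA_inverse_quotTriv he hφ ha]
    exact (e.mem_tangentSpaceOf_iff hW (he a ha) hΓa.1 _).1 v.2.2.2.1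
  have hb : (quotTriv Γ φ b).inverse (w.1 b) = 0 := by
    have h1 : w.1 b = 0 := w.2.2.2.2
    rw [h1, map_zero]
  rw [indexForm, ← hJ.jetForm_eq_pairIndexForm hab
    (fun t ht d d' => e.lagHess_symm hU hH hreg hab hΓ he ht d d') hG
    (e.contDiffOn_lagHess hU hH hreg hab hΓ he).continuousOn
    (fun z => e.mem_tangentSpaceOf_conormal_iff hW (he a ha) hΓa (φ a z))
    (e.isH1_inverse_quotTriv hU hH hreg hΓ he hφ v)
    (e.isH1_inverse_quotTriv hU hH hreg hΓ he hφ w) (hva v) (hva w) hb]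
  -- The coordinates of a field in `e` and in `φ` differ by `A_G`, but only on `[a, b]`.
  exact jetForm_congr hab.le _ (hv v) (hv w)

end IndexForm
end TimeChart

end

/-! ### Uniqueness of the bounded extension -/

section
variable {n : ℕ} {M : Type*} [TopologicalSpace M] [ChartedSpace (Eu n) M] [IsManifold (𝓡 n) ∞ M]

namespace TimeChart
variable (e : TimeChart n M) {H : ℝ × Cot n M → ℝ} {U : Set (ℝ × Cot n M)} (hU : IsOpen U)
  (hH : ContMDiffOn (𝓘(ℝ, ℝ).prod (ICot n)) 𝓘(ℝ, ℝ) ∞ H U) (hreg : IsHyperRegular H U)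
  {a b : ℝ} {hab : a < b} {Γ : ℝ → Cot n M} (hΓ : IsHamiltonianCurve H U a b Γ)
  (he : ∀ t ∈ Icc a b, (t, (Γ t).proj) ∈ e.source) {P : Set M}

theorem isBoundedForm_hessForm :
    IsBoundedForm (e.hessForm (hab := hab) hU hH hreg hΓ he P) :=
  e.isBoundedForm_fieldForm he (e.contDiffOn_lagHess hU hH hreg hab hΓ he).continuousOn
    (e.contMDiffOn_proj hU hH hreg hab hΓ he)

/-- The form `hessForm` is the only bounded extension of its restriction to the `C¹` fields. -/
theorem eq_hessForm {B : LinearMap.BilinForm ℝ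
      (H1Fields (n := n) (fun t => (Γ t).proj) P a b hab)} (hB : IsBoundedForm B)
    (h : ∀ v w : C1Fields (n := n) (fun t => (Γ t).proj) P a b hab,
      B v.1 w.1 = e.hessForm hU hH hreg hΓ he P v.1 w.1) : B = e.hessForm hU hH hreg hΓ he P :=
  have hγ := e.contMDiffOn_proj hU hH hreg hab hΓ he
  eq_of_isBoundedForm hγ (e.isFrame_frame he hγ) hB (e.isBoundedForm_hessForm hU hH hreg hΓ he) h

end TimeChart

end

end HamiltonianIndex

end

open HamiltonianIndex in
theorem proposition3p3p2 {n : ℕ} {M : Type*} [TopologicalSpace M] [T2Space M]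
    [SecondCountableTopology M] [ChartedSpace (Eu n) M] [IsManifold (𝓡 n) ∞ M]
    (a b : ℝ) (hab : a < b) (P : Set M) (hP : IsSubmanifold (n := n) P)
    (U : Set (ℝ × Cot n M)) (hU : IsOpen U) (H : ℝ × Cot n M → ℝ)
    (hH : ContMDiffOn (𝓘(ℝ, ℝ).prod (ICot n)) 𝓘(ℝ, ℝ) ∞ H U) (hreg : IsHyperRegular H U)
    (Γ : ℝ → Cot n M) (hΓ : IsHamiltonianCurve H U a b Γ) (hΓa : Γ a ∈ conormal P) :
    (∃! h : LinearMap.BilinForm ℝ (C1Fields (n := n) (fun t => (Γ t).proj) P a b hab),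
      IsActionHessian H U (fun t => (Γ t).proj) P a b hab h) ∧
    ∀ h : LinearMap.BilinForm ℝ (C1Fields (n := n) (fun t => (Γ t).proj) P a b hab),
      IsActionHessian H U (fun t => (Γ t).proj) P a b hab h →
      ∃ B : LinearMap.BilinForm ℝ (H1Fields (n := n) (fun t => (Γ t).proj) P a b hab),
        (B.IsSymm ∧ IsBoundedForm B ∧ ∀ v w, B v.1 w.1 = h v w) ∧
        (∀ B' : LinearMap.BilinForm ℝ (H1Fields (n := n) (fun t => (Γ t).proj) P a b hab),
          B'.IsSymm ∧ IsBoundedForm B' ∧ (∀ v w, B' v.1 w.1 = h v w) → B' = B) ∧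
        ∀ (φ : ∀ t : ℝ, (Eu n × EuDual n) ≃L[ℝ] TangentSpace (ICot n) (Γ t))
          (X : ℝ → (Eu n × EuDual n) →L[ℝ] (Eu n × EuDual n)),
          IsSymplecticTrivialization Γ a b φ → IsCoefficient H U Γ a b φ X →
          ∀ v w : H1Fields (n := n) (fun t => (Γ t).proj) P a b hab,
            B v w = indexForm Γ P a b φ X v.1 w.1 := by
  obtain ⟨e, W, he, hW⟩ := exists_timeChart (γ := fun t => (Γ t).proj) hab
    (fun t ht => hΓ.continuousWithinAt_proj ht) hP hΓa.1
  have hBh := e.isActionHessian_hessForm (hab := hab) hU hH hreg hΓ he hW hΓa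
  refine ⟨⟨_, hBh, fun h hh => hh.unique e hU hH hreg hΓ he hW hΓa hBh⟩, fun h hh => ?_⟩
  -- Any Hessian is the restriction of `hessForm`, so this one form is the extension sought; it is
  -- built from `e` alone and equals the index form for every `φ`.
  have hhB := hh.unique e hU hH hreg hΓ he hW hΓa hBh
  have hB : ∀ v w, e.hessForm (hab := hab) hU hH hreg hΓ he P v.1 w.1 = h v w := fun v w =>
    (LinearMap.congr_fun₂ hhB v w).symm
  exact ⟨e.hessForm hU hH hreg hΓ he P, ⟨e.isSymm_hessForm hU hH hreg hΓ he,
      e.isBoundedForm_hessForm hU hH hreg hΓ he, hB⟩,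
    fun B' hB' => e.eq_hessForm hU hH hreg hΓ he hB'.2.1
      fun v w => (hB'.2.2 v w).trans (hB v w).symm,
    fun φ X hφ hX v w => e.hessForm_eq_indexForm hU hH hreg hΓ he hW hΓa hφ hX v w⟩
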